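/- Let $g\ge 1$. Let $\ell_1,\dots,\ell_{2g}>0$ with $\ell_{2g+1-k}=\ell_k$ for all $k$, let $a=\sum_{k\text{ even}}\ell_k$, and let $P_0=(0,-a),P_1,\dots,P_{2g}\in\mathbb{R}^2=\mathbb{C}$ be the staircase with $P_k-P_{k-1}=\ell_k$ for $k$ odd and $P_k-P_{k-1}=i\,\ell_k$ for $k$ even. Then $P_{2g}=(a,0)$, the staircase is symmetric in the line $y=-x$, and $P_g=(c,-c)$ with $c>0$. Let $b>c$. Let $Z$ be the union of the half-line $\{x=0,\ y\le -a\}$, the segments $\overline{P_{k-1}P_k}$ and the half-line $\{y=0,\ x\ge a\}$, and define two simply connected domains (a pair of conjugate orthodisks): * $\Omega_+$ is the intersection of the component of $\mathbb{C}\setminus Z$ to the upper left of $Z$ with $\{x>-b,\ y<b\}$. Its labelled vertices are $P_0,\dots,P_{2g}$, $V=(-b,b)$, the end $E_2$ of the half-strip going down ($y\to-\infty$) and the end $E_1$ of the half-strip going right ($x\to+\infty$). * $\Omega_-$ is the intersection of the component of $\mathbb{C}\setminus Z$ to the lower right of $Z$ with $\{x<b\}\cup\{y>-b\}$. Its labelled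 vertices are obtained by running along $Z$ in the opposite direction: the vertex labelled $P_j$ is the point $P_{2g-j}$ above, $E_2$ is the end of the half-strip going right, $E_1$ is the end of the half-strip going down, and $V=(b,-b)$. In each of the two domains $\Omega$ let $e_0=E_2P_0$, $e_k=P_{k-1}P_k$ ($1\le k\le 2g$), $e_{2g+1}=P_{2g}E_1$ denote the open edges along $Z$. Let $\delta$ be the class of arcs in $\Omega$ connecting $e_0$ to $e_{2g+1}$, let $c_i$ be the class of arcs in $\Omega$ connecting $e_{i-1}$ to $e_{i+1}$ (so that they cut off the edge $P_{i-1}P_i$), and let $\gamma_i=c_i+c_{2g+1-i}$, $1\le i\le g-1$, be the class of formal sums of an arc in $c_i$ and an arc in $c_{2g+1-i}$. For such a class $\Gamma$ let $$\operatorname{Ext}_\Omega(\Gamma)=\sup_\rho \frac{\ell_\rho(\Gamma)^2}{\operatorname{Area}(\rho)},$$ the supremum being over all Borel conformal metrics $\rho\,|dz|$ on $\Omega$ with $0<\operatorname{Area}(\rho)<\infty$, where $\ell_\rho(\Gamma)$ is the infimum of the $\rho$-lengths of the members of $\Gamma$ (the length of a formal sum being the sum of the lengths). Put $$\mathcal{H}(\Gamma)=\left|e^{1/\operatorname{Ext}_{\Omega_+}(\Gamma)}-e^{1/\operatorname{Ext}_{\Omega_-}(\Gamma)}\right|^2+\left|e^{\operatorname{Ext}_{\Omega_+}(\Gamma)}-e^{\operatorname{Ext}_{\Omega_-}(\Gamma)}\right|^2,\qquad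 \mathcal{H}=\sum_{i=1}^{g-1}\mathcal{H}(\gamma_i)+\mathcal{H}(\delta).$$ If $\mathcal{H}=0$, then the two orthodisks are reflexive: there is a biholomorphic map $f:\Omega_+\to\Omega_-$ which preserves the labelled vertices, i.e. $f$ and $f^{-1}$ take each of $P_0,\dots,P_{2g},V,E_1,E_2$ to the vertex with the same label in the sense of boundary limits. -/

import Mathlib

open Set Filter Topology MeasureTheory
open scoped ENNReal

noncomputable section

namespace Scherk

/-! ### Extremal length -/

/-- An open arc in `Ω`, parametrised by `(0, 1)`, running from a point of `A` to a point of `B`.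
The derivative may vanish, so every piecewise `C¹` arc has such a parametrisation. No regularity
is asked at the two end points, where only the limit has to exist. -/
structure IsArc (Ω A B : Set ℂ) (γ : ℝ → ℂ) : Prop where
  contDiffOn : ContDiffOn ℝ 1 γ (Ioo 0 1)
  mapsTo : MapsTo γ (Ioo 0 1) Ω
  start : ∃ p ∈ A, Tendsto γ (𝓝[>] 0) (𝓝 p)
  finish : ∃ q ∈ B, Tendsto γ (𝓝[<] 1) (𝓝 q)

/-- The length of the arc `γ` in the conformal metric `ρ |dz|`. -/
def arcLength (ρ : ℂ → ℝ≥0∞) (γ : ℝ → ℂ) : ℝ≥0∞ :=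
  ∫⁻ t in Ioo (0 : ℝ) 1, ρ (γ t) * ‖deriv γ t‖ₑ

/-- The length of a formal sum of arcs: the sum of the lengths of its members. -/
def multiLength (ρ : ℂ → ℝ≥0∞) (Γ : List (ℝ → ℂ)) : ℝ≥0∞ :=
  (Γ.map (arcLength ρ)).sum

/-- The area of `Ω` in the conformal metric `ρ |dz|`. -/
def area (Ω : Set ℂ) (ρ : ℂ → ℝ≥0∞) : ℝ≥0∞ :=
  ∫⁻ z in Ω, ρ z ^ 2

/-- The extremal length in `Ω` of a class `𝓕` of formal sums of arcs:
the supremum of `(inf length)² / area` over all Borel conformal metrics of finite positive area. -/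
def extremalLength (Ω : Set ℂ) (𝓕 : Set (List (ℝ → ℂ))) : ℝ≥0∞ :=
  ⨆ (ρ : ℂ → ℝ≥0∞) (_ : Measurable ρ) (_ : 0 < area Ω ρ) (_ : area Ω ρ < ∞),
    (⨅ Γ ∈ 𝓕, multiLength ρ Γ) ^ 2 / area Ω ρ

/-! ### Labelled domains and their cycles -/

/-- A planar domain whose boundary carries, in cyclic order and with the domain on the left, the
vertices `E₂, P₀, …, P_{2g}, E₁, V`. Here `P` is used for indices `0 ≤ j ≤ 2g`; the infinite
vertices `E₁`, `E₂` are recorded by the filters of points of the domain that tend to them; and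
`edge k` for `0 ≤ k ≤ 2g+1` are the open edges
`E₂P₀, P₀P₁, …, P_{2g-1}P_{2g}, P_{2g}E₁`. -/
structure Labelled where
  dom : Set ℂ
  P : ℕ → ℂ
  V : ℂ
  E₁ : Filter ℂ
  E₂ : Filter ℂ
  edge : ℕ → Set ℂ

/-- The extremal length of `δ`, the class of arcs connecting `E₂P₀` to `P_{2g}E₁`. -/
def extDelta (g : ℕ) (D : Labelled) : ℝ≥0∞ :=
  extremalLength D.dom {Γ | ∃ α, IsArc D.dom (D.edge 0) (D.edge (2 * g + 1)) α ∧ Γ = [α]}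

/-- `c_i` is the class of arcs that cut off the edge `P_{i-1}P_i`, that is, that connect the edges
preceding and following it (`edge i` is `P_{i-1}P_i`). -/
def cycleC (D : Labelled) (i : ℕ) : Set (ℝ → ℂ) :=
  {α | IsArc D.dom (D.edge (i - 1)) (D.edge (i + 1)) α}

/-- The extremal length of `γ_i = c_i + c_{2g+1-i}`. -/
def extGamma (g : ℕ) (D : Labelled) (i : ℕ) : ℝ≥0∞ :=
  extremalLength D.dom
    {Γ | ∃ α ∈ cycleC D i, ∃ β ∈ cycleC D (2 * g + 1 - i), Γ = [α, β]}

/-- The contribution to the height of a cycle whose extremal lengths in the two domains are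
`x` and `y`. -/
def heightTerm (x y : ℝ) : ℝ :=
  |Real.exp (1 / x) - Real.exp (1 / y)| ^ 2 + |Real.exp x - Real.exp y| ^ 2

/-- The height of a pair of labelled domains. (All extremal lengths that occur are positive and
finite for the domains considered below.) -/
def height (g : ℕ) (D D' : Labelled) : ℝ :=
  ∑ i ∈ Finset.Icc 1 (g - 1), heightTerm (extGamma g D i).toReal (extGamma g D' i).toReal
    + heightTerm (extDelta g D).toReal (extDelta g D').toReal

/-- `D` and `D'` are reflexive: there is a biholomorphic map `f` between them, with inverse `h`,
which takes each vertex to the vertex with the same label (in the sense of boundary limits, in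
both directions). -/
def Reflexive (g : ℕ) (D D' : Labelled) : Prop :=
  ∃ f h : ℂ → ℂ,
    DifferentiableOn ℂ f D.dom ∧ DifferentiableOn ℂ h D'.dom ∧
    MapsTo f D.dom D'.dom ∧ MapsTo h D'.dom D.dom ∧ InvOn h f D.dom D'.dom ∧
    (∀ j ≤ 2 * g, Tendsto f (𝓝[D.dom] D.P j) (𝓝[D'.dom] D'.P j) ∧
      Tendsto h (𝓝[D'.dom] D'.P j) (𝓝[D.dom] D.P j)) ∧
    (Tendsto f (𝓝[D.dom] D.V) (𝓝[D'.dom] D'.V) ∧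
      Tendsto h (𝓝[D'.dom] D'.V) (𝓝[D.dom] D.V)) ∧
    (Tendsto f D.E₁ D'.E₁ ∧ Tendsto h D'.E₁ D.E₁) ∧
    (Tendsto f D.E₂ D'.E₂ ∧ Tendsto h D'.E₂ D.E₂)

/-! ### The pairs of conjugate orthodisks -/

/-- Vertices of the staircase with edge lengths `len 0, …, len (2g-1)`, alternately going right
and up. The start `P₀ = -a i` is normalised so that `a` is the total length of the vertical
edges, i.e. so that the last vertex lies on the real axis. -/
def stairVertex {g : ℕ} (len : Fin (2 * g) → ℝ) (j : ℕ) : ℂ :=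
  -((∑ k : Fin (2 * g), if Odd (k : ℕ) then len k else 0 : ℝ) : ℂ) * Complex.I
    + ∑ k : Fin (2 * g), if (k : ℕ) < j then
        (len k : ℂ) * (if Even (k : ℕ) then 1 else Complex.I) else 0

/-- Geometric coordinates: the lengths of the edges `P_k P_{k+1}` of a staircase which is
symmetric in the line `y = -x`, and the width `b` of the half-strips. The middle vertex
`P_g = (c, -c)` lies on the diagonal and `b > c`. -/
structure Coord (g : ℕ) where
  len : Fin (2 * g) → ℝ
  len_pos : ∀ k, 0 < len k
  len_symm : ∀ k, len k.rev = len k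
  b : ℝ
  lt_b : (stairVertex len g).re < b

namespace Coord

variable {g : ℕ} (X : Coord g)

/-- The staircase vertices, from `P 0 = (0, -a)` to `P (2g) = (a, 0)`. -/
def P (j : ℕ) : ℂ := stairVertex X.len j

/-- The open edges of the zigzag, in order: the negative `y`-axis below `P 0`, the finite edges,
and the positive `x`-axis to the right of `P (2g)`. -/
def edge (k : ℕ) : Set ℂ :=
  if k = 0 then {z | z.re = 0 ∧ z.im < (X.P 0).im}
  else if k ≤ 2 * g then openSegment ℝ (X.P (k - 1)) (X.P k)
  else {z | z.im = 0 ∧ (X.P (2 * g)).re < z.re}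

/-- The zigzag: the union of all edges and vertices. -/
def zigzag : Set ℂ :=
  (⋃ k ∈ Finset.range (2 * g + 2), X.edge k) ∪ ⋃ j ∈ Finset.range (2 * g + 1), {X.P j}

/-- The upper left one of the two regions separated by the (monotone) zigzag. -/
def upperLeft : Set ℂ := {z | ∃ w ∈ X.zigzag, z.re < w.re ∧ w.im < z.im}

/-- The lower right one of the two regions separated by the (monotone) zigzag. -/
def lowerRight : Set ℂ := {z | ∃ w ∈ X.zigzag, w.re < z.re ∧ z.im < w.im}

/-- The upper left orthodisk, with outer vertex `V₊ = (-b, b)` of angle `π/2`. The end `E₂` is the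
half-strip going down and `E₁` the half-strip going right. -/
def plus : Labelled where
  dom := X.upperLeft ∩ {z | -X.b < z.re ∧ z.im < X.b}
  P := X.P
  V := ⟨-X.b, X.b⟩
  E₁ := comap Complex.re atTop ⊓ 𝓟 (X.upperLeft ∩ {z | -X.b < z.re ∧ z.im < X.b})
  E₂ := comap Complex.im atBot ⊓ 𝓟 (X.upperLeft ∩ {z | -X.b < z.re ∧ z.im < X.b})
  edge := X.edge

/-- The lower right orthodisk, with outer vertex `V₋ = (b, -b)` of angle `3π/2`. Here the domain
lies on the other side of the zigzag, so the labels run along it in the opposite direction: `P_j`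
is the point of the zigzag that is `P_{2g-j}` for the upper left domain, `E₂` is the half-strip
going right and `E₁` the half-strip going down. -/
def minus : Labelled where
  dom := X.lowerRight ∩ {z | z.re < X.b ∨ -X.b < z.im}
  P := fun j => X.P (2 * g - j)
  V := ⟨X.b, -X.b⟩
  E₁ := comap Complex.im atBot ⊓ 𝓟 (X.lowerRight ∩ {z | z.re < X.b ∨ -X.b < z.im})
  E₂ := comap Complex.re atTop ⊓ 𝓟 (X.lowerRight ∩ {z | z.re < X.b ∨ -X.b < z.im})
  edge := fun k => X.edge (2 * g + 1 - k)

end Coord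

end Scherk

end

open Set Filter Topology MeasureTheory
open scoped ENNReal

noncomputable section

namespace Scherk

open Metric

/-! ### The Riemann mapping theorem -/

/-- Hurwitz: if the limit has an isolated zero, so do the approximants, nearby. -/
theorem eventually_exists_zero {ι : Type*} {l : Filter ι} {U : Set ℂ} (hU : IsOpen U)
    {F : ι → ℂ → ℂ} {f : ℂ → ℂ} (hf : TendstoLocallyUniformlyOn F f l U)
    (hF : ∀ n, DifferentiableOn ℂ (F n) U) (hfd : DifferentiableOn ℂ f U) {z : ℂ} (hz : z ∈ U)
    (h0 : f z = 0) (hne : ¬ ∀ᶠ w in 𝓝 z, f w = 0) :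
    ∀ᶠ n in l, ∃ w ∈ U, F n w = 0 := by
  have hfa : AnalyticAt ℂ f z := hfd.analyticAt (hU.mem_nhds hz)
  have h1 := hfa.eventually_eq_zero_or_eventually_ne_zero.resolve_left hne
  rw [eventually_nhdsWithin_iff] at h1
  obtain ⟨r, hr, hrU⟩ := nhds_basis_closedBall.mem_iff.1
    (inter_mem h1 (hU.mem_nhds hz))
  have hcU : closedBall z r ⊆ U := fun w hw => (hrU hw).2
  have hsph : ∀ w ∈ sphere z r, f w ≠ 0 := fun w hw =>
    (hrU (sphere_subset_closedBall hw)).1 (by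
      rintro rfl
      simp only [mem_sphere, dist_self] at hw
      exact hr.ne hw)
  obtain ⟨δ, hδ, hδf⟩ : ∃ δ > 0, ∀ w ∈ sphere z r, δ ≤ ‖f w‖ := by
    obtain ⟨w, hw, hmin⟩ := (isCompact_sphere z r).exists_isMinOn
      (NormedSpace.sphere_nonempty.2 hr.le)
      ((hfd.continuousOn.mono (sphere_subset_closedBall.trans hcU)).norm)
    exact ⟨‖f w‖, norm_pos_iff.2 (hsph w hw), fun v hv => hmin hv⟩
  have hunif := (tendstoLocallyUniformlyOn_iff_forall_isCompact hU).1 hf _ hcU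
    (isCompact_closedBall z r)
  filter_upwards [Metric.tendstoUniformlyOn_iff.1 hunif (δ / 2) (half_pos hδ)] with n hn
  by_contra! hno
  have hd : DiffContOnCl ℂ (fun w => (F n w)⁻¹) (ball z r) := by
    have : DifferentiableOn ℂ (fun w => (F n w)⁻¹) (closedBall z r) :=
      ((hF n).mono hcU).inv fun w hw => hno w (hcU hw)
    exact (this.mono closure_ball_subset_closedBall).diffContOnCl
  have hb : ‖(F n z)⁻¹‖ ≤ (δ / 2)⁻¹ := by
    refine Complex.norm_le_of_forall_mem_frontier_norm_le isBounded_ball hd (fun w hw => ?_)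
      (subset_closure (mem_ball_self hr))
    rw [frontier_ball z hr.ne'] at hw
    have h2 := hn w (sphere_subset_closedBall hw)
    have h3 := hδf w hw
    rw [norm_inv]
    refine inv_anti₀ (half_pos hδ) ?_
    rw [dist_eq_norm] at h2
    have := norm_sub_norm_le (f w) (F n w)
    linarith
  have h4 := hn z (mem_closedBall_self hr.le)
  rw [h0, dist_eq_norm, zero_sub, norm_neg] at h4
  rw [norm_inv, inv_le_inv₀ (norm_pos_iff.2 (hno z hz)) (half_pos hδ)] at hb
  linarith

/-- A bounded sequence of holomorphic functions that converges pointwise along a filter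
converges locally uniformly. -/
theorem tendstoLocallyUniformlyOn_of_bounded {ι : Type*} {l : Filter ι} [l.NeBot] {U : Set ℂ}
    (hU : IsOpen U) {F : ι → ℂ → ℂ} {f : ℂ → ℂ} (hF : ∀ n, DifferentiableOn ℂ (F n) U)
    (hb : ∀ n, MapsTo (F n) U (ball 0 1)) (hf : ∀ z ∈ U, Tendsto (fun n => F n z) l (𝓝 (f z))) :
    TendstoLocallyUniformlyOn F f l U := by
  rw [Metric.tendstoLocallyUniformlyOn_iff]
  intro ε hε x hx
  obtain ⟨r, hr, hrU⟩ := Metric.isOpen_iff.1 hU x hx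
  have key : ∀ n, ∀ y ∈ ball x r, dist (F n y) (F n x) ≤ 2 / r * dist y x := fun n y hy => by
    refine Complex.dist_le_div_mul_dist_of_mapsTo_ball ((hF n).mono hrU) (fun w hw => ?_) hy
    have h1 := hb n (hrU hw)
    have h2 := hb n hx
    simp only [mem_ball, dist_zero_right] at h1 h2
    rw [mem_closedBall, dist_eq_norm]
    linarith [norm_sub_le (F n w) (F n x)]
  have keyf : ∀ y ∈ ball x r, dist (f y) (f x) ≤ 2 / r * dist y x := fun y hy =>
    le_of_tendsto ((hf y (hrU hy)).dist (hf x hx)) (Eventually.of_forall fun n => key n y hy)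
  set s := min r (ε * r / 8) with hs
  have hs0 : 0 < s := lt_min hr (by positivity)
  refine ⟨ball x s, mem_nhdsWithin_of_mem_nhds (ball_mem_nhds x hs0), ?_⟩
  filter_upwards [Metric.tendsto_nhds.1 (hf x hx) (ε / 4) (by positivity)] with n hn y hy
  have hyr : y ∈ ball x r := ball_subset_ball (min_le_left _ _) hy
  have hy2 : dist y x ≤ ε * r / 8 := (mem_ball.1 hy).le.trans (min_le_right _ _)
  have hq : 2 / r * dist y x ≤ ε / 4 := by
    calc 2 / r * dist y x ≤ 2 / r * (ε * r / 8) := by gcongr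
      _ = ε / 4 := by field_simp; ring
  have h1 := key n y hyr
  have h2 := keyf y hyr
  have h3 := dist_triangle4 (f y) (f x) (F n x) (F n y)
  rw [dist_comm (f x) (F n x), dist_comm (F n x) (F n y)] at h3
  linarith

/-- The disc automorphism that takes `a` to `0`. -/
def discAut (a z : ℂ) : ℂ := (z - a) / (1 - (starRingEnd ℂ) a * z)

theorem one_sub_conj_mul_ne_zero {a z : ℂ} (ha : ‖a‖ < 1) (hz : ‖z‖ < 1) :
    1 - (starRingEnd ℂ) a * z ≠ 0 := by
  intro h
  have h1 : (starRingEnd ℂ) a * z = 1 := (sub_eq_zero.1 h).symm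
  have h2 : ‖a‖ * ‖z‖ = 1 := by
    rw [← RCLike.norm_conj a, ← norm_mul, h1, norm_one]
  nlinarith [norm_nonneg a, norm_nonneg z]

theorem norm_discAut_lt_one {a z : ℂ} (ha : ‖a‖ < 1) (hz : ‖z‖ < 1) : ‖discAut a z‖ < 1 := by
  rw [discAut, norm_div, div_lt_one (norm_pos_iff.2 (one_sub_conj_mul_ne_zero ha hz)),
    ← sq_lt_sq₀ (norm_nonneg _) (norm_nonneg _), ← Complex.normSq_eq_norm_sq,
    ← Complex.normSq_eq_norm_sq]
  have h1 : ‖a‖ ^ 2 < 1 := by nlinarith [norm_nonneg a]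
  have h2 : ‖z‖ ^ 2 < 1 := by nlinarith [norm_nonneg z]
  rw [← Complex.normSq_eq_norm_sq, Complex.normSq_apply] at h1 h2
  simp only [Complex.normSq_apply, Complex.sub_re, Complex.sub_im, Complex.mul_re,
    Complex.mul_im, Complex.conj_re, Complex.conj_im, Complex.one_re, Complex.one_im]
  nlinarith [mul_pos (sub_pos.2 h1) (sub_pos.2 h2)]

theorem differentiableOn_discAut {a : ℂ} (ha : ‖a‖ < 1) :
    DifferentiableOn ℂ (discAut a) (ball 0 1) := by
  intro z hz
  have := one_sub_conj_mul_ne_zero ha (mem_ball_zero_iff.1 hz)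
  have h1 : DifferentiableAt ℂ (fun z => 1 - (starRingEnd ℂ) a * z) z := by fun_prop
  exact ((differentiableAt_id.sub_const a).div h1 this).differentiableWithinAt

theorem discAut_neg_discAut {a z : ℂ} (ha : ‖a‖ < 1) (hz : ‖z‖ < 1) :
    discAut (-a) (discAut a z) = z := by
  have h1 := one_sub_conj_mul_ne_zero ha hz
  have h2 := one_sub_conj_mul_ne_zero ha ha
  unfold discAut
  have h3 : 1 - (starRingEnd ℂ) (-a) * ((z - a) / (1 - (starRingEnd ℂ) a * z))
      = (1 - (starRingEnd ℂ) a * a) / (1 - (starRingEnd ℂ) a * z) := by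
    rw [map_neg]; field_simp; ring
  have h4 : (z - a) / (1 - (starRingEnd ℂ) a * z) - -a
      = z * (1 - (starRingEnd ℂ) a * a) / (1 - (starRingEnd ℂ) a * z) := by
    rw [eq_div_iff h1, sub_neg_eq_add, add_mul, div_mul_cancel₀ _ h1]; ring
  rw [h3, h4, div_div_div_cancel_right₀ h1, mul_div_cancel_right₀ _ h2]

theorem discAut_self (a : ℂ) : discAut a a = 0 := by simp [discAut]

/-- A holomorphic self map of the disc fixing `0` whose derivative there has modulus one is
injective. -/
theorem injOn_of_norm_deriv_eq_one {f : ℂ → ℂ} (hf : DifferentiableOn ℂ f (ball 0 1))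
    (hm : MapsTo f (ball 0 1) (ball 0 1)) (h0 : f 0 = 0) (h1 : ‖deriv f 0‖ = 1) :
    InjOn f (ball 0 1) := by
  have := Complex.affine_of_mapsTo_ball_of_norm_dslope_eq_div (c := 0) (R₁ := 1) (R₂ := 1)
    (z₀ := 0) hf (by rw [h0]; exact hm.mono_right ball_subset_closedBall) (by simp)
    (by simpa using h1)
  intro z hz w hw hzw
  rw [this hz, this hw] at hzw
  have hne : deriv f 0 ≠ 0 := by rw [← norm_pos_iff, h1]; exact one_pos
  simpa [h0, hne] using hzw

/-- The inverse of an injective holomorphic map with non-vanishing derivative. -/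
theorem exists_holomorphic_inverse {U : Set ℂ} (hU : IsOpen U) {f : ℂ → ℂ}
    (hf : DifferentiableOn ℂ f U) (hinj : InjOn f U) (hd : ∀ z ∈ U, deriv f z ≠ 0) :
    ∃ h : ℂ → ℂ, DifferentiableOn ℂ h (f '' U) ∧ ∀ z ∈ U, h (f z) = z := by
  refine ⟨Function.invFunOn f U, ?_, fun z hz => hinj.leftInvOn_invFunOn hz⟩
  rintro _ ⟨z, hz, rfl⟩
  have hs : HasStrictDerivAt f (deriv f z) z :=
    (hf.analyticAt (hU.mem_nhds hz)).hasStrictDerivAt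
  have hl : ∀ᶠ x in 𝓝 z, Function.invFunOn f U (f x) = x := by
    filter_upwards [hU.mem_nhds hz] with x hx using hinj.leftInvOn_invFunOn hx
  exact (hs.to_local_left_inverse (hd z hz) hl).hasDerivAt.differentiableAt.differentiableWithinAt

/-- **Riemann mapping theorem** for simply connected domains whose complement has interior. -/
theorem exists_conformal_equiv_ball {U : Set ℂ} (hUo : IsOpen U) (hUc : IsSimplyConnected U)
    {p : ℂ} {ε : ℝ} (hε : 0 < ε) (hp : ∀ z ∈ U, ε < dist z p) {z₀ : ℂ} (hz₀ : z₀ ∈ U) :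
    ∃ f h : ℂ → ℂ, DifferentiableOn ℂ f U ∧ DifferentiableOn ℂ h (ball 0 1) ∧
      MapsTo f U (ball 0 1) ∧ MapsTo h (ball 0 1) U ∧ InvOn h f U (ball 0 1) ∧ f z₀ = 0 := by
  set S : Set (ℂ → ℂ) := {f | DifferentiableOn ℂ f U ∧ MapsTo f U (ball 0 1) ∧ InjOn f U ∧
    (∀ z ∈ U, deriv f z ≠ 0) ∧ f z₀ = 0} with hS
  have hUpre : IsPreconnected U := hUc.isPathConnected.isConnected.isPreconnected
  have hcomp : ∀ {f : ℂ → ℂ} {a : ℂ}, DifferentiableOn ℂ f U → MapsTo f U (ball 0 1) →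
      InjOn f U → (∀ z ∈ U, deriv f z ≠ 0) → f z₀ = a → (fun z => discAut a (f z)) ∈ S := by
    intro f a hfd hfm hfi hfn hfa
    have ha : ‖a‖ < 1 := by rw [← hfa]; exact mem_ball_zero_iff.1 (hfm hz₀)
    have hleft : ∀ z ∈ U, discAut (-a) (discAut a (f z)) = f z := fun z hz =>
      discAut_neg_discAut ha (mem_ball_zero_iff.1 (hfm hz))
    have hm : MapsTo (fun z => discAut a (f z)) U (ball 0 1) := fun z hz =>
      mem_ball_zero_iff.2 (norm_discAut_lt_one ha (mem_ball_zero_iff.1 (hfm hz)))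
    have hd : DifferentiableOn ℂ (fun z => discAut a (f z)) U :=
      (differentiableOn_discAut ha).comp hfd hfm
    refine ⟨hd, hm, fun z hz w hw hzw => ?_, fun z hz h => ?_, by simp [hfa, discAut_self]⟩
    · apply hfi hz hw
      rw [← hleft z hz, ← hleft w hw]
      exact congrArg _ hzw
    · apply hfn z hz
      have h1 : HasDerivAt (fun z => discAut a (f z)) 0 z := by
        rw [← h]; exact (hd.differentiableAt (hUo.mem_nhds hz)).hasDerivAt
      have h2 : DifferentiableAt ℂ (discAut (-a)) (discAut a (f z)) :=
        (differentiableOn_discAut (by rwa [norm_neg])).differentiableAt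
          (isOpen_ball.mem_nhds (hm hz))
      have h3 := h2.hasDerivAt.comp z h1
      have h4 : (discAut (-a) ∘ fun z => discAut a (f z)) =ᶠ[𝓝 z] f := by
        filter_upwards [hUo.mem_nhds hz] with w hw using hleft w hw
      rw [← h4.deriv_eq, h3.deriv, mul_zero]
  have hSne : S.Nonempty := by
    have hzp : ∀ z ∈ U, z - p ≠ 0 := fun z hz h => by
      have := hp z hz
      rw [sub_eq_zero.1 h, dist_self] at this
      exact this.not_ge hε.le
    refine ⟨_, hcomp (f := fun z => ε / (z - p)) (a := ε / (z₀ - p)) ?_ ?_ ?_ ?_ rfl⟩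
    · intro z hz
      exact ((differentiableAt_const (ε : ℂ)).div (differentiableAt_id.sub_const p)
        (hzp z hz)).differentiableWithinAt
    · intro z hz
      have h1 := hp z hz
      rw [dist_eq_norm] at h1
      rw [mem_ball_zero_iff, norm_div, Complex.norm_real, Real.norm_of_nonneg hε.le,
        div_lt_one (hε.trans h1)]
      exact h1
    · intro z hz w hw h
      have hε' : (ε : ℂ) ≠ 0 := by exact_mod_cast hε.ne'
      have h1 := hzp z hz
      have h2 := hzp w hw
      simp only at h
      rw [div_eq_div_iff h1 h2] at h
      have := mul_left_cancel₀ hε' h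
      linear_combination -this
    · intro z hz
      have h1 : HasDerivAt (fun z => ε / (z - p)) ((0 * (z - p) - ε * 1) / (z - p) ^ 2) z :=
        (hasDerivAt_const z (ε : ℂ)).div ((hasDerivAt_id z).sub_const p) (hzp z hz)
      rw [h1.deriv]
      have hε' : (ε : ℂ) ≠ 0 := by exact_mod_cast hε.ne'
      have := hzp z hz
      simp only [zero_mul, mul_one, zero_sub]
      exact div_ne_zero (neg_ne_zero.2 hε') (pow_ne_zero _ this)
  obtain ⟨r, hr, hrU⟩ := Metric.isOpen_iff.1 hUo z₀ hz₀
  have hbdd : BddAbove ((fun f : ℂ → ℂ => ‖deriv f z₀‖) '' S) := by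
    refine ⟨1 / r, ?_⟩
    rintro _ ⟨f, hf, rfl⟩
    refine Complex.norm_deriv_le_div_of_mapsTo_ball (hf.1.mono hrU) (fun z hz => ?_) hr
    rw [hf.2.2.2.2]
    exact ball_subset_closedBall (hf.2.1 (hrU hz))
  set M := sSup ((fun f : ℂ → ℂ => ‖deriv f z₀‖) '' S) with hM
  have hle : ∀ f ∈ S, ‖deriv f z₀‖ ≤ M := fun f hf => le_csSup hbdd (mem_image_of_mem _ hf)
  obtain ⟨u, -, hut, huS⟩ := exists_seq_tendsto_sSup (hSne.image _) hbdd
  choose F hFS hFu using huS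
  set l : Filter ℕ := (hyperfilter ℕ : Filter ℕ) with hl
  have hlim : ∀ z ∈ U, ∃ w, Tendsto (fun n => F n z) l (𝓝 w) := by
    intro z hz
    obtain ⟨w, -, hw⟩ := (isCompact_closedBall (0 : ℂ) 1).ultrafilter_le_nhds'
      ((hyperfilter ℕ).map fun n => F n z)
      (by
        rw [Ultrafilter.mem_map]
        exact univ_mem' fun n => ball_subset_closedBall ((hFS n).2.1 hz))
    exact ⟨w, hw⟩
  choose! g hg using hlim
  have hloc : TendstoLocallyUniformlyOn F g l U :=
    tendstoLocallyUniformlyOn_of_bounded hUo (fun n => (hFS n).1) (fun n => (hFS n).2.1) hg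
  have hgd : DifferentiableOn ℂ g U :=
    hloc.differentiableOn (Eventually.of_forall fun n => (hFS n).1) hUo
  have hdloc : TendstoLocallyUniformlyOn (deriv ∘ F) (deriv g) l U :=
    hloc.deriv (Eventually.of_forall fun n => (hFS n).1) hUo
  have hgM : ‖deriv g z₀‖ = M := by
    have h1 := (hdloc.tendsto_at hz₀).norm
    have h2 : Tendsto u l (𝓝 M) := hut.mono_left (hl ▸ Nat.hyperfilter_le_atTop)
    refine tendsto_nhds_unique h1 (h2.congr fun n => (hFu n).symm)
  have hMpos : 0 < M := by
    obtain ⟨f, hf⟩ := hSne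
    exact (norm_pos_iff.2 (hf.2.2.2.1 z₀ hz₀)).trans_le (hle f hf)
  have hgne : deriv g z₀ ≠ 0 := by rw [← norm_pos_iff, hgM]; exact hMpos
  have hg0 : g z₀ = 0 := tendsto_nhds_unique (hg z₀ hz₀)
    (by simp only [(hFS _).2.2.2.2]; exact tendsto_const_nhds)
  have hga : AnalyticOnNhd ℂ g U := hgd.analyticOnNhd hUo
  have hnc : ∀ z ∈ U, ∀ c, ¬ ∀ᶠ w in 𝓝 z, g w = c := by
    intro z hz c hc
    have := hga.eqOn_of_preconnected_of_eventuallyEq analyticOnNhd_const hUpre hz hc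
    have h2 : g =ᶠ[𝓝 z₀] fun _ => c := this.eventuallyEq_of_mem (hUo.mem_nhds hz₀)
    exact hgne (by rw [h2.deriv_eq, deriv_const])
  have hgn : ∀ z ∈ U, deriv g z ≠ 0 := by
    intro z hz h0
    by_cases hev : ∀ᶠ w in 𝓝 z, deriv g w = 0
    · have := hga.deriv.eqOn_of_preconnected_of_eventuallyEq analyticOnNhd_const hUpre hz hev
      exact hgne (this hz₀)
    · obtain ⟨n, w, hw, hnw⟩ := (eventually_exists_zero hUo hdloc
        (fun n => (hFS n).1.deriv hUo) (hgd.deriv hUo) hz h0 hev).exists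
      exact (hFS n).2.2.2.1 w hw hnw
  have hgi : InjOn g U := by
    intro z hz w hw hzw
    by_contra hne
    have hV : IsOpen (U \ {w}) := hUo.sdiff isClosed_singleton
    have hloc2 : TendstoLocallyUniformlyOn (fun n v => F n v - F n w) (fun v => g v - g w) l
        (U \ {w}) := by
      have h1 := hloc.mono (sdiff_subset (t := {w}))
      have h2 : TendstoLocallyUniformlyOn (fun n (_ : ℂ) => F n w) (fun _ => g w) l (U \ {w}) := by
        refine TendstoUniformlyOn.tendstoLocallyUniformlyOn ?_
        rw [Metric.tendstoUniformlyOn_iff]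
        intro δ hδ
        filter_upwards [Metric.tendsto_nhds.1 (hg w hw) δ hδ] with n hn v _
        rwa [dist_comm]
      exact h1.sub h2
    obtain ⟨n, v, hv, hnv⟩ := (eventually_exists_zero hV hloc2
      (fun n => ((hFS n).1.mono sdiff_subset).sub_const _) ((hgd.mono sdiff_subset).sub_const _)
      (⟨hz, hne⟩ : z ∈ U \ {w}) (by simp [hzw])
      (fun h => hnc z hz (g w) (h.mono fun v hv => sub_eq_zero.1 hv))).exists
    exact hv.2 ((hFS n).2.2.1 hv.1 hw (sub_eq_zero.1 hnv))
  have hgm : MapsTo g U (ball 0 1) := by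
    have hc : MapsTo g U (closedBall 0 1) := fun z hz =>
      isClosed_closedBall.mem_of_tendsto (hg z hz)
        (Eventually.of_forall fun n => ball_subset_closedBall ((hFS n).2.1 hz))
    intro z hz
    by_contra hcon
    have h1 : ‖g z‖ = 1 := le_antisymm (mem_closedBall_zero_iff.1 (hc hz))
      (by simpa using hcon)
    refine hnc z hz (g z) (Complex.eventually_eq_of_isLocalMax_norm
      (by filter_upwards [hUo.mem_nhds hz] with w hw using hgd.differentiableAt (hUo.mem_nhds hw))
      ?_)
    filter_upwards [hUo.mem_nhds hz] with w hw
    simp only [Function.comp, h1]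
    exact mem_closedBall_zero_iff.1 (hc hw)
  have hgS : g ∈ S := ⟨hgd, hgm, hgi, hgn, hg0⟩
  have hsurj : ball 0 1 ⊆ g '' U := by
    intro w hw
    by_contra hwU
    have hw1 : ‖w‖ < 1 := mem_ball_zero_iff.1 hw
    have hnw : ∀ z ∈ U, discAut w (g z) ≠ 0 := fun z hz h => by
      rw [discAut, div_eq_zero_iff] at h
      rcases h with h | h
      · exact hwU ⟨z, hz, sub_eq_zero.1 h⟩
      · exact one_sub_conj_mul_ne_zero hw1 (mem_ball_zero_iff.1 (hgm hz)) h
    have hGd : DifferentiableOn ℂ (fun z => discAut w (g z)) U :=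
      (differentiableOn_discAut hw1).comp hgd hgm
    obtain ⟨s, hsc, hs2⟩ := Complex.exists_continuousOn_pow_eq hUc hUo hGd.continuousOn
      (by rintro ⟨z, hz, h⟩; exact hnw z hz h) two_ne_zero
    have hsne : ∀ z ∈ U, s z ≠ 0 := fun z hz h => hnw z hz (by rw [← hs2 z, h]; simp)
    have hsd : DifferentiableOn ℂ s U := by
      intro z hz
      have hsq : HasStrictDerivAt (fun x : ℂ => x ^ 2) ((2 : ℕ) * s z ^ (2 - 1)) (s z) :=
        hasStrictDerivAt_pow 2 (s z)
      have hne : ((2 : ℕ) : ℂ) * s z ^ (2 - 1) ≠ 0 := by simpa using hsne z hz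
      have hcont : ContinuousAt s z := hsc.continuousAt (hUo.mem_nhds hz)
      have h2 := hsq.to_localInverse hne
      have h3 : ∀ᶠ x in 𝓝 z, s x = hsq.localInverse _ _ _ hne (s x ^ 2) :=
        (hcont.eventually (hsq.eventually_left_inverse hne)).mono fun x hx => hx.symm
      have h4 : DifferentiableAt ℂ (fun x => hsq.localInverse _ _ _ hne (discAut w (g x))) z := by
        have h5 : DifferentiableAt ℂ (hsq.localInverse _ _ _ hne) (discAut w (g z)) := by
          rw [← hs2 z]; exact h2.hasDerivAt.differentiableAt
        exact h5.comp z (hGd.differentiableAt (hUo.mem_nhds hz))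
      refine (h4.congr_of_eventuallyEq ?_).differentiableWithinAt
      filter_upwards [h3] with x hx
      rw [hx, hs2 x]
    have hsm : MapsTo s U (ball 0 1) := fun z hz => by
      have h1 := norm_discAut_lt_one hw1 (mem_ball_zero_iff.1 (hgm hz))
      rw [← hs2 z, norm_pow] at h1
      rw [mem_ball_zero_iff]
      nlinarith [norm_nonneg (s z)]
    have hback : ∀ z ∈ U, discAut (-w) (s z ^ 2) = g z := fun z hz => by
      rw [hs2 z]; exact discAut_neg_discAut hw1 (mem_ball_zero_iff.1 (hgm hz))
    have hsqm : MapsTo (fun x : ℂ => x ^ 2) (ball 0 1) (ball 0 1) := fun x hx => by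
      rw [mem_ball_zero_iff] at hx ⊢
      rw [norm_pow]; nlinarith [norm_nonneg x]
    set a := s z₀ with ha
    have ha1 : ‖a‖ < 1 := mem_ball_zero_iff.1 (hsm hz₀)
    have hna1 : ‖-a‖ < 1 := by rwa [norm_neg]
    have hnw1 : ‖-w‖ < 1 := by rwa [norm_neg]
    set Φ : ℂ → ℂ := fun x => discAut (-w) (discAut (-a) x ^ 2) with hΦ
    have hsdne : ∀ z ∈ U, deriv s z ≠ 0 := by
      intro z hz h
      apply hgn z hz
      have h1 : HasDerivAt s 0 z := by
        rw [← h]; exact (hsd.differentiableAt (hUo.mem_nhds hz)).hasDerivAt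
      have h2 : DifferentiableAt ℂ (fun x : ℂ => discAut (-w) (x ^ 2)) (s z) :=
        (((differentiableOn_discAut hnw1).comp (differentiableOn_id.pow 2)
          hsqm).differentiableAt (isOpen_ball.mem_nhds (hsm hz)))
      have h3 := h2.hasDerivAt.comp z h1
      have h4 : ((fun x : ℂ => discAut (-w) (x ^ 2)) ∘ s) =ᶠ[𝓝 z] g := by
        filter_upwards [hUo.mem_nhds hz] with v hv using hback v hv
      rw [← h4.deriv_eq, h3.deriv, mul_zero]
    have hFS' : (fun z => discAut a (s z)) ∈ S := by
      refine hcomp hsd hsm (fun z hz v hv h => ?_) hsdne rfl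
      apply hgi hz hv
      rw [← hback z hz, ← hback v hv, h]
    have hΦd : DifferentiableOn ℂ Φ (ball 0 1) := by
      have h1 : MapsTo (discAut (-a)) (ball 0 1) (ball 0 1) := fun x hx =>
        mem_ball_zero_iff.2 (norm_discAut_lt_one hna1 (mem_ball_zero_iff.1 hx))
      exact (differentiableOn_discAut hnw1).comp ((differentiableOn_discAut hna1).pow 2)
        (hsqm.comp h1)
    have hΦm : MapsTo Φ (ball 0 1) (ball 0 1) := fun x hx =>
      mem_ball_zero_iff.2 (norm_discAut_lt_one hnw1 (mem_ball_zero_iff.1 (hsqm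
        (mem_ball_zero_iff.2 (norm_discAut_lt_one hna1 (mem_ball_zero_iff.1 hx))))))
    have hΦg : ∀ z ∈ U, Φ (discAut a (s z)) = g z := fun z hz => by
      simp only [hΦ]
      rw [discAut_neg_discAut ha1 (mem_ball_zero_iff.1 (hsm hz)), hback z hz]
    have hF0 : discAut a (s z₀) = 0 := discAut_self a
    have hΦ0 : Φ 0 = 0 := by
      have := hΦg z₀ hz₀
      rwa [hF0, hg0] at this
    have hchain : deriv g z₀ = deriv Φ 0 * deriv (fun z => discAut a (s z)) z₀ := by
      have h1 : HasDerivAt Φ (deriv Φ 0) (discAut a (s z₀)) := by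
        rw [hF0]; exact (hΦd.differentiableAt (isOpen_ball.mem_nhds (by simp))).hasDerivAt
      have h2 := h1.comp z₀ (hFS'.1.differentiableAt (hUo.mem_nhds hz₀)).hasDerivAt
      have h4 : (Φ ∘ fun z => discAut a (s z)) =ᶠ[𝓝 z₀] g := by
        filter_upwards [hUo.mem_nhds hz₀] with v hv using hΦg v hv
      rw [← h4.deriv_eq, h2.deriv]
    have hΦ1 : ‖deriv Φ 0‖ ≤ 1 := by
      have := Complex.norm_deriv_le_div_of_mapsTo_ball (c := 0) (R₁ := 1) (R₂ := 1) hΦd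
        (by rw [hΦ0]; exact hΦm.mono_right ball_subset_closedBall) one_pos
      simpa using this
    have hΦne : ‖deriv Φ 0‖ ≠ 1 := by
      intro h
      have hinj := injOn_of_norm_deriv_eq_one hΦd hΦm hΦ0 h
      have hane : a ≠ 0 := hsne z₀ hz₀
      have hp1 : discAut a a ∈ ball (0 : ℂ) 1 := by
        rw [discAut_self]; simp
      have hp2 : discAut a (-a) ∈ ball (0 : ℂ) 1 :=
        mem_ball_zero_iff.2 (norm_discAut_lt_one ha1 hna1)
      have h3 : Φ (discAut a a) = Φ (discAut a (-a)) := by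
        simp only [hΦ]
        rw [discAut_neg_discAut ha1 ha1, discAut_neg_discAut ha1 hna1]
        simp
      have h4 := hinj hp1 hp2 h3
      have h5 := congrArg (discAut (-a)) h4
      rw [discAut_neg_discAut ha1 ha1, discAut_neg_discAut ha1 hna1] at h5
      exact hane (self_eq_neg.1 h5)
    have h6 := hle _ hFS'
    have h7 : M = ‖deriv Φ 0‖ * ‖deriv (fun z => discAut a (s z)) z₀‖ := by
      rw [← norm_mul, ← hchain, hgM]
    have h8 : ‖deriv Φ 0‖ < 1 := lt_of_le_of_ne hΦ1 hΦne
    nlinarith [norm_nonneg (deriv Φ 0)]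
  have himg : g '' U = ball 0 1 := (image_subset_iff.2 hgm).antisymm hsurj
  obtain ⟨h, hhd, hhl⟩ := exists_holomorphic_inverse hUo hgd hgi hgn
  rw [himg] at hhd
  refine ⟨g, h, hgd, hhd, hgm, fun w hw => ?_, ⟨hhl, fun w hw => ?_⟩, hg0⟩
  · obtain ⟨z, hz, rfl⟩ := hsurj hw
    rwa [hhl z hz]
  · obtain ⟨z, hz, rfl⟩ := hsurj hw
    rw [hhl z hz]

/-! ### Area and length integrals -/

theorem abs_det_smul_one (c : ℂ) : |(c • (1 : ℂ →L[ℝ] ℂ)).det| = ‖c‖ ^ 2 := by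
  have h : (c • (1 : ℂ →L[ℝ] ℂ)).det = Complex.normSq c := by
    rw [← Algebra.norm_complex_apply, Algebra.norm_apply]
    rfl
  rw [h, abs_of_nonneg (Complex.normSq_nonneg c), Complex.normSq_eq_norm_sq]

/-- Change of variables under an injective holomorphic map. -/
theorem lintegral_image_holomorphic {S : Set ℂ} (hS : MeasurableSet S) {g g' : ℂ → ℂ}
    (hg : ∀ z ∈ S, HasDerivAt g (g' z) z) (hinj : InjOn g S) (ρ : ℂ → ℝ≥0∞) :
    ∫⁻ w in g '' S, ρ w = ∫⁻ z in S, ‖g' z‖ₑ ^ 2 * ρ (g z) := by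
  rw [lintegral_image_eq_lintegral_abs_det_fderiv_mul volume hS
    (fun z hz => (hg z hz).complexToReal_fderiv.hasFDerivWithinAt) hinj]
  refine lintegral_congr fun z => ?_
  rw [abs_det_smul_one, ENNReal.ofReal_pow (norm_nonneg _), ofReal_norm]

theorem lintegral_reProdIm {A B : Set ℝ}
    {f : ℂ → ℝ≥0∞} (hf : AEMeasurable f (volume.restrict (A ×ℂ B))) :
    ∫⁻ z in A ×ℂ B, f z = ∫⁻ y in B, ∫⁻ x in A, f (x + y * Complex.I) := by
  have hmp := Complex.volume_preserving_equiv_real_prod.symm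
  have hpre : Complex.measurableEquivRealProd.symm ⁻¹' (A ×ℂ B) = A ×ˢ B := by
    ext p; simp [Complex.mem_reProdIm, Complex.measurableEquivRealProd]
  have hres := hmp.restrict_preimage_emb Complex.measurableEquivRealProd.symm.measurableEmbedding
    (A ×ℂ B)
  rw [hpre] at hres
  rw [← hres.lintegral_comp_emb Complex.measurableEquivRealProd.symm.measurableEmbedding,
    Measure.volume_eq_prod, ← Measure.prod_restrict, lintegral_prod_symm]
  · refine lintegral_congr fun y => lintegral_congr fun x => ?_
    congr 1
    apply Complex.ext <;> simp [Complex.measurableEquivRealProd]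
  · rw [Measure.prod_restrict, ← Measure.volume_eq_prod]
    exact hf.comp_quasiMeasurePreserving hres.quasiMeasurePreserving

theorem lintegral_reProdIm_symm {A B : Set ℝ}
    {f : ℂ → ℝ≥0∞} (hf : AEMeasurable f (volume.restrict (A ×ℂ B))) :
    ∫⁻ z in A ×ℂ B, f z = ∫⁻ x in A, ∫⁻ y in B, f (x + y * Complex.I) := by
  have hmp := Complex.volume_preserving_equiv_real_prod.symm
  have hpre : Complex.measurableEquivRealProd.symm ⁻¹' (A ×ℂ B) = A ×ˢ B := by
    ext p; simp [Complex.mem_reProdIm, Complex.measurableEquivRealProd]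
  have hres := hmp.restrict_preimage_emb Complex.measurableEquivRealProd.symm.measurableEmbedding
    (A ×ℂ B)
  rw [hpre] at hres
  rw [← hres.lintegral_comp_emb Complex.measurableEquivRealProd.symm.measurableEmbedding,
    Measure.volume_eq_prod, ← Measure.prod_restrict, lintegral_prod]
  · refine lintegral_congr fun y => lintegral_congr fun x => ?_
    congr 1
    apply Complex.ext <;> simp [Complex.measurableEquivRealProd]
  · rw [Measure.prod_restrict, ← Measure.volume_eq_prod]
    exact hf.comp_quasiMeasurePreserving hres.quasiMeasurePreserving

/-- The Cauchy-Schwarz inequality against the constant function. -/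
theorem lintegral_sq_le {α : Type*} [MeasurableSpace α] (μ : Measure α) {f : α → ℝ≥0∞}
    (hf : AEMeasurable f μ) : (∫⁻ x, f x ∂μ) ^ 2 ≤ μ univ * ∫⁻ x, f x ^ 2 ∂μ := by
  have h := ENNReal.lintegral_mul_le_Lp_mul_Lq μ Real.HolderConjugate.two_two
    (aemeasurable_const (b := (1 : ℝ≥0∞))) hf
  simp only [Pi.mul_apply, one_mul, ENNReal.rpow_two, one_pow, lintegral_one] at h
  calc (∫⁻ x, f x ∂μ) ^ 2
      ≤ (μ univ ^ (1 / 2 : ℝ) * (∫⁻ x, f x ^ 2 ∂μ) ^ (1 / 2 : ℝ)) ^ 2 := by gcongr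
    _ = μ univ * ∫⁻ x, f x ^ 2 ∂μ := by
        rw [mul_pow, ← ENNReal.rpow_natCast, ← ENNReal.rpow_natCast, ← ENNReal.rpow_mul,
          ← ENNReal.rpow_mul]
        norm_num

/-- The length of a smooth arc dominates the displacement of its end points. -/
theorem enorm_sub_le_lintegral_deriv {c : ℝ → ℂ} {a b : ℝ} (hab : a ≤ b)
    (hc : ∀ t ∈ Icc a b, DifferentiableAt ℝ c t) (hc' : ContinuousOn (deriv c) (Icc a b)) :
    ‖c b - c a‖ₑ ≤ ∫⁻ t in Ioc a b, ‖deriv c t‖ₑ := by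
  have h := intervalIntegral.integral_eq_sub_of_hasDerivAt (f := c) (f' := deriv c) (a := a)
    (b := b) (fun t ht => (hc t (by rwa [uIcc_of_le hab] at ht)).hasDerivAt)
    (by rw [← uIcc_of_le hab] at hc'; exact hc'.intervalIntegrable)
  rw [← h, intervalIntegral.integral_of_le hab]
  exact enorm_integral_le_lintegral_enorm _

/-! ### Conformal equivalences and boundary charts -/

/-- `φ : Ω → D` is biholomorphic with inverse `h`. -/
structure IsConformalEquiv (φ h : ℂ → ℂ) (Ω D : Set ℂ) : Prop where
  diff : DifferentiableOn ℂ φ Ω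
  diff_inv : DifferentiableOn ℂ h D
  mapsTo : MapsTo φ Ω D
  mapsTo_inv : MapsTo h D Ω
  left_inv : ∀ z ∈ Ω, h (φ z) = z
  right_inv : ∀ w ∈ D, φ (h w) = w

theorem IsConformalEquiv.symm {φ h : ℂ → ℂ} {Ω D : Set ℂ} (H : IsConformalEquiv φ h Ω D) :
    IsConformalEquiv h φ D Ω :=
  ⟨H.diff_inv, H.diff, H.mapsTo_inv, H.mapsTo, H.right_inv, H.left_inv⟩

theorem IsConformalEquiv.trans {φ h ψ k : ℂ → ℂ} {Ω D E : Set ℂ} (H : IsConformalEquiv φ h Ω D)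
    (K : IsConformalEquiv ψ k D E) :
    IsConformalEquiv (fun z => ψ (φ z)) (fun z => h (k z)) Ω E :=
  ⟨K.diff.comp H.diff H.mapsTo, H.diff_inv.comp K.diff_inv K.mapsTo_inv,
    K.mapsTo.comp H.mapsTo, H.mapsTo_inv.comp K.mapsTo_inv,
    fun z hz => by simp only [K.left_inv _ (H.mapsTo hz), H.left_inv z hz],
    fun z hz => by simp only [H.right_inv _ (K.mapsTo_inv hz), K.right_inv z hz]⟩

theorem IsConformalEquiv.injOn {φ h : ℂ → ℂ} {Ω D : Set ℂ} (H : IsConformalEquiv φ h Ω D) :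
    InjOn φ Ω := fun z hz w hw hzw => by
  rw [← H.left_inv z hz, ← H.left_inv w hw, hzw]

theorem IsConformalEquiv.image_eq {φ h : ℂ → ℂ} {Ω D : Set ℂ} (H : IsConformalEquiv φ h Ω D) :
    φ '' Ω = D :=
  (image_subset_iff.2 H.mapsTo).antisymm fun w hw => ⟨h w, H.mapsTo_inv hw, H.right_inv w hw⟩

/-- The half-strip `Re > t`, `|Im| < θ`. -/
def halfStrip (θ t : ℝ) : Set ℂ := Ioi t ×ℂ Ioo (-θ) θ

/-- The half-strip together with its vertical side. -/
def halfStripClosed (θ t : ℝ) : Set ℂ := Ici t ×ℂ Ioo (-θ) θ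

theorem isOpen_halfStrip (θ t : ℝ) : IsOpen (halfStrip θ t) := isOpen_Ioi.reProdIm isOpen_Ioo

theorem convex_halfStrip (θ t : ℝ) : Convex ℝ (halfStrip θ t) :=
  ((convex_Ioi t).linear_preimage Complex.reLm).inter
    ((convex_Ioo (-θ) θ).linear_preimage Complex.imLm)

theorem halfStrip_mono {θ s t : ℝ} (h : s ≤ t) : halfStrip θ t ⊆ halfStrip θ s :=
  fun _ hz => ⟨h.trans_lt hz.1, hz.2⟩

theorem halfStrip_subset_closed {θ t : ℝ} : halfStrip θ t ⊆ halfStripClosed θ t :=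
  fun _ hz => ⟨le_of_lt (show t < _ from hz.1), hz.2⟩

theorem halfStripClosed_subset {θ s t : ℝ} (h : s < t) : halfStripClosed θ t ⊆ halfStrip θ s :=
  fun _ hz => ⟨h.trans_le hz.1, hz.2⟩

/-- A conformal half-strip in `Ω` which shrinks to the boundary element of `Ω` described by the
filter `𝓕`. -/
structure IsBoundaryChart (Ω : Set ℂ) (𝓕 : Filter ℂ) (χ : ℂ → ℂ) (θ : ℝ) : Prop where
  pos : 0 < θ
  diff : Differentiable ℂ χ
  deriv_ne : ∀ ζ, deriv χ ζ ≠ 0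
  inj : InjOn χ (halfStrip θ 0)
  mapsTo : MapsTo χ (halfStrip θ 0) Ω
  hasBasis : 𝓕.HasBasis (fun t : ℝ => 0 < t) (fun t => χ '' halfStrip θ t)
  closed : ∀ t : ℝ, 0 < t → ∀ z ∈ Ω, z ∈ closure (χ '' halfStripClosed θ t) → z ∈ χ '' halfStripClosed θ t
  exits : ∀ t : ℝ, 0 < t → χ (t + θ * Complex.I) ∉ Ω

theorem isOpen_image_of_injOn {U S : Set ℂ} {f : ℂ → ℂ} (hU : IsOpen U) (hUc : IsPreconnected U)
    (hf : DifferentiableOn ℂ f U) (hi : InjOn f U) (hS : IsOpen S) (hSU : S ⊆ U) :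
    IsOpen (f '' S) := by
  rcases (hf.analyticOnNhd hU).is_constant_or_isOpen hUc with ⟨w, hw⟩ | h
  · have hsub : U.Subsingleton := fun a ha b hb => hi ha hb ((hw a ha).trans (hw b hb).symm)
    rcases S.eq_empty_or_nonempty with rfl | ⟨z, hz⟩
    · simp
    · exfalso
      have : U = {z} := hsub.eq_singleton_of_mem (hSU hz)
      rw [this] at hU
      exact not_isOpen_singleton z hU
  · exact h S hSU hS

theorem IsBoundaryChart.neBot {Ω : Set ℂ} {𝓕 : Filter ℂ} {χ : ℂ → ℂ} {θ : ℝ}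
    (C : IsBoundaryChart Ω 𝓕 χ θ) : 𝓕.NeBot := by
  rw [C.hasBasis.neBot_iff]
  intro t _
  exact Set.Nonempty.image _ ⟨⟨t + 1, 0⟩, by
    simp [halfStrip, Complex.mem_reProdIm, C.pos]⟩

theorem IsBoundaryChart.isOpen_image {Ω : Set ℂ} {𝓕 : Filter ℂ} {χ : ℂ → ℂ} {θ : ℝ}
    (C : IsBoundaryChart Ω 𝓕 χ θ) {t : ℝ} (ht : 0 ≤ t) : IsOpen (χ '' halfStrip θ t) :=
  isOpen_image_of_injOn (isOpen_halfStrip θ 0) (convex_halfStrip θ 0).isPreconnected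
    C.diff.differentiableOn C.inj (isOpen_halfStrip θ t) (halfStrip_mono ht)

theorem IsBoundaryChart.isOpen_compl {Ω : Set ℂ} (hΩ : IsOpen Ω) {𝓕 : Filter ℂ} {χ : ℂ → ℂ}
    {θ : ℝ} (C : IsBoundaryChart Ω 𝓕 χ θ) {t : ℝ} (ht : 0 < t) :
    IsOpen (Ω \ χ '' halfStripClosed θ t) := by
  have : Ω \ χ '' halfStripClosed θ t = Ω \ closure (χ '' halfStripClosed θ t) := by
    ext z
    exact ⟨fun h => ⟨h.1, fun h' => h.2 (C.closed t ht z h.1 h')⟩,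
      fun h => ⟨h.1, fun h' => h.2 (subset_closure h')⟩⟩
  rw [this]
  exact hΩ.sdiff isClosed_closure

theorem IsBoundaryChart.exists_notMem {Ω : Set ℂ} {𝓕 : Filter ℂ} {χ : ℂ → ℂ} {θ : ℝ}
    (C : IsBoundaryChart Ω 𝓕 χ θ) (z : ℂ) :
    ∃ T > 0, ∀ t ≥ T, z ∉ χ '' halfStripClosed θ t := by
  by_cases hz : z ∈ χ '' halfStrip θ 0
  · obtain ⟨ζ, hζ, rfl⟩ := hz
    refine ⟨ζ.re + 1, by have := hζ.1; simp only [mem_preimage, mem_Ioi] at this; linarith, ?_⟩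
    rintro t ht ⟨ζ', hζ', h⟩
    have h0 : (0 : ℝ) < t := by have := hζ.1; simp only [mem_preimage, mem_Ioi] at this; linarith
    have := C.inj (halfStripClosed_subset h0 hζ') hζ h
    subst this
    have := hζ'.1
    simp only [mem_preimage, mem_Ici] at this
    linarith
  · exact ⟨1, one_pos, fun t ht h => hz (image_mono (halfStripClosed_subset
      (one_pos.trans_le ht)) h)⟩

/-- The length-area principle on a half-strip. -/
theorem exists_lintegral_deriv_lt {g : ℂ → ℂ} {θ : ℝ}
    (hg : DifferentiableOn ℂ g (halfStrip θ 0)) (hinj : InjOn g (halfStrip θ 0))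
    (hm : MapsTo g (halfStrip θ 0) (ball 0 1)) {ε : ℝ≥0∞} (hε : ε ≠ 0) {T : ℝ} (hT : 0 ≤ T) :
    ∃ t > T, ∫⁻ y in Ioo (-θ) θ, ‖deriv g (t + y * Complex.I)‖ₑ < ε := by
  by_contra! hcon
  have hmeas : Measurable fun z => ‖deriv g z‖ₑ ^ 2 := (measurable_deriv g).enorm.pow_const 2
  have h1 : ∀ t > T, ε ^ 2 ≤ volume (Ioo (-θ) θ) *
      ∫⁻ y in Ioo (-θ) θ, ‖deriv g (t + y * Complex.I)‖ₑ ^ 2 := fun t ht => by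
    have h2 := lintegral_sq_le (volume.restrict (Ioo (-θ) θ))
      (f := fun y : ℝ => ‖deriv g (t + y * Complex.I)‖ₑ)
      ((measurable_deriv g).enorm.comp (by fun_prop)).aemeasurable
    rw [Measure.restrict_apply_univ] at h2
    exact (pow_le_pow_left' (hcon t ht) 2).trans h2
  have harea : ∫⁻ z in halfStrip θ T, ‖deriv g z‖ₑ ^ 2 ≤ volume (ball (0 : ℂ) 1) := by
    have h2 := lintegral_image_holomorphic (isOpen_halfStrip θ T).measurableSet
      (g := g) (g' := deriv g)
      (fun z hz => (hg.differentiableAt ((isOpen_halfStrip θ 0).mem_nhds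
        (halfStrip_mono hT hz))).hasDerivAt)
      (hinj.mono (halfStrip_mono hT)) (fun _ => 1)
    simp only [lintegral_const, Measure.restrict_apply_univ, one_mul, mul_one] at h2
    rw [← h2]
    exact measure_mono (image_subset_iff.2 fun z hz => hm (halfStrip_mono hT hz))
  have h3 : ∫⁻ x in Ioi T, ε ^ 2 ≤ volume (Ioo (-θ) θ) * volume (ball (0 : ℂ) 1) := by
    calc ∫⁻ x in Ioi T, ε ^ 2
        ≤ ∫⁻ x in Ioi T, volume (Ioo (-θ) θ) *
            ∫⁻ y in Ioo (-θ) θ, ‖deriv g (x + y * Complex.I)‖ₑ ^ 2 :=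
          setLIntegral_mono' measurableSet_Ioi h1
      _ = volume (Ioo (-θ) θ) * ∫⁻ x in Ioi T,
            ∫⁻ y in Ioo (-θ) θ, ‖deriv g (x + y * Complex.I)‖ₑ ^ 2 :=
          lintegral_const_mul' _ _ (by simp)
      _ = volume (Ioo (-θ) θ) * ∫⁻ z in halfStrip θ T, ‖deriv g z‖ₑ ^ 2 := by
          rw [halfStrip, lintegral_reProdIm_symm hmeas.aemeasurable]
      _ ≤ _ := by gcongr
  have h4 : volume (Ioo (-θ) θ) * volume (ball (0 : ℂ) 1) < ∞ :=
    ENNReal.mul_lt_top (by simp) measure_ball_lt_top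
  rw [lintegral_const, Measure.restrict_apply_univ, Real.volume_Ioi,
    ENNReal.mul_top (pow_ne_zero 2 hε)] at h3
  exact absurd (h3.trans_lt h4) (lt_irrefl _)

theorem IsConformalEquiv.comp_chart {Ω D : Set ℂ} {φ h : ℂ → ℂ} (H : IsConformalEquiv φ h Ω D)
    {𝓕 : Filter ℂ} {χ : ℂ → ℂ} {θ : ℝ} (C : IsBoundaryChart Ω 𝓕 χ θ) :
    DifferentiableOn ℂ (fun ζ => φ (χ ζ)) (halfStrip θ 0) ∧
    InjOn (fun ζ => φ (χ ζ)) (halfStrip θ 0) ∧ MapsTo (fun ζ => φ (χ ζ)) (halfStrip θ 0) D :=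
  ⟨H.diff.comp C.diff.differentiableOn C.mapsTo, H.injOn.comp C.inj C.mapsTo,
    H.mapsTo.comp C.mapsTo⟩

theorem exists_image_subset_closedBall {Ω : Set ℂ} (hΩ : IsOpen Ω) {φ h : ℂ → ℂ}
    (H : IsConformalEquiv φ h Ω (ball 0 1)) {𝓕 : Filter ℂ} {χ : ℂ → ℂ} {θ : ℝ}
    (C : IsBoundaryChart Ω 𝓕 χ θ) {ε : ℝ} (hε : 0 < ε) :
    ∃ t > 0, ∃ w : ℂ, ‖w‖ = 1 ∧ ∀ ζ ∈ halfStrip θ t, φ (χ ζ) ∈ closedBall w (2 * ε) := by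
  obtain ⟨hgd, hgi, hgm⟩ := H.comp_chart C
  set g : ℂ → ℂ := fun ζ => φ (χ ζ) with hg
  obtain ⟨T, hT, hTn⟩ := C.exists_notMem (h 0)
  obtain ⟨t, ht, hlen⟩ := exists_lintegral_deriv_lt hgd hgi hgm
    (ε := ENNReal.ofReal ε) (by simpa using hε) hT.le
  have ht0 : 0 < t := hT.trans ht
  have hmem : ∀ y ∈ Ioo (-θ) θ, (t + y * Complex.I : ℂ) ∈ halfStrip θ 0 := fun y hy => by
    simpa [halfStrip, Complex.mem_reProdIm, ht0] using hy
  -- the cut has small diameter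
  have hdist : ∀ y₁ ∈ Ioo (-θ) θ, ∀ y₂ ∈ Ioo (-θ) θ, y₁ ≤ y₂ →
      dist (g (t + y₁ * Complex.I)) (g (t + y₂ * Complex.I)) ≤ ε := by
    intro y₁ h₁ y₂ h₂ h12
    have hsub : Icc y₁ y₂ ⊆ Ioo (-θ) θ := fun y hy => ⟨h₁.1.trans_le hy.1, hy.2.trans_lt h₂.2⟩
    have hder : ∀ y ∈ Ioo (-θ) θ, HasDerivAt (fun y : ℝ => g (t + y * Complex.I))
        (deriv g (t + y * Complex.I) * Complex.I) y := fun y hy => by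
      have h1 := (hgd.differentiableAt ((isOpen_halfStrip θ 0).mem_nhds (hmem y hy))).hasDerivAt
      have h2 : HasDerivAt (fun y : ℂ => (t : ℂ) + y * Complex.I) Complex.I (y : ℂ) := by
        simpa using ((hasDerivAt_id (y : ℂ)).mul_const Complex.I).const_add (t : ℂ)
      exact (h1.comp (y : ℂ) h2).comp_ofReal
    have hcont : ContinuousOn (deriv fun y : ℝ => g (t + y * Complex.I)) (Icc y₁ y₂) := by
      have h1 : ContinuousOn (deriv g) (halfStrip θ 0) :=
        (hgd.deriv (isOpen_halfStrip θ 0)).continuousOn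
      have h2 : ContinuousOn (fun y : ℝ => deriv g (t + y * Complex.I) * Complex.I)
          (Icc y₁ y₂) := by
        refine (h1.comp (f := fun y : ℝ => (t + y * Complex.I : ℂ)) (by fun_prop)
          fun y hy => hmem y (hsub hy)).mul continuousOn_const
      exact h2.congr fun y hy => (hder y (hsub hy)).deriv
    have h1 := enorm_sub_le_lintegral_deriv h12
      (fun y hy => (hder y (hsub hy)).differentiableAt) hcont
    have h2 : ∫⁻ y in Ioc y₁ y₂, ‖deriv (fun y : ℝ => g (t + y * Complex.I)) y‖ₑ
        ≤ ∫⁻ y in Ioo (-θ) θ, ‖deriv g (t + y * Complex.I)‖ₑ := by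
      refine (lintegral_mono_set (Ioc_subset_Icc_self.trans hsub)).trans_eq
        (setLIntegral_congr_fun measurableSet_Ioo fun y hy => ?_)
      simp only [(hder y hy).deriv, enorm_mul]
      simp [enorm_eq_nnnorm]
    have h3 := (h1.trans h2).trans hlen.le
    rw [← ofReal_norm, ENNReal.ofReal_le_ofReal_iff hε.le] at h3
    rwa [dist_comm, dist_eq_norm]
  -- an end point of the cut on the circle
  obtain ⟨w, hw1, hwcut⟩ : ∃ w : ℂ, ‖w‖ = 1 ∧
      ∀ y ∈ Ioo (-θ) θ, dist (g (t + y * Complex.I)) w ≤ ε := by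
    have hne : (𝓝[<] θ).NeBot := inferInstance
    set 𝓤 := Ultrafilter.of (𝓝[<] θ) with h𝓤
    have h𝓤le : (𝓤 : Filter ℝ) ≤ 𝓝[<] θ := Ultrafilter.of_le _
    have hev : ∀ᶠ y in (𝓤 : Filter ℝ), y ∈ Ioo (-θ) θ :=
      h𝓤le (Ioo_mem_nhdsLT (by linarith [C.pos]))
    obtain ⟨w, hwc, hw⟩ := (isCompact_closedBall (0 : ℂ) 1).ultrafilter_le_nhds'
      (𝓤.map fun y : ℝ => g (t + y * Complex.I))
      (hev.mono fun y hy => ball_subset_closedBall (hgm (hmem y hy)))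
    have hwt : Tendsto (fun y : ℝ => g (t + y * Complex.I)) 𝓤 (𝓝 w) := hw
    refine ⟨w, le_antisymm (mem_closedBall_zero_iff.1 hwc) ?_, fun y hy => ?_⟩
    · by_contra! hlt
      have hwb : w ∈ ball (0 : ℂ) 1 := mem_ball_zero_iff.2 hlt
      have hcont : ContinuousAt h w :=
        (H.diff_inv.differentiableAt (isOpen_ball.mem_nhds hwb)).continuousAt
      have h1 : Tendsto (fun y : ℝ => h (g (t + y * Complex.I))) 𝓤 (𝓝 (h w)) :=
        hcont.tendsto.comp hwt
      have h2 : Tendsto (fun y : ℝ => χ (t + y * Complex.I)) 𝓤 (𝓝 (χ (t + θ * Complex.I))) := by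
        have : Continuous fun y : ℝ => χ (t + y * Complex.I) :=
          C.diff.continuous.comp (by fun_prop)
        exact (this.tendsto θ).mono_left (h𝓤le.trans nhdsWithin_le_nhds)
      have h3 := tendsto_nhds_unique (h1.congr' (hev.mono fun y hy =>
        H.left_inv _ (C.mapsTo (hmem y hy)))) h2
      exact C.exits t ht0 (h3 ▸ H.mapsTo_inv hwb)
    · refine le_of_tendsto (tendsto_const_nhds.dist hwt) ?_
      filter_upwards [hev, h𝓤le (Ioo_mem_nhdsLT hy.2)] with y' hy' hyy
      exact hdist y hy y' hy' hyy.1.le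
  refine ⟨t, ht0, w, hw1, fun ζ hζ => ?_⟩
  by_contra hout
  have hout' : 2 * ε < dist (g ζ) w := by simpa using hout
  have hgζ : ‖g ζ‖ < 1 := mem_ball_zero_iff.1 (hgm (halfStrip_mono ht0.le hζ))
  set S := segment ℝ (0 : ℂ) (g ζ) with hSdef
  have hSball : S ⊆ ball 0 1 := (convex_ball (0 : ℂ) 1).segment_subset (by simp)
    (mem_ball_zero_iff.2 hgζ)
  have hScut : ∀ v ∈ S, ε < dist v w := by
    intro v hv
    rw [hSdef, segment_eq_image] at hv
    obtain ⟨s, hs, rfl⟩ := hv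
    simp only [smul_zero, zero_add]
    have e1 : dist (g ζ) (s • g ζ) ≤ 1 - s * ‖g ζ‖ := by
      rw [dist_eq_norm]
      have : g ζ - s • g ζ = (1 - s) • g ζ := by rw [sub_smul, one_smul]
      rw [this, norm_smul, Real.norm_of_nonneg (by linarith [hs.2])]
      nlinarith [hs.1, hs.2, norm_nonneg (g ζ)]
    have e2 : 1 - s * ‖g ζ‖ ≤ dist (s • g ζ) w := by
      rw [dist_comm, dist_eq_norm]
      have := norm_sub_norm_le w (s • g ζ)
      rwa [hw1, norm_smul, Real.norm_of_nonneg hs.1] at this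
    linarith [dist_triangle (g ζ) (s • g ζ) w]
  have hpre : IsPreconnected (h '' S) :=
    (convex_segment (0 : ℂ) (g ζ)).isPreconnected.image h (H.diff_inv.continuousOn.mono hSball)
  have hcov : h '' S ⊆ χ '' halfStrip θ t ∪ (Ω \ χ '' halfStripClosed θ t) := by
    rintro _ ⟨v, hv, rfl⟩
    by_cases hc : h v ∈ χ '' halfStripClosed θ t
    · left
      obtain ⟨ω, hω, hωv⟩ := hc
      rcases (show t ≤ ω.re from hω.1).eq_or_lt with heq | hlt
      · exfalso
        have h1 : g ω = v := by rw [hg]; simp only [hωv, H.right_inv v (hSball hv)]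
        have h2 : ω = t + ω.im * Complex.I := by
          apply Complex.ext <;> simp [heq]
        have h3 := hwcut ω.im hω.2
        rw [← h2, h1] at h3
        linarith [hScut v hv]
      · exact ⟨ω, ⟨hlt, hω.2⟩, hωv⟩
    · exact Or.inr ⟨H.mapsTo_inv (hSball hv), hc⟩
  have hdisj : Disjoint (χ '' halfStrip θ t) (Ω \ χ '' halfStripClosed θ t) :=
    disjoint_left.2 fun z hz hz' => hz'.2 (image_mono halfStrip_subset_closed hz)
  have h0 : h 0 ∈ Ω \ χ '' halfStripClosed θ t :=
    ⟨H.mapsTo_inv (by simp), hTn t ht.le⟩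
  have hsub := hpre.subset_right_of_subset_union (C.isOpen_image ht0.le)
    (C.isOpen_compl hΩ ht0) hdisj hcov ⟨h 0, ⟨0, left_mem_segment ℝ _ _, rfl⟩, h0⟩
  have h5 := hsub ⟨g ζ, right_mem_segment ℝ _ _, rfl⟩
  rw [hg] at h5
  simp only [H.left_inv _ (C.mapsTo (halfStrip_mono ht0.le hζ))] at h5
  exact h5.2 ⟨ζ, halfStrip_subset_closed hζ, rfl⟩

/-- A conformal map onto the disc has a limit at every charted boundary element. -/
theorem exists_tendsto_of_chart {Ω : Set ℂ} (hΩ : IsOpen Ω) {φ h : ℂ → ℂ}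
    (H : IsConformalEquiv φ h Ω (ball 0 1)) {𝓕 : Filter ℂ} {χ : ℂ → ℂ} {θ : ℝ}
    (C : IsBoundaryChart Ω 𝓕 χ θ) : ∃ ξ : ℂ, ‖ξ‖ = 1 ∧ Tendsto φ 𝓕 (𝓝 ξ) := by
  have hne := C.neBot
  have hmemF : ∀ t > 0, ∀ w : ℂ, ∀ r : ℝ, (∀ ζ ∈ halfStrip θ t, φ (χ ζ) ∈ closedBall w r) →
      ∀ᶠ z in 𝓕, φ z ∈ closedBall w r := fun t ht w r hw => by
    filter_upwards [C.hasBasis.mem_of_mem ht]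
    rintro _ ⟨ζ, hζ, rfl⟩
    exact hw ζ hζ
  have hcau : Cauchy (map φ 𝓕) := by
    rw [Metric.cauchy_iff]
    refine ⟨hne.map φ, fun ε hε => ?_⟩
    obtain ⟨t, ht, w, -, hw⟩ := exists_image_subset_closedBall hΩ H C (ε := ε / 8) (by positivity)
    refine ⟨closedBall w (2 * (ε / 8)), hmemF t ht w _ hw, fun x hx y hy => ?_⟩
    have := dist_triangle_right x y w
    rw [mem_closedBall] at hx hy
    linarith
  obtain ⟨ξ, hξ⟩ := CompleteSpace.complete hcau
  refine ⟨ξ, ?_, hξ⟩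
  have hb : ∀ ε > 0, |‖ξ‖ - 1| ≤ 2 * ε := fun ε hε => by
    obtain ⟨t, ht, w, hw1, hw⟩ := exists_image_subset_closedBall hΩ H C hε
    have h1 : ξ ∈ closedBall w (2 * ε) :=
      isClosed_closedBall.mem_of_tendsto hξ (hmemF t ht w _ hw)
    rw [mem_closedBall, dist_eq_norm] at h1
    rw [← hw1]
    exact (abs_norm_sub_norm_le ξ w).trans h1
  by_contra hne1
  have h1 : 0 < |‖ξ‖ - 1| := abs_pos.2 (sub_ne_zero.2 hne1)
  linarith [hb (|‖ξ‖ - 1| / 4) (by positivity)]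

theorem DifferentiableOn.contDiffOn_real {U : Set ℂ} {f : ℂ → ℂ} (hf : DifferentiableOn ℂ f U)
    (hU : IsOpen U) : ContDiffOn ℝ 1 f U :=
  (hf.contDiffOn hU).restrict_scalars ℝ

/-- An arc that enters a boundary half-strip from depth `a` to depth `a + 1` crosses a piece of
length at least one in the coordinate of the half-strip. -/
theorem exists_crossing {Ω : Set ℂ} {𝓕 : Filter ℂ} {χ : ℂ → ℂ} {θ : ℝ}
    (C : IsBoundaryChart Ω 𝓕 χ θ) {q : ℂ → ℂ} (hq : DifferentiableOn ℂ q (χ '' halfStrip θ 0))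
    (hqχ : ∀ ζ ∈ halfStrip θ 0, q (χ ζ) = ζ) {c : ℝ → ℂ} {O : Set ℝ} (hO : IsOpen O)
    (hcO : ContDiffOn ℝ 1 c O) {y₁ y₂ : ℝ} (hyO : Icc y₁ y₂ ⊆ O) (h12 : y₁ ≤ y₂)
    (hcΩ : ∀ y ∈ Icc y₁ y₂, c y ∈ Ω) {a : ℝ} (ha : 0 < a)
    (h1 : c y₁ ∈ χ '' halfStripClosed θ (a + 1)) (h2 : c y₂ ∉ χ '' halfStrip θ a) :
    ∃ s t, Ioo s t ⊆ Icc y₁ y₂ ∧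
      (∀ y ∈ Ioo s t, c y ∈ χ '' halfStrip θ a ∧ (q (c y)).re < a + 1) ∧
      1 ≤ ∫⁻ y in Ioo s t, ‖deriv (fun y => q (c y)) y‖ₑ := by
  have hcc : ContinuousOn c (Icc y₁ y₂) := hcO.continuousOn.mono hyO
  have ha1 : 0 < a + 1 := by linarith
  -- relatively closed sets of parameters
  have hclosed : ∀ t, 0 < t → IsClosed {y ∈ Icc y₁ y₂ | c y ∈ χ '' halfStripClosed θ t} := by
    intro t ht
    have : {y ∈ Icc y₁ y₂ | c y ∈ χ '' halfStripClosed θ t}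
        = Icc y₁ y₂ ∩ c ⁻¹' closure (χ '' halfStripClosed θ t) := by
      ext y
      exact ⟨fun h => ⟨h.1, subset_closure h.2⟩, fun h => ⟨h.1, C.closed t ht _ (hcΩ y h.1) h.2⟩⟩
    rw [this]
    exact hcc.preimage_isClosed_of_isClosed isClosed_Icc isClosed_closure
  have hAc := hclosed (a + 1) ha1
  have hAcomp : IsCompact {y ∈ Icc y₁ y₂ | c y ∈ χ '' halfStripClosed θ (a + 1)} :=
    isCompact_Icc.of_isClosed_subset hAc fun y hy => hy.1
  obtain ⟨s, ⟨hsI, hsc⟩, hsmax⟩ := hAcomp.exists_isGreatest ⟨y₁, left_mem_Icc.2 h12, h1⟩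
  have hsub1 : halfStripClosed θ (a + 1) ⊆ halfStrip θ a := halfStripClosed_subset (by linarith)
  have hBc : IsClosed (Icc s y₂ ∩ c ⁻¹' (χ '' halfStrip θ a)ᶜ) :=
    (hcc.mono (Icc_subset_Icc_left hsI.1)).preimage_isClosed_of_isClosed isClosed_Icc
      (C.isOpen_image ha.le).isClosed_compl
  have hBcomp : IsCompact (Icc s y₂ ∩ c ⁻¹' (χ '' halfStrip θ a)ᶜ) :=
    isCompact_Icc.of_isClosed_subset hBc inter_subset_left
  obtain ⟨t, ⟨htI, htc⟩, htmin⟩ := hBcomp.exists_isLeast ⟨y₂, right_mem_Icc.2 hsI.2, h2⟩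
  have hst : s < t := lt_of_le_of_ne htI.1 (by
    rintro rfl
    exact htc (image_mono hsub1 hsc))
  have hsubI : Icc s t ⊆ Icc y₁ y₂ := Icc_subset_Icc hsI.1 htI.2
  have hin : ∀ y ∈ Ico s t, c y ∈ χ '' halfStrip θ a := fun y hy => by
    by_contra hcon
    exact (htmin ⟨⟨hy.1, hy.2.le.trans htI.2⟩, hcon⟩).not_gt hy.2
  have ha0 : halfStrip θ a ⊆ halfStrip θ 0 := halfStrip_mono ha.le
  have hlt : ∀ d, 0 < d → ∀ y ∈ Ico s t, c y ∉ χ '' halfStripClosed θ (a + d) →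
      (q (c y)).re < a + d := by
    intro d hd y hy hn
    obtain ⟨ζ, hζ, hζy⟩ := hin y hy
    rw [← hζy, hqχ ζ (ha0 hζ)]
    by_contra! hge
    exact hn ⟨ζ, ⟨hge, hζ.2⟩, hζy⟩
  set W : ℝ → ℂ := fun y => q (c y) with hW
  have hO' : IsOpen (O ∩ c ⁻¹' (χ '' halfStrip θ 0)) :=
    hcO.continuousOn.isOpen_inter_preimage hO (C.isOpen_image le_rfl)
  have hWd : ContDiffOn ℝ 1 W (O ∩ c ⁻¹' (χ '' halfStrip θ 0)) :=
    (DifferentiableOn.contDiffOn_real hq (C.isOpen_image le_rfl)).comp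
      (hcO.mono inter_subset_left) fun y hy => hy.2
  have hsubO : Ico s t ⊆ O ∩ c ⁻¹' (χ '' halfStrip θ 0) := fun y hy =>
    ⟨hyO (hsubI (Ico_subset_Icc_self hy)), image_mono ha0 (hin y hy)⟩
  refine ⟨s, t, Ioo_subset_Icc_self.trans hsubI, fun y hy => ⟨hin y (Ioo_subset_Ico_self hy),
    hlt 1 one_pos y (Ioo_subset_Ico_self hy) fun h => ?_⟩, ?_⟩
  · exact (hsmax ⟨hsubI (Ioo_subset_Icc_self hy), h⟩).not_gt hy.1
  have hWs : a + 1 ≤ (W s).re := by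
    obtain ⟨ζ, hζ, hζy⟩ := hsc
    rw [hW]; simp only
    rw [← hζy, hqχ ζ (ha0 (hsub1 hζ))]
    exact hζ.1
  have hkey : ∀ d : ℝ, 0 < d → ENNReal.ofReal (1 - d) ≤ ∫⁻ y in Ioo s t, ‖deriv W y‖ₑ := by
    intro d hd
    have hopen : ∀ᶠ y in 𝓝[<] t, c y ∉ χ '' halfStripClosed θ (a + d) := by
      have htn : t ∉ {y ∈ Icc y₁ y₂ | c y ∈ χ '' halfStripClosed θ (a + d)} := fun h =>
        htc (image_mono (halfStripClosed_subset (by linarith)) h.2)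
      have := (hclosed (a + d) (by linarith)).isOpen_compl.mem_nhds htn
      filter_upwards [mem_nhdsWithin_of_mem_nhds this, Ioo_mem_nhdsLT hst] with y hy hyI h
      exact hy ⟨hsubI (Ioo_subset_Icc_self hyI), h⟩
    obtain ⟨y, hyn, hyI⟩ := (hopen.and (Ioo_mem_nhdsLT hst)).exists
    have hyd := hlt d hd y (Ioo_subset_Ico_self hyI) hyn
    have hsub2 : Icc s y ⊆ O ∩ c ⁻¹' (χ '' halfStrip θ 0) := fun v hv =>
      hsubO ⟨hv.1, hv.2.trans_lt hyI.2⟩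
    have h3 := enorm_sub_le_lintegral_deriv (c := W) hyI.1.le
      (fun v hv => (hWd.differentiableOn one_ne_zero).differentiableAt
        (hO'.mem_nhds (hsub2 hv)))
      ((hWd.continuousOn_deriv_of_isOpen hO' le_rfl).mono hsub2)
    have h4 : ENNReal.ofReal (1 - d) ≤ ‖W y - W s‖ₑ := by
      rw [← ofReal_norm]
      refine ENNReal.ofReal_le_ofReal ?_
      have := (abs_le.1 (Complex.abs_re_le_norm (W y - W s))).1
      rw [Complex.sub_re] at this
      linarith
    exact (h4.trans h3).trans (lintegral_mono_set fun v hv => ⟨hv.1, hv.2.trans_lt hyI.2⟩)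
  have hlim : Tendsto (fun d : ℝ => ENNReal.ofReal (1 - d)) (𝓝[>] 0) (𝓝 (ENNReal.ofReal 1)) := by
    have : Continuous fun d : ℝ => ENNReal.ofReal (1 - d) :=
      ENNReal.continuous_ofReal.comp (by fun_prop)
    have h := this.tendsto 0
    rw [sub_zero] at h
    exact h.mono_left nhdsWithin_le_nhds
  rw [ENNReal.ofReal_one] at hlim
  exact le_of_tendsto hlim (by filter_upwards [self_mem_nhdsWithin] with d hd using hkey d hd)

theorem exists_norm_sub_eq {Ω D : Set ℂ} {φ h : ℂ → ℂ} (H : IsConformalEquiv φ h Ω D)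
    {𝓕 : Filter ℂ} {χ : ℂ → ℂ} {θ : ℝ} (C : IsBoundaryChart Ω 𝓕 χ θ) {ξ : ℂ} (hξD : ξ ∉ D)
    (hξ : Tendsto φ 𝓕 (𝓝 ξ)) {t : ℝ} (ht : 0 < t) :
    ∃ T : ℝ, ∀ x > T, ∃ ζ ∈ halfStrip θ t, ‖φ (χ ζ) - ξ‖ = Real.exp (-x) := by
  obtain ⟨hgd, hgi, hgm⟩ := H.comp_chart C
  have hpre : IsPreconnected ((fun ζ => ‖φ (χ ζ) - ξ‖) '' halfStrip θ t) :=
    (convex_halfStrip θ t).isPreconnected.image _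
      ((hgd.continuousOn.mono (halfStrip_mono ht.le)).sub continuousOn_const).norm
  have hp0 : (⟨t + 1, 0⟩ : ℂ) ∈ halfStrip θ t := by
    simp [halfStrip, Complex.mem_reProdIm, C.pos]
  set d := ‖φ (χ ⟨t + 1, 0⟩) - ξ‖ with hd
  have hd0 : 0 < d := norm_pos_iff.2 (sub_ne_zero.2 fun h' =>
    hξD (h' ▸ hgm (halfStrip_mono ht.le hp0)))
  refine ⟨-Real.log d, fun x hx => ?_⟩
  have hxd : Real.exp (-x) < d := by
    rw [← Real.lt_log_iff_exp_lt hd0]; linarith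
  have hne := C.neBot
  have hev : ∀ᶠ z in 𝓕, z ∈ χ '' halfStrip θ t ∧ ‖φ z - ξ‖ < Real.exp (-x) :=
    (eventually_mem_set.2 (C.hasBasis.mem_of_mem ht)).and
      ((Metric.tendsto_nhds.1 hξ _ (Real.exp_pos (-x))).mono fun z hz => by
        rwa [dist_eq_norm] at hz)
  obtain ⟨z, ⟨ζ, hζ, rfl⟩, hz⟩ := hev.exists
  obtain ⟨ω, hω, he⟩ := hpre.ordConnected.out (mem_image_of_mem _ hζ) (mem_image_of_mem _ hp0)
    ⟨hz.le, hxd.le⟩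
  exact ⟨ω, hω, he⟩

/-- The logarithmic coordinate of the unit disc at its boundary point `ξ`. -/
def discLog (ξ s : ℂ) : ℂ := ξ * (1 - Complex.exp (-s))

theorem exists_discLog_eq {ξ p : ℂ} (hξ : ‖ξ‖ = 1) (hp : ‖p‖ < 1) {x : ℝ}
    (h : ‖p - ξ‖ = Real.exp (-x)) :
    ∃ y ∈ Ioo (-(Real.pi / 2)) (Real.pi / 2), discLog ξ (x + y * Complex.I) = p := by
  have hξ0 : ξ ≠ 0 := by rw [← norm_pos_iff, hξ]; exact one_pos
  set v := 1 - p / ξ with hv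
  have hvre : 0 < v.re := by
    have h1 : (p / ξ).re ≤ ‖p / ξ‖ := Complex.re_le_norm _
    rw [norm_div, hξ, div_one] at h1
    simp only [hv, Complex.sub_re, Complex.one_re]; linarith
  have hvn : ‖v‖ = Real.exp (-x) := by
    have : v = -(p - ξ) / ξ := by rw [hv]; field_simp; ring
    rw [this, norm_div, norm_neg, hξ, div_one, h]
  have harg := Complex.abs_arg_lt_pi_div_two_iff.2 (Or.inl hvre)
  rw [abs_lt] at harg
  refine ⟨-v.arg, ⟨by linarith, by linarith⟩, ?_⟩
  have he : Complex.exp (-(x + (-v.arg : ℝ) * Complex.I)) = v := by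
    calc Complex.exp (-(x + (-v.arg : ℝ) * Complex.I))
        = Complex.exp ((-x : ℝ) : ℂ) * Complex.exp (v.arg * Complex.I) := by
          rw [← Complex.exp_add]; congr 1; push_cast; ring
      _ = ‖v‖ * Complex.exp (v.arg * Complex.I) := by rw [hvn, Complex.ofReal_exp]
      _ = v := Complex.norm_mul_exp_arg_mul_I v
  rw [discLog, he, hv]
  field_simp; ring

theorem norm_discLog_lt_one_iff {ξ : ℂ} (hξ : ‖ξ‖ = 1) (x y : ℝ) :
    ‖discLog ξ (x + y * Complex.I)‖ < 1 ↔ Real.exp (-x) < 2 * Real.cos y := by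
  have hE : 0 < Real.exp (-x) := Real.exp_pos _
  have h1 : Complex.exp (-(x + y * Complex.I))
      = ⟨Real.exp (-x) * Real.cos y, -(Real.exp (-x) * Real.sin y)⟩ := by
    apply Complex.ext <;> simp [Complex.exp_re, Complex.exp_im]
  rw [discLog, norm_mul, hξ, one_mul, ← sq_lt_sq₀ (norm_nonneg _) zero_le_one, one_pow,
    ← Complex.normSq_eq_norm_sq, h1, Complex.normSq_apply]
  simp only [Complex.sub_re, Complex.sub_im, Complex.one_re, Complex.one_im]
  have h2 := Real.sin_sq_add_cos_sq y
  have h3 : (1 - Real.exp (-x) * Real.cos y) * (1 - Real.exp (-x) * Real.cos y) +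
      (0 - -(Real.exp (-x) * Real.sin y)) * (0 - -(Real.exp (-x) * Real.sin y))
      = 1 - Real.exp (-x) * (2 * Real.cos y - Real.exp (-x)) := by
    linear_combination Real.exp (-x) ^ 2 * h2
  rw [h3, sub_lt_self_iff, mul_pos_iff_of_pos_left hE, sub_pos]

theorem differentiable_discLog (ξ : ℂ) : Differentiable ℂ (discLog ξ) := by
  unfold discLog; fun_prop

theorem injOn_discLog {ξ : ℂ} (hξ : ξ ≠ 0) (T : ℝ) :
    InjOn (discLog ξ) (halfStrip (Real.pi / 2) T) := by
  intro s hs t ht h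
  have h1 : Complex.exp (-s) = Complex.exp (-t) := by
    have := mul_left_cancel₀ hξ h
    linear_combination -this
  have hs2 := hs.2
  have ht2 := ht.2
  simp only [mem_preimage, mem_Ioo] at hs2 ht2
  have h2 := Complex.exp_inj_of_neg_pi_lt_of_le_pi (x := -s) (y := -t)
    (by rw [Complex.neg_im]; linarith [Real.pi_pos]) (by rw [Complex.neg_im]; linarith [Real.pi_pos])
    (by rw [Complex.neg_im]; linarith [Real.pi_pos]) (by rw [Complex.neg_im]; linarith [Real.pi_pos])
    h1
  exact neg_injective h2

/-- Different boundary elements have different limits. -/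
theorem ne_of_disjoint_charts {Ω : Set ℂ} {φ h : ℂ → ℂ}
    (H : IsConformalEquiv φ h Ω (ball 0 1)) {𝓕₁ 𝓕₂ : Filter ℂ} {χ₁ χ₂ : ℂ → ℂ} {θ₁ θ₂ : ℝ}
    (C₁ : IsBoundaryChart Ω 𝓕₁ χ₁ θ₁) (C₂ : IsBoundaryChart Ω 𝓕₂ χ₂ θ₂) (hd : Disjoint 𝓕₁ 𝓕₂)
    {ξ₁ ξ₂ : ℂ} (hξ : ‖ξ₁‖ = 1) (h₁ : Tendsto φ 𝓕₁ (𝓝 ξ₁)) (h₂ : Tendsto φ 𝓕₂ (𝓝 ξ₂)) :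
    ξ₁ ≠ ξ₂ := by
  rintro rfl
  set ξ := ξ₁
  have hξ0 : ξ ≠ 0 := by rw [← norm_pos_iff, hξ]; exact one_pos
  have hξD : ξ ∉ ball (0 : ℂ) 1 := by simp [hξ]
  obtain ⟨a, ha, b, hb, hab⟩ := (C₁.hasBasis.disjoint_iff C₂.hasBasis).1 hd
  obtain ⟨T₁, hT₁⟩ := exists_norm_sub_eq H C₁ hξD h₁ (t := a + 1) (by linarith)
  obtain ⟨T₂, hT₂⟩ := exists_norm_sub_eq H C₂ hξD h₂ hb
  obtain ⟨q, hqd, hqχ⟩ := exists_holomorphic_inverse (isOpen_halfStrip θ₁ 0)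
    C₁.diff.differentiableOn C₁.inj fun ζ _ => C₁.deriv_ne ζ
  set T := max T₁ T₂ with hT
  set Q : ℂ → ℂ := fun s => q (h (discLog ξ s)) with hQ
  have hEc : Continuous (discLog ξ) := (differentiable_discLog ξ).continuous
  set B := halfStrip (Real.pi / 2) T ∩ discLog ξ ⁻¹' ball 0 1 with hB
  have hBo : IsOpen B := (isOpen_halfStrip _ _).inter (isOpen_ball.preimage hEc)
  have hcd : DifferentiableOn ℂ (fun s => h (discLog ξ s)) B :=
    H.diff_inv.comp (differentiable_discLog ξ).differentiableOn fun s hs => hs.2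
  set B' := B ∩ (fun s => h (discLog ξ s)) ⁻¹' (χ₁ '' halfStrip θ₁ a) with hB'
  have hB'o : IsOpen B' :=
    hcd.continuousOn.isOpen_inter_preimage hBo (C₁.isOpen_image ha.le)
  have ha0 : halfStrip θ₁ a ⊆ halfStrip θ₁ 0 := halfStrip_mono ha.le
  have hQd : DifferentiableOn ℂ Q B' :=
    hqd.comp (hcd.mono inter_subset_left) fun s hs => image_mono ha0 hs.2
  set N := B' ∩ Q ⁻¹' {z | z.re < a + 1} with hN
  have hNo : IsOpen N := hQd.continuousOn.isOpen_inter_preimage hB'o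
    (isOpen_lt Complex.continuous_re continuous_const)
  have hQN : MapsTo Q N (Ioo a (a + 1) ×ℂ Ioo (-θ₁) θ₁) := by
    intro s hs
    obtain ⟨ζ, hζ, hζs⟩ := hs.1.2
    have h1 : Q s = ζ := by rw [hQ]; simp only at hζs ⊢; rw [← hζs, hqχ ζ (ha0 hζ)]
    have h2 := hs.2
    simp only [mem_preimage, h1, mem_ofPred_eq] at h2
    rw [h1]
    exact ⟨⟨hζ.1, h2⟩, hζ.2⟩
  have hQinj : InjOn Q N := by
    intro s hs t ht hst
    obtain ⟨ζ, hζ, hζs⟩ := hs.1.2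
    obtain ⟨ω, hω, hωt⟩ := ht.1.2
    simp only at hζs hωt
    have h1 : h (discLog ξ s) = h (discLog ξ t) := by
      rw [hQ] at hst
      simp only [← hζs, ← hωt, hqχ ζ (ha0 hζ), hqχ ω (ha0 hω)] at hst
      rw [← hζs, ← hωt, hst]
    exact injOn_discLog hξ0 T hs.1.1.1 ht.1.1.1 (H.symm.injOn hs.1.1.2 ht.1.1.2 h1)
  set f : ℂ → ℝ≥0∞ := N.indicator fun s => ‖deriv Q s‖ₑ with hf
  have hfm : Measurable f := (measurable_deriv Q).enorm.indicator hNo.measurableSet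
  have harea : ∫⁻ s in halfStrip (Real.pi / 2) T, f s ^ 2
      ≤ volume (Ioo a (a + 1) ×ℂ Ioo (-θ₁) θ₁) := by
    have h1 := lintegral_image_holomorphic hNo.measurableSet (g := Q) (g' := deriv Q)
      (fun z hz => (hQd.differentiableAt (hB'o.mem_nhds hz.1)).hasDerivAt) hQinj (fun _ => 1)
    simp only [lintegral_const, Measure.restrict_apply_univ, one_mul, mul_one] at h1
    have h2 : ∀ s, f s ^ 2 = N.indicator (fun s => ‖deriv Q s‖ₑ ^ 2) s := fun s => by
      by_cases hs : s ∈ N <;> simp [hf, hs]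
    simp only [h2]
    calc _ ≤ ∫⁻ s, N.indicator (fun s => ‖deriv Q s‖ₑ ^ 2) s := setLIntegral_le_lintegral _ _
      _ = volume (Q '' N) := by rw [lintegral_indicator hNo.measurableSet, h1]
      _ ≤ _ := measure_mono (image_subset_iff.2 hQN)
  have hvol : volume (Ioo a (a + 1) ×ℂ Ioo (-θ₁) θ₁) < ∞ := by
    have : Bornology.IsBounded (Ioo a (a + 1) ×ℂ Ioo (-θ₁) θ₁) :=
      (isBounded_Ioo _ _).reProdIm (isBounded_Ioo _ _)
    exact this.measure_lt_top
  -- every vertical segment crosses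
  have hcross : ∀ x > T,
      1 ≤ ∫⁻ y in Ioo (-(Real.pi / 2)) (Real.pi / 2), f (x + y * Complex.I) := by
    intro x hx
    obtain ⟨ζ₁, hζ₁, he₁⟩ := hT₁ x ((le_max_left _ _).trans_lt hx)
    obtain ⟨ζ₂, hζ₂, he₂⟩ := hT₂ x ((le_max_right _ _).trans_lt hx)
    have ha1 : 0 ≤ a + 1 := by linarith
    have hm₁ := C₁.mapsTo (halfStrip_mono ha1 hζ₁)
    have hm₂ := C₂.mapsTo (halfStrip_mono hb.le hζ₂)
    have hb₁ := mem_ball_zero_iff.1 (H.mapsTo hm₁)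
    have hb₂ := mem_ball_zero_iff.1 (H.mapsTo hm₂)
    obtain ⟨y₁, hy₁, hp₁⟩ := exists_discLog_eq hξ hb₁ he₁
    obtain ⟨y₂, hy₂, hp₂⟩ := exists_discLog_eq hξ hb₂ he₂
    obtain ⟨ε, hε, hεy⟩ : ∃ ε : ℝ, (ε = 1 ∨ ε = -1) ∧ ε * y₁ ≤ ε * y₂ := by
      rcases le_total y₁ y₂ with h | h
      · exact ⟨1, Or.inl rfl, by linarith⟩
      · exact ⟨-1, Or.inr rfl, by linarith⟩
    have hεε : ε * ε = 1 := by rcases hε with rfl | rfl <;> norm_num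
    have hεI : ∀ y, ε * y ∈ Ioo (-(Real.pi / 2)) (Real.pi / 2) ↔
        y ∈ Ioo (-(Real.pi / 2)) (Real.pi / 2) := fun y => by
      rcases hε with rfl | rfl
      · simp
      · constructor <;> intro h <;> constructor <;> linarith [h.1, h.2]
    have hball : ∀ y ∈ Icc (ε * y₁) (ε * y₂),
        ε * y ∈ Ioo (-(Real.pi / 2)) (Real.pi / 2) ∧
        discLog ξ (x + (ε * y : ℝ) * Complex.I) ∈ ball (0 : ℂ) 1 := by
      intro y hy
      have h1 := (hεI y₁).2 hy₁
      have h2 := (hεI y₂).2 hy₂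
      have hyI : y ∈ Ioo (-(Real.pi / 2)) (Real.pi / 2) :=
        ⟨h1.1.trans_le hy.1, hy.2.trans_lt h2.2⟩
      refine ⟨(hεI y).2 hyI, ?_⟩
      rw [mem_ball_zero_iff, norm_discLog_lt_one_iff hξ]
      have hcos : ∀ v, Real.cos (ε * v) = Real.cos v := fun v => by
        rcases hε with rfl | rfl <;> simp
      have c1 := (norm_discLog_lt_one_iff hξ x y₁).1 (by rw [hp₁]; exact hb₁)
      have c2 := (norm_discLog_lt_one_iff hξ x y₂).1 (by rw [hp₂]; exact hb₂)
      have hconc := strictConcaveOn_cos_Icc.concaveOn.ge_on_segment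
        (x := ε * y₁) (y := ε * y₂) (z := y) ⟨h1.1.le, h1.2.le⟩ ⟨h2.1.le, h2.2.le⟩
        (by rw [segment_eq_Icc hεy]; exact hy)
      rw [hcos, hcos] at hconc
      rw [hcos]
      rcases min_le_iff.1 hconc with h | h <;> linarith
    set c : ℝ → ℂ := fun y => h (discLog ξ (x + (ε * y : ℝ) * Complex.I)) with hc
    have hlin : Continuous fun y : ℝ => (x + (ε * y : ℝ) * Complex.I : ℂ) := by fun_prop
    set O := (fun y : ℝ => (x + (ε * y : ℝ) * Complex.I : ℂ)) ⁻¹' B with hOdef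
    have hOo : IsOpen O := hBo.preimage hlin
    have hcO : ContDiffOn ℝ 1 c O := by
      refine (DifferentiableOn.contDiffOn_real hcd hBo).comp
        (f := fun y : ℝ => (x + (ε * y : ℝ) * Complex.I : ℂ)) ?_ fun y hy => hy
      apply ContDiff.contDiffOn
      have : (fun y : ℝ => (x + (ε * y : ℝ) * Complex.I : ℂ))
          = fun y : ℝ => (x : ℂ) + y • (ε * Complex.I) := by
        ext y; rw [Complex.real_smul]; push_cast; ring
      rw [this]
      fun_prop
    have hsubO : Icc (ε * y₁) (ε * y₂) ⊆ O := fun y hy => by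
      refine ⟨⟨?_, ?_⟩, (hball y hy).2⟩
      · simpa using hx
      · simpa using (hball y hy).1
    have hcy : ∀ y, c (ε * y) = h (discLog ξ (x + y * Complex.I)) := fun y => by
      simp only [hc, ← mul_assoc, hεε, one_mul]
    obtain ⟨s, t, hst, hin, hlen⟩ := exists_crossing C₁ hqd hqχ hOo hcO hsubO hεy
      (fun y hy => H.mapsTo_inv (hball y hy).2) ha
      (by rw [hcy, hp₁, H.left_inv _ hm₁]; exact ⟨ζ₁, halfStrip_subset_closed hζ₁, rfl⟩)
      (by
        rw [hcy, hp₂, H.left_inv _ hm₂]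
        exact fun hmem => disjoint_left.1 hab hmem ⟨ζ₂, hζ₂, rfl⟩)
    have hNy : ∀ y ∈ Ioo s t, (x + (ε * y : ℝ) * Complex.I : ℂ) ∈ N := fun y hy =>
      ⟨⟨hsubO (hst hy), (hin y hy).1⟩, (hin y hy).2⟩
    have hder : ∀ y ∈ Ioo s t, ‖deriv (fun y => q (c y)) y‖ₑ
        = f (x + (ε * y : ℝ) * Complex.I) := fun y hy => by
      have h1 : HasDerivAt Q (deriv Q (x + (ε * y : ℝ) * Complex.I))
          (x + (ε * y : ℝ) * Complex.I) :=
        (hQd.differentiableAt (hB'o.mem_nhds (hNy y hy).1)).hasDerivAt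
      have h2 : HasDerivAt (fun y : ℝ => (x + (ε * y : ℝ) * Complex.I : ℂ))
          (ε * Complex.I) y := by
        have h3 : HasDerivAt (fun y : ℝ => ((ε * y : ℝ) : ℂ)) (ε : ℂ) y := by
          have := ((hasDerivAt_id y).const_mul ε).ofReal_comp
          simpa using this
        simpa using (h3.mul_const Complex.I).const_add (x : ℂ)
      have h4 : HasDerivAt (Q ∘ fun y : ℝ => (x + (ε * y : ℝ) * Complex.I : ℂ)) _ y :=
        h1.scomp y h2
      change HasDerivAt (fun y => q (c y)) _ y at h4
      rw [h4.deriv, hf, indicator_of_mem (hNy y hy), smul_eq_mul, enorm_mul]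
      have h5 : ‖(ε * Complex.I : ℂ)‖ₑ = 1 := by
        rcases hε with rfl | rfl <;> simp [enorm_eq_nnnorm]
      rw [h5, one_mul]
    calc (1 : ℝ≥0∞) ≤ ∫⁻ y in Ioo s t, ‖deriv (fun y => q (c y)) y‖ₑ := hlen
      _ = ∫⁻ y in Ioo s t, f (x + (ε * y : ℝ) * Complex.I) :=
          setLIntegral_congr_fun measurableSet_Ioo hder
      _ ≤ ∫⁻ y in Ioo (-(Real.pi / 2)) (Real.pi / 2), f (x + (ε * y : ℝ) * Complex.I) :=
          lintegral_mono_set fun y hy => (hεI y).1 (hball y (hst hy)).1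
      _ = ∫⁻ y in Ioo (-(Real.pi / 2)) (Real.pi / 2), f (x + y * Complex.I) := by
          rcases hε with rfl | rfl
          · simp
          · have h1 := (Measure.measurePreserving_neg (volume : Measure ℝ)).setLIntegral_comp_preimage
              (s := Ioo (-(Real.pi / 2)) (Real.pi / 2)) measurableSet_Ioo
              (f := fun y : ℝ => f (x + y * Complex.I)) (hfm.comp (by fun_prop))
            have h2 : Neg.neg ⁻¹' Ioo (-(Real.pi / 2)) (Real.pi / 2)
                = Ioo (-(Real.pi / 2)) (Real.pi / 2) := by simp
            rw [h2] at h1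
            rw [← h1]
            simp
  have hsq : ∀ x > T, 1 ≤ ENNReal.ofReal Real.pi *
      ∫⁻ y in Ioo (-(Real.pi / 2)) (Real.pi / 2), f (x + y * Complex.I) ^ 2 := by
    intro x hx
    have h1 := lintegral_sq_le (volume.restrict (Ioo (-(Real.pi / 2)) (Real.pi / 2)))
      (f := fun y : ℝ => f (x + y * Complex.I)) (hfm.comp (by fun_prop)).aemeasurable
    rw [Measure.restrict_apply_univ, Real.volume_Ioo] at h1
    have h2 : Real.pi / 2 - -(Real.pi / 2) = Real.pi := by ring
    rw [h2] at h1
    exact (one_le_pow₀ (hcross x hx)).trans h1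
  have hfin : ∫⁻ _ in Ioi T, (1 : ℝ≥0∞) ≤ ENNReal.ofReal Real.pi *
      volume (Ioo a (a + 1) ×ℂ Ioo (-θ₁) θ₁) := by
    calc ∫⁻ _ in Ioi T, (1 : ℝ≥0∞)
        ≤ ∫⁻ x in Ioi T, ENNReal.ofReal Real.pi *
            ∫⁻ y in Ioo (-(Real.pi / 2)) (Real.pi / 2), f (x + y * Complex.I) ^ 2 :=
          setLIntegral_mono' measurableSet_Ioi hsq
      _ = ENNReal.ofReal Real.pi * ∫⁻ s in halfStrip (Real.pi / 2) T, f s ^ 2 := by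
          rw [lintegral_const_mul' _ _ (by simp), halfStrip,
            lintegral_reProdIm_symm (hfm.pow_const 2).aemeasurable]
      _ ≤ _ := by gcongr
  rw [lintegral_one, Measure.restrict_apply_univ, Real.volume_Ioi] at hfin
  exact absurd (hfin.trans_lt (ENNReal.mul_lt_top (by simp) hvol)) (lt_irrefl _)

/-- If the charted boundary elements together with the points of `Ω` exhaust all ultrafilters,
then the inverse of a conformal map onto the disc has limits at the corresponding points. -/
theorem tendsto_inverse_of_charts {Ω : Set ℂ} (hΩ : IsOpen Ω) {φ h : ℂ → ℂ}
    (H : IsConformalEquiv φ h Ω (ball 0 1)) {ι : Type*} {𝓕 : ι → Filter ℂ} {χ : ι → ℂ → ℂ}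
    {θ : ι → ℝ} (C : ∀ i, IsBoundaryChart Ω (𝓕 i) (χ i) (θ i))
    (hdisj : ∀ i j, i ≠ j → Disjoint (𝓕 i) (𝓕 j))
    (hcov : ∀ 𝓤 : Ultrafilter ℂ, Ω ∈ 𝓤 → (∃ z ∈ Ω, (𝓤 : Filter ℂ) ≤ 𝓝 z) ∨ ∃ i, (𝓤 : Filter ℂ) ≤ 𝓕 i)
    {i : ι} {ξ : ℂ} (hξ : ‖ξ‖ = 1) (hφ : Tendsto φ (𝓕 i) (𝓝 ξ)) :
    Tendsto h (𝓝[ball 0 1] ξ) (𝓕 i) := by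
  rw [tendsto_iff_ultrafilter]
  intro 𝓥 h𝓥
  have hball : ∀ᶠ w in (𝓥 : Filter ℂ), w ∈ ball (0 : ℂ) 1 := h𝓥 self_mem_nhdsWithin
  have hback : Tendsto (fun w => φ (h w)) 𝓥 (𝓝 ξ) := by
    refine Tendsto.congr' ?_ (tendsto_id.mono_left (h𝓥.trans nhdsWithin_le_nhds))
    filter_upwards [hball] with w hw using (H.right_inv w hw).symm
  rcases hcov (𝓥.map h) (hball.mono fun w hw => H.mapsTo_inv hw) with ⟨z, hz, hle⟩ | ⟨j, hle⟩
  · exfalso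
    have h1 : Tendsto (fun w => φ (h w)) 𝓥 (𝓝 (φ z)) :=
      (H.diff.differentiableAt (hΩ.mem_nhds hz)).continuousAt.tendsto.comp hle
    have h2 := tendsto_nhds_unique hback h1
    have h3 := mem_ball_zero_iff.1 (H.mapsTo hz)
    rw [← h2, hξ] at h3
    exact lt_irrefl _ h3
  · by_cases hij : j = i
    · exact hij ▸ hle
    · exfalso
      obtain ⟨ξ', hξ', hφ'⟩ := exists_tendsto_of_chart hΩ H (C j)
      have h1 : Tendsto (fun w => φ (h w)) 𝓥 (𝓝 ξ') := hφ'.comp hle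
      exact ne_of_disjoint_charts H (C j) (C i) (hdisj j i hij) hξ' hφ' hφ
        (tendsto_nhds_unique h1 hback)

/-! ### Holomorphic functions on the upper half-plane -/

/-- The upper half-plane. -/
def upperHalf : Set ℂ := {z | 0 < z.im}

theorem isOpen_upperHalf : IsOpen upperHalf := isOpen_lt continuous_const Complex.continuous_im

theorem convex_upperHalf : Convex ℝ upperHalf := (convex_Ioi (0 : ℝ)).linear_preimage Complex.imLm

theorem ofReal_mem_closure_upperHalf (x : ℝ) : (x : ℂ) ∈ closure upperHalf := by
  refine mem_closure_of_tendsto (f := fun t : ℝ => (x + t * Complex.I : ℂ)) (b := 𝓝[>] 0) ?_ ?_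
  · have : Continuous fun t : ℝ => (x + t * Complex.I : ℂ) := by fun_prop
    have h := this.tendsto 0
    simp only [Complex.ofReal_zero, zero_mul, add_zero] at h
    exact h.mono_left nhdsWithin_le_nhds
  · filter_upwards [self_mem_nhdsWithin] with t ht
    simpa [upperHalf] using ht

instance neBot_nhdsWithin_upperHalf (x : ℝ) : (𝓝[upperHalf] (x : ℂ)).NeBot :=
  mem_closure_iff_nhdsWithin_neBot.1 (ofReal_mem_closure_upperHalf x)

/-- A holomorphic function on the upper half-plane has a primitive. -/
theorem exists_primitive_upperHalf {f : ℂ → ℂ} (hf : DifferentiableOn ℂ f upperHalf) :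
    ∃ F : ℂ → ℂ, ∀ z ∈ upperHalf, HasDerivAt F (f z) z := by
  set B : ℕ → Set ℂ := fun n => ball ((n + 1 : ℝ) * Complex.I) (n + 1) with hB
  have hmem : ∀ n z, z ∈ B n ↔ z.re ^ 2 + z.im ^ 2 < 2 * (n + 1) * z.im := by
    intro n z
    have hn : (0 : ℝ) ≤ n + 1 := by positivity
    rw [hB]
    simp only [mem_ball, dist_eq_norm]
    rw [← sq_lt_sq₀ (norm_nonneg _) hn, ← Complex.normSq_eq_norm_sq, Complex.normSq_apply]
    simp only [Complex.sub_re, Complex.sub_im, Complex.mul_re, Complex.mul_im, Complex.ofReal_re,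
      Complex.ofReal_im, Complex.I_re, Complex.I_im]
    constructor <;> intro h <;> nlinarith
  have hBH : ∀ n, B n ⊆ upperHalf := fun n z hz => by
    rw [hmem] at hz
    by_contra hcon
    have h1 : z.im ≤ 0 := not_lt.1 hcon
    have hn : (0 : ℝ) ≤ n + 1 := by positivity
    nlinarith [sq_nonneg z.re, sq_nonneg z.im]
  have hmono : ∀ m n, m ≤ n → B m ⊆ B n := fun m n hmn z hz => by
    have h1 : 0 < z.im := hBH m hz
    rw [hmem] at hz ⊢
    have : (m : ℝ) ≤ n := by exact_mod_cast hmn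
    nlinarith
  have hex : ∀ z ∈ upperHalf, ∃ n, z ∈ B n := fun z hz => by
    have hz' : 0 < z.im := hz
    obtain ⟨n, hn⟩ := exists_nat_gt ((z.re ^ 2 + z.im ^ 2) / (2 * z.im))
    refine ⟨n, ?_⟩
    rw [hmem]
    rw [div_lt_iff₀ (by positivity)] at hn
    nlinarith
  have hI : ∀ n, Complex.I ∈ B n := fun n => by
    rw [hmem]; simp only [Complex.I_re, Complex.I_im]
    have : (0 : ℝ) ≤ n := by positivity
    nlinarith
  have hprim : ∀ n, ∃ g : ℂ → ℂ, g Complex.I = 0 ∧ ∀ z ∈ B n, HasDerivAt g (f z) z := fun n => by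
    obtain ⟨g, hg⟩ := (hf.mono (hBH n)).isExactOn_ball
    exact ⟨fun z => g z - g Complex.I, by simp, fun z hz => (hg z hz).sub_const _⟩
  choose g hg0 hg using hprim
  have hagree : ∀ m n, m ≤ n → EqOn (g m) (g n) (B m) := fun m n hmn =>
    isOpen_ball.eqOn_of_deriv_eq (convex_ball _ _).isPreconnected
      (fun z hz => (hg m z hz).differentiableAt.differentiableWithinAt)
      (fun z hz => (hg n z (hmono m n hmn hz)).differentiableAt.differentiableWithinAt)
      (fun z hz => by rw [(hg m z hz).deriv, (hg n z (hmono m n hmn hz)).deriv]) (hI m)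
      (by rw [hg0, hg0])
  choose! N hN using hex
  refine ⟨fun z => g (N z) z, fun z hz => ?_⟩
  refine (hg (N z) z (hN z hz)).congr_of_eventuallyEq ?_
  filter_upwards [isOpen_ball.mem_nhds (hN z hz)] with w hw
  have hwH := hBH _ hw
  rcases le_total (N w) (N z) with h | h
  · exact hagree _ _ h (hN w hwH)
  · exact (hagree _ _ h hw).symm

/-- A function with bounded derivative on a convex set has limits at the boundary. -/
theorem exists_tendsto_of_deriv_bound {C : Set ℂ} (hC : Convex ℝ C) {k k' : ℂ → ℂ} {M : ℝ}
    (hk : ∀ z ∈ C, HasDerivAt k (k' z) z) (hM : ∀ z ∈ C, ‖k' z‖ ≤ M) {p : ℂ}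
    (hp : p ∈ closure C) : ∃ L, Tendsto k (𝓝[C] p) (𝓝 L) := by
  have hne := mem_closure_iff_nhdsWithin_neBot.1 hp
  have hM0 : 0 ≤ M := by
    obtain ⟨z, hz⟩ := closure_nonempty_iff.1 ⟨p, hp⟩
    exact (norm_nonneg _).trans (hM z hz)
  have hl : LipschitzOnWith ⟨M, hM0⟩ k C :=
    hC.lipschitzOnWith_of_nnnorm_hasDerivWithin_le
      (fun z hz => (hk z hz).hasDerivWithinAt) fun z hz => hM z hz
  have hc : Cauchy (map k (𝓝[C] p)) :=
    (cauchy_nhds.mono' hne nhdsWithin_le_nhds).map_of_le hl.uniformContinuousOn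
      (le_principal_iff.2 self_mem_nhdsWithin)
  exact CompleteSpace.complete hc

/-- The end of the upper half-plane at infinity. -/
def upperInfty : Filter ℂ := Bornology.cobounded ℂ ⊓ 𝓟 upperHalf

theorem ultrafilter_upperHalf (𝓤 : Ultrafilter ℂ) (h : upperHalf ∈ 𝓤) :
    (∃ z ∈ upperHalf, (𝓤 : Filter ℂ) ≤ 𝓝 z) ∨ (∃ x : ℝ, (𝓤 : Filter ℂ) ≤ 𝓝[upperHalf] (x : ℂ)) ∨
      (𝓤 : Filter ℂ) ≤ upperInfty := by
  have hle : (𝓤 : Filter ℂ) ≤ 𝓟 upperHalf := le_principal_iff.2 h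
  by_cases hb : ∃ R : ℝ, closedBall (0 : ℂ) R ∈ 𝓤
  · obtain ⟨R, hR⟩ := hb
    obtain ⟨z, -, hz⟩ := (isCompact_closedBall (0 : ℂ) R).ultrafilter_le_nhds' 𝓤 hR
    have him : 0 ≤ z.im := by
      have : Tendsto Complex.im (𝓤 : Filter ℂ) (𝓝 z.im) := (Complex.continuous_im.tendsto z).mono_left hz
      exact ge_of_tendsto this (by filter_upwards [h] with w hw using le_of_lt hw)
    rcases him.eq_or_lt with h0 | h0
    · right; left
      have : z = (z.re : ℂ) := Complex.ext rfl h0.symm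
      exact ⟨z.re, this ▸ le_inf hz hle⟩
    · exact Or.inl ⟨z, h0, hz⟩
  · right; right
    refine le_inf ?_ hle
    push Not at hb
    rw [Metric.hasBasis_cobounded_compl_closedBall (0 : ℂ) |>.ge_iff]
    intro R _
    exact Ultrafilter.compl_mem_iff_notMem.2 (hb R)

/-! ### The inverse square root -/

/-- The branch of `z ^ (-1/2)` with cut along the negative imaginary axis. -/
def invSqrt (z : ℂ) : ℂ := Complex.exp (-(Complex.log (-Complex.I * z) + Real.pi / 2 * Complex.I) / 2)

theorem invSqrt_ne_zero (z : ℂ) : invSqrt z ≠ 0 := Complex.exp_ne_zero _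

theorem invSqrt_sq {z : ℂ} (hz : z ≠ 0) : invSqrt z ^ 2 = z⁻¹ := by
  have h1 : -Complex.I * z ≠ 0 := mul_ne_zero (neg_ne_zero.2 Complex.I_ne_zero) hz
  rw [invSqrt, ← Complex.exp_nat_mul]
  have : ((2 : ℕ) : ℂ) * (-(Complex.log (-Complex.I * z) + Real.pi / 2 * Complex.I) / 2)
      = -(Complex.log (-Complex.I * z) + Real.pi / 2 * Complex.I) := by push_cast; ring
  rw [this, Complex.exp_neg, Complex.exp_add, Complex.exp_log h1, Complex.exp_pi_div_two_mul_I]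
  congr 1
  linear_combination -z * Complex.I_mul_I

theorem norm_invSqrt_sq {z : ℂ} (hz : z ≠ 0) : ‖invSqrt z‖ ^ 2 = ‖z‖⁻¹ := by
  rw [← norm_pow, invSqrt_sq hz, norm_inv]

theorem differentiableAt_invSqrt {z : ℂ} (hz : 0 < z.im ∨ z.re ≠ 0) :
    DifferentiableAt ℂ invSqrt z := by
  have hs : -Complex.I * z ∈ Complex.slitPlane := by
    rw [Complex.mem_slitPlane_iff]
    rcases hz with h | h
    · left; simpa using h
    · right; simpa using h
  have h1 : DifferentiableAt ℂ (fun z => Complex.log (-Complex.I * z)) z :=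
    (differentiableAt_id.const_mul _).clog hs
  unfold invSqrt
  fun_prop

theorem invSqrt_of_pos {x : ℝ} (hx : 0 < x) : ∃ p : ℝ, 0 < p ∧ invSqrt x = p := by
  refine ⟨Real.exp (-Real.log x / 2), Real.exp_pos _, ?_⟩
  have h1 : Complex.log (-Complex.I * x) = Real.log x + -(Real.pi / 2) * Complex.I := by
    rw [mul_comm, Complex.log_ofReal_mul hx (neg_ne_zero.2 Complex.I_ne_zero), Complex.log_neg_I]
  rw [invSqrt, h1, Complex.ofReal_exp]
  congr 1
  push_cast; ring

theorem invSqrt_of_neg {x : ℝ} (hx : x < 0) : ∃ p : ℝ, 0 < p ∧ invSqrt x = -Complex.I * p := by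
  refine ⟨Real.exp (-Real.log (-x) / 2), Real.exp_pos _, ?_⟩
  have h1 : Complex.log (-Complex.I * x) = Real.log (-x) + Real.pi / 2 * Complex.I := by
    have h2 : -Complex.I * x = ((-x : ℝ) : ℂ) * Complex.I := by push_cast; ring
    rw [h2, Complex.log_ofReal_mul (neg_pos.2 hx) Complex.I_ne_zero, Complex.log_I]
  have h3 : Complex.exp (-(Real.pi / 2 * Complex.I)) = -Complex.I := by
    rw [Complex.exp_neg, Complex.exp_pi_div_two_mul_I, Complex.inv_I]
  rw [invSqrt, h1, Complex.ofReal_exp, ← h3, ← Complex.exp_add]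
  congr 1
  push_cast; ring

theorem invSqrt_eq_cpow {z : ℂ} (hz : 0 < z.im) : invSqrt z = z ^ (-1 / 2 : ℂ) := by
  have hz0 : z ≠ 0 := by rintro rfl; simp at hz
  have h1 : Complex.log (-Complex.I * z) + Real.pi / 2 * Complex.I = Complex.log z := by
    have hre : 0 < (-Complex.I * z).re := by simpa using hz
    have harg := abs_lt.1 (Complex.abs_arg_lt_pi_div_two_iff.2 (Or.inl hre))
    have h0 : -Complex.I * z ≠ 0 := mul_ne_zero (neg_ne_zero.2 Complex.I_ne_zero) hz0
    have hexp : Complex.exp (Complex.log (-Complex.I * z) + Real.pi / 2 * Complex.I) = z := by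
      rw [Complex.exp_add, Complex.exp_log h0, Complex.exp_pi_div_two_mul_I]
      linear_combination -z * Complex.I_mul_I
    have him : (Complex.log (-Complex.I * z) + Real.pi / 2 * Complex.I).im
        = (-Complex.I * z).arg + Real.pi / 2 := by
      simp [Complex.add_im, Complex.log_im]
    rw [← Complex.log_exp (x := Complex.log (-Complex.I * z) + Real.pi / 2 * Complex.I), hexp]
    · rw [him]; linarith [Real.pi_pos, harg.1]
    · rw [him]; linarith [Real.pi_pos, harg.2]
  rw [invSqrt, h1, Complex.cpow_def_of_ne_zero hz0]
  congr 1
  ring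

/-! ### The Schwarz-Christoffel integral of a quadrilateral -/

/-- The Schwarz-Christoffel integrand. -/
def scKernel (u : Fin 4 → ℝ) (z : ℂ) : ℂ := -∏ j, invSqrt (z - u j)

theorem scKernel_ne_zero (u : Fin 4 → ℝ) (z : ℂ) : scKernel u z ≠ 0 :=
  neg_ne_zero.2 (Finset.prod_ne_zero_iff.2 fun _ _ => invSqrt_ne_zero _)

theorem differentiableAt_scKernel {u : Fin 4 → ℝ} {z : ℂ} (hz : 0 < z.im ∨ ∀ j, z.re ≠ u j) :
    DifferentiableAt ℂ (scKernel u) z := by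
  have h : ∀ j, DifferentiableAt ℂ (fun z : ℂ => invSqrt (z - u j)) z := fun j => by
    have h1 : DifferentiableAt ℂ invSqrt (z - u j) := by
      refine differentiableAt_invSqrt ?_
      rcases hz with h | h
      · left; simpa using h
      · right; simpa [sub_eq_zero] using h j
    exact DifferentiableAt.comp (g := invSqrt) (f := fun z : ℂ => z - u j) z h1 (by fun_prop)
  unfold scKernel
  exact (DifferentiableAt.fun_finsetProd fun j _ => h j).neg

theorem norm_scKernel_sq {u : Fin 4 → ℝ} {z : ℂ} (hz : ∀ j, z - u j ≠ 0) :
    ‖scKernel u z‖ ^ 2 = ∏ j, ‖z - u j‖⁻¹ := by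
  rw [scKernel, norm_neg, norm_prod, ← Finset.prod_pow]
  exact Finset.prod_congr rfl fun j _ => norm_invSqrt_sq (hz j)

theorem sub_ofReal_ne_zero {z : ℂ} (hz : z ∈ upperHalf) (x : ℝ) : z - x ≠ 0 := fun h => by
  have h1 : 0 < z.im := hz
  rw [sub_eq_zero.1 h] at h1
  simp at h1

theorem differentiableOn_scKernel (u : Fin 4 → ℝ) : DifferentiableOn ℂ (scKernel u) upperHalf :=
  fun _ hz => (differentiableAt_scKernel (Or.inl hz)).differentiableWithinAt

theorem scKernel_eq_cpow (u : Fin 4 → ℝ) {z : ℂ} (hz : z ∈ upperHalf) :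
    scKernel u z = -∏ j, (z - u j) ^ (-1 / 2 : ℂ) := by
  rw [scKernel]
  congr 1
  refine Finset.prod_congr rfl fun j _ => invSqrt_eq_cpow ?_
  have h1 : 0 < z.im := hz
  simpa using h1

variable {u : Fin 4 → ℝ} {F : ℂ → ℂ}

theorem exists_tendsto_regular (hF : ∀ z ∈ upperHalf, HasDerivAt F (scKernel u z) z) {x : ℝ}
    (hx : ∀ j, x ≠ u j) : ∃ L, Tendsto F (𝓝[upperHalf] (x : ℂ)) (𝓝 L) := by
  have hc : ContinuousAt (fun z => ‖scKernel u z‖) (x : ℂ) :=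
    (differentiableAt_scKernel (Or.inr (by simpa using hx))).continuousAt.norm
  have hev : ∀ᶠ z in 𝓝 (x : ℂ), ‖scKernel u z‖ < ‖scKernel u x‖ + 1 :=
    hc.tendsto.eventually (gt_mem_nhds (lt_add_one _))
  obtain ⟨r, hr, hrb⟩ := Metric.eventually_nhds_iff_ball.1 hev
  have hnh : 𝓝[upperHalf ∩ ball (x : ℂ) r] (x : ℂ) = 𝓝[upperHalf] (x : ℂ) := by
    rw [nhdsWithin_inter_of_mem' (mem_nhdsWithin_of_mem_nhds (ball_mem_nhds _ hr))]
  obtain ⟨L, hL⟩ := exists_tendsto_of_deriv_bound (convex_upperHalf.inter (convex_ball (x : ℂ) r))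
    (fun z hz => hF z hz.1) (M := ‖scKernel u x‖ + 1) (fun z hz => (hrb z hz.2).le)
    (p := (x : ℂ)) (by
      rw [mem_closure_iff_nhdsWithin_neBot, hnh]; infer_instance)
  exact ⟨L, hnh ▸ hL⟩

theorem exists_tendsto_vertex (hu : Function.Injective u)
    (hF : ∀ z ∈ upperHalf, HasDerivAt F (scKernel u z) z) (j : Fin 4) :
    ∃ L, Tendsto F (𝓝[upperHalf] (u j : ℂ)) (𝓝 L) := by
  set Q : Set ℂ := {ζ | 0 < ζ.re ∧ 0 < ζ.im} with hQ
  have hQc : Convex ℝ Q := ((convex_Ioi (0 : ℝ)).linear_preimage Complex.reLm).inter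
    ((convex_Ioi (0 : ℝ)).linear_preimage Complex.imLm)
  have hQu : ∀ ζ ∈ Q, (u j : ℂ) + ζ ^ 2 ∈ upperHalf := fun ζ hζ => by
    have : 0 < ζ.re * ζ.im := mul_pos hζ.1 hζ.2
    simp only [upperHalf, mem_ofPred_eq, Complex.add_im, Complex.ofReal_im, sq, Complex.mul_im]
    nlinarith
  have hQ0 : ∀ ζ ∈ Q, ζ ≠ 0 := fun ζ hζ h => by
    have := hζ.1; rw [h] at this; simp at this
  -- the product of the other factors stays bounded
  set P : ℂ → ℝ := fun ζ => ∏ i ∈ Finset.univ.erase j, ‖(u j : ℂ) + ζ ^ 2 - u i‖⁻¹ with hP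
  have hPc : ContinuousAt P 0 := by
    refine tendsto_finsetProd _ fun i hi => ?_
    have hne : ‖(u j : ℂ) + (0 : ℂ) ^ 2 - u i‖ ≠ 0 := by
      rw [norm_ne_zero_iff]
      have : u j ≠ u i := fun h => (Finset.ne_of_mem_erase hi) (hu h).symm
      simpa [sub_eq_zero] using this
    exact ContinuousAt.inv₀ (by fun_prop) hne
  obtain ⟨r, hr, hrb⟩ := Metric.eventually_nhds_iff_ball.1
    (hPc.tendsto.eventually (gt_mem_nhds (lt_add_one (P 0))))
  have hP0 : 0 ≤ P 0 + 1 := by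
    have : 0 ≤ P 0 := Finset.prod_nonneg fun _ _ => inv_nonneg.2 (norm_nonneg _)
    linarith
  have hbd : ∀ ζ ∈ Q ∩ ball (0 : ℂ) r, ‖scKernel u (u j + ζ ^ 2) * (2 * ζ)‖
      ≤ Real.sqrt (4 * (P 0 + 1)) := by
    intro ζ hζ
    apply Real.le_sqrt_of_sq_le
    have hζn : 0 < ‖ζ‖ := norm_pos_iff.2 (hQ0 ζ hζ.1)
    rw [norm_mul, mul_pow, norm_scKernel_sq fun i => sub_ofReal_ne_zero (hQu ζ hζ.1) (u i),
      ← Finset.mul_prod_erase _ _ (Finset.mem_univ j)]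
    have h1 : (u j : ℂ) + ζ ^ 2 - u j = ζ ^ 2 := by ring
    have h2 := (hrb ζ hζ.2).le
    rw [h1, norm_pow, norm_mul, Complex.norm_ofNat, mul_pow]
    calc (‖ζ‖ ^ 2)⁻¹ * (∏ i ∈ Finset.univ.erase j, ‖(u j : ℂ) + ζ ^ 2 - u i‖⁻¹) * (2 ^ 2 * ‖ζ‖ ^ 2)
        = 4 * P ζ := by rw [hP]; field_simp; norm_num
      _ ≤ _ := by linarith
  have hcl : (0 : ℂ) ∈ closure (Q ∩ ball (0 : ℂ) r) := by
    refine mem_closure_of_tendsto (f := fun t : ℝ => (⟨t, t⟩ : ℂ)) (b := 𝓝[>] 0) ?_ ?_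
    · have : Continuous fun t : ℝ => (⟨t, t⟩ : ℂ) := by
        have h : (fun t : ℝ => (⟨t, t⟩ : ℂ)) = fun t : ℝ => (t : ℂ) + t * Complex.I := by
          ext t; apply Complex.ext <;> simp
        rw [h]; fun_prop
      exact (this.tendsto 0).mono_left nhdsWithin_le_nhds
    · have hb : ∀ᶠ t : ℝ in 𝓝[>] 0, (⟨t, t⟩ : ℂ) ∈ ball (0 : ℂ) r := by
        have : Continuous fun t : ℝ => (⟨t, t⟩ : ℂ) := by
          have h : (fun t : ℝ => (⟨t, t⟩ : ℂ)) = fun t : ℝ => (t : ℂ) + t * Complex.I := by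
            ext t; apply Complex.ext <;> simp
          rw [h]; fun_prop
        exact ((this.tendsto 0).mono_left nhdsWithin_le_nhds).eventually (ball_mem_nhds _ hr)
      filter_upwards [self_mem_nhdsWithin, hb] with t ht htb
      exact ⟨⟨ht, ht⟩, htb⟩
  obtain ⟨L, hL⟩ := exists_tendsto_of_deriv_bound (hQc.inter (convex_ball (0 : ℂ) r))
    (k := fun ζ => F (u j + ζ ^ 2)) (k' := fun ζ => scKernel u (u j + ζ ^ 2) * (2 * ζ))
    (fun ζ hζ => by
      have h1 : HasDerivAt (fun ζ : ℂ => (u j : ℂ) + ζ ^ 2) (2 * ζ) ζ := by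
        simpa using (hasDerivAt_pow 2 ζ).const_add (u j : ℂ)
      exact (hF _ (hQu ζ hζ.1)).comp ζ h1) hbd hcl
  refine ⟨L, ?_⟩
  have hsqrt : Tendsto (fun z : ℂ => (z - u j) ^ (1 / 2 : ℂ)) (𝓝[upperHalf] (u j : ℂ))
      (𝓝[Q ∩ ball (0 : ℂ) r] 0) := by
    have h0 : Tendsto (fun z : ℂ => (z - u j) ^ (1 / 2 : ℂ)) (𝓝[upperHalf] (u j : ℂ)) (𝓝 0) := by
      rw [tendsto_zero_iff_norm_tendsto_zero]
      have h1 : Tendsto (fun z : ℂ => Real.sqrt ‖z - u j‖) (𝓝[upperHalf] (u j : ℂ)) (𝓝 0) := by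
        have : Continuous fun z : ℂ => Real.sqrt ‖z - u j‖ := by fun_prop
        have h2 := this.tendsto (u j : ℂ)
        simp only [sub_self, norm_zero, Real.sqrt_zero] at h2
        exact h2.mono_left nhdsWithin_le_nhds
      refine h1.congr' ?_
      filter_upwards [self_mem_nhdsWithin] with z hz
      have hz0 := sub_ofReal_ne_zero hz (u j)
      have h3 : ((z - u j) ^ (1 / 2 : ℂ)) ^ 2 = z - u j := by
        rw [← Complex.cpow_nat_mul]; simp
      have h4 : ‖(z - u j) ^ (1 / 2 : ℂ)‖ ^ 2 = ‖z - u j‖ := by rw [← norm_pow, h3]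
      rw [← h4, Real.sqrt_sq (norm_nonneg _)]
    refine tendsto_nhdsWithin_iff.2 ⟨h0, ?_⟩
    filter_upwards [self_mem_nhdsWithin, h0.eventually (ball_mem_nhds _ hr)] with z hz hzb
    refine ⟨?_, hzb⟩
    have hz0 := sub_ofReal_ne_zero hz (u j)
    have him : 0 < (z - u j).im := by
      have : 0 < z.im := hz
      simpa using this
    have h3 : ((z - u j) ^ (1 / 2 : ℂ)) ^ 2 = z - u j := by
      rw [← Complex.cpow_nat_mul]; simp
    have hre : 0 < ((z - u j) ^ (1 / 2 : ℂ)).re := by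
      rw [Complex.cpow_def_of_ne_zero hz0, Complex.exp_re]
      refine mul_pos (Real.exp_pos _) (Real.cos_pos_of_mem_Ioo ?_)
      have h5 : (Complex.log (z - u j) * (1 / 2 : ℂ)).im = (z - u j).arg / 2 := by
        have : Complex.log (z - u j) * (1 / 2 : ℂ) = ((1 / 2 : ℝ) : ℂ) * Complex.log (z - u j) := by
          push_cast; ring
        rw [this, Complex.im_ofReal_mul, Complex.log_im]; ring
      rw [h5]
      have h6 := Complex.neg_pi_lt_arg (z - u j)
      have h7 : (z - u j).arg < Real.pi := by
        refine lt_of_le_of_ne (Complex.arg_le_pi _) fun h => ?_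
        rw [Complex.arg_eq_pi_iff] at h
        exact him.ne' h.2
      constructor <;> linarith
    refine ⟨hre, ?_⟩
    have h8 := congrArg Complex.im h3
    rw [sq, Complex.mul_im] at h8
    by_contra hcon
    rw [not_lt] at hcon
    nlinarith
  refine (hL.comp hsqrt).congr' ?_
  filter_upwards [self_mem_nhdsWithin] with z hz
  have h3 : ((z - u j) ^ (1 / 2 : ℂ)) ^ 2 = z - u j := by
    rw [← Complex.cpow_nat_mul]; simp
  simp only [Function.comp, h3, add_sub_cancel]

theorem exists_tendsto_upperInfty (hF : ∀ z ∈ upperHalf, HasDerivAt F (scKernel u z) z) :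
    ∃ L, Tendsto F upperInfty (𝓝 L) := by
  have hinv : ∀ ζ ∈ upperHalf, -ζ⁻¹ ∈ upperHalf := fun ζ hζ => by
    have h1 : 0 < ζ.im := hζ
    have h0 : ζ ≠ 0 := by rintro rfl; simp at h1
    simp only [upperHalf, mem_ofPred_eq, Complex.neg_im, Complex.inv_im, neg_div, neg_neg]
    exact div_pos h1 (Complex.normSq_pos.2 h0)
  have hne : ∀ ζ ∈ upperHalf, ζ ≠ 0 := fun ζ hζ h => by
    have h1 : 0 < ζ.im := hζ
    rw [h] at h1; simp at h1
  set P : ℂ → ℝ := fun ζ => ∏ i, ‖1 + u i * ζ‖⁻¹ with hP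
  have hPc : ContinuousAt P 0 := by
    refine tendsto_finsetProd _ fun i _ => ?_
    exact ContinuousAt.inv₀ (by fun_prop) (by simp)
  obtain ⟨r, hr, hrb⟩ := Metric.eventually_nhds_iff_ball.1
    (hPc.tendsto.eventually (gt_mem_nhds (lt_add_one (P 0))))
  have hbd : ∀ ζ ∈ upperHalf ∩ ball (0 : ℂ) r, ‖scKernel u (-ζ⁻¹) * (ζ ^ 2)⁻¹‖
      ≤ Real.sqrt (P 0 + 1) := by
    intro ζ hζ
    apply Real.le_sqrt_of_sq_le
    have hζ0 := hne ζ hζ.1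
    have hζn : ‖ζ‖ ≠ 0 := norm_ne_zero_iff.2 hζ0
    rw [norm_mul, mul_pow, norm_scKernel_sq fun i => sub_ofReal_ne_zero (hinv ζ hζ.1) (u i)]
    have h1 : ∀ i, ‖-ζ⁻¹ - u i‖⁻¹ = ‖ζ‖ * ‖1 + u i * ζ‖⁻¹ := fun i => by
      have : -ζ⁻¹ - u i = -(1 + u i * ζ) / ζ := by field_simp; ring
      rw [this, norm_div, norm_neg, inv_div, div_eq_mul_inv]
    simp only [h1, Finset.prod_mul_distrib, Finset.prod_const, Finset.card_univ, Fintype.card_fin]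
    have h2 := (hrb ζ hζ.2).le
    calc ‖ζ‖ ^ 4 * (∏ i, ‖1 + u i * ζ‖⁻¹) * ‖(ζ ^ 2)⁻¹‖ ^ 2 = P ζ := by
          simp only [hP, norm_inv, norm_pow]
          generalize ∏ i, ‖1 + u i * ζ‖⁻¹ = q
          field_simp
      _ ≤ _ := h2
  have hnh : 𝓝[upperHalf ∩ ball (0 : ℂ) r] (0 : ℂ) = 𝓝[upperHalf] (0 : ℂ) := by
    rw [nhdsWithin_inter_of_mem' (mem_nhdsWithin_of_mem_nhds (ball_mem_nhds _ hr))]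
  have hcl : (0 : ℂ) ∈ closure (upperHalf ∩ ball (0 : ℂ) r) := by
    rw [mem_closure_iff_nhdsWithin_neBot, hnh]
    exact_mod_cast neBot_nhdsWithin_upperHalf 0
  obtain ⟨L, hL⟩ := exists_tendsto_of_deriv_bound (convex_upperHalf.inter (convex_ball (0 : ℂ) r))
    (k := fun ζ => F (-ζ⁻¹)) (k' := fun ζ => scKernel u (-ζ⁻¹) * (ζ ^ 2)⁻¹)
    (fun ζ hζ => by
      have h1 : HasDerivAt (fun ζ : ℂ => -ζ⁻¹) (ζ ^ 2)⁻¹ ζ := by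
        simpa using (hasDerivAt_inv (hne ζ hζ.1)).fun_neg
      exact (hF _ (hinv ζ hζ.1)).comp ζ h1) hbd hcl
  refine ⟨L, ?_⟩
  rw [hnh] at hL
  have ht : Tendsto (fun z : ℂ => -z⁻¹) upperInfty (𝓝[upperHalf] (0 : ℂ)) := by
    refine tendsto_nhdsWithin_iff.2 ⟨?_, ?_⟩
    · have h1 : Tendsto (fun z : ℂ => z⁻¹) (Bornology.cobounded ℂ) (𝓝 0) :=
        tendsto_inv₀_cobounded
      have h2 : Tendsto (fun z : ℂ => z⁻¹) upperInfty (𝓝 0) := h1.mono_left inf_le_left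
      simpa using h2.neg
    · have : upperHalf ∈ upperInfty := mem_inf_of_right (mem_principal_self _)
      filter_upwards [this] with z hz using hinv z hz
  refine (hL.comp ht).congr fun z => ?_
  simp [Function.comp]

/-! ### Proper local homeomorphisms onto a rectangle -/

/-- The open rectangle with sides `m` and `1`. -/
def rect (m : ℝ) : Set ℂ := Ioo 0 m ×ℂ Ioo 0 1

/-- The closed rectangle with sides `m` and `1`. -/
def rectClosed (m : ℝ) : Set ℂ := Icc 0 m ×ℂ Icc 0 1

theorem isOpen_rect (m : ℝ) : IsOpen (rect m) := isOpen_Ioo.reProdIm isOpen_Ioo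

theorem convex_rect (m : ℝ) : Convex ℝ (rect m) := 
  ((convex_Ioo (0 : ℝ) m).linear_preimage Complex.reLm).inter
    ((convex_Ioo (0 : ℝ) 1).linear_preimage Complex.imLm)

theorem interior_rectClosed (m : ℝ) : interior (rectClosed m) = rect m := by
  rw [rectClosed, Complex.interior_reProdIm, interior_Icc, interior_Icc, rect]

theorem subset_of_clopen {D N : Set ℂ} (hD : IsPreconnected D) (hN : IsOpen N)
    (hcl : D ∩ closure N ⊆ N) (hne : (D ∩ N).Nonempty) : D ⊆ N := by
  refine IsPreconnected.subset_left_of_subset_union hN (v := (closure N)ᶜ)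
    isClosed_closure.isOpen_compl (disjoint_compl_right_iff_subset.2 subset_closure) ?_ hne hD
  intro z hz
  by_cases h : z ∈ closure N
  · exact Or.inl (hcl ⟨hz, h⟩)
  · exact Or.inr h

theorem exists_ultrafilter_of_mem_closure_image {F : ℂ → ℂ} {S : Set ℂ} {w : ℂ}
    (hw : w ∈ closure (F '' S)) : ∃ 𝓤 : Ultrafilter ℂ, S ∈ 𝓤 ∧ Tendsto F 𝓤 (𝓝 w) := by
  have : (comap F (𝓝 w) ⊓ 𝓟 S).NeBot := by
    rw [inf_principal_neBot_iff]
    intro U hU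
    obtain ⟨V, hV, hVU⟩ := mem_comap.1 hU
    obtain ⟨_, hv, z, hz, rfl⟩ := mem_closure_iff_nhds.1 hw V hV
    exact ⟨z, hVU hv, hz⟩
  refine ⟨Ultrafilter.of (comap F (𝓝 w) ⊓ 𝓟 S), ?_, ?_⟩
  · exact Ultrafilter.of_le _ (mem_inf_of_right (mem_principal_self S))
  · exact (tendsto_comap.mono_left inf_le_left).mono_left (Ultrafilter.of_le _)

theorem eventually_eq_of_hasStrictDerivAt {F : ℂ → ℂ} {f' x : ℂ} (h : HasStrictDerivAt F f' x)
    (h0 : f' ≠ 0) : ∀ᶠ p : ℂ × ℂ in 𝓝 (x, x), F p.1 = F p.2 → p.1 = p.2 := by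
  have h1 := h.hasStrictFDerivAt.isLittleO
  have h2 := h1.def (c := ‖f'‖ / 2) (by positivity)
  filter_upwards [h2] with p hp hF
  by_contra hne
  have h3 : 0 < ‖p.1 - p.2‖ := norm_pos_iff.2 (sub_ne_zero.2 hne)
  have h4 : 0 < ‖f'‖ := norm_pos_iff.2 h0
  simp only [hF, sub_self, zero_sub, norm_neg, ContinuousLinearMap.toSpanSingleton_apply,
    smul_eq_mul, norm_mul] at hp
  nlinarith

theorem false_of_two_branches {F a b : ℂ → ℂ} {f' x : ℂ} (h : HasStrictDerivAt F f' x)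
    (h0 : f' ≠ 0) {l : Filter ℂ} [l.NeBot] (ha : Tendsto a l (𝓝 x)) (hb : Tendsto b l (𝓝 x))
    (hab : ∀ᶠ w in l, a w ≠ b w ∧ F (a w) = F (b w)) : False := by
  have h1 := (ha.prodMk_nhds hb).eventually (eventually_eq_of_hasStrictDerivAt h h0)
  obtain ⟨w, h2, h3⟩ := (h1.and hab).exists
  exact h3.1 (h2 h3.2)

variable {F : ℂ → ℂ} {H : Set ℂ} {m : ℝ}

theorem isOpen_image_of_deriv_ne_zero (hH : IsOpen H) (hd : DifferentiableOn ℂ F H)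
    (h0 : ∀ z ∈ H, deriv F z ≠ 0) : IsOpen (F '' H) := by
  rw [isOpen_iff_mem_nhds]
  rintro _ ⟨z, hz, rfl⟩
  have h1 := (hd.analyticAt (hH.mem_nhds hz)).hasStrictDerivAt
  rw [← h1.map_nhds_eq (h0 z hz)]
  exact image_mem_map (hH.mem_nhds hz)

/-- The boundary behaviour of a proper map onto the rectangle. -/
def IsProperToRect (F : ℂ → ℂ) (H : Set ℂ) (m : ℝ) : Prop :=
  ∀ 𝓤 : Ultrafilter ℂ, H ∈ 𝓤 → (∃ z ∈ H, (𝓤 : Filter ℂ) ≤ 𝓝 z) ∨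
    ∃ w ∈ rectClosed m \ rect m, Tendsto F 𝓤 (𝓝 w)

theorem IsProperToRect.closure_image (hb : IsProperToRect F H m) (hH : IsOpen H)
    (hd : DifferentiableOn ℂ F H) : closure (F '' H) ⊆ F '' H ∪ (rectClosed m \ rect m) := by
  intro w hw
  obtain ⟨𝓤, hS, ht⟩ := exists_ultrafilter_of_mem_closure_image hw
  rcases hb 𝓤 hS with ⟨z, hz, hle⟩ | ⟨w', hw', ht'⟩
  · left
    have h1 : Tendsto F (𝓝 z) (𝓝 (F z)) := (hd.differentiableAt (hH.mem_nhds hz)).continuousAt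
    exact ⟨z, hz, tendsto_nhds_unique (h1.mono_left hle) ht⟩
  · right
    rwa [tendsto_nhds_unique ht ht']

theorem IsProperToRect.isBounded (hb : IsProperToRect F H m) (hH : IsOpen H)
    (hd : DifferentiableOn ℂ F H) : ∃ R, ∀ z ∈ H, ‖F z‖ < R := by
  by_contra! hcon
  have hne : (comap (fun z => ‖F z‖) atTop ⊓ 𝓟 H).NeBot := by
    rw [inf_principal_neBot_iff]
    intro U hU
    obtain ⟨V, hV, hVU⟩ := mem_comap.1 hU
    obtain ⟨R, hR⟩ := mem_atTop_sets.1 hV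
    obtain ⟨z, hz, hzR⟩ := hcon R
    exact ⟨z, hVU (hR _ hzR), hz⟩
  set 𝓤 := Ultrafilter.of (comap (fun z => ‖F z‖) atTop ⊓ 𝓟 H)
  have hS : H ∈ 𝓤 := Ultrafilter.of_le _ (mem_inf_of_right (mem_principal_self H))
  have ht : Tendsto (fun z => ‖F z‖) 𝓤 atTop :=
    (tendsto_comap.mono_left inf_le_left).mono_left (Ultrafilter.of_le _)
  have : ∃ w, Tendsto F 𝓤 (𝓝 w) := by
    rcases hb 𝓤 hS with ⟨z, hz, hle⟩ | ⟨w, -, h⟩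
    · exact ⟨_, (hd.differentiableAt (hH.mem_nhds hz)).continuousAt.tendsto.mono_left hle⟩
    · exact ⟨w, h⟩
  obtain ⟨w, hw⟩ := this
  exact not_tendsto_nhds_of_tendsto_atTop ht _ hw.norm

theorem IsProperToRect.image_eq (hb : IsProperToRect F H m) (hH : IsOpen H) (hne : H.Nonempty)
    (hd : DifferentiableOn ℂ F H) (h0 : ∀ z ∈ H, deriv F z ≠ 0) : F '' H = rect m := by
  have hop := isOpen_image_of_deriv_ne_zero hH hd h0
  have hcl := hb.closure_image hH hd
  obtain ⟨R, hR⟩ := hb.isBounded hH hd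
  -- a half-plane disjoint from the closed rectangle is disjoint from the image
  have key : ∀ D : Set ℂ, Convex ℝ D → Disjoint D (rectClosed m) →
      (∃ z ∈ D, R ≤ ‖z‖) → ∀ z ∈ H, F z ∉ D := by
    rintro D hD hdis ⟨p, hp, hpR⟩ z hz hzD
    have : D ⊆ F '' H := subset_of_clopen hD.isPreconnected hop (fun w hw => by
      rcases hcl hw.2 with h | h
      · exact h
      · exact absurd h.1 (disjoint_left.1 hdis hw.1)) ⟨_, hzD, z, hz, rfl⟩
    obtain ⟨q, hq, rfl⟩ := this hp
    exact absurd (hR q hq) (not_lt.2 hpR)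
  have hsub : F '' H ⊆ rectClosed m := by
    rintro _ ⟨z, hz, rfl⟩
    refine ⟨⟨?_, ?_⟩, ⟨?_, ?_⟩⟩ <;> by_contra hcon <;> rw [not_le] at hcon
    · refine key {w | w.re < 0} ((convex_Iio (0 : ℝ)).linear_preimage Complex.reLm)
        (disjoint_left.2 fun w hw hw' => not_le.2 hw hw'.1.1)
        ⟨((-(|R| + 1) : ℝ) : ℂ), ?_, ?_⟩ z hz hcon
      · simp only [mem_ofPred_eq, Complex.ofReal_re]
        have := abs_nonneg R; linarith
      · rw [Complex.norm_real, Real.norm_eq_abs, abs_neg]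
        exact (le_abs_self R).trans ((le_add_of_nonneg_right zero_le_one).trans (le_abs_self _))
    · refine key {w | m < w.re} ((convex_Ioi (m : ℝ)).linear_preimage Complex.reLm)
        (disjoint_left.2 fun w hw hw' => not_le.2 hw hw'.1.2)
        ⟨((|R| + |m| + 1 : ℝ) : ℂ), ?_, ?_⟩ z hz hcon
      · simp only [mem_ofPred_eq, Complex.ofReal_re]
        have := le_abs_self m; have := abs_nonneg R; linarith
      · rw [Complex.norm_real, Real.norm_eq_abs]
        refine le_trans ?_ (le_abs_self _)
        have := le_abs_self R; have := abs_nonneg m; linarith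
    · refine key {w | w.im < 0} ((convex_Iio (0 : ℝ)).linear_preimage Complex.imLm)
        (disjoint_left.2 fun w hw hw' => not_le.2 hw hw'.2.1)
        ⟨((-(|R| + 1) : ℝ) : ℂ) * Complex.I, ?_, ?_⟩ z hz hcon
      · simp only [mem_ofPred_eq, Complex.im_ofReal_mul, Complex.I_im]
        have := abs_nonneg R; linarith
      · rw [norm_mul, Complex.norm_I, mul_one, Complex.norm_real, Real.norm_eq_abs, abs_neg]
        exact (le_abs_self R).trans ((le_add_of_nonneg_right zero_le_one).trans (le_abs_self _))
    · refine key {w | 1 < w.im} ((convex_Ioi (1 : ℝ)).linear_preimage Complex.imLm)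
        (disjoint_left.2 fun w hw hw' => not_le.2 hw hw'.2.2)
        ⟨((|R| + 2 : ℝ) : ℂ) * Complex.I, ?_, ?_⟩ z hz hcon
      · simp only [mem_ofPred_eq, Complex.im_ofReal_mul, Complex.I_im]
        have := abs_nonneg R; linarith
      · rw [norm_mul, Complex.norm_I, mul_one, Complex.norm_real, Real.norm_eq_abs]
        refine le_trans ?_ (le_abs_self _)
        have := le_abs_self R; linarith
  have hsub' : F '' H ⊆ rect m := interior_rectClosed m ▸ interior_maximal hsub hop
  refine hsub'.antisymm (subset_of_clopen (convex_rect m).isPreconnected hop (fun w hw => ?_) ?_)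
  · rcases hcl hw.2 with h | h
    · exact h
    · exact absurd hw.1 h.2
  · obtain ⟨z, hz⟩ := hne
    exact ⟨F z, hsub' ⟨z, hz, rfl⟩, z, hz, rfl⟩

/-- Injectivity of a proper local homeomorphism follows from injectivity near one boundary
point. -/
theorem IsProperToRect.injOn (hb : IsProperToRect F H m) (hH : IsOpen H)
    (hd : DifferentiableOn ℂ F H) (h0 : ∀ z ∈ H, deriv F z ≠ 0) (hF : F '' H = rect m)
    {w₀ x₀ : ℂ} (hw₀ : w₀ ∈ closure (rect m))
    (huniq : ∀ 𝓤 : Ultrafilter ℂ, H ∈ 𝓤 → Tendsto F 𝓤 (𝓝 w₀) → (𝓤 : Filter ℂ) ≤ 𝓝[H] x₀)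
    {g : ℂ → ℂ} {g' : ℂ} (hg : HasStrictDerivAt g g' x₀) (hg' : g' ≠ 0)
    (hgF : F =ᶠ[𝓝[H] x₀] g) : InjOn F H := by
  set N : Set ℂ := {w | ∃ a ∈ H, ∃ b ∈ H, a ≠ b ∧ F a = w ∧ F b = w} with hN
  have hstrict : ∀ z ∈ H, HasStrictDerivAt F (deriv F z) z := fun z hz =>
    (hd.analyticAt (hH.mem_nhds hz)).hasStrictDerivAt
  have hmap : ∀ z ∈ H, map F (𝓝 z) = 𝓝 (F z) := fun z hz =>
    (hstrict z hz).map_nhds_eq (h0 z hz)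
  have hNo : IsOpen N := by
    rw [isOpen_iff_mem_nhds]
    rintro w ⟨a, ha, b, hb', hab, rfl, hbw⟩
    obtain ⟨U, V, hU, hV, haU, hbV, hUV⟩ := t2_separation hab
    have h1 : F '' (U ∩ H) ∈ 𝓝 (F a) := by
      rw [← hmap a ha]
      exact image_mem_map (inter_mem (hU.mem_nhds haU) (hH.mem_nhds ha))
    have h2 : F '' (V ∩ H) ∈ 𝓝 (F a) := by
      rw [← hbw, ← hmap b hb']
      exact image_mem_map (inter_mem (hV.mem_nhds hbV) (hH.mem_nhds hb'))
    filter_upwards [h1, h2]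
    rintro w ⟨c, hc, hcw⟩ ⟨d, hd', hdw⟩
    exact ⟨c, hc.2, d, hd'.2, fun h => disjoint_left.1 hUV hc.1 (h ▸ hd'.1), hcw, hdw⟩
  choose! a haH b hbH hab haF hbF using fun w (hw : w ∈ N) => hw
  have hcl : rect m ∩ closure N ⊆ N := by
    rintro w ⟨hw, hwN⟩
    obtain ⟨𝓤, hNU, hle⟩ := mem_closure_iff_ultrafilter.1 hwN
    have hlim : ∀ c : ℂ → ℂ, (∀ w ∈ N, c w ∈ H) → (∀ w ∈ N, F (c w) = w) →
        ∃ z ∈ H, Tendsto c 𝓤 (𝓝 z) ∧ F z = w := by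
      intro c hcH hcF
      have hHc : H ∈ 𝓤.map c := by
        rw [Ultrafilter.mem_map]; filter_upwards [hNU] with w hw using hcH w hw
      have ht : Tendsto F (𝓤.map c : Ultrafilter ℂ) (𝓝 w) := by
        rw [Ultrafilter.coe_map, tendsto_map'_iff]
        refine (tendsto_id'.2 hle).congr' ?_
        filter_upwards [hNU] with w hw using (hcF w hw).symm
      rcases hb _ hHc with ⟨z, hz, hzle⟩ | ⟨w', hw', ht'⟩
      · refine ⟨z, hz, ?_, ?_⟩
        · rwa [Ultrafilter.coe_map] at hzle
        · have h1 : Tendsto F (𝓝 z) (𝓝 (F z)) := (hd.differentiableAt (hH.mem_nhds hz)).continuousAt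
          exact tendsto_nhds_unique (h1.mono_left hzle) ht
      · rw [tendsto_nhds_unique ht' ht] at hw'
        exact absurd hw hw'.2
    obtain ⟨p, hp, hpt, hpF⟩ := hlim a haH haF
    obtain ⟨q, hq, hqt, hqF⟩ := hlim b hbH hbF
    refine ⟨p, hp, q, hq, fun hpq => ?_, hpF, hqF⟩
    subst hpq
    refine false_of_two_branches (hstrict p hp) (h0 p hp) hpt hqt ?_
    filter_upwards [hNU] with w hw
    exact ⟨hab w hw, (haF w hw).trans (hbF w hw).symm⟩
  have hempty : ¬ (rect m ∩ N).Nonempty := fun hne => by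
    have hsub := subset_of_clopen (convex_rect m).isPreconnected hNo hcl hne
    obtain ⟨𝓤, hRU, hle⟩ := mem_closure_iff_ultrafilter.1 hw₀
    have hNU : N ∈ 𝓤 := mem_of_superset hRU hsub
    have hlim : ∀ c : ℂ → ℂ, (∀ w ∈ N, c w ∈ H) → (∀ w ∈ N, F (c w) = w) →
        Tendsto c 𝓤 (𝓝[H] x₀) := by
      intro c hcH hcF
      have hHc : H ∈ 𝓤.map c := by
        rw [Ultrafilter.mem_map]; filter_upwards [hNU] with w hw using hcH w hw
      have ht : Tendsto F (𝓤.map c : Ultrafilter ℂ) (𝓝 w₀) := by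
        rw [Ultrafilter.coe_map, tendsto_map'_iff]
        refine (tendsto_id'.2 hle).congr' ?_
        filter_upwards [hNU] with w hw using (hcF w hw).symm
      have := huniq _ hHc ht
      rwa [Ultrafilter.coe_map] at this
    have h1 := hlim a haH haF
    have h2 := hlim b hbH hbF
    refine false_of_two_branches hg hg' (h1.mono_right nhdsWithin_le_nhds)
      (h2.mono_right nhdsWithin_le_nhds) ?_
    filter_upwards [hNU, h1.eventually hgF, h2.eventually hgF] with w hw h3 h4
    exact ⟨hab w hw, by rw [← h3, ← h4, haF w hw, hbF w hw]⟩
  intro p hp q hq hpq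
  by_contra hne
  exact hempty ⟨F p, hF ▸ mem_image_of_mem F hp, p, hp, q, hq, hne, rfl, hpq.symm⟩

/-! ### Boundary values of the Schwarz-Christoffel integral -/

theorem exists_strictMonoOn_of_hasDerivAt {L : ℝ → ℂ} {D : Set ℝ} (hD : Convex ℝ D)
    (hL : ContinuousOn L D) {c : ℂ} (hc : c ≠ 0)
    (hd : ∀ x ∈ interior D, ∃ p : ℝ, 0 < p ∧ HasDerivAt L (c * p) x) {a : ℝ} (ha : a ∈ D) :
    ∃ q : ℝ → ℝ, StrictMonoOn q D ∧ q a = 0 ∧ ∀ x ∈ D, L x = L a + c * q x := by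
  have hcont : ContinuousOn (fun x => (L x - L a) / c) D := (hL.sub continuousOn_const).div_const c
  have hder : ∀ x ∈ interior D, ∃ p : ℝ, 0 < p ∧ HasDerivAt (fun x => (L x - L a) / c) p x := by
    intro x hx
    obtain ⟨p, hp, h⟩ := hd x hx
    refine ⟨p, hp, ?_⟩
    have := (h.sub_const (L a)).div_const c
    rwa [mul_div_cancel_left₀ _ hc] at this
  have hre : ∀ x ∈ interior D, ∃ p : ℝ, 0 < p ∧ HasDerivAt (fun x => ((L x - L a) / c).re) p x := by
    intro x hx
    obtain ⟨p, hp, h⟩ := hder x hx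
    exact ⟨p, hp, by
      have := Complex.reCLM.hasFDerivAt.comp_hasDerivAt x h
      exact this.congr_deriv (by simp)⟩
  have him : ∀ x ∈ interior D, HasDerivAt (fun x => ((L x - L a) / c).im) 0 x := by
    intro x hx
    obtain ⟨p, hp, h⟩ := hder x hx
    have := Complex.imCLM.hasFDerivAt.comp_hasDerivAt x h
    exact this.congr_deriv (by simp)
  refine ⟨fun x => ((L x - L a) / c).re, ?_, by simp, ?_⟩
  · refine strictMonoOn_of_deriv_pos hD (Complex.continuous_re.comp_continuousOn hcont) ?_
    intro x hx
    obtain ⟨p, hp, h⟩ := hre x hx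
    rwa [h.deriv]
  · intro x hx
    have hcim := Complex.continuous_im.comp_continuousOn hcont
    have h1 : MonotoneOn (fun x => ((L x - L a) / c).im) D := monotoneOn_of_deriv_nonneg hD hcim
      (fun y hy => (him y hy).differentiableAt.differentiableWithinAt)
      fun y hy => (him y hy).deriv.ge
    have h2 : AntitoneOn (fun x => ((L x - L a) / c).im) D := antitoneOn_of_deriv_nonpos hD hcim
      (fun y hy => (him y hy).differentiableAt.differentiableWithinAt)
      fun y hy => (him y hy).deriv.le
    have h3 : ((L x - L a) / c).im = 0 := by
      rcases le_total x a with h | h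
      · have := h1 hx ha h; have := h2 hx ha h; simp at *; linarith
      · have := h1 ha hx h; have := h2 ha hx h; simp at *; linarith
    have h4 : (L x - L a) / c = (((L x - L a) / c).re : ℂ) := Complex.ext rfl (by simpa using h3)
    rw [← h4]
    field_simp
    ring

theorem exists_scKernel_ofReal (u : Fin 4 → ℝ) {x : ℝ} (hx : ∀ j, x ≠ u j) : ∃ p : ℝ, 0 < p ∧
    scKernel u x = -(∏ j, if u j < x then 1 else -Complex.I) * p := by
  have : ∀ j, ∃ p : ℝ, 0 < p ∧ invSqrt ((x : ℂ) - u j) =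
      (if u j < x then 1 else -Complex.I) * p := by
    intro j
    rw [← Complex.ofReal_sub]
    split_ifs with h
    · simpa using invSqrt_of_pos (sub_pos.2 h)
    · exact invSqrt_of_neg (sub_neg.2 (lt_of_le_of_ne (not_lt.1 h) (hx j)))
  choose p hp h using this
  refine ⟨∏ j, p j, Finset.prod_pos fun j _ => hp j, ?_⟩
  rw [scKernel, Finset.prod_congr rfl fun j _ => h j, Finset.prod_mul_distrib]
  push_cast
  ring

variable {u : Fin 4 → ℝ} {F : ℂ → ℂ}

theorem exists_local_primitive (hF : ∀ z ∈ upperHalf, HasDerivAt F (scKernel u z) z) {x : ℝ}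
    (hx : ∀ j, x ≠ u j) : ∃ r > 0, ∃ g : ℂ → ℂ,
      (∀ z ∈ ball (x : ℂ) r, HasDerivAt g (scKernel u z) z) ∧
      EqOn F g (upperHalf ∩ ball (x : ℂ) r) := by
  have hopen : ∀ᶠ z : ℂ in 𝓝 (x : ℂ), ∀ j, z.re ≠ u j := by
    rw [eventually_all]
    intro j
    exact (Complex.continuous_re.tendsto (x : ℂ)).eventually (isOpen_ne.mem_nhds (by simpa using hx j))
  obtain ⟨r, hr, hrb⟩ := Metric.eventually_nhds_iff_ball.1 hopen
  have hdiff : DifferentiableOn ℂ (scKernel u) (ball (x : ℂ) r) := fun z hz =>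
    (differentiableAt_scKernel (Or.inr (hrb z hz))).differentiableWithinAt
  obtain ⟨g, hg⟩ := hdiff.isExactOn_ball
  have hz₀ : (x : ℂ) + (r / 2 : ℝ) * Complex.I ∈ upperHalf ∩ ball (x : ℂ) r := by
    refine ⟨?_, ?_⟩
    · simp only [upperHalf, mem_ofPred_eq, Complex.add_im, Complex.ofReal_im,
        Complex.im_ofReal_mul, Complex.I_im]
      linarith
    · rw [mem_ball, dist_eq_norm, add_sub_cancel_left, norm_mul, Complex.norm_I, mul_one,
        Complex.norm_real, Real.norm_of_nonneg (by positivity)]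
      linarith
  set z₀ := (x : ℂ) + (r / 2 : ℝ) * Complex.I
  refine ⟨r, hr, fun z => g z + (F z₀ - g z₀), fun z hz => (hg z hz).add_const _, fun z hz => ?_⟩
  have hd : ∀ z ∈ upperHalf ∩ ball (x : ℂ) r, HasDerivAt (fun z => F z - g z) 0 z := fun z hz => by
    simpa using (hF z hz.1).fun_sub (hg z hz.2)
  have := (isOpen_upperHalf.inter isOpen_ball).is_const_of_deriv_eq_zero
    (convex_upperHalf.inter (convex_ball (x : ℂ) r)).isPreconnected
    (fun z hz => (hd z hz).differentiableAt.differentiableWithinAt)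
    (fun z hz => (hd z hz).deriv) hz hz₀
  simp only at this ⊢
  rw [← this]; ring

/-- Boundary values of the Schwarz-Christoffel integral. -/
theorem exists_boundary_values (hu : Function.Injective u)
    (hF : ∀ z ∈ upperHalf, HasDerivAt F (scKernel u z) z) : ∃ L : ℝ → ℂ, Continuous L ∧
      (∀ x : ℝ, Tendsto F (𝓝[upperHalf] (x : ℂ)) (𝓝 (L x))) ∧
      ∀ x : ℝ, (∀ j, x ≠ u j) → HasDerivAt L (scKernel u x) x := by
  have hex : ∀ x : ℝ, ∃ l, Tendsto F (𝓝[upperHalf] (x : ℂ)) (𝓝 l) := fun x => by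
    by_cases h : ∃ j, x = u j
    · obtain ⟨j, rfl⟩ := h
      exact exists_tendsto_vertex hu hF j
    · push Not at h
      exact exists_tendsto_regular hF h
  have hL : ∀ x : ℝ, Tendsto F (𝓝[upperHalf] (x : ℂ)) (𝓝 (extendFrom upperHalf F x)) :=
    fun x => tendsto_extendFrom (hex x)
  refine ⟨fun x => extendFrom upperHalf F x, ?_, hL, fun x hx => ?_⟩
  · have h1 : ContinuousOn (extendFrom upperHalf F) (range ((↑) : ℝ → ℂ)) := by
      refine continuousOn_extendFrom ?_ ?_
      · rintro _ ⟨x, rfl⟩; exact ofReal_mem_closure_upperHalf x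
      · rintro _ ⟨x, rfl⟩; exact hex x
    exact h1.comp_continuous Complex.continuous_ofReal fun x => mem_range_self x
  · obtain ⟨r, hr, g, hg, hgF⟩ := exists_local_primitive hF hx
    have h1 : HasDerivAt (fun y : ℝ => g y) (scKernel u x) x :=
      (hg x (mem_ball_self hr)).comp_ofReal
    refine h1.congr_of_eventuallyEq ?_
    have h2 : ∀ᶠ y : ℝ in 𝓝 x, (y : ℂ) ∈ ball (x : ℂ) r :=
      Complex.continuous_ofReal.continuousAt.eventually (ball_mem_nhds _ hr)
    filter_upwards [h2] with y hy
    refine tendsto_nhds_unique (hL y) ?_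
    refine ((hg y hy).continuousAt.tendsto.mono_left nhdsWithin_le_nhds).congr' ?_
    filter_upwards [self_mem_nhdsWithin, mem_nhdsWithin_of_mem_nhds (isOpen_ball.mem_nhds hy)]
      with z hz hz' using (hgF ⟨hz, hz'⟩).symm

theorem tendsto_boundary_values {L : ℝ → ℂ} {l : ℂ}
    (hL : ∀ x : ℝ, Tendsto F (𝓝[upperHalf] (x : ℂ)) (𝓝 (L x))) (hl : Tendsto F upperInfty (𝓝 l)) :
    Tendsto L (Bornology.cobounded ℝ) (𝓝 l) := by
  refine (closed_nhds_basis l).tendsto_right_iff.2 fun N hN => ?_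
  have h1 : ∀ᶠ z in Bornology.cobounded ℂ, z ∈ upperHalf → F z ∈ N :=
    eventually_inf_principal.1 (hl.eventually hN.1)
  obtain ⟨R, hR⟩ := (hasBasis_cobounded_norm (E := ℂ)).eventually_iff.1 h1
  refine (hasBasis_cobounded_norm (E := ℝ)).eventually_iff.2 ⟨R + 1, hR.1, fun x hx => ?_⟩
  refine hN.2.mem_of_tendsto (hL x) ?_
  have h2 : ∀ᶠ z : ℂ in 𝓝 (x : ℂ), R < ‖z‖ :=
    continuous_norm.continuousAt.eventually (lt_mem_nhds (by
      have h3 : R + 1 ≤ ‖x‖ := hx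
      simp only [Complex.norm_real]; linarith))
  filter_upwards [self_mem_nhdsWithin, mem_nhdsWithin_of_mem_nhds h2] with z hz hzn
  exact hR.2 (le_of_lt hzn) hz

/-- The location of the boundary values of the normalised Schwarz-Christoffel map onto the
rectangle `rect m`. -/
structure RectBoundary (u : Fin 4 → ℝ) (m : ℝ) (L : ℝ → ℂ) : Prop where
  cont : Continuous L
  cases : ∀ x : ℝ, (x < u 0 ∧ (L x).im = 1 ∧ 0 < (L x).re ∧ (L x).re < m) ∨
    (x = u 0 ∧ L x = Complex.I) ∨
    ((u 0 < x ∧ x < u 1) ∧ (L x).re = 0 ∧ 0 < (L x).im ∧ (L x).im < 1) ∨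
    (x = u 1 ∧ L x = 0) ∨
    ((u 1 < x ∧ x < u 2) ∧ (L x).im = 0 ∧ 0 < (L x).re ∧ (L x).re < m) ∨
    (x = u 2 ∧ L x = m) ∨
    ((u 2 < x ∧ x < u 3) ∧ (L x).re = m ∧ 0 < (L x).im ∧ (L x).im < 1) ∨
    (x = u 3 ∧ L x = m + Complex.I) ∨
    (u 3 < x ∧ (L x).im = 1 ∧ 0 < (L x).re ∧ (L x).re < m)
  injOn_left : InjOn L (Icc (u 0) (u 1))
  injOn_right : InjOn L (Icc (u 2) (u 3))

theorem exists_rectBoundary {u : Fin 4 → ℝ} (hu : StrictMono u) : ∃ (m κ : ℝ) (F : ℂ → ℂ)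
    (L : ℝ → ℂ) (r : ℝ), 0 < m ∧ κ ≠ 0 ∧ (∀ z ∈ upperHalf, HasDerivAt F (κ * scKernel u z) z) ∧
    (∀ x : ℝ, Tendsto F (𝓝[upperHalf] (x : ℂ)) (𝓝 (L x))) ∧
    Tendsto F upperInfty (𝓝 (r + Complex.I)) ∧ (0 < r ∧ r < m) ∧ RectBoundary u m L := by
  obtain ⟨F, hF⟩ := exists_primitive_upperHalf (differentiableOn_scKernel u)
  obtain ⟨L, hLc, hL, hLd⟩ := exists_boundary_values hu.injective hF
  obtain ⟨l, hl⟩ := exists_tendsto_upperInfty hF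
  have hLl := tendsto_boundary_values hL hl
  have h01 : u 0 < u 1 := hu (by decide)
  have h12 : u 1 < u 2 := hu (by decide)
  have h23 : u 2 < u 3 := hu (by decide)
  have hI2 : Complex.I * Complex.I = -1 := Complex.I_mul_I
  -- the direction of the boundary values on the five intervals
  obtain ⟨q₁, hq₁, hq₁0, hq₁L⟩ := exists_strictMonoOn_of_hasDerivAt (convex_Iic (u 0))
    hLc.continuousOn (c := -1) (by simp) (fun x hx => by
      rw [interior_Iic] at hx
      have hx : x < u 0 := hx
      have hne : ∀ j, x ≠ u j := by
        intro j; fin_cases j <;> simp <;> linarith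
      obtain ⟨p, hp, h⟩ := exists_scKernel_ofReal u hne
      refine ⟨p, hp, (hLd x hne).congr_deriv ?_⟩
      rw [h, Fin.prod_univ_four, if_neg (by linarith), if_neg (by linarith), if_neg (by linarith),
        if_neg (by linarith)]
      linear_combination (-(p : ℂ)) * (Complex.I * Complex.I - 1) * hI2) self_mem_Iic
  obtain ⟨q₂, hq₂, hq₂0, hq₂L⟩ := exists_strictMonoOn_of_hasDerivAt (convex_Icc (u 0) (u 1))
    hLc.continuousOn (c := -Complex.I) (by simp) (fun x hx => by
      rw [interior_Icc] at hx
      obtain ⟨hx1, hx2⟩ := hx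
      have hne : ∀ j, x ≠ u j := by
        intro j; fin_cases j <;> simp <;> first | exact ne_of_gt (by linarith) | exact ne_of_lt (by linarith)
      obtain ⟨p, hp, h⟩ := exists_scKernel_ofReal u hne
      refine ⟨p, hp, (hLd x hne).congr_deriv ?_⟩
      rw [h, Fin.prod_univ_four, if_pos (by linarith), if_neg (by linarith), if_neg (by linarith),
        if_neg (by linarith)]
      linear_combination (p : ℂ) * Complex.I * hI2) (right_mem_Icc.2 h01.le)
  obtain ⟨q₃, hq₃, hq₃0, hq₃L⟩ := exists_strictMonoOn_of_hasDerivAt (convex_Icc (u 1) (u 2))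
    hLc.continuousOn (c := 1) (by simp) (fun x hx => by
      rw [interior_Icc] at hx
      obtain ⟨hx1, hx2⟩ := hx
      have hne : ∀ j, x ≠ u j := by
        intro j; fin_cases j <;> simp <;> first | exact ne_of_gt (by linarith) | exact ne_of_lt (by linarith)
      obtain ⟨p, hp, h⟩ := exists_scKernel_ofReal u hne
      refine ⟨p, hp, (hLd x hne).congr_deriv ?_⟩
      rw [h, Fin.prod_univ_four, if_pos (by linarith), if_pos (by linarith), if_neg (by linarith),
        if_neg (by linarith)]
      linear_combination (-(p : ℂ)) * hI2) (left_mem_Icc.2 h12.le)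
  obtain ⟨q₄, hq₄, hq₄0, hq₄L⟩ := exists_strictMonoOn_of_hasDerivAt (convex_Icc (u 2) (u 3))
    hLc.continuousOn (c := Complex.I) (by simp) (fun x hx => by
      rw [interior_Icc] at hx
      obtain ⟨hx1, hx2⟩ := hx
      have hne : ∀ j, x ≠ u j := by
        intro j; fin_cases j <;> simp <;> first | exact ne_of_gt (by linarith) | exact ne_of_lt (by linarith)
      obtain ⟨p, hp, h⟩ := exists_scKernel_ofReal u hne
      refine ⟨p, hp, (hLd x hne).congr_deriv ?_⟩
      rw [h, Fin.prod_univ_four, if_pos (by linarith), if_pos (by linarith), if_pos (by linarith),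
        if_neg (by linarith)]
      ring) (left_mem_Icc.2 h23.le)
  obtain ⟨q₅, hq₅, hq₅0, hq₅L⟩ := exists_strictMonoOn_of_hasDerivAt (convex_Ici (u 3))
    hLc.continuousOn (c := -1) (by simp) (fun x hx => by
      rw [interior_Ici] at hx
      have hx : u 3 < x := hx
      have hne : ∀ j, x ≠ u j := by
        intro j; fin_cases j <;> simp <;> exact ne_of_gt (by linarith)
      obtain ⟨p, hp, h⟩ := exists_scKernel_ofReal u hne
      refine ⟨p, hp, (hLd x hne).congr_deriv ?_⟩
      rw [h, Fin.prod_univ_four, if_pos (by linarith), if_pos (by linarith), if_pos (by linarith),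
        if_pos (by linarith)]
      ring) self_mem_Ici
  have hβ : 0 < q₃ (u 2) := hq₃0 ▸ hq₃ (left_mem_Icc.2 h12.le) (right_mem_Icc.2 h12.le) h12
  have hh : 0 < q₄ (u 3) := hq₄0 ▸ hq₄ (left_mem_Icc.2 h23.le) (right_mem_Icc.2 h23.le) h23
  have hL2 : L (u 2) = L (u 1) + q₃ (u 2) := by
    simpa using hq₃L (u 2) (right_mem_Icc.2 h12.le)
  have hL3 : L (u 3) = L (u 1) + q₃ (u 2) + Complex.I * q₄ (u 3) := by
    rw [hq₄L (u 3) (right_mem_Icc.2 h23.le), hL2]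
  have hL0 : L (u 0) = L (u 1) - Complex.I * q₂ (u 0) := by
    rw [hq₂L (u 0) (left_mem_Icc.2 h01.le)]; ring
  -- the value at infinity
  have htop : Tendsto L atTop (𝓝 l) := hLl.mono_left (by
    rw [IsOrderBornology.cobounded_eq]; exact le_sup_right)
  have hbot : Tendsto L atBot (𝓝 l) := hLl.mono_left (by
    rw [IsOrderBornology.cobounded_eq]; exact le_sup_left)
  have htre := (Complex.continuous_re.tendsto l).comp htop
  have htim := (Complex.continuous_im.tendsto l).comp htop
  have hbre := (Complex.continuous_re.tendsto l).comp hbot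
  have hbim := (Complex.continuous_im.tendsto l).comp hbot
  have hlim₁ : l.im = (L (u 3)).im := by
    refine tendsto_nhds_unique htim (tendsto_const_nhds.congr' ?_)
    filter_upwards [eventually_ge_atTop (u 3)] with x hx
    simp [hq₅L x hx]
  have hlim₂ : l.im = (L (u 0)).im := by
    refine tendsto_nhds_unique hbim (tendsto_const_nhds.congr' ?_)
    filter_upwards [eventually_le_atBot (u 0)] with x hx
    simp [hq₁L x hx]
  have hre₁ : ∀ x, u 3 ≤ x → l.re < (L x).re := fun x hx => by
    have h1 : l.re ≤ (L (x + 1)).re := by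
      refine le_of_tendsto htre ?_
      filter_upwards [eventually_ge_atTop (x + 1)] with y hy
      have hy3 : u 3 ≤ y := by linarith
      have := hq₅.monotoneOn (show u 3 ≤ x + 1 by linarith) hy3 hy
      simp only [Function.comp, hq₅L y hy3, hq₅L (x + 1) (show u 3 ≤ x + 1 by linarith)]
      simp only [Complex.add_re, neg_mul, one_mul, Complex.neg_re, Complex.ofReal_re]
      linarith
    have h2 := hq₅ hx (show u 3 ≤ x + 1 by linarith) (lt_add_one x)
    rw [hq₅L (x + 1) (show u 3 ≤ x + 1 by linarith)] at h1
    rw [hq₅L x hx]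
    simp at h1 ⊢
    linarith
  have hre₂ : ∀ x, x ≤ u 0 → (L x).re < l.re := fun x hx => by
    have h1 : (L (x - 1)).re ≤ l.re := by
      refine ge_of_tendsto hbre ?_
      filter_upwards [eventually_le_atBot (x - 1)] with y hy
      have hy3 : y ≤ u 0 := by linarith
      have := hq₁.monotoneOn hy3 (show x - 1 ≤ u 0 by linarith) hy
      simp only [Function.comp, hq₁L y hy3, hq₁L (x - 1) (show x - 1 ≤ u 0 by linarith)]
      simp only [Complex.add_re, neg_mul, one_mul, Complex.neg_re, Complex.ofReal_re]
      linarith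
    have h2 := hq₁ (show x - 1 ≤ u 0 by linarith) hx (sub_one_lt x)
    rw [hq₁L (x - 1) (show x - 1 ≤ u 0 by linarith)] at h1
    rw [hq₁L x hx]
    simp at h1 ⊢
    linarith
  set β := q₃ (u 2) with hβdef
  set h := q₄ (u 3) with hhdef
  have hq20 : q₂ (u 0) = -h := by
    have := hlim₁.symm.trans hlim₂
    rw [hL3, hL0] at this
    simp at this
    linarith
  rw [hq20] at hL0
  set A := L (u 1) with hA
  have hlre₁ : l.re < A.re + β := by simpa [hL3] using hre₁ _ le_rfl
  have hlre₂ : A.re < l.re := by simpa [hL0] using hre₂ _ le_rfl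
  have hlim : l.im = A.im + h := by simpa [hL3] using hlim₁
  have hhC : (h : ℂ) ≠ 0 := by exact_mod_cast hh.ne'
  refine ⟨β / h, 1 / h, fun z => (F z - A) / h, fun x => (L x - A) / h, (l.re - A.re) / h,
    div_pos hβ hh, (one_div_pos.2 hh).ne', ?_, fun x => ((hL x).sub_const A).div_const _, ?_,
    ⟨div_pos (by linarith) hh, by gcongr; linarith⟩, (hLc.sub continuous_const).div_const _, ?_,
    ?_, ?_⟩
  · intro z hz
    refine (((hF z hz).sub_const A).div_const (h : ℂ)).congr_deriv ?_
    push_cast; ring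
  · have := (hl.sub_const A).div_const (h : ℂ)
    convert this using 2
    have h1 : l - A = ((l.re - A.re : ℝ) : ℂ) + h * Complex.I :=
      Complex.ext (by simp) (by simp; linarith)
    rw [h1]; push_cast; field_simp
  · intro x
    simp only [Complex.div_ofReal_re, Complex.div_ofReal_im, Complex.sub_re, Complex.sub_im]
    have hdiv : ∀ t, 0 < t → t < β → 0 < t / h ∧ t / h < β / h := fun t h1 h2 =>
      ⟨div_pos h1 hh, by gcongr⟩
    have hdiv' : ∀ t, 0 < t → t < h → 0 < t / h ∧ t / h < 1 := fun t h1 h2 =>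
      ⟨div_pos h1 hh, (div_lt_one hh).2 h2⟩
    rcases lt_trichotomy x (u 0) with hx | hx | hx
    · left
      have h1 := hq₁L x hx.le
      have h2 := hq₁ hx.le self_mem_Iic hx
      have h3 := hre₂ x hx.le
      rw [h1, hL0] at h3 ⊢
      simp at h3 ⊢
      exact ⟨hx, hh.ne', hdiv _ (by linarith) (by linarith)⟩
    · right; left
      refine ⟨hx, ?_⟩
      rw [hx, hL0]; push_cast; field_simp; ring
    rcases lt_trichotomy x (u 1) with hx' | hx' | hx'
    · right; right; left
      have hmem : x ∈ Icc (u 0) (u 1) := ⟨hx.le, hx'.le⟩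
      have h1 := hq₂L x hmem
      have h2 := hq₂ (left_mem_Icc.2 h01.le) hmem hx
      have h3 := hq₂ hmem (right_mem_Icc.2 h01.le) hx'
      rw [h1]
      simp
      refine ⟨⟨hx, hx'⟩, ?_⟩
      have := hdiv' (-q₂ x) (by linarith) (by linarith)
      simpa using this
    · right; right; right; left
      exact ⟨hx', by rw [hx']; simp [hA]⟩
    rcases lt_trichotomy x (u 2) with hx'' | hx'' | hx''
    · right; right; right; right; left
      have hmem : x ∈ Icc (u 1) (u 2) := ⟨hx'.le, hx''.le⟩
      have h1 := hq₃L x hmem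
      have h2 := hq₃ (left_mem_Icc.2 h12.le) hmem hx'
      have h3 := hq₃ hmem (right_mem_Icc.2 h12.le) hx''
      rw [h1]
      simp
      exact ⟨⟨hx', hx''⟩, hdiv _ (by linarith) (by linarith)⟩
    · right; right; right; right; right; left
      exact ⟨hx'', by rw [hx'', hL2]; push_cast; ring⟩
    rcases lt_trichotomy x (u 3) with hx3 | hx3 | hx3
    · right; right; right; right; right; right; left
      have hmem : x ∈ Icc (u 2) (u 3) := ⟨hx''.le, hx3.le⟩
      have h1 := hq₄L x hmem
      have h2 := hq₄ (left_mem_Icc.2 h23.le) hmem hx''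
      have h3 := hq₄ hmem (right_mem_Icc.2 h23.le) hx3
      rw [h1, hL2]
      simp
      exact ⟨⟨hx'', hx3⟩, hdiv' _ (by linarith) (by linarith)⟩
    · right; right; right; right; right; right; right; left
      exact ⟨hx3, by rw [hx3, hL3]; push_cast; field_simp; ring⟩
    · right; right; right; right; right; right; right; right
      have h1 := hq₅L x hx3.le
      have h2 := hq₅ self_mem_Ici hx3.le hx3
      have h3 := hre₁ x hx3.le
      rw [h1, hL3] at h3 ⊢
      simp at h3 ⊢
      exact ⟨hx3, hh.ne', hdiv _ (by linarith) (by linarith)⟩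
  · intro x hx y hy hxy
    simp only [hq₂L x hx, hq₂L y hy] at hxy
    refine hq₂.injOn hx hy ?_
    have := (div_left_inj' hhC).1 hxy
    simpa using this
  · intro x hx y hy hxy
    simp only [hq₄L x hx, hq₄L y hy] at hxy
    refine hq₄.injOn hx hy ?_
    have := (div_left_inj' hhC).1 hxy
    simpa using this

/-- The corners of the rectangle, in the order in which they correspond to `u 0, …, u 3`. -/
def rectCorner (m : ℝ) : Fin 4 → ℂ := ![Complex.I, 0, m, m + Complex.I]

/-- `F` maps the upper half-plane conformally onto `rect m`, with inverse `G`, taking the points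
`u 0 < u 1 < u 2 < u 3` to the corners. -/
structure IsRectMap (u : Fin 4 → ℝ) (m κ : ℝ) (F G : ℂ → ℂ) : Prop where
  m_pos : 0 < m
  conf : IsConformalEquiv F G upperHalf (rect m)
  hasDerivAt : ∀ z ∈ upperHalf, HasDerivAt F (κ * ∏ j, (z - u j) ^ (-1 / 2 : ℂ)) z
  left : ∀ x ∈ Ioo (u 0) (u 1), Tendsto (fun z => (F z).re) (𝓝[upperHalf] (x : ℂ)) (𝓝 0)
  right : ∀ x ∈ Ioo (u 2) (u 3), Tendsto (fun z => (F z).re) (𝓝[upperHalf] (x : ℂ)) (𝓝 m)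
  left_inv : ∀ y ∈ Ioo (0 : ℝ) 1, ∃ x ∈ Ioo (u 0) (u 1),
    Tendsto G (𝓝[rect m] (y * Complex.I)) (𝓝[upperHalf] (x : ℂ))
  right_inv : ∀ y ∈ Ioo (0 : ℝ) 1, ∃ x ∈ Ioo (u 2) (u 3),
    Tendsto G (𝓝[rect m] (m + y * Complex.I)) (𝓝[upperHalf] (x : ℂ))
  corner : ∀ j, Tendsto F (𝓝[upperHalf] (u j : ℂ)) (𝓝[rect m] (rectCorner m j))
  corner_inv : ∀ j, Tendsto G (𝓝[rect m] (rectCorner m j)) (𝓝[upperHalf] (u j : ℂ))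

theorem mem_closure_rect {m : ℝ} (hm : 0 < m) {w : ℂ} (hw : w ∈ rectClosed m) :
    w ∈ closure (rect m) := by
  rw [rect, Complex.closure_reProdIm, closure_Ioo hm.ne, closure_Ioo zero_ne_one]
  exact hw

theorem exists_isRectMap {u : Fin 4 → ℝ} (hu : StrictMono u) :
    ∃ (m κ : ℝ) (F G : ℂ → ℂ), IsRectMap u m κ F G := by
  obtain ⟨m, κ, F, L, r, hm, hκ, hF, hL, hr, hr0, hB⟩ := exists_rectBoundary hu
  have h01 : u 0 < u 1 := hu (by decide)
  have h12 : u 1 < u 2 := hu (by decide)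
  have h23 : u 2 < u 3 := hu (by decide)
  have hbd : ∀ x, L x ∈ rectClosed m \ rect m := by
    intro x
    simp only [rectClosed, rect, Complex.mem_reProdIm, mem_Icc, mem_Ioo, Set.mem_sdiff]
    rcases hB.cases x with h | ⟨-, h⟩ | h | ⟨-, h⟩ | h | ⟨-, h⟩ | h | ⟨-, h⟩ | h <;>
      first
        | (rw [h]; simp [hm.le])
        | exact ⟨⟨⟨by linarith, by linarith⟩, ⟨by linarith, by linarith⟩⟩, fun h' => by linarith [h'.1.1, h'.1.2, h'.2.1, h'.2.2]⟩
  have hprop : IsProperToRect F upperHalf m := by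
    intro 𝓤 h𝓤
    rcases ultrafilter_upperHalf 𝓤 h𝓤 with h | ⟨x, hx⟩ | h
    · exact Or.inl h
    · exact Or.inr ⟨L x, hbd x, (hL x).mono_left hx⟩
    · refine Or.inr ⟨r + Complex.I, ?_, hr.mono_left h⟩
      simp [rectClosed, rect, Complex.mem_reProdIm, hr0.1.le, hr0.2.le]
  have hd : DifferentiableOn ℂ F upperHalf := fun z hz =>
    (hF z hz).differentiableAt.differentiableWithinAt
  have h0 : ∀ z ∈ upperHalf, deriv F z ≠ 0 := fun z hz => by
    rw [(hF z hz).deriv]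
    exact mul_ne_zero (by exact_mod_cast hκ) (scKernel_ne_zero u z)
  have himg := hprop.image_eq isOpen_upperHalf ⟨Complex.I, by simp [upperHalf]⟩ hd h0
  have huniq : ∀ w₀ ∉ rect m, ∀ x₀ : ℝ, (∀ x, L x = w₀ → x = x₀) → w₀ ≠ r + Complex.I →
      ∀ 𝓤 : Ultrafilter ℂ, upperHalf ∈ 𝓤 → Tendsto F 𝓤 (𝓝 w₀) →
        (𝓤 : Filter ℂ) ≤ 𝓝[upperHalf] (x₀ : ℂ) := by
    intro w₀ hw₀ x₀ hx₀ hne 𝓤 h𝓤 ht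
    rcases ultrafilter_upperHalf 𝓤 h𝓤 with ⟨z, hz, hle⟩ | ⟨x, hx⟩ | h
    · have h1 : Tendsto F (𝓝 z) (𝓝 (F z)) := (hF z hz).continuousAt
      rw [← tendsto_nhds_unique (h1.mono_left hle) ht, ← himg] at hw₀
      exact absurd ⟨z, hz, rfl⟩ hw₀
    · rwa [hx₀ x (tendsto_nhds_unique ((hL x).mono_left hx) ht)] at hx
    · exact absurd (tendsto_nhds_unique ht (hr.mono_left h)) hne
  -- the points of the open sides and the corners are taken exactly once
  have hleft : ∀ y ∈ Ioo (0 : ℝ) 1, ∃ x₀ ∈ Ioo (u 0) (u 1), L x₀ = y * Complex.I ∧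
      ∀ x, L x = y * Complex.I → x = x₀ := by
    intro y hy
    have hc : ContinuousOn (fun x => (L x).im) (Icc (u 0) (u 1)) :=
      (Complex.continuous_im.comp hB.cont).continuousOn
    have hv0 : (L (u 0)).im = 1 := by
      rcases hB.cases (u 0) with h | ⟨-, h⟩ | h | h | h | h | h | h | h <;>
        first | (exfalso; linarith [h.1]) | simp [h]
    have hv1 : (L (u 1)).im = 0 := by
      rcases hB.cases (u 1) with h | h | h | ⟨-, h⟩ | h | h | h | h | h <;>
        first | (exfalso; linarith [h.1]) | simp [h]
    obtain ⟨x₀, hx₀, hy₀⟩ := intermediate_value_Icc' h01.le hc (show y ∈ Icc _ _ by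
      simp only [hv0, hv1]; exact ⟨hy.1.le, hy.2.le⟩)
    simp only at hy₀
    have hmem : x₀ ∈ Ioo (u 0) (u 1) := by
      refine ⟨lt_of_le_of_ne hx₀.1 ?_, lt_of_le_of_ne hx₀.2 ?_⟩
      · rintro rfl; rw [hv0] at hy₀; exact hy.2.ne hy₀.symm
      · rintro rfl; rw [hv1] at hy₀; exact hy.1.ne hy₀
    have hval : L x₀ = y * Complex.I := by
      rcases hB.cases x₀ with h | h | h | h | h | h | h | h | h <;>
        first
          | (exfalso; linarith [h.1, hmem.1, hmem.2])
          | exact Complex.ext (by simpa using h.2.1) (by simpa using hy₀)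
    refine ⟨x₀, hmem, hval, fun x hx => ?_⟩
    have hre : (L x).re = 0 := by rw [hx]; simp
    have him : (L x).im = y := by rw [hx]; simp
    rcases hB.cases x with h | ⟨-, h⟩ | h | ⟨-, h⟩ | h | ⟨-, h⟩ | h | ⟨-, h⟩ | h <;>
      first
        | exact hB.injOn_left ⟨h.1.1.le, h.1.2.le⟩ ⟨hmem.1.le, hmem.2.le⟩ (hx.trans hval.symm)
        | (exfalso; rw [h] at hre him; simp at hre him; linarith [hy.1, hy.2])
        | (exfalso; linarith [h.2.1, h.2.2.1, hy.1, hy.2])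
  have hright : ∀ y ∈ Ioo (0 : ℝ) 1, ∃ x₀ ∈ Ioo (u 2) (u 3), L x₀ = m + y * Complex.I ∧
      ∀ x, L x = m + y * Complex.I → x = x₀ := by
    intro y hy
    have hc : ContinuousOn (fun x => (L x).im) (Icc (u 2) (u 3)) :=
      (Complex.continuous_im.comp hB.cont).continuousOn
    have hv2 : (L (u 2)).im = 0 := by
      rcases hB.cases (u 2) with h | h | h | h | h | ⟨-, h⟩ | h | h | h <;>
        first | (exfalso; linarith [h.1]) | simp [h]
    have hv3 : (L (u 3)).im = 1 := by
      rcases hB.cases (u 3) with h | h | h | h | h | h | h | ⟨-, h⟩ | h <;>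
        first | (exfalso; linarith [h.1]) | simp [h]
    obtain ⟨x₀, hx₀, hy₀⟩ := intermediate_value_Icc h23.le hc (show y ∈ Icc _ _ by
      simp only [hv2, hv3]; exact ⟨hy.1.le, hy.2.le⟩)
    simp only at hy₀
    have hmem : x₀ ∈ Ioo (u 2) (u 3) := by
      refine ⟨lt_of_le_of_ne hx₀.1 ?_, lt_of_le_of_ne hx₀.2 ?_⟩
      · rintro rfl; rw [hv2] at hy₀; exact hy.1.ne hy₀
      · rintro rfl; rw [hv3] at hy₀; exact hy.2.ne hy₀.symm
    have hval : L x₀ = m + y * Complex.I := by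
      rcases hB.cases x₀ with h | h | h | h | h | h | h | h | h <;>
        first
          | (exfalso; linarith [h.1, hmem.1, hmem.2])
          | exact Complex.ext (by simpa using h.2.1) (by simpa using hy₀)
    refine ⟨x₀, hmem, hval, fun x hx => ?_⟩
    have hre : (L x).re = m := by rw [hx]; simp
    have him : (L x).im = y := by rw [hx]; simp
    rcases hB.cases x with h | ⟨-, h⟩ | h | ⟨-, h⟩ | h | ⟨-, h⟩ | h | ⟨-, h⟩ | h <;>
      first
        | exact hB.injOn_right ⟨h.1.1.le, h.1.2.le⟩ ⟨hmem.1.le, hmem.2.le⟩ (hx.trans hval.symm)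
        | (exfalso; rw [h] at hre him; simp at hre him; linarith [hy.1, hy.2])
        | (exfalso; linarith [h.2.1, h.2.2.1, hy.1, hy.2])
  have hcorner : ∀ j, L (u j) = rectCorner m j ∧ ∀ x, L x = rectCorner m j → x = u j := by
    have hval : ∀ j, L (u j) = rectCorner m j := by
      intro j
      fin_cases j
      · rcases hB.cases (u 0) with h | h | h | h | h | h | h | h | h <;>
          first | (exfalso; linarith [h.1]) | exact h.2
      · rcases hB.cases (u 1) with h | h | h | h | h | h | h | h | h <;>
          first | (exfalso; linarith [h.1]) | exact h.2
      · rcases hB.cases (u 2) with h | h | h | h | h | h | h | h | h <;>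
          first | (exfalso; linarith [h.1]) | exact h.2
      · rcases hB.cases (u 3) with h | h | h | h | h | h | h | h | h <;>
          first | (exfalso; linarith [h.1]) | exact h.2
    refine fun j => ⟨hval j, fun x hx => ?_⟩
    have hre := congrArg Complex.re hx
    have him := congrArg Complex.im hx
    fin_cases j <;> simp [rectCorner] at hre him ⊢ <;>
      rcases hB.cases x with h | ⟨h', h⟩ | h | ⟨h', h⟩ | h | ⟨h', h⟩ | h | ⟨h', h⟩ | h <;>
      first
        | exact h'
        | (exfalso; rw [h] at hre him; simp at hre him <;> linarith)
        | (exfalso; linarith [h.2.1, h.2.2.1, h.2.2.2])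
  have hleft_bd : ∀ y : ℝ, ((y : ℂ) * Complex.I) ∉ rect m ∧ (y : ℂ) * Complex.I ≠ r + Complex.I :=
    fun y => ⟨fun h => by simpa using h.1.1, fun h => by
      have := congrArg Complex.re h; simp at this; linarith⟩
  have hright_bd : ∀ y : ℝ, (m + (y : ℂ) * Complex.I) ∉ rect m ∧
      m + (y : ℂ) * Complex.I ≠ r + Complex.I :=
    fun y => ⟨fun h => by simpa using h.1.2, fun h => by
      have := congrArg Complex.re h; simp at this; linarith⟩
  have hinj : InjOn F upperHalf := by
    obtain ⟨x₀, hx₀, hLx₀, hux₀⟩ := hleft (1 / 2) (by norm_num)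
    have hxne : ∀ j, x₀ ≠ u j := by
      intro j; fin_cases j <;> simp <;>
        first | exact ne_of_gt (by linarith [hx₀.1]) | exact ne_of_lt (by linarith [hx₀.2])
    have hF' : ∀ z ∈ upperHalf, HasDerivAt (fun z => F z / κ) (scKernel u z) z := fun z hz => by
      have hκC : (κ : ℂ) ≠ 0 := by exact_mod_cast hκ
      simpa [mul_div_cancel_left₀ _ hκC] using (hF z hz).div_const (κ : ℂ)
    obtain ⟨ρ, hρ, g, hg, hgF⟩ := exists_local_primitive hF' hxne
    have hgd : DifferentiableOn ℂ g (ball (x₀ : ℂ) ρ) := fun z hz =>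
      (hg z hz).differentiableAt.differentiableWithinAt
    have hgs := (hgd.analyticAt (ball_mem_nhds _ hρ)).hasStrictDerivAt
    rw [(hg _ (mem_ball_self hρ)).deriv] at hgs
    have hκC : (κ : ℂ) ≠ 0 := by exact_mod_cast hκ
    refine hprop.injOn isOpen_upperHalf hd h0 himg (w₀ := L x₀) (x₀ := x₀)
      (mem_closure_rect hm (hbd x₀).1)
      (huniq _ (hbd x₀).2 x₀ (by rwa [hLx₀]) (by rw [hLx₀]; exact (hleft_bd _).2))
      (hgs.const_mul (κ : ℂ)) (mul_ne_zero hκC (scKernel_ne_zero u _)) ?_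
    filter_upwards [self_mem_nhdsWithin, mem_nhdsWithin_of_mem_nhds (ball_mem_nhds _ hρ)]
      with z hz hz'
    rw [← hgF ⟨hz, hz'⟩]
    field_simp
  obtain ⟨G, hGd, hGF⟩ := exists_holomorphic_inverse isOpen_upperHalf hd hinj h0
  rw [himg] at hGd
  have hmapsF : MapsTo F upperHalf (rect m) := himg ▸ mapsTo_image F upperHalf
  have hFG : ∀ w ∈ rect m, G w ∈ upperHalf ∧ F (G w) = w := by
    intro w hw
    rw [← himg] at hw
    obtain ⟨z, hz, rfl⟩ := hw
    rw [hGF z hz]; exact ⟨hz, rfl⟩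
  have hGlim : ∀ w₀ ∉ rect m, ∀ x₀ : ℝ, (∀ x, L x = w₀ → x = x₀) → w₀ ≠ r + Complex.I →
      Tendsto G (𝓝[rect m] w₀) (𝓝[upperHalf] (x₀ : ℂ)) := by
    intro w₀ hw₀ x₀ hx₀ hne
    rw [tendsto_iff_ultrafilter]
    intro 𝓤 h𝓤
    have hmem : rect m ∈ 𝓤 := h𝓤 self_mem_nhdsWithin
    refine huniq w₀ hw₀ x₀ hx₀ hne (𝓤.map G) ?_ ?_
    · rw [Ultrafilter.mem_map]; filter_upwards [hmem] with w hw using (hFG w hw).1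
    · rw [Ultrafilter.coe_map, tendsto_map'_iff]
      refine (tendsto_id'.2 (h𝓤.trans nhdsWithin_le_nhds)).congr' ?_
      filter_upwards [hmem] with w hw using (hFG w hw).2.symm
  refine ⟨m, -κ, F, G, hm, ⟨hd, hGd, hmapsF, fun w hw => (hFG w hw).1, hGF,
    fun w hw => (hFG w hw).2⟩, fun z hz => ?_, fun x hx => ?_, fun x hx => ?_, fun y hy => ?_,
    fun y hy => ?_, fun j => ?_, fun j => ?_⟩
  · refine (hF z hz).congr_deriv ?_
    rw [scKernel_eq_cpow u hz]; push_cast; ring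
  · have h1 := (Complex.continuous_re.tendsto (L x)).comp (hL x)
    have h2 : (L x).re = 0 := by
      rcases hB.cases x with h | h | h | h | h | h | h | h | h <;>
        first
          | (exfalso; linarith [h.1, hx.1, hx.2])
          | exact h.2.1
    rwa [h2] at h1
  · have h1 := (Complex.continuous_re.tendsto (L x)).comp (hL x)
    have h2 : (L x).re = m := by
      rcases hB.cases x with h | h | h | h | h | h | h | h | h <;>
        first
          | (exfalso; linarith [h.1, hx.1, hx.2])
          | exact h.2.1
    rwa [h2] at h1
  · obtain ⟨x, hx, -, h⟩ := hleft y hy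
    exact ⟨x, hx, hGlim _ (hleft_bd y).1 x h (hleft_bd y).2⟩
  · obtain ⟨x, hx, -, h⟩ := hright y hy
    exact ⟨x, hx, hGlim _ (hright_bd y).1 x h (hright_bd y).2⟩
  · refine tendsto_nhdsWithin_iff.2 ⟨(hcorner j).1 ▸ hL (u j), ?_⟩
    filter_upwards [self_mem_nhdsWithin] with z hz using hmapsF hz
  · refine hGlim _ ((hcorner j).1 ▸ (hbd (u j)).2) _ (hcorner j).2 fun h => ?_
    have h1 := congrArg Complex.re h
    fin_cases j <;> simp [rectCorner] at h1 <;> linarith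

/-! ### Automorphisms of the disc and of the half-plane -/

theorem exists_rotation {f k : ℂ → ℂ} (H : IsConformalEquiv f k (ball 0 1) (ball 0 1))
    (h0 : f 0 = 0) : ∃ c : ℂ, ‖c‖ = 1 ∧ ∀ z ∈ ball (0 : ℂ) 1, f z = c * z := by
  have hmem : (0 : ℂ) ∈ ball (0 : ℂ) 1 := mem_ball_self one_pos
  have hk0 : k 0 = 0 := by simpa [h0] using H.left_inv 0 hmem
  have hdf := H.diff.differentiableAt (ball_mem_nhds (0 : ℂ) one_pos)
  have hdk := H.diff_inv.differentiableAt (ball_mem_nhds (0 : ℂ) one_pos)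
  have h1 : ‖deriv f 0‖ ≤ 1 := Complex.norm_deriv_le_one_of_mapsTo_ball H.diff
    (by rw [h0]; exact H.mapsTo.mono_right ball_subset_closedBall) one_pos
  have h2 : ‖deriv k 0‖ ≤ 1 := Complex.norm_deriv_le_one_of_mapsTo_ball H.diff_inv
    (by rw [hk0]; exact H.mapsTo_inv.mono_right ball_subset_closedBall) one_pos
  have h3 : deriv k 0 * deriv f 0 = 1 := by
    have h4 : HasDerivAt (fun z => k (f z)) (deriv k 0 * deriv f 0) 0 := by
      refine HasDerivAt.comp (h₂ := k) 0 ?_ hdf.hasDerivAt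
      rw [h0]; exact hdk.hasDerivAt
    have h5 : HasDerivAt (fun z => k (f z)) 1 0 := by
      refine (hasDerivAt_id (0 : ℂ)).congr_of_eventuallyEq ?_
      filter_upwards [ball_mem_nhds (0 : ℂ) one_pos] with z hz using H.left_inv z hz
    exact h4.unique h5
  have h6 : ‖deriv f 0‖ = 1 := by
    have := congrArg norm h3
    rw [norm_mul, norm_one] at this
    nlinarith [norm_nonneg (deriv f 0), norm_nonneg (deriv k 0)]
  refine ⟨deriv f 0, h6, fun z hz => ?_⟩
  have := Complex.affine_of_mapsTo_ball_of_norm_dslope_eq_div (c := 0) (R₁ := 1) (R₂ := 1)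
    (z₀ := 0) H.diff (by rw [h0]; exact H.mapsTo.mono_right ball_subset_closedBall) (by simp)
    (by simpa using h6)
  rw [this hz]
  simp [h0, mul_comm]

/-- The Cayley transform taking `a` in the upper half-plane to `0`. -/
def cayley (a z : ℂ) : ℂ := (z - a) / (z - (starRingEnd ℂ) a)

/-- The inverse of the Cayley transform. -/
def cayleyInv (a w : ℂ) : ℂ := (a - (starRingEnd ℂ) a * w) / (1 - w)

theorem sub_conj_ne_zero {a z : ℂ} (ha : a ∈ upperHalf) (hz : 0 ≤ z.im) :
    z - (starRingEnd ℂ) a ≠ 0 := fun h => by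
  have h1 : 0 < a.im := ha
  have := congrArg Complex.im h
  simp at this
  linarith

theorem one_sub_ne_zero_of_mem_ball {w : ℂ} (hw : w ∈ ball (0 : ℂ) 1) : 1 - w ≠ 0 := fun h => by
  rw [mem_ball_zero_iff, ← sub_eq_zero.1 h] at hw
  simp at hw

theorem isConformalEquiv_cayley {a : ℂ} (ha : a ∈ upperHalf) :
    IsConformalEquiv (cayley a) (cayleyInv a) upperHalf (ball 0 1) := by
  have h1 : 0 < a.im := ha
  have hne : ∀ z ∈ upperHalf, z - (starRingEnd ℂ) a ≠ 0 := fun z hz =>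
    sub_conj_ne_zero ha (le_of_lt hz)
  have haa : a - (starRingEnd ℂ) a ≠ 0 := hne a ha
  refine ⟨fun z hz => ?_, fun z hz => ?_, fun z hz => ?_, fun w hw => ?_, fun z hz => ?_,
    fun w hw => ?_⟩
  · have : DifferentiableAt ℂ (fun z => (z - a) / (z - (starRingEnd ℂ) a)) z :=
      DifferentiableAt.fun_div (by fun_prop) (by fun_prop) (hne z hz)
    exact this.differentiableWithinAt
  · have : DifferentiableAt ℂ (fun w => (a - (starRingEnd ℂ) a * w) / (1 - w)) z :=
      DifferentiableAt.fun_div (by fun_prop) (by fun_prop) (one_sub_ne_zero_of_mem_ball hz)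
    exact this.differentiableWithinAt
  · have hz' : 0 < z.im := hz
    rw [mem_ball_zero_iff, cayley, norm_div, div_lt_one (norm_pos_iff.2 (hne z hz)),
      ← sq_lt_sq₀ (norm_nonneg _) (norm_nonneg _), ← Complex.normSq_eq_norm_sq,
      ← Complex.normSq_eq_norm_sq, Complex.normSq_apply, Complex.normSq_apply]
    simp
    nlinarith [mul_pos h1 hz']
  · have hw1 := one_sub_ne_zero_of_mem_ball hw
    have hw' : Complex.normSq w < 1 := by
      rw [Complex.normSq_eq_norm_sq]
      have := mem_ball_zero_iff.1 hw
      nlinarith [norm_nonneg w]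
    have hpos : 0 < Complex.normSq (1 - w) := Complex.normSq_pos.2 hw1
    have : (cayleyInv a w).im = a.im * (1 - Complex.normSq w) / Complex.normSq (1 - w) := by
      rw [cayleyInv, Complex.div_im, Complex.normSq_apply w]
      simp
      field_simp
      ring
    show 0 < (cayleyInv a w).im
    rw [this]
    exact div_pos (mul_pos h1 (by linarith)) hpos
  · have h2 := hne z hz
    have h3 : 1 - cayley a z = (a - (starRingEnd ℂ) a) / (z - (starRingEnd ℂ) a) := by
      rw [cayley]; field_simp; ring
    rw [cayleyInv, h3, div_eq_iff (div_ne_zero haa h2), cayley]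
    field_simp
    ring
  · have hw1 := one_sub_ne_zero_of_mem_ball hw
    have h3 : cayleyInv a w - (starRingEnd ℂ) a = (a - (starRingEnd ℂ) a) / (1 - w) := by
      rw [cayleyInv]; field_simp; ring
    rw [cayley, h3, div_eq_iff (div_ne_zero haa hw1), cayleyInv]
    field_simp
    ring

theorem cayley_sub {a x y : ℂ} (hx : x - (starRingEnd ℂ) a ≠ 0) (hy : y - (starRingEnd ℂ) a ≠ 0) :
    (cayley a x - cayley a y) * ((x - (starRingEnd ℂ) a) * (y - (starRingEnd ℂ) a)) =
      (x - y) * (a - (starRingEnd ℂ) a) := by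
  rw [cayley, cayley]
  field_simp
  ring

theorem cross_ratio_eq_of_sub {u u' P E E' : Fin 4 → ℂ} {A B c : ℂ} (hA : A ≠ 0) (hB : B ≠ 0)
    (hd : ∀ i j, (P i - P j) * (E i * E j) = (u i - u j) * B)
    (hd' : ∀ i j, (c * P i - c * P j) * (E' i * E' j) = (u' i - u' j) * A) :
    (u 0 - u 1) * (u 2 - u 3) * ((u' 0 - u' 2) * (u' 1 - u' 3)) =
      (u' 0 - u' 1) * (u' 2 - u' 3) * ((u 0 - u 2) * (u 1 - u 3)) := by
  apply mul_right_cancel₀ (pow_ne_zero 2 (mul_ne_zero hA hB))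
  have l : (u 0 - u 1) * (u 2 - u 3) * ((u' 0 - u' 2) * (u' 1 - u' 3)) * (A * B) ^ 2 =
      ((u 0 - u 1) * B) * ((u 2 - u 3) * B) * (((u' 0 - u' 2) * A) * ((u' 1 - u' 3) * A)) := by
    ring
  have r : (u' 0 - u' 1) * (u' 2 - u' 3) * ((u 0 - u 2) * (u 1 - u 3)) * (A * B) ^ 2 =
      ((u' 0 - u' 1) * A) * ((u' 2 - u' 3) * A) * (((u 0 - u 2) * B) * ((u 1 - u 3) * B)) := by
    ring
  rw [l, r, ← hd, ← hd, ← hd, ← hd, ← hd', ← hd', ← hd', ← hd', ← mul_sub, ← mul_sub, ← mul_sub,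
    ← mul_sub]
  generalize P 0 - P 1 = a
  generalize P 2 - P 3 = b
  generalize P 0 - P 2 = d
  generalize P 1 - P 3 = e
  ring

/-- Conformal automorphisms of the half-plane preserve the cross-ratio of boundary points. -/
theorem cross_ratio_eq {T S : ℂ → ℂ} (H : IsConformalEquiv T S upperHalf upperHalf)
    {u u' : Fin 4 → ℝ} (hT : ∀ j, Tendsto T (𝓝[upperHalf] (u j : ℂ)) (𝓝 (u' j : ℂ))) :
    (u 0 - u 1) * (u 2 - u 3) * ((u' 0 - u' 2) * (u' 1 - u' 3)) =
      (u' 0 - u' 1) * (u' 2 - u' 3) * ((u 0 - u 2) * (u 1 - u 3)) := by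
  have hI : Complex.I ∈ upperHalf := by simp [upperHalf]
  set a := T Complex.I with hadef
  have ha : a ∈ upperHalf := H.mapsTo hI
  have K := ((isConformalEquiv_cayley hI).symm.trans H).trans (isConformalEquiv_cayley ha)
  have h0 : cayley a (T (cayleyInv Complex.I 0)) = 0 := by
    have : cayleyInv Complex.I 0 = Complex.I := by simp [cayleyInv]
    rw [this, cayley]; simp [hadef]
  obtain ⟨c, hc, hcz⟩ := exists_rotation K h0
  have hc0 : c ≠ 0 := norm_ne_zero_iff.1 (by rw [hc]; exact one_ne_zero)
  have hrel : ∀ z ∈ upperHalf, cayley a (T z) = c * cayley Complex.I z := fun z hz => by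
    have := hcz _ ((isConformalEquiv_cayley hI).mapsTo hz)
    simpa only [(isConformalEquiv_cayley hI).left_inv z hz] using this
  have hne : ∀ {b : ℂ}, b ∈ upperHalf → ∀ x : ℝ, (x : ℂ) - (starRingEnd ℂ) b ≠ 0 := fun hb x =>
    sub_conj_ne_zero hb (by simp)
  have hcont : ∀ {b : ℂ}, b ∈ upperHalf → ∀ x : ℝ, ContinuousAt (cayley b) (x : ℂ) := fun hb x => by
    unfold cayley
    exact ContinuousAt.div (by fun_prop) (by fun_prop) (hne hb x)
  have hbd : ∀ j, cayley a (u' j) = c * cayley Complex.I (u j) := fun j => by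
    have h1 := (hcont ha (u' j)).tendsto.comp (hT j)
    have h2 := ((hcont hI (u j)).tendsto.mono_left
      (nhdsWithin_le_nhds (s := upperHalf))).const_mul c
    refine tendsto_nhds_unique h1 (h2.congr' ?_)
    filter_upwards [self_mem_nhdsWithin] with z hz using (hrel z hz).symm
  have hd' : ∀ i j, (cayley a (u' i) - cayley a (u' j)) *
      (((u' i : ℂ) - (starRingEnd ℂ) a) * ((u' j : ℂ) - (starRingEnd ℂ) a)) =
      ((u' i : ℂ) - u' j) * (a - (starRingEnd ℂ) a) := fun i j => cayley_sub (hne ha _) (hne ha _)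
  have hd : ∀ i j, (cayley Complex.I (u i) - cayley Complex.I (u j)) *
      (((u i : ℂ) - (starRingEnd ℂ) Complex.I) * ((u j : ℂ) - (starRingEnd ℂ) Complex.I)) =
      ((u i : ℂ) - u j) * (Complex.I - (starRingEnd ℂ) Complex.I) := fun i j =>
    cayley_sub (hne hI _) (hne hI _)
  simp only [hbd] at hd'
  have ha2 : a - (starRingEnd ℂ) a ≠ 0 := sub_conj_ne_zero ha (le_of_lt ha)
  have hI2 : Complex.I - (starRingEnd ℂ) Complex.I ≠ 0 := sub_conj_ne_zero hI (le_of_lt hI)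
  have key := cross_ratio_eq_of_sub (u := fun i => (u i : ℂ)) (u' := fun i => (u' i : ℂ))
    (P := fun i => cayley Complex.I (u i)) ha2 hI2 hd hd'
  exact_mod_cast key

theorem IsRectMap.cross_ratio_eq {u u' : Fin 4 → ℝ} {m κ κ' : ℝ} {F G F' G' : ℂ → ℂ}
    (h : IsRectMap u m κ F G) (h' : IsRectMap u' m κ' F' G') :
    (u 0 - u 1) * (u 2 - u 3) * ((u' 0 - u' 2) * (u' 1 - u' 3)) =
      (u' 0 - u' 1) * (u' 2 - u' 3) * ((u 0 - u 2) * (u 1 - u 3)) :=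
  Scherk.cross_ratio_eq (h.conf.trans h'.conf.symm) fun j =>
    ((h'.corner_inv j).comp (h.corner j)).mono_right nhdsWithin_le_nhds

/-! ### Bounds for extremal lengths -/

theorem volume_rect (m : ℝ) : volume (rect m) = ENNReal.ofReal m := by
  have := lintegral_reProdIm (A := Ioo 0 m) (B := Ioo (0 : ℝ) 1) (f := fun _ => 1)
    aemeasurable_const
  simpa [rect, lintegral_const, Measure.restrict_apply MeasurableSet.univ] using this

/-- A holomorphic embedding of the rectangle `rect m` in `Ω` whose horizontal segments become
arcs from `A` to `B`. -/
structure IsRectFamily (Ω A B : Set ℂ) (m : ℝ) (K : ℂ → ℂ) : Prop where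
  diff : DifferentiableOn ℂ K (rect m)
  injOn : InjOn K (rect m)
  mapsTo : MapsTo K (rect m) Ω
  start : ∀ y ∈ Ioo (0 : ℝ) 1, ∃ p ∈ A, Tendsto K (𝓝[rect m] (y * Complex.I)) (𝓝 p)
  finish : ∀ y ∈ Ioo (0 : ℝ) 1, ∃ p ∈ B, Tendsto K (𝓝[rect m] (m + y * Complex.I)) (𝓝 p)

/-- The horizontal segment of the rectangle `rect m` at height `y`. -/
def horizontal (m y t : ℝ) : ℂ := m * t + y * Complex.I

theorem horizontal_mem {m y t : ℝ} (hm : 0 < m) (hy : y ∈ Ioo (0 : ℝ) 1) (ht : t ∈ Ioo (0 : ℝ) 1) :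
    horizontal m y t ∈ rect m := by
  refine ⟨?_, ?_⟩
  · simp only [horizontal, mem_preimage, Complex.add_re, Complex.re_ofReal_mul, Complex.ofReal_re,
      Complex.I_re, mul_zero, add_zero]
    exact ⟨mul_pos hm ht.1, by nlinarith [ht.2]⟩
  · simpa [horizontal] using hy

theorem hasDerivAt_horizontal (m y t : ℝ) : HasDerivAt (horizontal m y) m t := by
  have h : HasDerivAt (fun t : ℝ => ((m * t : ℝ) : ℂ)) m t := by
    simpa using ((hasDerivAt_id t).const_mul m).ofReal_comp
  have h2 := h.add_const ((y : ℂ) * Complex.I)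
  have : horizontal m y = fun t : ℝ => ((m * t : ℝ) : ℂ) + y * Complex.I := by
    ext t; simp [horizontal]
  rwa [this]

theorem continuous_horizontal (m y : ℝ) : Continuous (horizontal m y) := by
  unfold horizontal; fun_prop

variable {Ω A B : Set ℂ} {m : ℝ} {K : ℂ → ℂ}

theorem IsRectFamily.hasDerivAt (hK : IsRectFamily Ω A B m K) (hm : 0 < m) {y t : ℝ}
    (hy : y ∈ Ioo (0 : ℝ) 1) (ht : t ∈ Ioo (0 : ℝ) 1) :
    HasDerivAt (fun t => K (horizontal m y t)) (deriv K (horizontal m y t) * m) t := by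
  have h1 := (hK.diff.differentiableAt
    ((isOpen_rect m).mem_nhds (horizontal_mem hm hy ht))).hasDerivAt
  exact h1.comp (h := horizontal m y) t (hasDerivAt_horizontal m y t)

theorem IsRectFamily.isArc (hK : IsRectFamily Ω A B m K) (hm : 0 < m) {y : ℝ}
    (hy : y ∈ Ioo (0 : ℝ) 1) : IsArc Ω A B fun t => K (horizontal m y t) := by
  have hmaps : MapsTo (horizontal m y) (Ioo 0 1) (rect m) := fun t ht => horizontal_mem hm hy ht
  refine ⟨?_, fun t ht => hK.mapsTo (hmaps ht), ?_, ?_⟩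
  · have h1 := DifferentiableOn.contDiffOn_real hK.diff (isOpen_rect m)
    have h2 : ContDiff ℝ 1 (horizontal m y) := by
      unfold horizontal
      exact (contDiff_const.mul Complex.ofRealCLM.contDiff).add contDiff_const
    exact h1.comp h2.contDiffOn hmaps
  · obtain ⟨p, hp, h⟩ := hK.start y hy
    refine ⟨p, hp, h.comp (tendsto_nhdsWithin_iff.2 ⟨?_, ?_⟩)⟩
    · have := (continuous_horizontal m y).tendsto 0
      simp only [horizontal, Complex.ofReal_zero, mul_zero, zero_add] at this
      exact this.mono_left nhdsWithin_le_nhds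
    · filter_upwards [Ioo_mem_nhdsGT (zero_lt_one' ℝ)] with t ht using hmaps ht
  · obtain ⟨p, hp, h⟩ := hK.finish y hy
    refine ⟨p, hp, h.comp (tendsto_nhdsWithin_iff.2 ⟨?_, ?_⟩)⟩
    · have := (continuous_horizontal m y).tendsto 1
      simp only [horizontal, Complex.ofReal_one, mul_one] at this
      exact this.mono_left nhdsWithin_le_nhds
    · filter_upwards [Ioo_mem_nhdsLT (zero_lt_one' ℝ)] with t ht using hmaps ht

/-- The length-area inequality. -/
theorem IsRectFamily.sq_lintegral_arcLength_le (hK : IsRectFamily Ω A B m K) (hm : 0 < m)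
    {ρ : ℂ → ℝ≥0∞} (hρ : Measurable ρ) :
    (∫⁻ y in Ioo (0 : ℝ) 1, arcLength ρ fun t => K (horizontal m y t)) ^ 2 ≤
      ENNReal.ofReal m * ∫⁻ w in K '' rect m, ρ w ^ 2 := by
  have hmeas : MeasurableSet (rect m) := (isOpen_rect m).measurableSet
  set f : ℂ → ℝ≥0∞ := fun z => ρ (K z) * ‖deriv K z‖ₑ with hf
  have hfm : AEMeasurable f (volume.restrict (rect m)) := by
    have h1 : AEMeasurable K (volume.restrict (rect m)) :=
      hK.diff.continuousOn.aemeasurable hmeas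
    exact (hρ.comp_aemeasurable h1).mul (measurable_deriv K).enorm.aemeasurable
  have hlen : ∀ y ∈ Ioo (0 : ℝ) 1, arcLength ρ (fun t => K (horizontal m y t)) =
      ∫⁻ x in Ioo (0 : ℝ) m, f (x + y * Complex.I) := by
    intro y hy
    have himg : (fun t => m * t) '' Ioo (0 : ℝ) 1 = Ioo (0 : ℝ) m := by
      rw [image_mul_left_Ioo hm]; simp
    rw [← himg, lintegral_image_eq_lintegral_abs_deriv_mul (f' := fun _ => m) measurableSet_Ioo
      (fun t _ => by simpa using ((hasDerivAt_id t).const_mul m).hasDerivWithinAt)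
      (fun a _ b _ h => mul_left_cancel₀ hm.ne' h), arcLength]
    refine setLIntegral_congr_fun measurableSet_Ioo fun t ht => ?_
    have hen : ‖(m : ℂ)‖ₑ = ENNReal.ofReal m := by
      rw [← ofReal_norm, Complex.norm_real, Real.norm_of_nonneg hm.le]
    have harg : ((m * t : ℝ) : ℂ) + y * Complex.I = horizontal m y t := by simp [horizontal]
    simp only [hf]
    rw [(hK.hasDerivAt hm hy ht).deriv, harg, enorm_mul, hen, abs_of_pos hm]
    ring
  have hvol : (volume.restrict (rect m)) univ = ENNReal.ofReal m := by
    rw [Measure.restrict_apply MeasurableSet.univ, univ_inter, volume_rect]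
  calc (∫⁻ y in Ioo (0 : ℝ) 1, arcLength ρ fun t => K (horizontal m y t)) ^ 2
      = (∫⁻ z in rect m, f z) ^ 2 := by
        rw [setLIntegral_congr_fun measurableSet_Ioo hlen, rect, lintegral_reProdIm hfm]
    _ ≤ ENNReal.ofReal m * ∫⁻ z in rect m, f z ^ 2 := hvol ▸ lintegral_sq_le _ hfm
    _ = _ := by
        rw [lintegral_image_holomorphic hmeas (fun z hz => (hK.diff.differentiableAt
          ((isOpen_rect m).mem_nhds hz)).hasDerivAt) hK.injOn]
        congr 1
        refine lintegral_congr fun z => ?_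
        simp only [hf]; ring

/-- An arc is at least as long, in the metric `|W'| |dz|`, as the variation of `Re W` along it. -/
theorem ofReal_le_arcLength (hΩ : IsOpen Ω) {W : ℂ → ℂ} (hW : DifferentiableOn ℂ W Ω)
    {α : ℝ → ℂ} (hα : ContDiffOn ℝ 1 α (Ioo 0 1)) (hm : MapsTo α (Ioo 0 1) Ω) {r s d : ℝ}
    (hr : Tendsto (fun t => (W (α t)).re) (𝓝[>] 0) (𝓝 r))
    (hs : Tendsto (fun t => (W (α t)).re) (𝓝[<] 1) (𝓝 s)) (hd : d ≤ |s - r|) :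
    ENNReal.ofReal d ≤ arcLength (fun z => ‖deriv W z‖ₑ) α := by
  have hα1 : ∀ t ∈ Ioo (0 : ℝ) 1, HasDerivAt (fun t => W (α t)) (deriv W (α t) * deriv α t) t := by
    intro t ht
    have h1 := (hW.differentiableAt (hΩ.mem_nhds (hm ht))).hasDerivAt
    have h2 := ((hα.differentiableOn one_ne_zero).differentiableAt
      (isOpen_Ioo.mem_nhds ht)).hasDerivAt
    exact h1.comp t h2
  have hcont : ContinuousOn (deriv fun t => W (α t)) (Ioo 0 1) := by
    have h1 := (DifferentiableOn.contDiffOn_real hW hΩ).comp hα hm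
    exact h1.continuousOn_deriv_of_isOpen isOpen_Ioo le_rfl
  have key : ∀ a ∈ Ioo (0 : ℝ) 1, ∀ b ∈ Ioo (0 : ℝ) 1, a ≤ b →
      ENNReal.ofReal |(W (α b)).re - (W (α a)).re| ≤ arcLength (fun z => ‖deriv W z‖ₑ) α := by
    intro a ha b hb hab
    have hsub : Icc a b ⊆ Ioo 0 1 := fun t ht => ⟨ha.1.trans_le ht.1, ht.2.trans_lt hb.2⟩
    have h1 := enorm_sub_le_lintegral_deriv (c := fun t => W (α t)) hab
      (fun t ht => (hα1 t (hsub ht)).differentiableAt) (hcont.mono hsub)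
    calc ENNReal.ofReal |(W (α b)).re - (W (α a)).re|
        ≤ ‖W (α b) - W (α a)‖ₑ := by
          rw [← ofReal_norm, ← Complex.sub_re]
          exact ENNReal.ofReal_le_ofReal (Complex.abs_re_le_norm _)
      _ ≤ _ := h1
      _ ≤ ∫⁻ t in Ioo (0 : ℝ) 1, ‖deriv (fun t => W (α t)) t‖ₑ :=
          lintegral_mono_set (Ioc_subset_Icc_self.trans hsub)
      _ = _ := by
          refine setLIntegral_congr_fun measurableSet_Ioo fun t ht => ?_
          simp only [(hα1 t ht).deriv, enorm_mul]
  have h1 : ∀ a ∈ Ioo (0 : ℝ) 1,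
      ENNReal.ofReal |s - (W (α a)).re| ≤ arcLength (fun z => ‖deriv W z‖ₑ) α := by
    intro a ha
    refine le_of_tendsto (ENNReal.tendsto_ofReal (hs.sub_const _).abs) ?_
    filter_upwards [Ioo_mem_nhdsLT ha.2] with b hb
    exact key a ha b ⟨ha.1.trans hb.1, hb.2⟩ hb.1.le
  refine (ENNReal.ofReal_le_ofReal hd).trans ?_
  refine le_of_tendsto (ENNReal.tendsto_ofReal (hr.const_sub s).abs) ?_
  filter_upwards [Ioo_mem_nhdsGT (zero_lt_one' ℝ)] with a ha using h1 a ha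

theorem extremalLength_le {𝓕 : Set (List (ℝ → ℂ))} {M : ℝ≥0∞}
    (h : ∀ ρ : ℂ → ℝ≥0∞, Measurable ρ → (⨅ Γ ∈ 𝓕, multiLength ρ Γ) ^ 2 ≤ M * area Ω ρ) :
    extremalLength Ω 𝓕 ≤ M := by
  refine iSup_le fun ρ => iSup_le fun hρ => iSup_le fun h1 => iSup_le fun h2 => ?_
  exact ENNReal.div_le_of_le_mul (h ρ hρ)

theorem le_extremalLength {𝓕 : Set (List (ℝ → ℂ))} {d : ℝ} {ρ : ℂ → ℝ≥0∞}
    (hρ : Measurable ρ) (hlen : ∀ Γ ∈ 𝓕, ENNReal.ofReal d ≤ multiLength ρ Γ)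
    (h0 : 0 < area Ω ρ) (ha : area Ω ρ ≤ ENNReal.ofReal d) :
    ENNReal.ofReal d ≤ extremalLength Ω 𝓕 := by
  refine le_trans ?_ (le_iSup_of_le ρ (le_iSup_of_le hρ (le_iSup_of_le h0
    (le_iSup_of_le (ha.trans_lt ENNReal.ofReal_lt_top) le_rfl))))
  have h1 : ENNReal.ofReal d ≤ ⨅ Γ ∈ 𝓕, multiLength ρ Γ := le_iInf₂ hlen
  rw [ENNReal.le_div_iff_mul_le (Or.inl h0.ne') (Or.inl (ha.trans_lt ENNReal.ofReal_lt_top).ne)]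
  calc ENNReal.ofReal d * area Ω ρ ≤ ENNReal.ofReal d * ENNReal.ofReal d := by gcongr
    _ = ENNReal.ofReal d ^ 2 := (sq _).symm
    _ ≤ _ := by gcongr

/-! ### Uniformised labelled domains and the extremal length of `δ` -/

/-- `φ`, with inverse `h`, maps the labelled domain `D` conformally onto the upper half-plane. The
vertices `E₂, P₀, …, P_{2g}, E₁` correspond to the points `x 0 < ⋯ < x (2g + 2)`, which lie
symmetrically about `0`, and `V` corresponds to `∞`. -/
structure Uniformized (g : ℕ) (D : Labelled) (φ h : ℂ → ℂ) (x : ℕ → ℝ) : Prop where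
  isOpen : IsOpen D.dom
  conf : IsConformalEquiv φ h D.dom upperHalf
  strictMono : ∀ i j, i < j → j ≤ 2 * g + 2 → x i < x j
  symm : ∀ k ≤ 2 * g + 2, x (2 * g + 2 - k) = -x k
  edge : ∀ k ≤ 2 * g + 1, ∀ p ∈ D.edge k, ∃ t ∈ Ioo (x k) (x (k + 1)),
    Tendsto φ (𝓝[D.dom] p) (𝓝 (t : ℂ))
  edge_inv : ∀ k ≤ 2 * g + 1, ∀ t ∈ Ioo (x k) (x (k + 1)), ∃ p ∈ D.edge k,
    Tendsto h (𝓝[upperHalf] (t : ℂ)) (𝓝 p)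
  vertex : ∀ j ≤ 2 * g, Tendsto φ (𝓝[D.dom] D.P j) (𝓝[upperHalf] (x (j + 1) : ℂ)) ∧
    Tendsto h (𝓝[upperHalf] (x (j + 1) : ℂ)) (𝓝[D.dom] D.P j)
  outer : Tendsto φ (𝓝[D.dom] D.V) upperInfty ∧ Tendsto h upperInfty (𝓝[D.dom] D.V)
  end₁ : Tendsto φ D.E₁ (𝓝[upperHalf] (x (2 * g + 2) : ℂ)) ∧
    Tendsto h (𝓝[upperHalf] (x (2 * g + 2) : ℂ)) D.E₁
  end₂ : Tendsto φ D.E₂ (𝓝[upperHalf] (x 0 : ℂ)) ∧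
    Tendsto h (𝓝[upperHalf] (x 0 : ℂ)) D.E₂

/-- The interval of the real axis corresponding to the `k`-th edge. -/
def realEdge (x : ℕ → ℝ) (k : ℕ) : Set ℂ := ((↑) : ℝ → ℂ) '' Ioo (x k) (x (k + 1))

variable {g : ℕ} {D : Labelled} {φ h : ℂ → ℂ} {x : ℕ → ℝ}

theorem Uniformized.isRectFamily (U : Uniformized g D φ h x) {k l : ℕ} (hk : k ≤ 2 * g + 1)
    (hl : l ≤ 2 * g + 1) {m : ℝ} {K : ℂ → ℂ}
    (hK : IsRectFamily upperHalf (realEdge x k) (realEdge x l) m K) :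
    IsRectFamily D.dom (D.edge k) (D.edge l) m fun z => h (K z) := by
  have hev : ∀ {w p : ℂ}, Tendsto K (𝓝[rect m] w) (𝓝 p) →
      Tendsto K (𝓝[rect m] w) (𝓝[upperHalf] p) := fun ht =>
    tendsto_nhdsWithin_iff.2 ⟨ht, by
      filter_upwards [self_mem_nhdsWithin] with z hz using hK.mapsTo hz⟩
  refine ⟨U.conf.diff_inv.comp hK.diff hK.mapsTo, U.conf.symm.injOn.comp hK.injOn hK.mapsTo,
    U.conf.mapsTo_inv.comp hK.mapsTo, fun y hy => ?_, fun y hy => ?_⟩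
  · obtain ⟨_, ⟨t, ht, rfl⟩, h1⟩ := hK.start y hy
    obtain ⟨p, hp, h2⟩ := U.edge_inv k hk t ht
    exact ⟨p, hp, h2.comp (hev h1)⟩
  · obtain ⟨_, ⟨t, ht, rfl⟩, h1⟩ := hK.finish y hy
    obtain ⟨p, hp, h2⟩ := U.edge_inv l hl t ht
    exact ⟨p, hp, h2.comp (hev h1)⟩

/-- An arc between two edges is at least as long as the difference of the boundary values of
`Re W` on the corresponding intervals. -/
theorem Uniformized.ofReal_le_arcLength (U : Uniformized g D φ h x) {W : ℂ → ℂ}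
    (hW : DifferentiableOn ℂ W upperHalf) {k l : ℕ} (hk : k ≤ 2 * g + 1) (hl : l ≤ 2 * g + 1)
    {r s d : ℝ}
    (hr : ∀ t ∈ Ioo (x k) (x (k + 1)), Tendsto (fun z => (W z).re) (𝓝[upperHalf] (t : ℂ)) (𝓝 r))
    (hs : ∀ t ∈ Ioo (x l) (x (l + 1)), Tendsto (fun z => (W z).re) (𝓝[upperHalf] (t : ℂ)) (𝓝 s))
    (hd : d ≤ |s - r|) {α : ℝ → ℂ} (hα : IsArc D.dom (D.edge k) (D.edge l) α) :
    ENNReal.ofReal d ≤ arcLength (fun z => ‖deriv (fun z => W (φ z)) z‖ₑ) α := by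
  have hev : ∀ {f : Filter ℝ} {p : ℂ} {t : ℝ}, (∀ᶠ s in f, s ∈ Ioo (0 : ℝ) 1) →
      Tendsto α f (𝓝 p) → Tendsto φ (𝓝[D.dom] p) (𝓝 (t : ℂ)) →
      Tendsto (fun s => φ (α s)) f (𝓝[upperHalf] (t : ℂ)) := by
    intro f p t hf hp ht
    have h1 : Tendsto α f (𝓝[D.dom] p) := tendsto_nhdsWithin_iff.2 ⟨hp, by
      filter_upwards [hf] with s hs using hα.mapsTo hs⟩
    refine tendsto_nhdsWithin_iff.2 ⟨ht.comp h1, ?_⟩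
    filter_upwards [hf] with s hs using U.conf.mapsTo (hα.mapsTo hs)
  obtain ⟨p, hp, hpt⟩ := hα.start
  obtain ⟨q, hq, hqt⟩ := hα.finish
  obtain ⟨t, ht, hpφ⟩ := U.edge k hk p hp
  obtain ⟨t', ht', hqφ⟩ := U.edge l hl q hq
  exact Scherk.ofReal_le_arcLength U.isOpen (hW.comp U.conf.diff U.conf.mapsTo) hα.contDiffOn
    hα.mapsTo ((hr t ht).comp (hev (Ioo_mem_nhdsGT one_pos) hpt hpφ))
    ((hs t' ht').comp (hev (Ioo_mem_nhdsLT one_pos) hqt hqφ)) hd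

theorem Uniformized.area_eq (U : Uniformized g D φ h x) {W : ℂ → ℂ}
    (hW : DifferentiableOn ℂ W upperHalf) :
    area D.dom (fun z => ‖deriv (fun z => W (φ z)) z‖ₑ) =
      ∫⁻ z in upperHalf, ‖deriv W z‖ₑ ^ 2 := by
  rw [← U.conf.image_eq, lintegral_image_holomorphic U.isOpen.measurableSet (fun z hz =>
    (U.conf.diff.differentiableAt (U.isOpen.mem_nhds hz)).hasDerivAt) U.conf.injOn, area]
  refine setLIntegral_congr_fun U.isOpen.measurableSet fun z hz => ?_
  have h1 := (U.conf.diff.differentiableAt (U.isOpen.mem_nhds hz)).hasDerivAt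
  have h2 := (hW.differentiableAt (isOpen_upperHalf.mem_nhds (U.conf.mapsTo hz))).hasDerivAt
  have h3 : HasDerivAt (fun z => W (φ z)) (deriv W (φ z) * deriv φ z) z := h2.comp z h1
  simp only [h3.deriv, enorm_mul]
  ring

theorem le_setLIntegral_Ioo {c : ℝ≥0∞} {f : ℝ → ℝ≥0∞} (h : ∀ y ∈ Ioo (0 : ℝ) 1, c ≤ f y) :
    c ≤ ∫⁻ y in Ioo (0 : ℝ) 1, f y := by
  calc c = ∫⁻ _ in Ioo (0 : ℝ) 1, c := by simp
    _ ≤ _ := setLIntegral_mono' measurableSet_Ioo h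

theorem lintegral_sq_of_isRectMap {u : Fin 4 → ℝ} {m κ : ℝ} {F G : ℂ → ℂ}
    (hF : IsRectMap u m κ F G) : ∫⁻ z in upperHalf, ‖deriv F z‖ₑ ^ 2 = ENNReal.ofReal m := by
  have h1 := lintegral_image_holomorphic isOpen_upperHalf.measurableSet
    (fun z hz => (hF.hasDerivAt z hz).differentiableAt.hasDerivAt) hF.conf.injOn (fun _ => 1)
  rw [hF.conf.image_eq] at h1
  simpa [volume_rect] using h1.symm

theorem Uniformized.extDelta_eq (U : Uniformized g D φ h x) {m κ : ℝ} {F G : ℂ → ℂ}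
    (hF : IsRectMap ![x 0, x 1, x (2 * g + 1), x (2 * g + 2)] m κ F G) :
    extDelta g D = ENNReal.ofReal m := by
  apply le_antisymm
  · refine extremalLength_le fun ρ hρ => ?_
    have hK : IsRectFamily upperHalf (realEdge x 0) (realEdge x (2 * g + 1)) m G := by
      refine ⟨hF.conf.diff_inv, hF.conf.symm.injOn, hF.conf.mapsTo_inv, fun y hy => ?_,
        fun y hy => ?_⟩
      · obtain ⟨t, ht, h1⟩ := hF.left_inv y hy
        exact ⟨t, ⟨t, ht, rfl⟩, h1.mono_right nhdsWithin_le_nhds⟩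
      · obtain ⟨t, ht, h1⟩ := hF.right_inv y hy
        exact ⟨t, ⟨t, ht, rfl⟩, h1.mono_right nhdsWithin_le_nhds⟩
    have hK' := U.isRectFamily (by lia) le_rfl hK
    calc _ ≤ (∫⁻ y in Ioo (0 : ℝ) 1, arcLength ρ fun t => h (G (horizontal m y t))) ^ 2 := by
          gcongr
          refine le_setLIntegral_Ioo fun y hy => ?_
          refine (iInf₂_le [fun t => h (G (horizontal m y t))]
            ⟨_, hK'.isArc hF.m_pos hy, rfl⟩).trans ?_
          simp [multiLength]
      _ ≤ _ := hK'.sq_lintegral_arcLength_le hF.m_pos hρ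
      _ ≤ _ := by
          rw [area]
          gcongr
          exact image_subset_iff.2 hK'.mapsTo
  · have ha := U.area_eq hF.conf.diff
    rw [lintegral_sq_of_isRectMap hF] at ha
    refine le_extremalLength (measurable_deriv _).enorm ?_
      (ha ▸ ENNReal.ofReal_pos.2 hF.m_pos) ha.le
    rintro _ ⟨α, hα, rfl⟩
    simp only [multiLength, List.map_cons, List.map_nil, List.sum_cons, List.sum_nil, add_zero]
    exact U.ofReal_le_arcLength hF.conf.diff (by lia) le_rfl hF.left hF.right
      (by rw [sub_zero]; exact le_abs_self m) hα

/-! ### The extremal length of `γ` -/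

/-- The left quadrant of the upper half-plane. -/
def leftQuadrant : Set ℂ := {z | z.re < 0 ∧ 0 < z.im}

/-- The inverse of `z ↦ -z²` as a map from the upper half-plane to its left quadrant. -/
def negSqrt (w : ℂ) : ℂ := -(-w) ^ (1 / 2 : ℂ)

theorem leftQuadrant_subset : leftQuadrant ⊆ upperHalf := fun _ hz => hz.2

theorem isOpen_leftQuadrant : IsOpen leftQuadrant :=
  (isOpen_lt Complex.continuous_re continuous_const).inter
    (isOpen_lt continuous_const Complex.continuous_im)

theorem convex_leftQuadrant : Convex ℝ leftQuadrant :=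
  ((convex_Iio (0 : ℝ)).linear_preimage Complex.reLm).inter
    ((convex_Ioi (0 : ℝ)).linear_preimage Complex.imLm)

theorem cpow_half_sq (z : ℂ) : (z ^ (1 / 2 : ℂ)) ^ 2 = z := by
  rw [← Complex.cpow_nat_mul]; simp

theorem cpow_half_re_pos {z : ℂ} (hz : z ∈ Complex.slitPlane) : 0 < (z ^ (1 / 2 : ℂ)).re := by
  rw [Complex.cpow_def_of_ne_zero (Complex.slitPlane_ne_zero hz), Complex.exp_re]
  refine mul_pos (Real.exp_pos _) (Real.cos_pos_of_mem_Ioo ?_)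
  have h5 : (Complex.log z * (1 / 2 : ℂ)).im = z.arg / 2 := by
    have : Complex.log z * (1 / 2 : ℂ) = ((1 / 2 : ℝ) : ℂ) * Complex.log z := by
      push_cast; ring
    rw [this, Complex.im_ofReal_mul, Complex.log_im]; ring
  rw [h5]
  have h6 := Complex.neg_pi_lt_arg z
  have h7 : z.arg < Real.pi :=
    lt_of_le_of_ne (Complex.arg_le_pi _) (Complex.mem_slitPlane_iff_arg.1 hz).1
  constructor <;> linarith

theorem neg_mem_slitPlane {w : ℂ} (hw : w ∈ upperHalf) : -w ∈ Complex.slitPlane := by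
  have h1 : 0 < w.im := hw
  exact Or.inr (by simpa using h1.ne')

theorem neg_sq_mem_upperHalf {z : ℂ} (hz : z ∈ leftQuadrant) : -z ^ 2 ∈ upperHalf := by
  have := mul_pos_of_neg_of_neg hz.1 (neg_neg_of_pos hz.2)
  simp only [upperHalf, mem_ofPred_eq, sq, Complex.neg_im, Complex.mul_im]
  nlinarith

theorem isConformalEquiv_neg_sq :
    IsConformalEquiv (fun z => -z ^ 2) negSqrt leftQuadrant upperHalf := by
  refine ⟨by fun_prop, fun w hw => ?_, fun z hz => neg_sq_mem_upperHalf hz, fun w hw => ?_,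
    fun z hz => ?_, fun w hw => ?_⟩
  · unfold negSqrt
    exact (DifferentiableAt.fun_neg (DifferentiableAt.cpow_const (by fun_prop)
      (neg_mem_slitPlane hw))).differentiableWithinAt
  · have h1 := cpow_half_re_pos (neg_mem_slitPlane hw)
    have h2 := congrArg Complex.im (cpow_half_sq (-w))
    have h3 : 0 < w.im := hw
    rw [sq, Complex.mul_im, Complex.neg_im] at h2
    refine ⟨by simpa [negSqrt] using h1, ?_⟩
    rw [negSqrt, Complex.neg_im]
    by_contra hcon
    nlinarith
  · have h1 := cpow_half_re_pos (neg_mem_slitPlane (neg_sq_mem_upperHalf hz))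
    have h2 := cpow_half_sq (-(-z ^ 2))
    rw [negSqrt]
    rw [neg_neg] at h1 h2 ⊢
    rcases sq_eq_sq_iff_eq_or_eq_neg.1 h2 with h | h
    · rw [h] at h1; exact absurd h1 (not_lt.2 hz.1.le)
    · rw [h, neg_neg]
  · simp only [negSqrt, neg_sq, cpow_half_sq, neg_neg]

theorem tendsto_negSqrt {t : ℝ} (ht : t < 0) : Tendsto negSqrt (𝓝 (t : ℂ))
    (𝓝 ((-Real.sqrt (-t) : ℝ) : ℂ)) := by
  have h1 : ContinuousAt negSqrt (t : ℂ) := by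
    unfold negSqrt
    refine ContinuousAt.fun_neg (ContinuousAt.cpow (by fun_prop) continuousAt_const ?_)
    exact Or.inl (by simpa using ht)
  have h2 : negSqrt t = ((-Real.sqrt (-t) : ℝ) : ℂ) := by
    rw [negSqrt, Real.sqrt_eq_rpow, Complex.ofReal_neg, Complex.ofReal_cpow (by linarith)]
    simp
  rw [← h2]
  exact h1

/-- The reflection of the upper half-plane in the imaginary axis. -/
def reflect (z : ℂ) : ℂ := -(starRingEnd ℂ) z

theorem continuous_reflect : Continuous reflect := Complex.continuous_conj.neg

@[simp] theorem reflect_re (z : ℂ) : (reflect z).re = -z.re := by simp [reflect]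

@[simp] theorem reflect_im (z : ℂ) : (reflect z).im = z.im := by simp [reflect]

@[simp] theorem reflect_reflect (z : ℂ) : reflect (reflect z) = z := by simp [reflect]

@[simp] theorem reflect_ofReal (t : ℝ) : reflect t = ((-t : ℝ) : ℂ) := by simp [reflect]

theorem reflect_mem_upperHalf {z : ℂ} (hz : z ∈ upperHalf) : reflect z ∈ upperHalf := by
  show 0 < (reflect z).im
  rw [reflect_im]; exact hz

theorem tendsto_reflect_upperHalf (z : ℂ) :
    Tendsto reflect (𝓝[upperHalf] z) (𝓝[upperHalf] (reflect z)) :=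
  tendsto_nhdsWithin_iff.2 ⟨(continuous_reflect.tendsto z).mono_left nhdsWithin_le_nhds, by
    filter_upwards [self_mem_nhdsWithin] with w hw using reflect_mem_upperHalf hw⟩

theorem hasDerivAt_reflect_comp {f : ℂ → ℂ} {f' z : ℂ} (hf : HasDerivAt f f' (reflect z)) :
    HasDerivAt (fun z => reflect (f (reflect z))) ((starRingEnd ℂ) f') z := by
  have h1 : HasDerivAt (fun w => -f (-w)) f' ((starRingEnd ℂ) z) := by
    have := (HasDerivAt.comp (h₂ := f) ((starRingEnd ℂ) z) hf (hasDerivAt_neg _)).fun_neg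
    simpa [Function.comp_def] using this
  have h2 := h1.conj_conj
  rw [Complex.conj_conj] at h2
  refine h2.congr_of_eventuallyEq (Eventually.of_forall fun w => ?_)
  simp [reflect, Function.comp]

theorem measurePreserving_reflect : MeasurePreserving reflect volume volume :=
  (Complex.conjLIE.trans (LinearIsometryEquiv.neg ℝ)).measurePreserving

theorem IsRectFamily.reflect {A B : Set ℂ} {m : ℝ} {K : ℂ → ℂ}
    (hK : IsRectFamily upperHalf A B m K) :
    IsRectFamily upperHalf (Scherk.reflect '' B) (Scherk.reflect '' A) m
      fun w => Scherk.reflect (K (m + Scherk.reflect w)) := by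
  have hmem : ∀ w ∈ rect m, (m : ℂ) + Scherk.reflect w ∈ rect m := by
    rintro w ⟨hw1, hw2⟩
    refine ⟨?_, ?_⟩
    · simp only [mem_preimage, Complex.add_re, Complex.ofReal_re, reflect_re]
      exact ⟨by linarith [hw1.2], by linarith [hw1.1]⟩
    · simpa using hw2
  have hlim : ∀ w₀ : ℂ, Tendsto (fun w => (m : ℂ) + Scherk.reflect w) (𝓝[rect m] w₀)
      (𝓝[rect m] (m + Scherk.reflect w₀)) := fun w₀ =>
    tendsto_nhdsWithin_iff.2 ⟨((continuous_const.add continuous_reflect).tendsto w₀).mono_left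
      nhdsWithin_le_nhds, by filter_upwards [self_mem_nhdsWithin] with w hw using hmem w hw⟩
  refine ⟨fun w hw => ?_, fun w hw w' hw' he => ?_, fun w hw =>
    reflect_mem_upperHalf (hK.mapsTo (hmem w hw)), fun y hy => ?_, fun y hy => ?_⟩
  · have h1 := (hK.diff.differentiableAt ((isOpen_rect m).mem_nhds (hmem w hw))).hasDerivAt
    have h2 : HasDerivAt (fun z => K (m + z)) (deriv K (m + Scherk.reflect w))
        (Scherk.reflect w) := by
      simpa using h1.comp_const_add (m : ℂ) (Scherk.reflect w)
    exact (hasDerivAt_reflect_comp h2).differentiableAt.differentiableWithinAt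
  · have h1 := congrArg Scherk.reflect he
    simp only [reflect_reflect] at h1
    have h2 := congrArg Scherk.reflect (add_left_cancel (hK.injOn (hmem w hw) (hmem w' hw') h1))
    simpa using h2
  · obtain ⟨p, hp, h1⟩ := hK.finish y hy
    refine ⟨_, ⟨p, hp, rfl⟩, (continuous_reflect.tendsto p).comp (h1.comp ?_)⟩
    convert hlim (y * Complex.I) using 3
    simp [Scherk.reflect]
  · obtain ⟨p, hp, h1⟩ := hK.start y hy
    refine ⟨_, ⟨p, hp, rfl⟩, (continuous_reflect.tendsto p).comp (h1.comp ?_)⟩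
    convert hlim (m + y * Complex.I) using 3
    simp [Scherk.reflect]

theorem reflect_image_realEdge {x : ℕ → ℝ} {k l : ℕ} (h1 : x l = -x (k + 1))
    (h2 : x (l + 1) = -x k) : reflect '' realEdge x k = realEdge x l := by
  ext z
  simp only [realEdge, mem_image, exists_exists_and_eq_and, reflect_ofReal, h1, h2]
  constructor
  · rintro ⟨t, ht, rfl⟩
    exact ⟨-t, ⟨neg_lt_neg ht.2, neg_lt_neg ht.1⟩, rfl⟩
  · rintro ⟨t, ht, rfl⟩
    exact ⟨-t, ⟨by linarith [ht.2], by linarith [ht.1]⟩, by simp⟩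

/-- The integrand of the pull-back of a Schwarz-Christoffel integral under `z ↦ -z²`. -/
def doubleKernel (κ : ℝ) (u : Fin 4 → ℝ) (z : ℂ) : ℂ :=
  κ * (∏ j, (-z ^ 2 - u j) ^ (-1 / 2 : ℂ)) * (-(2 * z))

theorem neg_sq_sub_mem_slitPlane {u : ℝ} (hu : u ≤ 0) {z : ℂ} (hz : z ∈ upperHalf) :
    -z ^ 2 - u ∈ Complex.slitPlane := by
  have h1 : 0 < z.im := hz
  rw [Complex.mem_slitPlane_iff]
  by_cases h : z.re = 0
  · left
    simp [sq, h]
    nlinarith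
  · right
    simp [sq]
    intro h2
    have h3 : z.re * z.im = 0 := by linarith
    simp [h, h1.ne'] at h3

theorem differentiableOn_doubleKernel (κ : ℝ) {u : Fin 4 → ℝ} (hu : ∀ j, u j ≤ 0) :
    DifferentiableOn ℂ (doubleKernel κ u) upperHalf := by
  intro z hz
  have h : ∀ j, DifferentiableAt ℂ (fun z : ℂ => (-z ^ 2 - u j) ^ (-1 / 2 : ℂ)) z := fun j =>
    DifferentiableAt.cpow_const (by fun_prop) (neg_sq_sub_mem_slitPlane (hu j) hz)
  unfold doubleKernel
  exact (((DifferentiableAt.fun_finsetProd fun j _ => h j).const_mul (κ : ℂ)).mul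
    (by fun_prop)).differentiableWithinAt

theorem doubleKernel_reflect (κ : ℝ) {u : Fin 4 → ℝ} (hu : ∀ j, u j ≤ 0) {z : ℂ}
    (hz : z ∈ upperHalf) :
    doubleKernel κ u (reflect z) = -(starRingEnd ℂ) (doubleKernel κ u z) := by
  have h : ∀ j, (-(reflect z) ^ 2 - u j) ^ (-1 / 2 : ℂ) =
      (starRingEnd ℂ) ((-z ^ 2 - u j) ^ (-1 / 2 : ℂ)) := fun j => by
    have h1 : -(reflect z) ^ 2 - u j = (starRingEnd ℂ) (-z ^ 2 - u j) := by simp [reflect]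
    have h2 := Complex.cpow_conj (-z ^ 2 - u j) (-1 / 2 : ℂ)
      (Complex.mem_slitPlane_iff_arg.1 (neg_sq_sub_mem_slitPlane (hu j) hz)).1
    have h3 : (starRingEnd ℂ) (-1 / 2 : ℂ) = -1 / 2 := by
      rw [map_div₀, map_neg, map_one, map_ofNat]
    rw [h3] at h2
    rw [h1, h2, Complex.conj_conj]
  simp only [doubleKernel, h, map_mul, map_prod, Complex.conj_ofReal, map_neg, map_ofNat]
  simp only [reflect]
  ring

/-- The pull-back of the Schwarz-Christoffel map under `z ↦ -z²`, continued symmetrically from the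
left quadrant to the half-plane. -/
theorem exists_double {u : Fin 4 → ℝ} (hu : ∀ j, u j ≤ 0) {m κ : ℝ} {F G : ℂ → ℂ}
    (hF : IsRectMap u m κ F G) : ∃ (W : ℂ → ℂ) (c : ℝ), DifferentiableOn ℂ W upperHalf ∧
      (∀ t r : ℝ, t < 0 →
        Tendsto (fun z => (F z).re) (𝓝[upperHalf] ((-t ^ 2 : ℝ) : ℂ)) (𝓝 r) →
        Tendsto (fun z => (W z).re) (𝓝[upperHalf] (t : ℂ)) (𝓝 (r + c)) ∧
        Tendsto (fun z => (W z).re) (𝓝[upperHalf] ((-t : ℝ) : ℂ)) (𝓝 (r + c))) ∧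
      ∫⁻ z in upperHalf, ‖deriv W z‖ₑ ^ 2 ≤ ENNReal.ofReal (2 * m) ∧
      0 < ∫⁻ z in upperHalf, ‖deriv W z‖ₑ ^ 2 := by
  obtain ⟨W, hW⟩ := exists_primitive_upperHalf (differentiableOn_doubleKernel κ hu)
  have hFd : ∀ z ∈ leftQuadrant, HasDerivAt (fun z => F (-z ^ 2)) (doubleKernel κ u z) z := by
    intro z hz
    have h1 : HasDerivAt (fun z : ℂ => -z ^ 2) (-(2 * z)) z := by
      simpa using (hasDerivAt_pow 2 z).fun_neg
    exact (hF.hasDerivAt _ (neg_sq_mem_upperHalf hz)).comp z h1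
  have hmem : (⟨-1, 1⟩ : ℂ) ∈ leftQuadrant := by constructor <;> norm_num
  set c : ℂ := W ⟨-1, 1⟩ - F (-(⟨-1, 1⟩ : ℂ) ^ 2) with hc
  have hWF : ∀ z ∈ leftQuadrant, W z = F (-z ^ 2) + c := by
    intro z hz
    have hd : ∀ z ∈ leftQuadrant, HasDerivAt (fun z => W z - F (-z ^ 2)) 0 z := fun z hz => by
      simpa using (hW z (leftQuadrant_subset hz)).fun_sub (hFd z hz)
    have := isOpen_leftQuadrant.is_const_of_deriv_eq_zero convex_leftQuadrant.isPreconnected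
      (fun z hz => (hd z hz).differentiableAt.differentiableWithinAt)
      (fun z hz => (hd z hz).deriv) hz hmem
    rw [hc, ← this]; ring
  have hsymm : ∀ z ∈ upperHalf, (W (reflect z)).re = (W z).re := by
    intro z hz
    have hd : ∀ z ∈ upperHalf, HasDerivAt (fun z => reflect (W (reflect z)) + W z) 0 z := by
      intro z hz
      have h1 := (hasDerivAt_reflect_comp (hW _ (reflect_mem_upperHalf hz))).fun_add (hW z hz)
      rw [doubleKernel_reflect κ hu hz] at h1
      simpa using h1
    have hI : Complex.I ∈ upperHalf := by simp [upperHalf]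
    have h2 := isOpen_upperHalf.is_const_of_deriv_eq_zero convex_upperHalf.isPreconnected
      (fun z hz => (hd z hz).differentiableAt.differentiableWithinAt)
      (fun z hz => (hd z hz).deriv) hz hI
    have h3 := congrArg Complex.re h2
    have hrI : reflect Complex.I = Complex.I := by simp [reflect]
    simp only [Complex.add_re, reflect_re, hrI] at h3
    linarith
  have hleft : ∀ t r : ℝ, t < 0 →
      Tendsto (fun z => (F z).re) (𝓝[upperHalf] ((-t ^ 2 : ℝ) : ℂ)) (𝓝 r) →
      Tendsto (fun z => (W z).re) (𝓝[upperHalf] (t : ℂ)) (𝓝 (r + c.re)) := by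
    intro t r ht h
    have hq : ∀ᶠ z in 𝓝[upperHalf] (t : ℂ), z ∈ leftQuadrant := by
      have h1 : ∀ᶠ z : ℂ in 𝓝 (t : ℂ), z.re < 0 :=
        Complex.continuous_re.continuousAt.eventually (gt_mem_nhds (by simpa using ht))
      filter_upwards [self_mem_nhdsWithin, mem_nhdsWithin_of_mem_nhds h1] with z hz hz'
        using ⟨hz', hz⟩
    have hsq : Tendsto (fun z : ℂ => -z ^ 2) (𝓝[upperHalf] (t : ℂ))
        (𝓝[upperHalf] ((-t ^ 2 : ℝ) : ℂ)) := by
      refine tendsto_nhdsWithin_iff.2 ⟨?_, ?_⟩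
      · have h1 : Continuous fun z : ℂ => -z ^ 2 := by fun_prop
        have h2 := h1.tendsto (t : ℂ)
        push_cast
        exact h2.mono_left nhdsWithin_le_nhds
      · filter_upwards [hq] with z hz using neg_sq_mem_upperHalf hz
    refine ((h.comp hsq).add_const c.re).congr' ?_
    filter_upwards [hq] with z hz
    simp only [Function.comp, hWF z hz, Complex.add_re]
  have hderiv : ∀ z ∈ upperHalf, deriv W z = doubleKernel κ u z := fun z hz => (hW z hz).deriv
  have hinj : InjOn (fun z => F (-z ^ 2)) leftQuadrant := hF.conf.injOn.comp
    isConformalEquiv_neg_sq.injOn isConformalEquiv_neg_sq.mapsTo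
  have himg : (fun z => F (-z ^ 2)) '' leftQuadrant = rect m := by
    have := (isConformalEquiv_neg_sq.trans hF.conf).image_eq
    exact this
  have hareaL : ∫⁻ z in leftQuadrant, ‖deriv W z‖ₑ ^ 2 = ENNReal.ofReal m := by
    have h1 := lintegral_image_holomorphic isOpen_leftQuadrant.measurableSet hFd hinj (fun _ => 1)
    rw [himg] at h1
    simp only [lintegral_const, one_mul, mul_one, Measure.restrict_apply MeasurableSet.univ,
      univ_inter, volume_rect] at h1
    rw [h1]
    refine setLIntegral_congr_fun isOpen_leftQuadrant.measurableSet fun z hz => ?_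
    simp only [hderiv z (leftQuadrant_subset hz)]
  have hareaR : ∫⁻ z in reflect ⁻¹' leftQuadrant, ‖deriv W z‖ₑ ^ 2 = ENNReal.ofReal m := by
    rw [← hareaL, ← measurePreserving_reflect.setLIntegral_comp_preimage
      isOpen_leftQuadrant.measurableSet ((measurable_deriv W).enorm.pow_const 2)]
    refine setLIntegral_congr_fun (isOpen_leftQuadrant.preimage continuous_reflect).measurableSet
      fun z hz => ?_
    have hz' : z ∈ upperHalf := by
      have := reflect_mem_upperHalf (leftQuadrant_subset hz); rwa [reflect_reflect] at this
    simp only [hderiv z hz', hderiv _ (reflect_mem_upperHalf hz'), doubleKernel_reflect κ hu hz',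
      enorm_neg]
    rw [← ofReal_norm, ← ofReal_norm, Complex.norm_conj]
  have haxis : volume {z : ℂ | z.re = 0} = 0 := by
    have h1 : {z : ℂ | z.re = 0} = ({0} : Set ℝ) ×ℂ univ := by
      ext z; simp [Complex.mem_reProdIm]
    have h2 := lintegral_reProdIm (A := {0}) (B := univ) (f := fun _ => 1) aemeasurable_const
    rw [h1]
    simpa using h2
  refine ⟨W, c.re, fun z hz => (hW z hz).differentiableAt.differentiableWithinAt,
    fun t r ht h => ⟨hleft t r ht h, ?_⟩, ?_, ?_⟩
  · have h1 : Tendsto reflect (𝓝[upperHalf] ((-t : ℝ) : ℂ)) (𝓝[upperHalf] (t : ℂ)) := by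
      have := tendsto_reflect_upperHalf ((-t : ℝ) : ℂ)
      rwa [reflect_ofReal, neg_neg] at this
    refine ((hleft t r ht h).comp h1).congr' ?_
    filter_upwards [self_mem_nhdsWithin] with z hz using hsymm z hz
  · have hsub : upperHalf ⊆ leftQuadrant ∪ reflect ⁻¹' leftQuadrant ∪ {z : ℂ | z.re = 0} := by
      intro z hz
      rcases lt_trichotomy z.re 0 with h | h | h
      · exact Or.inl (Or.inl ⟨h, hz⟩)
      · exact Or.inr h
      · exact Or.inl (Or.inr ⟨by simpa using h, reflect_mem_upperHalf hz⟩)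
    calc ∫⁻ z in upperHalf, ‖deriv W z‖ₑ ^ 2
        ≤ ∫⁻ z in leftQuadrant ∪ reflect ⁻¹' leftQuadrant ∪ {z : ℂ | z.re = 0},
            ‖deriv W z‖ₑ ^ 2 := lintegral_mono_set hsub
      _ ≤ ENNReal.ofReal m + ENNReal.ofReal m + 0 := by
          refine (lintegral_union_le _ _ _).trans (add_le_add ?_ ?_)
          · refine (lintegral_union_le _ _ _).trans (add_le_add hareaL.le hareaR.le)
          · rw [setLIntegral_measure_zero _ _ haxis]
      _ = _ := by
          rw [add_zero, ← ENNReal.ofReal_add hF.m_pos.le hF.m_pos.le, two_mul]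
  · calc 0 < ENNReal.ofReal m := ENNReal.ofReal_pos.2 hF.m_pos
      _ = _ := hareaL.symm
      _ ≤ _ := lintegral_mono_set leftQuadrant_subset

theorem ENNReal_add_sq_le (a b : ℝ≥0∞) : (a + b) ^ 2 ≤ 2 * (a ^ 2 + b ^ 2) := by
  rcases eq_or_ne a ∞ with rfl | ha
  · simp
  rcases eq_or_ne b ∞ with rfl | hb
  · simp
  lift a to NNReal using ha
  lift b to NNReal using hb
  exact_mod_cast (add_sq_le : (a + b) ^ 2 ≤ 2 * (a ^ 2 + b ^ 2))

theorem IsRectMap.isRectFamily_negSqrt {x : ℕ → ℝ} {k l : ℕ} {u : Fin 4 → ℝ} {m κ : ℝ}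
    {F G : ℂ → ℂ} (hF : IsRectMap u m κ F G) (hk : x k < x (k + 1)) (hk0 : x (k + 1) ≤ 0)
    (hl : x l < x (l + 1)) (hl0 : x (l + 1) ≤ 0) (h0 : u 0 = -x k ^ 2) (h1 : u 1 = -x (k + 1) ^ 2)
    (h2 : u 2 = -x l ^ 2) (h3 : u 3 = -x (l + 1) ^ 2) :
    IsRectFamily upperHalf (realEdge x k) (realEdge x l) m fun z => negSqrt (G z) := by
  have hQ := isConformalEquiv_neg_sq
  have hsqrt : ∀ {j : ℕ} {t : ℝ}, x j < x (j + 1) → x (j + 1) ≤ 0 →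
      t ∈ Ioo (-x j ^ 2) (-x (j + 1) ^ 2) →
      ((-Real.sqrt (-t) : ℝ) : ℂ) ∈ realEdge x j ∧ t < 0 := by
    intro j t hj hj0 ht
    have ht0 : t < 0 := ht.2.trans_le (neg_nonpos.2 (sq_nonneg _))
    refine ⟨⟨_, ⟨?_, ?_⟩, rfl⟩, ht0⟩
    · rw [lt_neg, Real.sqrt_lt' (by linarith), neg_sq]; linarith [ht.1]
    · rw [neg_lt]
      refine Real.lt_sqrt_of_sq_lt ?_
      rw [neg_sq]; linarith [ht.2]
  refine ⟨hQ.diff_inv.comp hF.conf.diff_inv hF.conf.mapsTo_inv,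
    hQ.symm.injOn.comp hF.conf.symm.injOn hF.conf.mapsTo_inv,
    fun z hz => leftQuadrant_subset (hQ.mapsTo_inv (hF.conf.mapsTo_inv hz)),
    fun y hy => ?_, fun y hy => ?_⟩
  · obtain ⟨t, ht, ht'⟩ := hF.left_inv y hy
    rw [h0, h1] at ht
    obtain ⟨h4, h5⟩ := hsqrt hk hk0 ht
    exact ⟨_, h4, (tendsto_negSqrt h5).comp (ht'.mono_right nhdsWithin_le_nhds)⟩
  · obtain ⟨t, ht, ht'⟩ := hF.right_inv y hy
    rw [h2, h3] at ht
    obtain ⟨h4, h5⟩ := hsqrt hl hl0 ht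
    exact ⟨_, h4, (tendsto_negSqrt h5).comp (ht'.mono_right nhdsWithin_le_nhds)⟩

variable {g : ℕ} {D : Labelled} {φ h : ℂ → ℂ} {x : ℕ → ℝ}

theorem Uniformized.middle (U : Uniformized g D φ h x) : x (g + 1) = 0 := by
  have := U.symm (g + 1) (by lia)
  rw [show 2 * g + 2 - (g + 1) = g + 1 by lia] at this
  linarith

theorem Uniformized.extGamma_eq (U : Uniformized g D φ h x) {i : ℕ} (hi : 1 ≤ i) (hig : i + 1 ≤ g)
    {m κ : ℝ} {F G : ℂ → ℂ}
    (hF : IsRectMap ![-x (i - 1) ^ 2, -x i ^ 2, -x (i + 1) ^ 2, -x (i + 2) ^ 2] m κ F G) :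
    extGamma g D i = ENNReal.ofReal (2 * m) := by
  have hii : i - 1 + 1 = i := by lia
  have hle : ∀ k ≤ g + 1, x k ≤ 0 := fun k hk => by
    rcases hk.eq_or_lt with rfl | h
    · exact U.middle.le
    · exact (U.middle ▸ U.strictMono k (g + 1) h (by lia)).le
  have hlt1 : x (i - 1) < x (i - 1 + 1) := U.strictMono _ _ (by lia) (by lia)
  have hlt2 : x (i + 1) < x (i + 1 + 1) := U.strictMono _ _ (by lia) (by lia)
  have e1 : x (2 * g - i) = -x (i + 1 + 1) := by
    rw [← U.symm (i + 1 + 1) (by lia)]; congr 1; lia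
  have e2 : x (2 * g - i + 1) = -x (i + 1) := by
    rw [← U.symm (i + 1) (by lia)]; congr 1; lia
  have e3 : x (2 * g + 2 - i) = -x (i - 1 + 1) := by
    rw [← U.symm (i - 1 + 1) (by lia)]; congr 1; lia
  have e4 : x (2 * g + 2 - i + 1) = -x (i - 1) := by
    rw [← U.symm (i - 1) (by lia)]; congr 1; lia
  have j1 : 2 * g + 1 - i - 1 = 2 * g - i := by lia
  have j2 : 2 * g + 1 - i + 1 = 2 * g + 2 - i := by lia
  have hm := hF.m_pos
  apply le_antisymm
  · refine extremalLength_le fun ρ hρ => ?_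
    have hL := hF.isRectFamily_negSqrt hlt1 (hle _ (by lia)) hlt2 (hle _ (by lia)) rfl
      (by simp [hii]) rfl rfl
    have hR := hL.reflect
    rw [reflect_image_realEdge e1 e2, reflect_image_realEdge e3 e4] at hR
    set KL : ℂ → ℂ := fun z => negSqrt (G z) with hKL
    set KR : ℂ → ℂ := fun w => reflect (KL (m + reflect w)) with hKR
    have hL' := U.isRectFamily (by lia) (by lia) hL
    have hR' := U.isRectFamily (by lia) (by lia) hR
    have hdisj : Disjoint ((fun z => h (KL z)) '' rect m) ((fun z => h (KR z)) '' rect m) := by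
      rw [disjoint_left]
      rintro _ ⟨z, hz, rfl⟩ ⟨w, hw, he⟩
      have h1 := U.conf.symm.injOn (hR.mapsTo hw) (hL.mapsTo hz) he
      have hQ : ∀ w ∈ rect m, (KL w).re < 0 := fun w hw =>
        (isConformalEquiv_neg_sq.mapsTo_inv (hF.conf.mapsTo_inv hw)).1
      have h2 := hQ z hz
      rw [← h1] at h2
      have hw' : (m : ℂ) + reflect w ∈ rect m := by
        obtain ⟨hw1, hw2⟩ := hw
        refine ⟨?_, ?_⟩
        · simp only [mem_preimage, Complex.add_re, Complex.ofReal_re, reflect_re]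
          exact ⟨by linarith [hw1.2], by linarith [hw1.1]⟩
        · simpa using hw2
      have h3 := hQ _ hw'
      simp only [hKR, reflect_re] at h2
      linarith
    set a := ∫⁻ y in Ioo (0 : ℝ) 1, arcLength ρ fun t => h (KL (horizontal m y t))
    set b := ∫⁻ y in Ioo (0 : ℝ) 1, arcLength ρ fun t => h (KR (horizontal m y t))
    set 𝓕 : Set (List (ℝ → ℂ)) :=
      {Γ | ∃ α ∈ cycleC D i, ∃ β ∈ cycleC D (2 * g + 1 - i), Γ = [α, β]}
    have hc : (⨅ Γ ∈ 𝓕, multiLength ρ Γ) ≤ a + b := by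
      have h1 : ∀ y ∈ Ioo (0 : ℝ) 1, (⨅ Γ ∈ 𝓕, multiLength ρ Γ) ≤
          (arcLength ρ fun t => h (KL (horizontal m y t))) + b := by
        intro y hy
        have h2 : (⨅ Γ ∈ 𝓕, multiLength ρ Γ) ≤ ∫⁻ y' in Ioo (0 : ℝ) 1,
            ((arcLength ρ fun t => h (KL (horizontal m y t))) +
              arcLength ρ fun t => h (KR (horizontal m y' t))) := by
          refine le_setLIntegral_Ioo fun y' hy' => ?_
          refine (iInf₂_le [fun t => h (KL (horizontal m y t)), fun t => h (KR (horizontal m y' t))]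
            ⟨_, hL'.isArc hm hy, _, ?_, rfl⟩).trans (by simp [multiLength])
          · have := hR'.isArc hm hy'
            rw [← j1, ← j2] at this
            exact this
        rwa [lintegral_add_left measurable_const, setLIntegral_const, Real.volume_Ioo, sub_zero,
          ENNReal.ofReal_one, mul_one] at h2
      have h3 := le_setLIntegral_Ioo h1
      rwa [lintegral_add_right _ measurable_const, setLIntegral_const, Real.volume_Ioo, sub_zero,
          ENNReal.ofReal_one, mul_one] at h3
    have hmeasR : MeasurableSet ((fun z => h (KR z)) '' rect m) :=
      (isOpen_image_of_injOn (isOpen_rect m) (convex_rect m).isPreconnected hR'.diff hR'.injOn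
        (isOpen_rect m) Subset.rfl).measurableSet
    calc _ ≤ (a + b) ^ 2 := by gcongr
      _ ≤ 2 * (a ^ 2 + b ^ 2) := ENNReal_add_sq_le a b
      _ ≤ 2 * (ENNReal.ofReal m * (∫⁻ w in (fun z => h (KL z)) '' rect m, ρ w ^ 2) +
            ENNReal.ofReal m * ∫⁻ w in (fun z => h (KR z)) '' rect m, ρ w ^ 2) := by
          gcongr
          · exact hL'.sq_lintegral_arcLength_le hm hρ
          · exact hR'.sq_lintegral_arcLength_le hm hρ
      _ = ENNReal.ofReal (2 * m) * ∫⁻ w in ((fun z => h (KL z)) '' rect m) ∪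
            ((fun z => h (KR z)) '' rect m), ρ w ^ 2 := by
          rw [lintegral_union hmeasR hdisj, ← mul_add, ← mul_assoc,
            ENNReal.ofReal_mul zero_le_two, ENNReal.ofReal_ofNat]
      _ ≤ _ := by
          rw [area]
          gcongr
          exact union_subset (image_subset_iff.2 hL'.mapsTo) (image_subset_iff.2 hR'.mapsTo)
  · obtain ⟨W, c, hWd, hWlim, hW1, hW2⟩ := exists_double (by
      intro j; fin_cases j <;> simp [sq_nonneg]) hF
    have ha := U.area_eq hWd
    have hsq : ∀ {k t}, t ∈ Ioo (x k) (x (k + 1)) → x (k + 1) ≤ 0 →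
        t < 0 ∧ -t ^ 2 ∈ Ioo (-x k ^ 2) (-x (k + 1) ^ 2) := by
      intro k t ht hk
      have h1 := ht.1; have h2 := ht.2
      exact ⟨by linarith, by nlinarith, by nlinarith⟩
    have hleft : ∀ t ∈ Ioo (x (i - 1)) (x (i - 1 + 1)), t < 0 ∧
        Tendsto (fun z => (F z).re) (𝓝[upperHalf] ((-t ^ 2 : ℝ) : ℂ)) (𝓝 0) := fun t ht => by
      have h1 := hsq ht (hle _ (by lia))
      rw [hii] at h1
      exact ⟨h1.1, hF.left _ h1.2⟩
    have hright : ∀ t ∈ Ioo (x (i + 1)) (x (i + 1 + 1)), t < 0 ∧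
        Tendsto (fun z => (F z).re) (𝓝[upperHalf] ((-t ^ 2 : ℝ) : ℂ)) (𝓝 m) := fun t ht => by
      have h1 := hsq ht (hle _ (by lia))
      exact ⟨h1.1, hF.right _ h1.2⟩
    refine le_extremalLength (measurable_deriv _).enorm ?_ (ha ▸ hW2) (ha ▸ hW1)
    rintro _ ⟨α, hα, β, hβ, rfl⟩
    have l1 := U.ofReal_le_arcLength hWd (k := i - 1) (l := i + 1) (by lia) (by lia)
      (r := 0 + c) (s := m + c) (d := m)
      (fun t ht => (hWlim t 0 (hleft t ht).1 (hleft t ht).2).1)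
      (fun t ht => (hWlim t m (hright t ht).1 (hright t ht).2).1)
      (by rw [show m + c - (0 + c) = m by ring]; exact le_abs_self m) hα
    have hβ' : IsArc D.dom (D.edge (2 * g - i)) (D.edge (2 * g + 2 - i)) β := by
      rw [← j1, ← j2]; exact hβ
    have l2 := U.ofReal_le_arcLength hWd (k := 2 * g - i) (l := 2 * g + 2 - i) (by lia) (by lia)
      (r := m + c) (s := 0 + c) (d := m)
      (fun t ht => by
        rw [e1, e2] at ht
        have ht' : -t ∈ Ioo (x (i + 1)) (x (i + 1 + 1)) := ⟨by linarith [ht.2], by linarith [ht.1]⟩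
        simpa using (hWlim (-t) m (hright _ ht').1 (hright _ ht').2).2)
      (fun t ht => by
        rw [e3, e4] at ht
        have ht' : -t ∈ Ioo (x (i - 1)) (x (i - 1 + 1)) := ⟨by linarith [ht.2], by linarith [ht.1]⟩
        simpa using (hWlim (-t) 0 (hleft _ ht').1 (hleft _ ht').2).2)
      (by rw [show 0 + c - (m + c) = -m by ring, abs_neg]; exact le_abs_self m) hβ'
    simp only [multiLength, List.map_cons, List.map_nil, List.sum_cons, List.sum_nil, add_zero]
    rw [two_mul, ENNReal.ofReal_add hm.le hm.le]
    exact add_le_add l1 l2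

/-! ### Equality of extremal lengths determines the vertices -/

theorem strictMono_vec {a b c d : ℝ} (h1 : a < b) (h2 : b < c) (h3 : c < d) :
    StrictMono ![a, b, c, d] := by
  refine Fin.strictMono_iff_lt_succ.2 fun i => ?_
  fin_cases i <;> simpa

theorem eq_of_heightTerm_eq_zero {x y : ℝ} (h : heightTerm x y = 0) : x = y := by
  rw [heightTerm] at h
  have h1 : |Real.exp x - Real.exp y| ^ 2 = 0 := by
    nlinarith [sq_nonneg |Real.exp (1 / x) - Real.exp (1 / y)|,
      sq_nonneg |Real.exp x - Real.exp y|]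
  have h2 := abs_eq_zero.1 (pow_eq_zero_iff two_ne_zero |>.1 h1)
  exact Real.exp_injective (sub_eq_zero.1 h2)

theorem heightTerm_nonneg (x y : ℝ) : 0 ≤ heightTerm x y := by
  rw [heightTerm]; positivity

/-- The cross-ratio of `x₀ < x₁ < -x₁ < -x₀` determines the quotient of `x₀` and `x₁`. -/
theorem mul_eq_of_symmetric_cross_ratio {a b a' b' : ℝ} (hab : a < b) (hb : b < 0) (hab' : a' < b')
    (hb' : b' < 0)
    (h : (a - b) * (-b - -a) * ((a' - -b') * (b' - -a')) =
      (a' - b') * (-b' - -a') * ((a - -b) * (b - -a))) : a * b' = a' * b := by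
  have h1 : ((a - b) * (a' + b')) ^ 2 = ((a' - b') * (a + b)) ^ 2 := by linarith
  have hp1 : 0 < (a - b) * (a' + b') := mul_pos_of_neg_of_neg (by linarith) (by linarith)
  have hp2 : 0 < (a' - b') * (a + b) := mul_pos_of_neg_of_neg (by linarith) (by linarith)
  have h2 : (a - b) * (a' + b') = (a' - b') * (a + b) := by
    rcases sq_eq_sq_iff_eq_or_eq_neg.1 h1 with h | h
    · exact h
    · linarith
  linarith

/-- Consecutive cross-ratios and the initial pair determine a sequence that ends in `0`. -/
theorem eq_of_cross_ratios {n : ℕ} {w v : ℕ → ℝ} (hn : 1 ≤ n)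
    (hw : ∀ i j, i < j → j ≤ n + 1 → w i < w j) (hv : ∀ i j, i < j → j ≤ n + 1 → v i < v j)
    (h0 : w 0 = v 0) (h1 : w 1 = v 1) (hwn : w (n + 1) = 0) (hvn : v (n + 1) = 0)
    (hcr : ∀ i, i + 2 ≤ n →
      (w i - w (i + 1)) * (w (i + 2) - w (i + 3)) * ((v i - v (i + 2)) * (v (i + 1) - v (i + 3))) =
      (v i - v (i + 1)) * (v (i + 2) - v (i + 3)) * ((w i - w (i + 2)) * (w (i + 1) - w (i + 3)))) :
    ∀ k ≤ n + 1, v k = w k := by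
  rcases hn.eq_or_lt with rfl | hn
  · intro k hk
    interval_cases k
    · exact h0.symm
    · exact h1.symm
    · rw [hwn, hvn]
  obtain ⟨p, hp⟩ : ∃ p : ℕ → ℝ, ∀ k, p k = (w k - w 1) / (w k - w 0) := ⟨_, fun _ => rfl⟩
  obtain ⟨q, hq⟩ : ∃ q : ℕ → ℝ, ∀ k, q k = (v k - w 1) / (v k - w 0) := ⟨_, fun _ => rfl⟩
  have hw0 : ∀ k, 1 ≤ k → k ≤ n + 1 → w k - w 0 ≠ 0 := fun k hk hk' =>
    (sub_pos.2 (hw 0 k hk hk')).ne'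
  have hv0 : ∀ k, 1 ≤ k → k ≤ n + 1 → v k - w 0 ≠ 0 := fun k hk hk' => by
    rw [h0]; exact (sub_pos.2 (hv 0 k hk hk')).ne'
  have h01 : w 1 - w 0 ≠ 0 := hw0 1 le_rfl (by lia)
  have hpsub : ∀ i j, 1 ≤ i → i ≤ n + 1 → 1 ≤ j → j ≤ n + 1 →
      w i - w j = (p i - p j) * ((w i - w 0) * (w j - w 0) / (w 1 - w 0)) := by
    intro i j hi hi' hj hj'
    have := hw0 i hi hi'
    have := hw0 j hj hj'
    simp only [hp]
    field_simp
    ring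
  have hqsub : ∀ i j, 1 ≤ i → i ≤ n + 1 → 1 ≤ j → j ≤ n + 1 →
      v i - v j = (q i - q j) * ((v i - w 0) * (v j - w 0) / (w 1 - w 0)) := by
    intro i j hi hi' hj hj'
    have := hv0 i hi hi'
    have := hv0 j hj hj'
    simp only [hq]
    field_simp
    ring
  have hp1 : p 1 = 0 := by simp [hp]
  have hq1 : q 1 = 0 := by simp [hq, h1]
  have hppos : ∀ k, 2 ≤ k → k ≤ n + 1 → 0 < p k := fun k hk hk' => by
    rw [hp]
    exact div_pos (sub_pos.2 (hw 1 k (by lia) hk')) (sub_pos.2 (hw 0 k (by lia) hk'))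
  have hqpos : ∀ k, 2 ≤ k → k ≤ n + 1 → 0 < q k := fun k hk hk' => by
    simp only [hq, h0, h1]
    exact div_pos (sub_pos.2 (hv 1 k (by lia) hk')) (sub_pos.2 (hv 0 k (by lia) hk'))
  obtain ⟨μ, hμ⟩ : ∃ μ, μ = q 2 / p 2 := ⟨_, rfl⟩
  have hμ0 : 0 < μ := hμ ▸ div_pos (hqpos 2 le_rfl (by lia)) (hppos 2 le_rfl (by lia))
  have hq2 : q 2 = μ * p 2 := hμ ▸ (div_mul_cancel₀ _ (hppos 2 le_rfl (by lia)).ne').symm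
  have hcr0 : (p 2 - p 3) * q 3 = (q 2 - q 3) * p 3 := by
    have h := hcr 0 (by lia)
    simp only [zero_add] at h
    rw [hpsub 2 3 (by lia) (by lia) (by lia) (by lia), hpsub 1 3 (by lia) (by lia) (by lia) (by lia),
      hqsub 2 3 (by lia) (by lia) (by lia) (by lia), hqsub 1 3 (by lia) (by lia) (by lia) (by lia),
      hp1, hq1, ← h0, ← h1] at h
    rw [← neg_sub (v 2) (w 0), ← neg_sub (w 2) (w 0), ← neg_sub (w 1) (w 0)] at h
    have a2 := hw0 2 (by lia) (by lia); have a3 := hw0 3 (by lia) (by lia)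
    have b2 := hv0 2 (by lia) (by lia); have b3 := hv0 3 (by lia) (by lia)
    generalize w 2 - w 0 = A2 at *
    generalize w 3 - w 0 = A3 at *
    generalize v 2 - w 0 = B2 at *
    generalize v 3 - w 0 = B3 at *
    generalize w 1 - w 0 = C at *
    have hfac : C * (A2 * A3 / C) * B2 * (C * B3 / C) ≠ 0 := by positivity
    apply mul_right_cancel₀ hfac
    linear_combination (-1) * h
  have hcrp : ∀ i, 1 ≤ i → i + 2 ≤ n →
      (p i - p (i + 1)) * (p (i + 2) - p (i + 3)) * ((q i - q (i + 2)) * (q (i + 1) - q (i + 3))) =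
      (q i - q (i + 1)) * (q (i + 2) - q (i + 3)) * ((p i - p (i + 2)) * (p (i + 1) - p (i + 3))) := by
    intro i hi hin
    have h := hcr i hin
    rw [hpsub i (i + 1) (by lia) (by lia) (by lia) (by lia),
      hpsub (i + 2) (i + 3) (by lia) (by lia) (by lia) (by lia),
      hpsub i (i + 2) (by lia) (by lia) (by lia) (by lia),
      hpsub (i + 1) (i + 3) (by lia) (by lia) (by lia) (by lia),
      hqsub i (i + 1) (by lia) (by lia) (by lia) (by lia),
      hqsub (i + 2) (i + 3) (by lia) (by lia) (by lia) (by lia),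
      hqsub i (i + 2) (by lia) (by lia) (by lia) (by lia),
      hqsub (i + 1) (i + 3) (by lia) (by lia) (by lia) (by lia)] at h
    have a0 := hw0 i (by lia) (by lia); have a1 := hw0 (i + 1) (by lia) (by lia)
    have a2 := hw0 (i + 2) (by lia) (by lia); have a3 := hw0 (i + 3) (by lia) (by lia)
    have b0 := hv0 i (by lia) (by lia); have b1 := hv0 (i + 1) (by lia) (by lia)
    have b2 := hv0 (i + 2) (by lia) (by lia); have b3 := hv0 (i + 3) (by lia) (by lia)
    generalize p i - p (i + 1) = P1 at *
    generalize p (i + 2) - p (i + 3) = P2 at *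
    generalize p i - p (i + 2) = P3 at *
    generalize p (i + 1) - p (i + 3) = P4 at *
    generalize q i - q (i + 1) = Q1 at *
    generalize q (i + 2) - q (i + 3) = Q2 at *
    generalize q i - q (i + 2) = Q3 at *
    generalize q (i + 1) - q (i + 3) = Q4 at *
    generalize w i - w 0 = A0 at *
    generalize w (i + 1) - w 0 = A1 at *
    generalize w (i + 2) - w 0 = A2 at *
    generalize w (i + 3) - w 0 = A3 at *
    generalize v i - w 0 = B0 at *
    generalize v (i + 1) - w 0 = B1 at *
    generalize v (i + 2) - w 0 = B2 at *
    generalize v (i + 3) - w 0 = B3 at *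
    generalize w 1 - w 0 = C at *
    have hfac : A0 * A1 * A2 * A3 * (B0 * B1 * B2 * B3) / C ^ 4 ≠ 0 := by positivity
    apply mul_right_cancel₀ hfac
    linear_combination h
  have hpne : ∀ i j, 1 ≤ i → i < j → j ≤ n + 1 → p i - p j ≠ 0 := fun i j hi hij hj h => by
    have h2 := hpsub i j hi (by lia) (by lia) hj
    rw [h, zero_mul] at h2
    linarith [hw i j hij hj]
  have hind : ∀ k, 1 ≤ k → k + 2 ≤ n + 1 →
      q k = μ * p k ∧ q (k + 1) = μ * p (k + 1) ∧ q (k + 2) = μ * p (k + 2) := by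
    intro k hk
    induction k, hk using Nat.le_induction with
    | base =>
      intro _
      refine ⟨by rw [hp1, hq1, mul_zero], hq2, ?_⟩
      have hp2 := hppos 2 le_rfl (by lia)
      have hmain : p 2 * (q 3 - μ * p 3) = 0 := by
        rw [hq2] at hcr0; linear_combination hcr0
      have := (mul_eq_zero.1 hmain).resolve_left hp2.ne'
      linarith
    | succ k hk ih =>
      intro hkn
      obtain ⟨e1, e2, e3⟩ := ih (by lia)
      refine ⟨e2, e3, ?_⟩
      have h := hcrp k hk (by lia)
      rw [e1, e2, e3] at h
      have d1 := hpne k (k + 1) hk (by lia) (by lia)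
      have d2 := hpne k (k + 2) hk (by lia) (by lia)
      have d3 := hpne (k + 1) (k + 2) (by lia) (by lia) (by lia)
      rw [show k + 1 + 2 = k + 3 by lia]
      generalize p k = P0 at *
      generalize p (k + 1) = P1 at *
      generalize p (k + 2) = P2 at *
      generalize p (k + 3) = P3 at *
      generalize q (k + 3) = Q3 at *
      have hmain : μ * ((P0 - P1) * (P0 - P2) * (P1 - P2)) * (Q3 - μ * P3) = 0 := by
        linear_combination h
      have := (mul_eq_zero.1 hmain).resolve_left
        (mul_ne_zero hμ0.ne' (mul_ne_zero (mul_ne_zero d1 d2) d3))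
      linarith
  have hall : ∀ k, 1 ≤ k → k ≤ n + 1 → q k = μ * p k := by
    intro k hk hkn
    rcases lt_trichotomy k n with h | rfl | h
    · exact (hind k hk (by lia)).1
    · have := (hind (k - 1) (by lia) (by lia)).2.1
      rwa [show k - 1 + 1 = k by lia] at this
    · have := (hind (n - 1) (by lia) (by lia)).2.2
      rwa [show n - 1 + 2 = k by lia] at this
  have hμ1 : μ = 1 := by
    have h2 := hall (n + 1) (by lia) le_rfl
    have h3 : q (n + 1) = p (n + 1) := by simp only [hp, hq, hwn, hvn]
    have h4 := hppos (n + 1) (by lia) le_rfl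
    rw [h3] at h2
    nlinarith
  intro k hk
  rcases Nat.eq_zero_or_pos k with rfl | hk0
  · exact h0.symm
  have h2 := hall k hk0 hk
  rw [hμ1, one_mul] at h2
  simp only [hp, hq] at h2
  rw [div_eq_div_iff (hv0 k hk0 hk) (hw0 k hk0 hk)] at h2
  have h3 : (w 1 - w 0) * (v k - w k) = 0 := by linear_combination h2
  have := (mul_eq_zero.1 h3).resolve_left h01
  linarith

theorem tendsto_mul_upperHalf {s : ℝ} (hs : 0 < s) (t : ℝ) :
    Tendsto (fun z : ℂ => s * z) (𝓝[upperHalf] (t : ℂ)) (𝓝[upperHalf] ((s * t : ℝ) : ℂ)) := by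
  refine tendsto_nhdsWithin_iff.2 ⟨?_, ?_⟩
  · have h1 : Continuous fun z : ℂ => (s : ℂ) * z := by fun_prop
    have h2 := h1.tendsto (t : ℂ)
    push_cast
    exact h2.mono_left nhdsWithin_le_nhds
  · filter_upwards [self_mem_nhdsWithin] with z hz
    have h1 : 0 < z.im := hz
    simpa [upperHalf] using mul_pos hs h1

theorem tendsto_mul_upperInfty {s : ℝ} (hs : 0 < s) :
    Tendsto (fun z : ℂ => s * z) upperInfty upperInfty := by
  refine tendsto_inf.2 ⟨?_, tendsto_principal.2 ?_⟩
  · have h1 : Tendsto (fun z : ℂ => (s : ℂ) * z) (Bornology.cobounded ℂ) (Bornology.cobounded ℂ) := by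
      rw [← tendsto_norm_atTop_iff_cobounded]
      simp only [norm_mul, Complex.norm_real, Real.norm_of_nonneg hs.le]
      exact tendsto_norm_cobounded_atTop.const_mul_atTop hs
    exact h1.mono_left inf_le_left
  · have : upperHalf ∈ upperInfty := mem_inf_of_right (mem_principal_self _)
    filter_upwards [this] with z hz
    have h1 : 0 < z.im := hz
    simpa [upperHalf] using mul_pos hs h1

theorem isConformalEquiv_mul {s : ℝ} (hs : 0 < s) :
    IsConformalEquiv (fun z : ℂ => s * z) (fun z : ℂ => (s⁻¹ : ℝ) * z) upperHalf upperHalf := by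
  have hsC : (s : ℂ) ≠ 0 := by exact_mod_cast hs.ne'
  have hmaps : ∀ {r : ℝ}, 0 < r → MapsTo (fun z : ℂ => (r : ℂ) * z) upperHalf upperHalf :=
    fun hr z hz => by
      have h1 : 0 < z.im := hz
      simpa [upperHalf] using mul_pos hr h1
  refine ⟨by fun_prop, by fun_prop, hmaps hs, hmaps (inv_pos.2 hs), fun z _ => ?_, fun z _ => ?_⟩
  · simp [hsC]
  · simp [hsC]

variable {g : ℕ} {D D' : Labelled} {φ h φ' h' : ℂ → ℂ} {x x' : ℕ → ℝ}

theorem Uniformized.neg (U : Uniformized g D φ h x) {k : ℕ} (hk : k < g + 1) : x k < 0 :=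
  U.middle ▸ U.strictMono k (g + 1) hk (by lia)

theorem Uniformized.sq_strictMono (U : Uniformized g D φ h x) {i j : ℕ} (hij : i < j)
    (hj : j ≤ g + 1) : -x i ^ 2 < -x j ^ 2 := by
  have h1 := U.strictMono i j hij (by lia)
  have h2 : x j ≤ 0 := by
    rcases hj.eq_or_lt with rfl | h
    · exact U.middle.le
    · exact (U.neg h).le
  nlinarith

theorem Uniformized.exists_scale (hg : 1 ≤ g) (U : Uniformized g D φ h x)
    (U' : Uniformized g D' φ' h' x') (hh : height g D D' = 0) :
    ∃ s : ℝ, 0 < s ∧ ∀ k ≤ 2 * g + 2, x' k = s * x k := by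
  have hsum : 0 ≤ ∑ i ∈ Finset.Icc 1 (g - 1),
      heightTerm (extGamma g D i).toReal (extGamma g D' i).toReal :=
    Finset.sum_nonneg fun _ _ => heightTerm_nonneg _ _
  have hδ0 := heightTerm_nonneg (extDelta g D).toReal (extDelta g D').toReal
  rw [height] at hh
  have hδ : (extDelta g D).toReal = (extDelta g D').toReal :=
    eq_of_heightTerm_eq_zero (by linarith)
  have hγ : ∀ i, 1 ≤ i → i + 1 ≤ g → (extGamma g D i).toReal = (extGamma g D' i).toReal := by
    intro i hi hig
    have h1 : ∑ i ∈ Finset.Icc 1 (g - 1),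
        heightTerm (extGamma g D i).toReal (extGamma g D' i).toReal = 0 := by linarith
    exact eq_of_heightTerm_eq_zero ((Finset.sum_eq_zero_iff_of_nonneg
      fun _ _ => heightTerm_nonneg _ _).1 h1 i (Finset.mem_Icc.2 ⟨hi, by lia⟩))
  have hfirst : x 0 * x' 1 = x' 0 * x 1 := by
    obtain ⟨m, κ, F, G, hF⟩ := exists_isRectMap (strictMono_vec
      (U.strictMono 0 1 (by lia) (by lia)) (U.strictMono 1 (2 * g + 1) (by lia) (by lia))
      (U.strictMono (2 * g + 1) (2 * g + 2) (by lia) le_rfl))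
    obtain ⟨m', κ', F', G', hF'⟩ := exists_isRectMap (strictMono_vec
      (U'.strictMono 0 1 (by lia) (by lia)) (U'.strictMono 1 (2 * g + 1) (by lia) (by lia))
      (U'.strictMono (2 * g + 1) (2 * g + 2) (by lia) le_rfl))
    have hm : m = m' := by
      rw [U.extDelta_eq hF, U'.extDelta_eq hF', ENNReal.toReal_ofReal hF.m_pos.le,
        ENNReal.toReal_ofReal hF'.m_pos.le] at hδ
      exact hδ
    subst hm
    have hcr := hF.cross_ratio_eq hF'
    have s1 := U.symm 1 (by lia); have s2 := U.symm 0 (by lia)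
    have s1' := U'.symm 1 (by lia); have s2' := U'.symm 0 (by lia)
    rw [show 2 * g + 2 - 1 = 2 * g + 1 by lia] at s1 s1'
    rw [Nat.sub_zero] at s2 s2'
    simp only [Matrix.cons_val, s1, s2, s1', s2'] at hcr
    exact mul_eq_of_symmetric_cross_ratio (U.strictMono 0 1 (by lia) (by lia)) (U.neg (by lia))
      (U'.strictMono 0 1 (by lia) (by lia)) (U'.neg (by lia)) hcr
  have hcr : ∀ i, i + 2 ≤ g →
      (-x i ^ 2 - -x (i + 1) ^ 2) * (-x (i + 2) ^ 2 - -x (i + 3) ^ 2) *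
        ((-x' i ^ 2 - -x' (i + 2) ^ 2) * (-x' (i + 1) ^ 2 - -x' (i + 3) ^ 2)) =
      (-x' i ^ 2 - -x' (i + 1) ^ 2) * (-x' (i + 2) ^ 2 - -x' (i + 3) ^ 2) *
        ((-x i ^ 2 - -x (i + 2) ^ 2) * (-x (i + 1) ^ 2 - -x (i + 3) ^ 2)) := by
    intro i hi
    obtain ⟨m, κ, F, G, hF⟩ := exists_isRectMap (strictMono_vec
      (U.sq_strictMono (i := i) (j := i + 1) (by lia) (by lia))
      (U.sq_strictMono (i := i + 1) (j := i + 2) (by lia) (by lia))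
      (U.sq_strictMono (i := i + 2) (j := i + 3) (by lia) (by lia)))
    obtain ⟨m', κ', F', G', hF'⟩ := exists_isRectMap (strictMono_vec
      (U'.sq_strictMono (i := i) (j := i + 1) (by lia) (by lia))
      (U'.sq_strictMono (i := i + 1) (j := i + 2) (by lia) (by lia))
      (U'.sq_strictMono (i := i + 2) (j := i + 3) (by lia) (by lia)))
    have hm : m = m' := by
      have h1 := hγ (i + 1) (by lia) (by lia)
      rw [U.extGamma_eq (by lia) (by lia) (i := i + 1) hF,
        U'.extGamma_eq (by lia) (by lia) (i := i + 1) hF',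
        ENNReal.toReal_ofReal (by linarith [hF.m_pos]),
        ENNReal.toReal_ofReal (by linarith [hF'.m_pos])] at h1
      linarith
    subst hm
    simpa using hF.cross_ratio_eq hF'
  have hx0 := U.neg (k := 0) (by lia)
  have hx0' := U'.neg (k := 0) (by lia)
  set s := x' 0 / x 0 with hs
  have hs0 : 0 < s := div_pos_of_neg_of_neg hx0' hx0
  have e0 : x' 0 = s * x 0 := (div_mul_cancel₀ _ hx0.ne).symm
  have e1 : x' 1 = s * x 1 := by
    rw [hs, div_mul_eq_mul_div, eq_div_iff hx0.ne]; linarith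
  have hkey : ∀ k ≤ g + 1, -x' k ^ 2 = s ^ 2 * -x k ^ 2 := by
    refine eq_of_cross_ratios (n := g) (w := fun k => s ^ 2 * -x k ^ 2) (v := fun k => -x' k ^ 2) hg
      (fun i j hij hj => ?_) (fun i j hij hj => U'.sq_strictMono hij hj) ?_ ?_ ?_ ?_ ?_
    · exact mul_lt_mul_of_pos_left (U.sq_strictMono hij hj) (by positivity)
    · simp only [e0]; ring
    · simp only [e1]; ring
    · simp only [U.middle]; ring
    · simp only [U'.middle]; ring
    · intro i hi
      linear_combination s ^ 4 * hcr i hi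
  have hleft : ∀ k ≤ g + 1, x' k = s * x k := by
    intro k hk
    rcases hk.eq_or_lt with rfl | hk'
    · rw [U.middle, U'.middle, mul_zero]
    have h1 := hkey k hk
    have h2 : x' k ^ 2 = (s * x k) ^ 2 := by linarith
    have h3 := U.neg hk'
    have h4 := U'.neg hk'
    rcases sq_eq_sq_iff_eq_or_eq_neg.1 h2 with h | h
    · exact h
    · nlinarith
  refine ⟨s, hs0, fun k hk => ?_⟩
  rcases le_total k (g + 1) with h | h
  · exact hleft k h
  · have h1 := U.symm (2 * g + 2 - k) (by lia)
    have h2 := U'.symm (2 * g + 2 - k) (by lia)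
    rw [Nat.sub_sub_self hk] at h1 h2
    rw [h1, h2, hleft _ (by lia)]
    ring

theorem reflexive_of_uniformized (hg : 1 ≤ g) (U : Uniformized g D φ h x)
    (U' : Uniformized g D' φ' h' x') (hh : height g D D' = 0) : Reflexive g D D' := by
  obtain ⟨s, hs, hx⟩ := U.exists_scale hg U' hh
  have hxi : ∀ k ≤ 2 * g + 2, x k = s⁻¹ * x' k := fun k hk => by
    rw [hx k hk]; field_simp
  have H := (U.conf.trans (isConformalEquiv_mul hs)).trans U'.conf.symm
  have hf : ∀ k ≤ 2 * g + 2, Tendsto (fun z : ℂ => (s : ℂ) * z) (𝓝[upperHalf] (x k : ℂ))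
      (𝓝[upperHalf] (x' k : ℂ)) := fun k hk => by
    rw [hx k hk]; exact tendsto_mul_upperHalf hs _
  have hi : ∀ k ≤ 2 * g + 2, Tendsto (fun z : ℂ => ((s⁻¹ : ℝ) : ℂ) * z) (𝓝[upperHalf] (x' k : ℂ))
      (𝓝[upperHalf] (x k : ℂ)) := fun k hk => by
    rw [hxi k hk]; exact tendsto_mul_upperHalf (inv_pos.2 hs) _
  refine ⟨_, _, H.diff, H.diff_inv, H.mapsTo, H.mapsTo_inv, ⟨H.left_inv, H.right_inv⟩,
    fun j hj => ⟨?_, ?_⟩, ⟨?_, ?_⟩, ⟨?_, ?_⟩, ?_, ?_⟩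
  · exact (U'.vertex j hj).2.comp ((hf (j + 1) (by lia)).comp (U.vertex j hj).1)
  · exact (U.vertex j hj).2.comp ((hi (j + 1) (by lia)).comp (U'.vertex j hj).1)
  · exact U'.outer.2.comp ((tendsto_mul_upperInfty hs).comp U.outer.1)
  · exact U.outer.2.comp ((tendsto_mul_upperInfty (inv_pos.2 hs)).comp U'.outer.1)
  · exact U'.end₁.2.comp ((hf (2 * g + 2) le_rfl).comp U.end₁.1)
  · exact U.end₁.2.comp ((hi (2 * g + 2) le_rfl).comp U'.end₁.1)
  · exact U'.end₂.2.comp ((hf 0 (by lia)).comp U.end₂.1)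
  · have hend := U'.end₂.1
    exact U.end₂.2.comp ((hi 0 (by lia)).comp hend)

/-! ### Boundary values of symmetric conformal maps -/

/-- The reflection in the line `y = -x`. -/
def diagRefl (z : ℂ) : ℂ := -Complex.I * (starRingEnd ℂ) z

theorem continuous_diagRefl : Continuous diagRefl :=
  continuous_const.mul Complex.continuous_conj

@[simp] theorem diagRefl_re (z : ℂ) : (diagRefl z).re = -z.im := by simp [diagRefl]

@[simp] theorem diagRefl_im (z : ℂ) : (diagRefl z).im = -z.re := by simp [diagRefl]

@[simp] theorem diagRefl_diagRefl (z : ℂ) : diagRefl (diagRefl z) = z := by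
  apply Complex.ext <;> simp

theorem differentiableOn_conj_comp_diagRefl {f : ℂ → ℂ} {S : Set ℂ} (hS : IsOpen S)
    (hf : DifferentiableOn ℂ f S) :
    DifferentiableOn ℂ (fun z => (starRingEnd ℂ) (f (diagRefl z))) (diagRefl ⁻¹' S) := by
  intro z hz
  have h1 : DifferentiableAt ℂ f (diagRefl z) := hf.differentiableAt (hS.mem_nhds hz)
  have h2 : DifferentiableAt ℂ (fun w => f (-Complex.I * w)) ((starRingEnd ℂ) z) :=
    DifferentiableAt.fun_comp' _ h1 (by fun_prop)
  have h3 := DifferentiableAt.conj_conj h2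
  simp only [Complex.conj_conj] at h3
  exact h3.differentiableWithinAt

/-- The filters of points of the domain tending to its ends or its finite boundary points. -/
def IsBoundaryFilter (D : Labelled) (𝓕 : Filter ℂ) : Prop :=
  𝓕 = D.E₁ ∨ 𝓕 = D.E₂ ∨ ∃ p ∈ closure D.dom \ D.dom, 𝓕 = 𝓝[D.dom] p

/-- A labelled domain which is symmetric in the line `y = -x` and has a chart at each of its
boundary points and ends. -/
structure IsSymmetricDomain (g : ℕ) (D : Labelled) : Prop where
  isOpen : IsOpen D.dom
  simplyConnected : IsSimplyConnected D.dom
  far : ∃ p : ℂ, ∃ ε > 0, ∀ z ∈ D.dom, ε < dist z p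
  refl : MapsTo diagRefl D.dom D.dom
  center : ∃ p ∈ D.dom, diagRefl p = p
  chart : ∀ p ∈ closure D.dom \ D.dom, ∃ χ θ, IsBoundaryChart D.dom (𝓝[D.dom] p) χ θ
  chart₁ : ∃ χ θ, IsBoundaryChart D.dom D.E₁ χ θ
  chart₂ : ∃ χ θ, IsBoundaryChart D.dom D.E₂ χ θ
  le_cobounded₁ : D.E₁ ≤ Bornology.cobounded ℂ
  le_cobounded₂ : D.E₂ ≤ Bornology.cobounded ℂ
  disjoint : Disjoint D.E₁ D.E₂
  cobounded_le : Bornology.cobounded ℂ ⊓ 𝓟 D.dom ≤ D.E₁ ⊔ D.E₂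
  refl_vertex : ∀ j ≤ 2 * g, diagRefl (D.P j) = D.P (2 * g - j)
  refl_outer : diagRefl D.V = D.V
  refl_end : Tendsto diagRefl D.E₂ D.E₁
  outer_mem : D.V ∈ closure D.dom \ D.dom
  vertex_mem : ∀ j ≤ 2 * g, D.P j ∈ closure D.dom \ D.dom
  vertex_ne : ∀ j ≤ 2 * g, D.P j ≠ D.V

variable {g : ℕ} {D : Labelled}

theorem IsSymmetricDomain.exists_chart (S : IsSymmetricDomain g D) {𝓕 : Filter ℂ}
    (h𝓕 : IsBoundaryFilter D 𝓕) : ∃ χ θ, IsBoundaryChart D.dom 𝓕 χ θ := by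
  rcases h𝓕 with rfl | rfl | ⟨p, hp, rfl⟩
  exacts [S.chart₁, S.chart₂, S.chart p hp]

theorem IsSymmetricDomain.disjoint_of_ne (S : IsSymmetricDomain g D) {𝓕 𝓖 : Filter ℂ}
    (h𝓕 : IsBoundaryFilter D 𝓕) (h𝓖 : IsBoundaryFilter D 𝓖) (hne : 𝓕 ≠ 𝓖) : Disjoint 𝓕 𝓖 := by
  have hc : ∀ p : ℂ, Disjoint (Bornology.cobounded ℂ) (𝓝[D.dom] p) := fun p =>
    (Metric.disjoint_cobounded_nhds p).mono_right nhdsWithin_le_nhds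
  rcases h𝓕 with rfl | rfl | ⟨p, hp, rfl⟩ <;> rcases h𝓖 with rfl | rfl | ⟨q, hq, rfl⟩
  · exact absurd rfl hne
  · exact S.disjoint
  · exact (hc q).mono_left S.le_cobounded₁
  · exact S.disjoint.symm
  · exact absurd rfl hne
  · exact (hc q).mono_left S.le_cobounded₂
  · exact ((hc p).mono_left S.le_cobounded₁).symm
  · exact ((hc p).mono_left S.le_cobounded₂).symm
  · have : p ≠ q := fun h => hne (by rw [h])
    exact (disjoint_nhds_nhds.2 this).mono nhdsWithin_le_nhds nhdsWithin_le_nhds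

theorem IsSymmetricDomain.ultrafilter (S : IsSymmetricDomain g D) (𝓤 : Ultrafilter ℂ)
    (h : D.dom ∈ 𝓤) :
    (∃ z ∈ D.dom, (𝓤 : Filter ℂ) ≤ 𝓝 z) ∨
      ∃ 𝓕, IsBoundaryFilter D 𝓕 ∧ (𝓤 : Filter ℂ) ≤ 𝓕 := by
  by_cases hc : (𝓤 : Filter ℂ) ≤ Bornology.cobounded ℂ
  · right
    have h1 : (𝓤 : Filter ℂ) ≤ D.E₁ ⊔ D.E₂ := (le_inf hc (le_principal_iff.2 h)).trans S.cobounded_le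
    rcases Ultrafilter.le_sup_iff.1 h1 with h2 | h2
    exacts [⟨_, Or.inl rfl, h2⟩, ⟨_, Or.inr (Or.inl rfl), h2⟩]
  · rw [Filter.le_def] at hc
    push Not at hc
    obtain ⟨s, hs, hs'⟩ := hc
    have h1 : sᶜ ∈ 𝓤 := Ultrafilter.compl_mem_iff_notMem.2 hs'
    have h2 : Bornology.IsBounded sᶜ := Bornology.isBounded_def.2 (by simpa using hs)
    obtain ⟨z, -, hz⟩ := isCompact_iff_ultrafilter_le_nhds.1 h2.isCompact_closure 𝓤
      (le_principal_iff.2 (mem_of_superset h1 subset_closure))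
    have hzc : z ∈ closure D.dom := mem_closure_iff_ultrafilter.2 ⟨𝓤, h, hz⟩
    by_cases hzd : z ∈ D.dom
    · exact Or.inl ⟨z, hzd, hz⟩
    · exact Or.inr ⟨_, Or.inr (Or.inr ⟨z, ⟨hzc, hzd⟩, rfl⟩), le_inf hz (le_principal_iff.2 h)⟩

theorem IsSymmetricDomain.tendsto_diagRefl (S : IsSymmetricDomain g D) (p : ℂ) :
    Tendsto diagRefl (𝓝[D.dom] p) (𝓝[D.dom] (diagRefl p)) :=
  continuous_diagRefl.continuousWithinAt.tendsto_nhdsWithin S.refl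

theorem IsSymmetricDomain.exists_disc_map (S : IsSymmetricDomain g D) :
    ∃ φ h, IsConformalEquiv φ h D.dom (ball 0 1) ∧ Tendsto φ (𝓝[D.dom] D.V) (𝓝 1) ∧
      ∀ z ∈ D.dom, φ (diagRefl z) = (starRingEnd ℂ) (φ z) := by
  obtain ⟨p, ε, hε, hp⟩ := S.far
  obtain ⟨z₀, hz₀, hz₀'⟩ := S.center
  obtain ⟨φ, h, h1, h2, h3, h4, h5, h6⟩ :=
    exists_conformal_equiv_ball S.isOpen S.simplyConnected hε hp hz₀
  have H : IsConformalEquiv φ h D.dom (ball 0 1) := ⟨h1, h2, h3, h4, h5.1, h5.2⟩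
  have hconj : ∀ w ∈ ball (0 : ℂ) 1, (starRingEnd ℂ) w ∈ ball (0 : ℂ) 1 := fun w hw => by
    simpa using hw
  have hinv : ∀ z ∈ D.dom, h (φ z) = z := fun z hz => H.left_inv z hz
  have hinv' : ∀ z ∈ ball (0 : ℂ) 1, φ (h z) = z := fun z hz => H.right_inv z hz
  have hd1 : DifferentiableOn ℂ (fun w => (starRingEnd ℂ) (φ (diagRefl (h w)))) (ball 0 1) :=
    (differentiableOn_conj_comp_diagRefl S.isOpen h1).comp h2 fun w hw => S.refl (h4 hw)
  have R : IsConformalEquiv (fun w => (starRingEnd ℂ) (φ (diagRefl (h w))))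
      (fun w => φ (diagRefl (h ((starRingEnd ℂ) w)))) (ball 0 1) (ball 0 1) := by
    refine ⟨hd1, ?_, fun w hw => hconj _ (h3 (S.refl (h4 hw))),
      fun w hw => h3 (S.refl (h4 (hconj _ hw))), fun w hw => ?_, fun w hw => ?_⟩
    · intro w hw
      have := (hd1.differentiableAt (isOpen_ball.mem_nhds (hconj w hw))).conj_conj
      simp only [Function.comp_def, Complex.conj_conj] at this
      exact this.differentiableWithinAt
    · have := h4 hw
      simp only [Complex.conj_conj]
      rw [hinv _ (S.refl this), diagRefl_diagRefl, hinv' _ hw]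
    · have := h4 (hconj _ hw)
      rw [hinv _ (S.refl this), diagRefl_diagRefl, hinv' _ (hconj _ hw), Complex.conj_conj]
  obtain ⟨c, hc, hrot⟩ := exists_rotation R (by
    have : h 0 = z₀ := by rw [← h6, hinv _ hz₀]
    simp only [this, hz₀', h6, map_zero])
  have hsym : ∀ z ∈ D.dom, φ (diagRefl z) = (starRingEnd ℂ) (c * φ z) := fun z hz => by
    rw [← hrot _ (h3 hz), hinv _ hz, Complex.conj_conj]
  obtain ⟨χ, θ, C⟩ := S.chart _ S.outer_mem
  obtain ⟨ξ, hξ, hφξ⟩ := exists_tendsto_of_chart S.isOpen H C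
  have := C.neBot
  have hξ' : ξ = (starRingEnd ℂ) (c * ξ) := by
    have hσ := S.tendsto_diagRefl D.V
    rw [S.refl_outer] at hσ
    refine tendsto_nhds_unique_of_eventuallyEq (hφξ.comp hσ)
      (((Complex.continuous_conj.comp (continuous_const_mul c)).tendsto ξ).comp hφξ) ?_
    filter_upwards [self_mem_nhdsWithin] with z hz using hsym z hz
  have hξξ : (starRingEnd ℂ) ξ * ξ = 1 := by
    rw [mul_comm, Complex.mul_conj, Complex.normSq_eq_norm_sq, hξ]; norm_num
  have hcc : (starRingEnd ℂ) c * c = 1 := by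
    rw [mul_comm, Complex.mul_conj, Complex.normSq_eq_norm_sq, hc]; norm_num
  have hcξ : (starRingEnd ℂ) ξ * (starRingEnd ℂ) c = ξ := by
    rw [mul_comm, ← map_mul]; exact hξ'.symm
  refine ⟨fun z => (starRingEnd ℂ) ξ * φ z, fun w => h (ξ * w), ⟨h1.const_mul _, ?_, ?_, ?_, ?_, ?_⟩,
    ?_, ?_⟩
  · refine h2.comp (differentiableOn_id.const_mul ξ) fun w hw => ?_
    simpa [hξ] using hw
  · intro z hz
    simpa [hξ] using h3 hz
  · intro w hw
    exact h4 (by simpa [hξ] using hw)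
  · intro z hz
    rw [← mul_assoc, mul_comm ξ, hξξ, one_mul, hinv _ hz]
  · intro w hw
    rw [hinv' _ (by simpa [hξ] using hw), ← mul_assoc, hξξ, one_mul]
  · have := hφξ.const_mul ((starRingEnd ℂ) ξ)
    rwa [hξξ] at this
  · intro z hz
    simp only
    rw [hsym z hz, map_mul, map_mul, Complex.conj_conj, ← mul_assoc, hcξ]

theorem cayleyInv_I_conj (w : ℂ) :
    cayleyInv Complex.I ((starRingEnd ℂ) w) = reflect (cayleyInv Complex.I w) := by
  simp only [cayleyInv, reflect, map_div₀, map_sub, map_mul, Complex.conj_I, map_neg, map_one]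
  rw [← neg_div]; congr 1; ring

theorem tendsto_cayleyInv_I {ξ : ℂ} (hξ : ‖ξ‖ = 1) (hne : ξ ≠ 1) :
    ∃ t : ℝ, cayley Complex.I t = ξ ∧
      Tendsto (cayleyInv Complex.I) (𝓝[ball 0 1] ξ) (𝓝[upperHalf] (t : ℂ)) := by
  have hI : Complex.I ∈ upperHalf := by simp [upperHalf]
  have h1 : 1 - ξ ≠ 0 := sub_ne_zero.2 hne.symm
  have hξξ : (starRingEnd ℂ) ξ * ξ = 1 := by
    rw [mul_comm, Complex.mul_conj, Complex.normSq_eq_norm_sq, hξ]; norm_num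
  have h1' : 1 - (starRingEnd ℂ) ξ ≠ 0 := by
    intro h; apply h1
    have := congrArg (starRingEnd ℂ) h
    simpa using this
  have hreal : (starRingEnd ℂ) (cayleyInv Complex.I ξ) = cayleyInv Complex.I ξ := by
    simp only [cayleyInv, map_div₀, map_sub, map_mul, Complex.conj_I, map_neg, map_one]
    rw [div_eq_div_iff h1' h1]
    linear_combination (2 * Complex.I) * hξξ
  obtain ⟨t, ht⟩ := Complex.conj_eq_iff_real.1 hreal
  refine ⟨t, ?_, ?_⟩
  · rw [← ht]
    have h2 : (cayleyInv Complex.I ξ - (starRingEnd ℂ) Complex.I) ≠ 0 := by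
      rw [ht]; exact sub_conj_ne_zero hI (by simp)
    rw [cayley, div_eq_iff h2, cayleyInv]
    simp only [Complex.conj_I]
    field_simp
    ring
  · rw [← ht]
    refine tendsto_nhdsWithin_iff.2 ⟨?_, ?_⟩
    · refine Tendsto.mono_left ?_ nhdsWithin_le_nhds
      have : ContinuousAt (cayleyInv Complex.I) ξ := by
        unfold cayleyInv
        fun_prop (disch := exact h1)
      exact this
    · filter_upwards [self_mem_nhdsWithin] with w hw using (isConformalEquiv_cayley hI).mapsTo_inv hw

theorem tendsto_cayley_I (t : ℝ) :
    Tendsto (cayley Complex.I) (𝓝[upperHalf] (t : ℂ)) (𝓝[ball 0 1] (cayley Complex.I t)) := by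
  have hI : Complex.I ∈ upperHalf := by simp [upperHalf]
  refine tendsto_nhdsWithin_iff.2 ⟨?_, ?_⟩
  · refine Tendsto.mono_left ?_ nhdsWithin_le_nhds
    have h1 := sub_conj_ne_zero hI (z := t) (by simp)
    have : ContinuousAt (cayley Complex.I) t := by
      unfold cayley
      fun_prop (disch := exact h1)
    exact this
  · filter_upwards [self_mem_nhdsWithin] with w hw using (isConformalEquiv_cayley hI).mapsTo hw

theorem tendsto_cayleyInv_I_infty :
    Tendsto (cayleyInv Complex.I) (𝓝[ball 0 1] 1) upperInfty := by
  have hI : Complex.I ∈ upperHalf := by simp [upperHalf]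
  refine tendsto_inf.2 ⟨?_, tendsto_principal.2 ?_⟩
  · rw [← tendsto_norm_atTop_iff_cobounded]
    have h1 : Tendsto (fun w : ℂ => ‖Complex.I - (starRingEnd ℂ) Complex.I * w‖) (𝓝[ball 0 1] 1)
        (𝓝 2) := by
      have : Continuous fun w : ℂ => ‖Complex.I - (starRingEnd ℂ) Complex.I * w‖ := by fun_prop
      have h2 := this.tendsto 1
      have h3 : ‖Complex.I - (starRingEnd ℂ) Complex.I * 1‖ = 2 := by
        simp only [Complex.conj_I, mul_one, sub_neg_eq_add, ← two_mul]
        simp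
      rw [h3] at h2
      exact h2.mono_left nhdsWithin_le_nhds
    have h2 : Tendsto (fun w : ℂ => ‖1 - w‖⁻¹) (𝓝[ball 0 1] 1) atTop := by
      refine tendsto_inv_nhdsGT_zero.comp (tendsto_nhdsWithin_iff.2 ⟨?_, ?_⟩)
      · have : Continuous fun w : ℂ => ‖1 - w‖ := by fun_prop
        have h2 := this.tendsto 1
        simp only [sub_self, norm_zero] at h2
        exact h2.mono_left nhdsWithin_le_nhds
      · filter_upwards [self_mem_nhdsWithin] with w hw
        exact norm_pos_iff.2 (one_sub_ne_zero_of_mem_ball hw)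
    refine (h1.pos_mul_atTop two_pos h2).congr fun w => ?_
    rw [cayleyInv, norm_div, div_eq_mul_inv]
  · filter_upwards [self_mem_nhdsWithin] with w hw using (isConformalEquiv_cayley hI).mapsTo_inv hw

theorem tendsto_cayley_I_infty :
    Tendsto (cayley Complex.I) upperInfty (𝓝[ball 0 1] 1) := by
  have hI : Complex.I ∈ upperHalf := by simp [upperHalf]
  refine tendsto_nhdsWithin_iff.2 ⟨?_, ?_⟩
  · have h1 : Tendsto (fun z : ℂ => z - (starRingEnd ℂ) Complex.I) upperInfty (Bornology.cobounded ℂ) := by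
      refine Tendsto.mono_left ?_ inf_le_left
      simp [sub_eq_add_neg]
    have h2 : Tendsto (fun z : ℂ => 1 - (2 * Complex.I) * (z - (starRingEnd ℂ) Complex.I)⁻¹)
        upperInfty (𝓝 1) := by
      have := ((tendsto_inv₀_cobounded.comp h1).const_mul (2 * Complex.I)).const_sub 1
      simpa using this
    refine h2.congr' ?_
    filter_upwards [mem_inf_of_right (mem_principal_self upperHalf)] with z hz
    have := sub_conj_ne_zero hI hz.le
    rw [cayley]
    field_simp
    simp only [Complex.conj_I]
    ring
  · filter_upwards [mem_inf_of_right (mem_principal_self upperHalf)] with w hw using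
      (isConformalEquiv_cayley hI).mapsTo hw

theorem IsSymmetricDomain.exists_boundary_value (S : IsSymmetricDomain g D) :
    ∃ (φ h : ℂ → ℂ) (Φ : Filter ℂ → ℝ), IsConformalEquiv φ h D.dom upperHalf ∧
      (∀ 𝓕, IsBoundaryFilter D 𝓕 → 𝓕 ≠ 𝓝[D.dom] D.V →
        Tendsto φ 𝓕 (𝓝[upperHalf] (Φ 𝓕 : ℂ)) ∧ Tendsto h (𝓝[upperHalf] (Φ 𝓕 : ℂ)) 𝓕) ∧
      Tendsto φ (𝓝[D.dom] D.V) upperInfty ∧ Tendsto h upperInfty (𝓝[D.dom] D.V) ∧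
      ∀ z ∈ D.dom, φ (diagRefl z) = reflect (φ z) := by
  have hI : Complex.I ∈ upperHalf := by simp [upperHalf]
  obtain ⟨f, k, H, hV, hsym⟩ := S.exists_disc_map
  choose χ θ C using fun i : {𝓕 // IsBoundaryFilter D 𝓕} => S.exists_chart i.2
  have hball : ∀ i : {𝓕 // IsBoundaryFilter D 𝓕}, ∀ ξ, Tendsto f i (𝓝 ξ) →
      Tendsto f i (𝓝[ball 0 1] ξ) := fun i ξ hξ => by
    refine tendsto_nhdsWithin_iff.2 ⟨hξ, ?_⟩
    filter_upwards [(C i).hasBasis.mem_of_mem one_pos] with z hz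
    obtain ⟨ζ, hζ, rfl⟩ := hz
    exact H.mapsTo ((C i).mapsTo ⟨one_pos.trans (show (1 : ℝ) < ζ.re from hζ.1), hζ.2⟩)
  have hback : ∀ i : {𝓕 // IsBoundaryFilter D 𝓕}, ∀ ξ : ℂ, ‖ξ‖ = 1 → Tendsto f i (𝓝 ξ) →
      Tendsto k (𝓝[ball 0 1] ξ) i := fun i ξ hξ h => by
    refine tendsto_inverse_of_charts S.isOpen H C (fun i j hij => S.disjoint_of_ne i.2 j.2
      fun h => hij (Subtype.ext h)) (fun 𝓤 h𝓤 => ?_) hξ h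
    rcases S.ultrafilter 𝓤 h𝓤 with h | ⟨𝓕, h𝓕, h⟩
    exacts [Or.inl h, Or.inr ⟨⟨𝓕, h𝓕⟩, h⟩]
  have hVb : IsBoundaryFilter D (𝓝[D.dom] D.V) := Or.inr (Or.inr ⟨_, S.outer_mem, rfl⟩)
  have key : ∀ 𝓕, ∃ t : ℝ, IsBoundaryFilter D 𝓕 → 𝓕 ≠ 𝓝[D.dom] D.V →
      Tendsto (fun z => cayleyInv Complex.I (f z)) 𝓕 (𝓝[upperHalf] (t : ℂ)) ∧
      Tendsto (fun z => k (cayley Complex.I z)) (𝓝[upperHalf] (t : ℂ)) 𝓕 := by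
    intro 𝓕
    by_cases h𝓕 : IsBoundaryFilter D 𝓕 ∧ 𝓕 ≠ 𝓝[D.dom] D.V
    · obtain ⟨ξ, hξ, hξ'⟩ := exists_tendsto_of_chart S.isOpen H (C ⟨𝓕, h𝓕.1⟩)
      have hne : ξ ≠ 1 := ne_of_disjoint_charts H (C ⟨𝓕, h𝓕.1⟩) (C ⟨_, hVb⟩)
        (S.disjoint_of_ne h𝓕.1 hVb h𝓕.2) hξ hξ' hV
      obtain ⟨t, ht, ht'⟩ := tendsto_cayleyInv_I hξ hne
      refine ⟨t, fun _ _ => ⟨ht'.comp (hball ⟨𝓕, h𝓕.1⟩ ξ hξ'), ?_⟩⟩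
      have := tendsto_cayley_I t
      rw [ht] at this
      exact (hback ⟨𝓕, h𝓕.1⟩ ξ hξ hξ').comp this
    · exact ⟨0, fun h1 h2 => absurd ⟨h1, h2⟩ h𝓕⟩
  choose Φ hΦ using key
  refine ⟨fun z => cayleyInv Complex.I (f z), fun z => k (cayley Complex.I z), Φ,
    H.trans (isConformalEquiv_cayley hI).symm, hΦ,
    tendsto_cayleyInv_I_infty.comp (hball ⟨_, hVb⟩ 1 hV),
    (hback ⟨_, hVb⟩ 1 (by simp) hV).comp tendsto_cayley_I_infty, fun z hz => ?_⟩
  simp only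
  rw [hsym z hz, cayleyInv_I_conj]

/-! ### The boundary correspondence preserves orientation -/

/-- `A` is a straight boundary edge in direction `κ`, parametrised by an interval `J`, with
the domain on its left. -/
structure IsOrientedEdge (D : Labelled) (A : Set ℂ) (q κ : ℂ) (J : Set ℝ) : Prop where
  eq_image : A = (fun t : ℝ => q + κ * t) '' J
  ordConnected : J.OrdConnected
  nonempty : J.Nonempty
  ne_zero : κ ≠ 0
  strip : ∃ η > 0, ∀ t ∈ J, ∀ y ∈ Ioo (0 : ℝ) η, q + κ * (t + y * Complex.I) ∈ D.dom
  notMem : ∀ p ∈ A, p ∉ D.dom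
  ne_outer : ∀ p ∈ A, p ≠ D.V

/-- The boundary filter `𝓕` is the initial point of the edge. -/
def StartsAt (D : Labelled) (q κ : ℂ) (J : Set ℝ) (𝓕 : Filter ℂ) : Prop :=
  ∀ t ∈ J, ∀ S ∈ 𝓕, ∃ s ∈ J, s < t ∧ S ∈ 𝓝[D.dom] (q + κ * s)

/-- The boundary filter `𝓕` is the final point of the edge. -/
def EndsAt (D : Labelled) (q κ : ℂ) (J : Set ℝ) (𝓕 : Filter ℂ) : Prop :=
  ∀ t ∈ J, ∀ S ∈ 𝓕, ∃ s ∈ J, t < s ∧ S ∈ 𝓝[D.dom] (q + κ * s)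

variable {g : ℕ} {D : Labelled} {A : Set ℂ} {q κ : ℂ} {J : Set ℝ}

theorem IsOrientedEdge.mem (E : IsOrientedEdge D A q κ J) {t : ℝ} (ht : t ∈ J) :
    q + κ * t ∈ A := by
  rw [E.eq_image]; exact ⟨t, ht, rfl⟩

theorem IsOrientedEdge.mem_closure (E : IsOrientedEdge D A q κ J) {t : ℝ} (ht : t ∈ J) :
    q + κ * t ∈ closure D.dom := by
  obtain ⟨η, hη, h⟩ := E.strip
  have h1 : Tendsto (fun y : ℝ => q + κ * (t + y * Complex.I)) (𝓝[>] 0) (𝓝 (q + κ * t)) := by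
    have : Continuous fun y : ℝ => q + κ * (t + y * Complex.I) := by fun_prop
    have h2 := this.tendsto 0
    simp only [Complex.ofReal_zero, zero_mul, add_zero] at h2
    exact h2.mono_left nhdsWithin_le_nhds
  refine mem_closure_of_tendsto h1 ?_
  filter_upwards [Ioo_mem_nhdsGT hη] with y hy using h t ht y hy

theorem IsOrientedEdge.mem_boundary (E : IsOrientedEdge D A q κ J) {p : ℂ} (hp : p ∈ A) :
    p ∈ closure D.dom \ D.dom := by
  refine ⟨?_, E.notMem p hp⟩
  have := hp
  rw [E.eq_image] at this
  obtain ⟨t, ht, rfl⟩ := this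
  exact E.mem_closure ht

/-- A holomorphic map of a strip to the upper half-plane which has real limits on the lower side of
the strip is monotone there. -/
theorem le_of_tendsto_upperHalf {L : ℂ → ℂ} {a b η : ℝ} (hab : a ≤ b) (hη : 0 < η)
    (hL : DifferentiableOn ℂ L (Icc a b ×ℂ Ioo 0 η))
    (hpos : MapsTo L (Icc a b ×ℂ Ioo 0 η) upperHalf) {u : ℝ → ℝ}
    (hu : ∀ t ∈ Icc a b, Tendsto L (𝓝[Icc a b ×ℂ Ioo 0 η] (t : ℂ)) (𝓝 (u t : ℂ))) : u a ≤ u b := by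
  set R : Set ℂ := Icc a b ×ℂ Ioo 0 η with hR
  set M := extendFrom R L with hM
  have hcl : Icc a b ×ℂ Ico 0 η ⊆ closure R := by
    rw [hR, Complex.closure_reProdIm, closure_Ioo hη.ne, closure_Icc]
    exact fun z hz => ⟨hz.1, hz.2.1, hz.2.2.le⟩
  have hMR : ∀ z ∈ R, M z = L z := fun z hz =>
    extendFrom_eq (subset_closure hz) (hL.continuousOn z hz)
  have hMu : ∀ t ∈ Icc a b, M t = u t := fun t ht =>
    extendFrom_eq (hcl ⟨by simpa using ht, by simpa using hη⟩) (hu t ht)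
  have hMc : ContinuousOn M (Icc a b ×ℂ Ico 0 η) := by
    refine continuousOn_extendFrom hcl fun z hz => ?_
    rcases hz.2.1.eq_or_lt with h | h
    · have hz' : z = (z.re : ℂ) := Complex.ext rfl (by simpa using h.symm)
      exact ⟨u z.re, by rw [hz']; exact hu _ hz.1⟩
    · exact ⟨L z, hL.continuousOn z ⟨hz.1, h, hz.2.2⟩⟩
  by_contra! hlt
  have hline : ∀ t ∈ Icc a b, ContinuousOn (fun y : ℝ => M (t + y * Complex.I)) (Ico 0 η) :=
    fun t ht => hMc.comp (by fun_prop) fun y hy => ⟨by simpa using ht, by simpa using hy⟩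
  have ha : a ∈ Icc a b := left_mem_Icc.2 hab
  have hb : b ∈ Icc a b := right_mem_Icc.2 hab
  have hc : ContinuousOn (fun y : ℝ => (M (b + y * Complex.I)).re - (M (a + y * Complex.I)).re)
      (Ico 0 η) :=
    (Complex.continuous_re.comp_continuousOn (hline b hb)).sub
      (Complex.continuous_re.comp_continuousOn (hline a ha))
  have hev : ∀ᶠ y : ℝ in 𝓝[Ico 0 η] (0 : ℝ),
      (M (b + y * Complex.I)).re - (M (a + y * Complex.I)).re < 0 := by
    refine Tendsto.eventually_lt_const ?_ (hc 0 ⟨le_rfl, hη⟩)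
    simp [hMu a ha, hMu b hb, hlt]
  rw [nhdsWithin_Ico_eq_nhdsGE hη] at hev
  obtain ⟨r, hr, hev⟩ := (mem_nhdsGE_iff_exists_Ico_subset).1 hev
  obtain ⟨y, hy0, hyr⟩ := exists_between (lt_min hr hη)
  have hyr' : y < r := hyr.trans_le (min_le_left _ _)
  have hyη : y < η := hyr.trans_le (min_le_right _ _)
  have hint := Complex.integral_boundary_rect_eq_zero_of_continuousOn_of_differentiableOn M
    (a : ℂ) (b + y * Complex.I) (by
      refine hMc.mono ?_
      simp only [Complex.ofReal_re, Complex.ofReal_im, Complex.add_re, Complex.mul_re,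
        Complex.I_re, Complex.I_im, Complex.add_im, Complex.mul_im]
      simp only [mul_zero, mul_one, sub_zero, add_zero, zero_add]
      rw [uIcc_of_le hab, uIcc_of_le hy0.le]
      exact fun z hz => ⟨hz.1, hz.2.1, hz.2.2.trans_lt hyη⟩) (by
      simp only [Complex.ofReal_re, Complex.ofReal_im, Complex.add_re, Complex.mul_re,
        Complex.I_re, Complex.I_im, Complex.add_im, Complex.mul_im]
      simp only [mul_zero, mul_one, sub_zero, add_zero, zero_add]
      rw [min_eq_left hab, max_eq_right hab, min_eq_left hy0.le, max_eq_right hy0.le]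
      have hsub : Ioo a b ×ℂ Ioo 0 y ⊆ R := fun z hz =>
        ⟨⟨hz.1.1.le, hz.1.2.le⟩, hz.2.1, hz.2.2.trans hyη⟩
      exact (hL.mono hsub).congr fun z hz => hMR z (hsub hz))
  simp only [Complex.ofReal_re, Complex.ofReal_im, Complex.add_re, Complex.mul_re,
    Complex.I_re, Complex.I_im, Complex.add_im, Complex.mul_im] at hint
  simp only [mul_zero, zero_mul, mul_one, sub_zero, add_zero, zero_add, smul_eq_mul,
    Complex.ofReal_zero] at hint
  have hIcc : Icc 0 y ⊆ Ico 0 η := fun s hs => ⟨hs.1, hs.2.trans_lt hyη⟩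
  have hi : ∀ t ∈ Icc a b, IntervalIntegrable (fun s : ℝ => M (t + s * Complex.I)) volume 0 y :=
    fun t ht => ((hline t ht).mono (by rw [uIcc_of_le hy0.le]; exact hIcc)).intervalIntegrable
  have hh : ∀ s ∈ Ico 0 η, ContinuousOn (fun x : ℝ => M (x + s * Complex.I)) (uIcc a b) :=
    fun s hs => hMc.comp (by fun_prop) fun x hx => by
      rw [uIcc_of_le hab] at hx
      exact ⟨by simpa using hx, by simpa using hs⟩
  have him := congrArg Complex.im hint
  have e0 : (∫ x in a..b, M x).im = 0 := by
    have := Complex.imCLM.intervalIntegral_comp_comm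
      (by simpa using (hh 0 ⟨le_rfl, hη⟩).intervalIntegrable (μ := volume))
    simp only [Complex.imCLM_apply] at this
    rw [← this]
    refine intervalIntegral.integral_zero_ae (Eventually.of_forall fun x hx => ?_)
    rw [uIoc_of_le hab] at hx
    simp [hMu x ⟨hx.1.le, hx.2⟩]
  have e1 : 0 ≤ (∫ x in a..b, M (x + y * Complex.I)).im := by
    have := Complex.imCLM.intervalIntegral_comp_comm
      ((hh y ⟨hy0.le, hyη⟩).intervalIntegrable (μ := volume))
    simp only [Complex.imCLM_apply] at this
    rw [← this]
    refine intervalIntegral.integral_nonneg hab fun x hx => ?_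
    have hx' : (x + y * Complex.I : ℂ) ∈ R := ⟨by simpa using hx, by simpa using ⟨hy0, hyη⟩⟩
    rw [hMR _ hx']
    exact (hpos hx').le
  have e2 : ∀ t ∈ Icc a b, (∫ s in (0 : ℝ)..y, M (t + s * Complex.I)).re =
      ∫ s in (0 : ℝ)..y, (M (t + s * Complex.I)).re := fun t ht => by
    have := Complex.reCLM.intervalIntegral_comp_comm (hi t ht)
    simp only [Complex.reCLM_apply] at this
    exact this.symm
  have e3 : 0 < ∫ s in (0 : ℝ)..y, ((M (a + s * Complex.I)).re - (M (b + s * Complex.I)).re) := by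
    refine intervalIntegral.intervalIntegral_pos_of_pos_on ?_ (fun s hs => ?_) hy0
    · exact ContinuousOn.intervalIntegrable (by
        rw [uIcc_of_le hy0.le]
        exact (hc.neg.mono hIcc).congr fun s _ => by simp)
    · have := hev ⟨hs.1.le, hs.2.trans hyr'⟩
      simp only [mem_ofPred_eq] at this
      linarith
  have hre : ∀ t ∈ Icc a b, IntervalIntegrable (fun s : ℝ => (M (t + s * Complex.I)).re) volume 0 y :=
    fun t ht => (Complex.continuous_re.comp_continuousOn
      ((hline t ht).mono (by rw [uIcc_of_le hy0.le]; exact hIcc))).intervalIntegrable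
  rw [intervalIntegral.integral_sub (hre a ha) (hre b hb), ← e2 a ha, ← e2 b hb] at e3
  simp only [Complex.add_im, Complex.sub_im, Complex.mul_im, Complex.I_re, Complex.I_im,
    Complex.zero_im, e0, zero_mul, one_mul] at him
  linarith

/-- A symmetric conformal map of the domain to the upper half-plane with `V` at infinity, together
with its boundary values. -/
structure IsBoundaryValue (D : Labelled) (φ h : ℂ → ℂ) (Φ : Filter ℂ → ℝ) : Prop where
  conf : IsConformalEquiv φ h D.dom upperHalf
  lim : ∀ 𝓕, IsBoundaryFilter D 𝓕 → 𝓕 ≠ 𝓝[D.dom] D.V →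
    Tendsto φ 𝓕 (𝓝[upperHalf] (Φ 𝓕 : ℂ)) ∧ Tendsto h (𝓝[upperHalf] (Φ 𝓕 : ℂ)) 𝓕
  outer : Tendsto φ (𝓝[D.dom] D.V) upperInfty ∧ Tendsto h upperInfty (𝓝[D.dom] D.V)
  symm : ∀ z ∈ D.dom, φ (diagRefl z) = reflect (φ z)

variable {φ h : ℂ → ℂ} {Φ : Filter ℂ → ℝ}

theorem nhdsWithin_ne_of_ne {Ω : Set ℂ} {p p' : ℂ} (hp : p ∈ closure Ω) (hne : p ≠ p') :
    𝓝[Ω] p ≠ 𝓝[Ω] p' := by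
  intro h
  have := mem_closure_iff_nhdsWithin_neBot.1 hp
  have h1 : 𝓝[Ω] p ≤ 𝓝 p' := h.le.trans nhdsWithin_le_nhds
  exact hne (tendsto_nhds_unique (f := id) (l := 𝓝[Ω] p) nhdsWithin_le_nhds h1)

theorem IsBoundaryValue.lim_point (B : IsBoundaryValue D φ h Φ) {p : ℂ}
    (hp : p ∈ closure D.dom \ D.dom) (hne : p ≠ D.V) :
    Tendsto φ (𝓝[D.dom] p) (𝓝[upperHalf] (Φ (𝓝[D.dom] p) : ℂ)) ∧
      Tendsto h (𝓝[upperHalf] (Φ (𝓝[D.dom] p) : ℂ)) (𝓝[D.dom] p) :=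
  B.lim _ (Or.inr (Or.inr ⟨p, hp, rfl⟩)) (nhdsWithin_ne_of_ne hp.1 hne)

theorem IsOrientedEdge.lim (E : IsOrientedEdge D A q κ J) (B : IsBoundaryValue D φ h Φ) {t : ℝ}
    (ht : t ∈ J) :
    Tendsto φ (𝓝[D.dom] (q + κ * t)) (𝓝[upperHalf] (Φ (𝓝[D.dom] (q + κ * t)) : ℂ)) ∧
      Tendsto h (𝓝[upperHalf] (Φ (𝓝[D.dom] (q + κ * t)) : ℂ)) (𝓝[D.dom] (q + κ * t)) :=
  B.lim_point (E.mem_boundary (E.mem ht)) (E.ne_outer _ (E.mem ht))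

theorem IsOrientedEdge.strictMonoOn (E : IsOrientedEdge D A q κ J)
    (B : IsBoundaryValue D φ h Φ) :
    StrictMonoOn (fun t : ℝ => Φ (𝓝[D.dom] (q + κ * t))) J := by
  intro a ha b hb hab
  have hinj : Φ (𝓝[D.dom] (q + κ * a)) ≠ Φ (𝓝[D.dom] (q + κ * b)) := by
    intro heq
    have h1 := (E.lim B ha).2
    rw [heq] at h1
    have h2 := tendsto_nhds_unique (h1.mono_right nhdsWithin_le_nhds)
      ((E.lim B hb).2.mono_right nhdsWithin_le_nhds)
    have h3 := mul_left_cancel₀ E.ne_zero (add_left_cancel h2)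
    exact hab.ne (Complex.ofReal_injective h3)
  refine lt_of_le_of_ne ?_ hinj
  obtain ⟨η, hη, hs⟩ := E.strip
  have hsub : MapsTo (fun z : ℂ => q + κ * z) (Icc a b ×ℂ Ioo 0 η) D.dom := fun z hz => by
    have := hs z.re (E.ordConnected.out ha hb hz.1) z.im hz.2
    rwa [Complex.re_add_im] at this
  refine le_of_tendsto_upperHalf (L := fun z => φ (q + κ * z))
    (u := fun t => Φ (𝓝[D.dom] (q + κ * t))) hab.le hη ?_ (fun z hz => B.conf.mapsTo (hsub hz))
    fun t ht => ?_
  · exact B.conf.diff.comp (by fun_prop) hsub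
  · refine ((E.lim B (E.ordConnected.out ha hb ht)).1.mono_right nhdsWithin_le_nhds).comp ?_
    have hc : Continuous fun z : ℂ => q + κ * z := by fun_prop
    exact hc.continuousWithinAt.tendsto_nhdsWithin hsub

theorem IsOrientedEdge.lt_of_startsAt (E : IsOrientedEdge D A q κ J)
    (B : IsBoundaryValue D φ h Φ) {𝓕 : Filter ℂ} {x : ℝ}
    (h𝓕 : Tendsto φ 𝓕 (𝓝 (x : ℂ))) (hs : StartsAt D q κ J 𝓕) {p : ℂ} (hp : p ∈ A) :
    x < Φ (𝓝[D.dom] p) := by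
  rw [E.eq_image] at hp
  obtain ⟨t, ht, rfl⟩ := hp
  have hle : ∀ t ∈ J, x ≤ Φ (𝓝[D.dom] (q + κ * t)) := fun t ht => by
    by_contra! hlt
    obtain ⟨m, hm, hm'⟩ := exists_between hlt
    obtain ⟨t', ht', htt, hS⟩ := hs t ht _
      (((Complex.continuous_re.tendsto (x : ℂ)).comp h𝓕).eventually_const_lt
        (by simpa using hm'))
    have := mem_closure_iff_nhdsWithin_neBot.1 (E.mem_closure ht')
    have h1 := ge_of_tendsto ((Complex.continuous_re.tendsto _).comp
      ((E.lim B ht').1.mono_right nhdsWithin_le_nhds)) (Filter.Eventually.mono hS fun z hz => le_of_lt hz)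
    have h2 := E.strictMonoOn B ht' ht htt
    simp only [Complex.ofReal_re] at h1 h2
    linarith
  obtain ⟨t', ht', htt, -⟩ := hs t ht univ univ_mem
  exact (hle t' ht').trans_lt (E.strictMonoOn B ht' ht htt)

theorem IsOrientedEdge.lt_of_endsAt (E : IsOrientedEdge D A q κ J)
    (B : IsBoundaryValue D φ h Φ) {𝓕 : Filter ℂ} {x : ℝ}
    (h𝓕 : Tendsto φ 𝓕 (𝓝 (x : ℂ))) (hs : EndsAt D q κ J 𝓕) {p : ℂ} (hp : p ∈ A) :
    Φ (𝓝[D.dom] p) < x := by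
  rw [E.eq_image] at hp
  obtain ⟨t, ht, rfl⟩ := hp
  have hle : ∀ t ∈ J, Φ (𝓝[D.dom] (q + κ * t)) ≤ x := fun t ht => by
    by_contra! hlt
    obtain ⟨m, hm, hm'⟩ := exists_between hlt
    obtain ⟨t', ht', htt, hS⟩ := hs t ht _
      (((Complex.continuous_re.tendsto (x : ℂ)).comp h𝓕).eventually_lt_const
        (by simpa using hm))
    have := mem_closure_iff_nhdsWithin_neBot.1 (E.mem_closure ht')
    have h1 := le_of_tendsto ((Complex.continuous_re.tendsto _).comp
      ((E.lim B ht').1.mono_right nhdsWithin_le_nhds)) (Filter.Eventually.mono hS fun z hz => le_of_lt hz)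
    have h2 := E.strictMonoOn B ht ht' htt
    simp only [Complex.ofReal_re] at h1 h2
    linarith
  obtain ⟨t', ht', htt, -⟩ := hs t ht univ univ_mem
  exact lt_of_lt_of_le (E.strictMonoOn B ht ht' htt) (hle _ ‹_›)

/-- Every real number is a boundary value. -/
theorem IsBoundaryValue.surjective (B : IsBoundaryValue D φ h Φ) (S : IsSymmetricDomain g D)
    (t : ℝ) : ∃ 𝓕, IsBoundaryFilter D 𝓕 ∧ 𝓕 ≠ 𝓝[D.dom] D.V ∧ Φ 𝓕 = t := by
  obtain ⟨𝓥, h𝓥⟩ := Ultrafilter.exists_le (𝓝[upperHalf] (t : ℂ))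
  have hH : upperHalf ∈ 𝓥 := h𝓥 self_mem_nhdsWithin
  have hU : D.dom ∈ 𝓥.map h := by
    rw [Ultrafilter.mem_map]
    exact mem_of_superset hH B.conf.mapsTo_inv
  have hlim : Tendsto φ (𝓥.map h : Ultrafilter ℂ) (𝓝 (t : ℂ)) := by
    rw [Ultrafilter.coe_map, tendsto_map'_iff]
    refine Tendsto.congr' ?_ (tendsto_id.mono_left (h𝓥.trans nhdsWithin_le_nhds))
    filter_upwards [hH] with w hw using (B.conf.right_inv w hw).symm
  rcases S.ultrafilter _ hU with ⟨z, hz, hz'⟩ | ⟨𝓕, h𝓕, hle⟩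
  · have h1 : Tendsto φ (𝓥.map h : Ultrafilter ℂ) (𝓝 (φ z)) :=
      ((B.conf.diff.continuousOn.continuousAt (S.isOpen.mem_nhds hz)).tendsto).mono_left hz'
    have h2 := tendsto_nhds_unique h1 hlim
    have h3 : 0 < (φ z).im := B.conf.mapsTo hz
    simp [h2] at h3
  · by_cases hV : 𝓕 = 𝓝[D.dom] D.V
    · subst hV
      have h1 : Tendsto φ (𝓥.map h : Ultrafilter ℂ) (Bornology.cobounded ℂ) :=
        (B.outer.1.mono_left hle).mono_right inf_le_left
      exact absurd hlim (h1.not_tendsto (Metric.disjoint_cobounded_nhds _))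
    · refine ⟨𝓕, h𝓕, hV, ?_⟩
      have h1 := ((B.lim 𝓕 h𝓕 hV).1.mono_left hle).mono_right nhdsWithin_le_nhds
      exact Complex.ofReal_injective (tendsto_nhds_unique h1 hlim)

/-- The filters of the vertices `E₂, P₀, …, P_{2g}, E₁` in their order along the zigzag. -/
def vertexFilter (g : ℕ) (D : Labelled) (k : ℕ) : Filter ℂ :=
  if k = 0 then D.E₂ else if k = 2 * g + 2 then D.E₁ else 𝓝[D.dom] D.P (k - 1)

/-- A symmetric domain whose boundary consists of oriented straight edges, the last two of which are
`A₁` from `E₁` to `V` and `A₂` from `V` to `E₂`. -/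
structure IsOrthodisk (g : ℕ) (D : Labelled) (A₁ A₂ : Set ℂ) : Prop extends
    IsSymmetricDomain g D where
  edge : ∀ k ≤ 2 * g + 1, ∃ q κ J, IsOrientedEdge D (D.edge k) q κ J ∧
    StartsAt D q κ J (vertexFilter g D k) ∧ EndsAt D q κ J (vertexFilter g D (k + 1))
  outerEdge₁ : ∃ q κ J, IsOrientedEdge D A₁ q κ J ∧ StartsAt D q κ J D.E₁
  outerEdge₂ : ∃ q κ J, IsOrientedEdge D A₂ q κ J ∧ EndsAt D q κ J D.E₂
  cases : ∀ p ∈ closure D.dom \ D.dom, p = D.V ∨ (∃ j ≤ 2 * g, p = D.P j) ∨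
    (∃ k ≤ 2 * g + 1, p ∈ D.edge k) ∨ p ∈ A₁ ∨ p ∈ A₂

theorem IsOrthodisk.exists_uniformized {A₁ A₂ : Set ℂ} (O : IsOrthodisk g D A₁ A₂) :
    ∃ φ h x, Uniformized g D φ h x := by
  have S := O.toIsSymmetricDomain
  obtain ⟨φ, h, Φ, H, h1, h2, h3, h4⟩ := S.exists_boundary_value
  have B : IsBoundaryValue D φ h Φ := ⟨H, h1, ⟨h2, h3⟩, h4⟩
  obtain ⟨χ₁, θ₁, C₁⟩ := S.chart₁
  obtain ⟨χ₂, θ₂, C₂⟩ := S.chart₂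
  have hn₁ := C₁.neBot
  have hn₂ := C₂.neBot
  have hEV : ∀ 𝓕 : Filter ℂ, 𝓕.NeBot → 𝓕 ≤ Bornology.cobounded ℂ → 𝓕 ≠ 𝓝[D.dom] D.V := by
    intro 𝓕 hn hc hV
    have : 𝓕 ≤ 𝓝 D.V := hV.le.trans nhdsWithin_le_nhds
    exact hn.ne (le_bot_iff.1 ((Metric.disjoint_cobounded_nhds D.V) hc this))
  obtain ⟨x, hx⟩ : ∃ x : ℕ → ℝ, x = fun k => Φ (vertexFilter g D k) := ⟨_, rfl⟩
  have hx0 : x 0 = Φ D.E₂ := by simp [hx, vertexFilter]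
  have hxl : x (2 * g + 2) = Φ D.E₁ := by simp [hx, vertexFilter]
  have hxj : ∀ j ≤ 2 * g, x (j + 1) = Φ (𝓝[D.dom] D.P j) := fun j hj => by
    simp only [hx, vertexFilter]
    rw [if_neg (by omega), if_neg (by omega), Nat.add_sub_cancel]
  have he₁ : Tendsto φ D.E₁ (𝓝[upperHalf] (x (2 * g + 2) : ℂ)) ∧
      Tendsto h (𝓝[upperHalf] (x (2 * g + 2) : ℂ)) D.E₁ := by
    rw [hxl]; exact B.lim _ (Or.inl rfl) (hEV _ hn₁ S.le_cobounded₁)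
  have he₂ : Tendsto φ D.E₂ (𝓝[upperHalf] (x 0 : ℂ)) ∧
      Tendsto h (𝓝[upperHalf] (x 0 : ℂ)) D.E₂ := by
    rw [hx0]; exact B.lim _ (Or.inr (Or.inl rfl)) (hEV _ hn₂ S.le_cobounded₂)
  have hv : ∀ j ≤ 2 * g, Tendsto φ (𝓝[D.dom] D.P j) (𝓝[upperHalf] (x (j + 1) : ℂ)) ∧
      Tendsto h (𝓝[upperHalf] (x (j + 1) : ℂ)) (𝓝[D.dom] D.P j) := fun j hj => by
    rw [hxj j hj]; exact B.lim_point (S.vertex_mem j hj) (S.vertex_ne j hj)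
  have hvf : ∀ k ≤ 2 * g + 2, Tendsto φ (vertexFilter g D k) (𝓝 (x k : ℂ)) := fun k hk => by
    rcases Nat.eq_zero_or_pos k with rfl | hk0
    · simpa [vertexFilter] using he₂.1.mono_right nhdsWithin_le_nhds
    · by_cases hk' : k = 2 * g + 2
      · subst hk'
        simpa [vertexFilter] using he₁.1.mono_right nhdsWithin_le_nhds
      · obtain ⟨j, rfl⟩ : ∃ j, k = j + 1 := ⟨k - 1, by omega⟩
        rw [vertexFilter, if_neg (by omega), if_neg hk', Nat.add_sub_cancel]
        exact (hv j (by omega)).1.mono_right nhdsWithin_le_nhds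
  have hedge : ∀ k ≤ 2 * g + 1, ∀ p ∈ D.edge k, Φ (𝓝[D.dom] p) ∈ Ioo (x k) (x (k + 1)) := by
    intro k hk p hp
    obtain ⟨q, κ, J, E, hs, ht⟩ := O.edge k hk
    exact ⟨E.lt_of_startsAt B (hvf k (by omega)) hs hp,
      E.lt_of_endsAt B (hvf (k + 1) (by omega)) ht hp⟩
  have hstep : ∀ k ≤ 2 * g + 1, x k < x (k + 1) := by
    intro k hk
    obtain ⟨q, κ, J, E, -, -⟩ := O.edge k hk
    obtain ⟨t, ht⟩ := E.nonempty
    have := hedge k hk _ (E.mem ht)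
    exact this.1.trans this.2
  have hmono : ∀ i j, i < j → j ≤ 2 * g + 2 → x i < x j := by
    intro i j hij
    induction j, hij using Nat.le_induction with
    | base => exact fun hj => hstep i (by omega)
    | succ j hj ih => exact fun hj' => (ih (by omega)).trans (hstep j (by omega))
  have hmono' : ∀ i j, i ≤ j → j ≤ 2 * g + 2 → x i ≤ x j := fun i j hij hj => by
    rcases hij.eq_or_lt with rfl | hij
    exacts [le_rfl, (hmono i j hij hj).le]
  have hrefl : ∀ {𝓕 𝓖 : Filter ℂ} {a b : ℝ} [𝓕.NeBot], D.dom ∈ 𝓕 → Tendsto diagRefl 𝓕 𝓖 →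
      Tendsto φ 𝓕 (𝓝 (a : ℂ)) → Tendsto φ 𝓖 (𝓝 (b : ℂ)) → b = -a := by
    intro 𝓕 𝓖 a b _ hd hr ha hb
    have h1 : Tendsto (fun z => reflect (φ z)) 𝓕 (𝓝 (reflect a)) :=
      (continuous_reflect.tendsto _).comp ha
    have h2 := tendsto_nhds_unique_of_eventuallyEq (hb.comp hr) h1 (by
      filter_upwards [hd] with z hz using B.symm z hz)
    rw [reflect_ofReal] at h2
    exact_mod_cast h2
  have hsymm0 : x (2 * g + 2) = -x 0 := by
    refine hrefl (𝓕 := D.E₂) ?_ S.refl_end (he₂.1.mono_right nhdsWithin_le_nhds)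
      (he₁.1.mono_right nhdsWithin_le_nhds)
    filter_upwards [C₂.hasBasis.mem_of_mem one_pos] with z hz
    obtain ⟨ζ, hζ, rfl⟩ := hz
    exact C₂.mapsTo ⟨one_pos.trans (show (1 : ℝ) < ζ.re from hζ.1), hζ.2⟩
  refine ⟨φ, h, x, S.isOpen, H, hmono, ?_, ?_, ?_, hv, B.outer, he₁, he₂⟩
  · intro k hk
    rcases Nat.eq_zero_or_pos k with rfl | hk0
    · simpa using hsymm0
    · by_cases hk' : k = 2 * g + 2
      · subst hk'
        simp [hsymm0]
      · obtain ⟨j, rfl⟩ : ∃ j, k = j + 1 := ⟨k - 1, by omega⟩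
        have hj : j ≤ 2 * g := by omega
        have : 2 * g + 2 - (j + 1) = (2 * g - j) + 1 := by omega
        rw [this]
        have hn := mem_closure_iff_nhdsWithin_neBot.1 (S.vertex_mem j hj).1
        have hr := S.tendsto_diagRefl (D.P j)
        rw [S.refl_vertex j hj] at hr
        exact hrefl self_mem_nhdsWithin hr ((hv j hj).1.mono_right nhdsWithin_le_nhds)
          ((hv _ (by omega)).1.mono_right nhdsWithin_le_nhds)
  · intro k hk p hp
    obtain ⟨q, κ, J, E, -, -⟩ := O.edge k hk
    exact ⟨_, hedge k hk p hp,
      (B.lim_point (E.mem_boundary hp) (E.ne_outer p hp)).1.mono_right nhdsWithin_le_nhds⟩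
  · intro k hk t ht
    obtain ⟨𝓕, h𝓕, hne, rfl⟩ := B.surjective S t
    have hnv : ∀ i ≤ 2 * g + 2, Φ 𝓕 ≠ x i := fun i hi heq => by
      rcases Nat.lt_or_ge k i with hki | hki
      · exact absurd (hmono' (k + 1) i hki hi) (by rw [← heq]; exact not_le.2 ht.2)
      · exact absurd (hmono' i k hki (by omega)) (by rw [← heq]; exact not_le.2 ht.1)
    rcases h𝓕 with rfl | rfl | ⟨p, hp, rfl⟩
    · exact absurd hxl.symm (hnv _ le_rfl)
    · exact absurd hx0.symm (hnv _ (by omega))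
    · rcases O.cases p hp with rfl | ⟨j, hj, rfl⟩ | ⟨l, hl, hpl⟩ | hp' | hp'
      · exact absurd rfl hne
      · exact absurd (hxj j hj).symm (hnv _ (by omega))
      · have hkl : l = k := by
          have hl' := hedge l hl p hpl
          rcases Nat.lt_trichotomy l k with hlk | hlk | hlk
          · exact absurd (hmono' (l + 1) k hlk (by omega)) (not_le.2 (ht.1.trans hl'.2))
          · exact hlk
          · exact absurd (hmono' (k + 1) l hlk (by omega)) (not_le.2 (hl'.1.trans ht.2))
        subst hkl
        obtain ⟨q, κ, J, E, -, -⟩ := O.edge l hl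
        exact ⟨p, hpl, (B.lim_point hp (E.ne_outer p hpl)).2.mono_right nhdsWithin_le_nhds⟩
      · obtain ⟨q, κ, J, E, hs⟩ := O.outerEdge₁
        have := E.lt_of_startsAt B (he₁.1.mono_right nhdsWithin_le_nhds) hs hp'
        exact absurd (hmono' (k + 1) (2 * g + 2) (by omega) le_rfl) (not_le.2 (this.trans ht.2))
      · obtain ⟨q, κ, J, E, hs⟩ := O.outerEdge₂
        have := E.lt_of_endsAt B (he₂.1.mono_right nhdsWithin_le_nhds) hs hp'
        exact absurd (hmono' 0 k (by omega) (by omega)) (not_le.2 (ht.1.trans this))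

/-! ### Charts at corners and ends of orthogonal polygons -/

theorem isBoundaryChart_corner {Ω : Set ℂ} {p κ : ℂ} {θ : ℝ} (hp : p ∉ Ω) (hκ : κ ≠ 0)
    (hθ : 0 < θ) (hθπ : θ < Real.pi)
    (hloc : ∀ ζ : ℂ, 0 < ζ.re → ζ.im ∈ Ico (-Real.pi) Real.pi →
      (p + κ * Complex.exp (-ζ) ∈ Ω ↔ ζ.im ∈ Ioo (-θ) θ)) :
    IsBoundaryChart Ω (𝓝[Ω] p) (fun ζ => p + κ * Complex.exp (-ζ)) θ := by
  have hκ' : 0 < ‖κ‖ := norm_pos_iff.2 hκ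
  have hπ : ∀ s, s ∈ Ioo (-θ) θ → s ∈ Ico (-Real.pi) Real.pi := fun s hs =>
    ⟨by linarith [hs.1], by linarith [hs.2]⟩
  have hdist : ∀ ζ : ℂ, dist (p + κ * Complex.exp (-ζ)) p = ‖κ‖ * Real.exp (-ζ.re) := fun ζ => by
    rw [dist_eq_norm, add_sub_cancel_left, norm_mul, Complex.norm_exp, Complex.neg_re]
  have hpol : ∀ z ∈ Ω, dist z p < ‖κ‖ →
      ∃ ζ : ℂ, 0 < ζ.re ∧ ζ.im ∈ Ioo (-θ) θ ∧ p + κ * Complex.exp (-ζ) = z := by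
    intro z hz hd
    have hzp : z ≠ p := fun h => hp (h ▸ hz)
    have hw : (z - p) / κ ≠ 0 := div_ne_zero (sub_ne_zero.2 hzp) hκ
    have heq : p + κ * Complex.exp (-(-Complex.log ((z - p) / κ))) = z := by
      rw [neg_neg, Complex.exp_log hw, mul_div_cancel₀ _ hκ]; ring
    have h0 : 0 < (-Complex.log ((z - p) / κ)).re := by
      rw [Complex.neg_re, Complex.log_re, neg_pos]
      refine Real.log_neg (norm_pos_iff.2 hw) ?_
      rw [norm_div, div_lt_one hκ', ← dist_eq_norm]
      exact hd
    refine ⟨_, h0, ?_, heq⟩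
    rw [← hloc _ h0 ?_, heq]
    · exact hz
    · rw [Complex.neg_im, Complex.log_im]
      exact ⟨neg_le_neg (Complex.arg_le_pi _), by linarith [Complex.neg_pi_lt_arg ((z - p) / κ)]⟩
  refine ⟨hθ, by fun_prop, fun ζ => ?_, fun ζ hζ ω hω h => ?_, fun ζ hζ => ?_, ?_, ?_, ?_⟩
  · have h1 : HasDerivAt (fun ζ : ℂ => p + κ * Complex.exp (-ζ)) (κ * (Complex.exp (-ζ) * (-1))) ζ :=
      (((hasDerivAt_neg ζ).cexp).const_mul κ).const_add p
    rw [h1.deriv]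
    simp [hκ, Complex.exp_ne_zero]
  · have h1 := mul_left_cancel₀ hκ (add_left_cancel h)
    have hζ' : ζ.im ∈ Ioo (-θ) θ := hζ.2
    have hω' : ω.im ∈ Ioo (-θ) θ := hω.2
    refine neg_injective (Complex.exp_inj_of_neg_pi_lt_of_le_pi ?_ ?_ ?_ ?_ h1) <;>
      simp only [Complex.neg_im] <;> linarith [hζ'.1, hζ'.2, hω'.1, hω'.2]
  · exact (hloc ζ hζ.1 (hπ _ hζ.2)).2 hζ.2
  · have himg : ∀ t : ℝ, 0 < t → (fun ζ => p + κ * Complex.exp (-ζ)) '' halfStrip θ t =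
        ball p (‖κ‖ * Real.exp (-t)) ∩ Ω := by
      intro t ht
      have ht1 : Real.exp (-t) < 1 := by simpa using ht
      ext z
      constructor
      · rintro ⟨ζ, hζ, rfl⟩
        have h1 : t < ζ.re := hζ.1
        refine ⟨?_, (hloc ζ (ht.trans h1) (hπ _ hζ.2)).2 hζ.2⟩
        rw [mem_ball, hdist]
        gcongr
      · rintro ⟨hz, hzΩ⟩
        rw [mem_ball] at hz
        obtain ⟨ζ, h0, hζ, rfl⟩ := hpol z hzΩ (hz.trans (by nlinarith))
        refine ⟨ζ, ⟨?_, hζ⟩, rfl⟩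
        rw [hdist] at hz
        have := lt_of_mul_lt_mul_left hz hκ'.le
        simpa using this
    refine nhdsWithin_basis_ball.to_hasBasis (fun ε hε => ?_) fun t ht => ?_
    · refine ⟨max 1 (-Real.log (ε / ‖κ‖)), lt_max_of_lt_left one_pos, ?_⟩
      rw [himg _ (lt_max_of_lt_left one_pos)]
      refine inter_subset_inter_left _ (ball_subset_ball ?_)
      have h1 : Real.exp (-max 1 (-Real.log (ε / ‖κ‖))) ≤ ε / ‖κ‖ := by
        rw [← Real.le_log_iff_exp_le (by positivity), neg_le]
        exact le_max_right _ _
      calc _ ≤ ‖κ‖ * (ε / ‖κ‖) := by gcongr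
        _ = ε := by field_simp
    · exact ⟨‖κ‖ * Real.exp (-t), by positivity, (himg t ht).ge⟩
  · intro t ht z hz hzc
    have ht1 : Real.exp (-t) < 1 := by simpa using ht
    have h1 : z ∈ closedBall p (‖κ‖ * Real.exp (-t)) := by
      refine closure_minimal ?_ isClosed_closedBall hzc
      rintro _ ⟨ζ, hζ, rfl⟩
      have h1 : t ≤ ζ.re := hζ.1
      rw [mem_closedBall, hdist]
      gcongr
    rw [mem_closedBall] at h1
    obtain ⟨ζ, h0, hζ, rfl⟩ := hpol z hz (h1.trans_lt (by nlinarith))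
    refine ⟨ζ, ⟨?_, hζ⟩, rfl⟩
    rw [hdist] at h1
    have := le_of_mul_le_mul_left h1 hκ'
    simpa using this
  · intro t ht hmem
    have h := (hloc (t + θ * Complex.I) (by simpa using ht)
      (by simpa using ⟨by linarith, hθπ⟩)).1 hmem
    simp at h

/-- Near `p` the set `S` is given by a monotone combination of the conditions to lie to the left of
and above `p` (for `ε = 1`), or to the right of and below `p` (for `ε = -1`). -/
def HasCornerGerm (ε : ℝ) (S : Set ℂ) (p : ℂ) : Prop :=
  ∃ f : Prop → Prop → Prop, (∀ a b a' b', (a → a') → (b → b') → f a b → f a' b') ∧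
    ∀ᶠ z in 𝓝 p, z ∈ S ↔ f (ε * (z.re - p.re) < 0) (0 < ε * (z.im - p.im))

theorem hasCornerGerm_of_eventually {ε : ℝ} {S T : Set ℂ} {p : ℂ} (h : HasCornerGerm ε S p)
    (hST : ∀ᶠ z in 𝓝 p, z ∈ T ↔ z ∈ S) : HasCornerGerm ε T p := by
  obtain ⟨f, hf, h⟩ := h
  exact ⟨f, hf, by filter_upwards [h, hST] with z h1 h2 using h2.trans h1⟩

theorem hasCornerGerm_univ (ε : ℝ) (p : ℂ) : HasCornerGerm ε univ p :=
  ⟨fun _ _ => True, by simp, by simp⟩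

theorem hasCornerGerm_empty (ε : ℝ) (p : ℂ) : HasCornerGerm ε ∅ p :=
  ⟨fun _ _ => False, by simp, by simp⟩

theorem HasCornerGerm.inter {ε : ℝ} {S T : Set ℂ} {p : ℂ} (hS : HasCornerGerm ε S p)
    (hT : HasCornerGerm ε T p) : HasCornerGerm ε (S ∩ T) p := by
  obtain ⟨f, hf, h⟩ := hS
  obtain ⟨k, hk, h'⟩ := hT
  refine ⟨fun a b => f a b ∧ k a b, fun a b a' b' h1 h2 h3 =>
    ⟨hf _ _ _ _ h1 h2 h3.1, hk _ _ _ _ h1 h2 h3.2⟩, ?_⟩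
  filter_upwards [h, h'] with z h1 h2 using and_congr h1 h2

theorem HasCornerGerm.union {ε : ℝ} {S T : Set ℂ} {p : ℂ} (hS : HasCornerGerm ε S p)
    (hT : HasCornerGerm ε T p) : HasCornerGerm ε (S ∪ T) p := by
  obtain ⟨f, hf, h⟩ := hS
  obtain ⟨k, hk, h'⟩ := hT
  refine ⟨fun a b => f a b ∨ k a b, fun a b a' b' h1 h2 h3 =>
    h3.imp (hf _ _ _ _ h1 h2) (hk _ _ _ _ h1 h2), ?_⟩
  filter_upwards [h, h'] with z h1 h2 using or_congr h1 h2

theorem HasCornerGerm.biUnion {ε : ℝ} {S : ℕ → Set ℂ} {p : ℂ}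
    (hS : ∀ n, HasCornerGerm ε (S n) p) (n : ℕ) : HasCornerGerm ε (⋃ j ≤ n, S j) p := by
  induction n with
  | zero => simpa using hS 0
  | succ n ih =>
    have : (⋃ j ≤ n + 1, S j) = (⋃ j ≤ n, S j) ∪ S (n + 1) := by
      ext z; simp only [mem_iUnion, mem_union, exists_prop, Nat.le_succ_iff]
      constructor
      · rintro ⟨j, h | rfl, hz⟩
        exacts [Or.inl ⟨j, h, hz⟩, Or.inr hz]
      · rintro (⟨j, h, hz⟩ | hz)
        exacts [⟨j, Or.inl h, hz⟩, ⟨_, Or.inr rfl, hz⟩]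
    rw [this]
    exact ih.union (hS _)

theorem hasCornerGerm_re (ε c : ℝ) (p : ℂ) : HasCornerGerm ε {z | ε * z.re < c} p := by
  have hc : Continuous fun z : ℂ => ε * z.re := by fun_prop
  rcases lt_trichotomy (ε * p.re) c with h | h | h
  · refine hasCornerGerm_of_eventually (hasCornerGerm_univ ε p) ?_
    filter_upwards [hc.continuousAt.eventually_lt_const h] with z hz
    simpa using hz
  · exact ⟨fun a _ => a, fun _ _ _ _ h1 _ h3 => h1 h3, Eventually.of_forall fun z => by
      rw [mem_ofPred_eq, mul_sub, h, sub_neg]⟩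
  · refine hasCornerGerm_of_eventually (hasCornerGerm_empty ε p) ?_
    filter_upwards [hc.continuousAt.eventually_const_lt h] with z hz
    simpa using hz.le

theorem hasCornerGerm_im (ε c : ℝ) (p : ℂ) : HasCornerGerm ε {z | c < ε * z.im} p := by
  have hc : Continuous fun z : ℂ => ε * z.im := by fun_prop
  rcases lt_trichotomy c (ε * p.im) with h | h | h
  · refine hasCornerGerm_of_eventually (hasCornerGerm_univ ε p) ?_
    filter_upwards [hc.continuousAt.eventually_const_lt h] with z hz
    simpa using hz
  · exact ⟨fun _ b => b, fun _ _ _ _ _ h2 h3 => h2 h3, Eventually.of_forall fun z => by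
      rw [mem_ofPred_eq, mul_sub ε z.im, ← h, sub_pos]⟩
  · refine hasCornerGerm_of_eventually (hasCornerGerm_empty ε p) ?_
    filter_upwards [hc.continuousAt.eventually_lt_const h] with z hz
    simpa using hz.le

theorem cos_neg_iff {α : ℝ} (h : α ∈ Icc (-(Real.pi / 2)) (2 * Real.pi)) :
    Real.cos α < 0 ↔ α ∈ Ioo (Real.pi / 2) (3 * Real.pi / 2) := by
  have := Real.pi_pos
  constructor
  · intro hc
    constructor
    · by_contra! h1
      exact absurd (Real.cos_nonneg_of_mem_Icc ⟨h.1, h1⟩) (not_le.2 hc)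
    · by_contra! h1
      have h2 := Real.cos_nonneg_of_mem_Icc (x := α - 2 * Real.pi)
        ⟨by linarith, by linarith [h.2]⟩
      rw [Real.cos_sub_two_pi] at h2
      linarith
  · exact fun h1 => Real.cos_neg_of_pi_div_two_lt_of_lt h1.1 (by linarith [h1.2])

theorem sin_pos_iff {α : ℝ} (h : α ∈ Icc (-(Real.pi / 2)) (2 * Real.pi)) :
    0 < Real.sin α ↔ α ∈ Ioo 0 Real.pi := by
  have := Real.pi_pos
  constructor
  · intro hc
    constructor
    · by_contra! h1
      have := Real.sin_nonpos_of_nonpos_of_neg_pi_le h1 (by linarith [h.1])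
      linarith
    · by_contra! h1
      have h2 := Real.sin_nonpos_of_nonpos_of_neg_pi_le (x := α - 2 * Real.pi)
        (by linarith [h.2]) (by linarith)
      rw [Real.sin_sub_two_pi] at h2
      linarith
  · exact fun h1 => Real.sin_pos_of_pos_of_lt_pi h1.1 h1.2

/-- The half-opening and the bisector of the sector given by a monotone combination of the
conditions `Re w < 0` and `0 < Im w`. -/
theorem exists_sector {f : Prop → Prop → Prop} (h0 : ¬f False False) (h1 : f True True) :
    ∃ α θ : ℝ, 0 < θ ∧ θ < Real.pi ∧ ∀ s ∈ Ico (-Real.pi) Real.pi,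
      (f (Real.cos (α - s) < 0) (0 < Real.sin (α - s)) ↔ s ∈ Ioo (-θ) θ) := by
  have hπ := Real.pi_pos
  have hf : ∀ a b, f a b ↔ (a ∧ b) ∨ (a ∧ f True False) ∨ (b ∧ f False True) := by
    intro a b
    by_cases ha : a <;> by_cases hb : b <;> simp [ha, hb, h0, h1]
  by_cases hTF : f True False <;> by_cases hFT : f False True
  · refine ⟨3 * Real.pi / 4, 3 * Real.pi / 4, by linarith, by linarith, fun s hs => ?_⟩
    have hm : 3 * Real.pi / 4 - s ∈ Icc (-(Real.pi / 2)) (2 * Real.pi) :=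
      ⟨by linarith [hs.2], by linarith [hs.1]⟩
    rw [hf, cos_neg_iff hm, sin_pos_iff hm]
    simp only [hTF, hFT, and_true, mem_Ioo]
    constructor
    · rintro (h | h | h) <;> constructor <;> linarith [h.1, h.2]
    · rintro ⟨h, h'⟩
      by_cases h2 : 3 * Real.pi / 4 - s < Real.pi
      · exact Or.inr (Or.inr ⟨by linarith, h2⟩)
      · exact Or.inr (Or.inl ⟨by linarith, by linarith⟩)
  · refine ⟨Real.pi, Real.pi / 2, by linarith, by linarith, fun s hs => ?_⟩
    have hm : Real.pi - s ∈ Icc (-(Real.pi / 2)) (2 * Real.pi) :=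
      ⟨by linarith [hs.2], by linarith [hs.1]⟩
    rw [hf, cos_neg_iff hm, sin_pos_iff hm]
    simp only [hTF, hFT, and_true, and_false, or_false, mem_Ioo]
    constructor
    · rintro (h | h)
      · constructor <;> linarith [h.1.1, h.1.2]
      · constructor <;> linarith [h.1, h.2]
    · rintro ⟨h, h'⟩
      exact Or.inr ⟨by linarith, by linarith⟩
  · refine ⟨Real.pi / 2, Real.pi / 2, by linarith, by linarith, fun s hs => ?_⟩
    have hm : Real.pi / 2 - s ∈ Icc (-(Real.pi / 2)) (2 * Real.pi) :=
      ⟨by linarith [hs.2], by linarith [hs.1]⟩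
    rw [hf, cos_neg_iff hm, sin_pos_iff hm]
    simp only [hTF, hFT, and_true, and_false, false_or, mem_Ioo]
    constructor
    · rintro (h | h)
      · constructor <;> linarith [h.2.1, h.2.2]
      · constructor <;> linarith [h.1, h.2]
    · rintro ⟨h, h'⟩
      exact Or.inr ⟨by linarith, by linarith⟩
  · refine ⟨3 * Real.pi / 4, Real.pi / 4, by linarith, by linarith, fun s hs => ?_⟩
    have hm : 3 * Real.pi / 4 - s ∈ Icc (-(Real.pi / 2)) (2 * Real.pi) :=
      ⟨by linarith [hs.2], by linarith [hs.1]⟩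
    rw [hf, cos_neg_iff hm, sin_pos_iff hm]
    simp only [hTF, hFT, and_false, or_false, mem_Ioo]
    constructor
    · rintro h
      constructor <;> linarith [h.1.1, h.2.2]
    · rintro ⟨h, h'⟩
      exact ⟨⟨by linarith, by linarith⟩, by linarith, by linarith⟩

theorem HasCornerGerm.exists_chart {ε : ℝ} (hε : ε * ε = 1) {Ω : Set ℂ} {p : ℂ}
    (h : HasCornerGerm ε Ω p) (hp : p ∈ closure Ω \ Ω) :
    ∃ χ θ, IsBoundaryChart Ω (𝓝[Ω] p) χ θ := by
  obtain ⟨f, hf, hev⟩ := h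
  have h0 : ¬f False False := fun h => hp.2 (hev.self_of_nhds.2 (by simpa using h))
  have h1 : f True True := by
    by_contra h1
    have h2 : ∀ᶠ z in 𝓝 p, z ∉ Ω := by
      filter_upwards [hev] with z hz hzΩ
      exact h1 (hf _ _ _ _ (fun _ => trivial) (fun _ => trivial) (hz.1 hzΩ))
    exact (mem_closure_iff_frequently.1 hp.1) h2
  obtain ⟨α, θ, hθ, hθπ, hs⟩ := exists_sector h0 h1
  obtain ⟨r, hr, hball⟩ := Metric.eventually_nhds_iff.1 hev
  have hε0 : ε ≠ 0 := fun h => by simp [h] at hε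
  have hε1 : ‖(ε : ℂ)‖ = 1 := by
    rcases mul_self_eq_one_iff.1 hε with rfl | rfl <;> simp
  refine ⟨_, θ, isBoundaryChart_corner (κ := (r * ε : ℝ) * Complex.exp (α * Complex.I)) hp.2
    (by simp [hr.ne', hε0]) hθ hθπ fun ζ hζ him => ?_⟩
  have hz : p + (r * ε : ℝ) * Complex.exp (α * Complex.I) * Complex.exp (-ζ) =
      p + ε * ((r * Real.exp (-ζ.re) : ℝ) * Complex.exp ((α - ζ.im : ℝ) * Complex.I)) := by
    have : Complex.exp (α * Complex.I) * Complex.exp (-ζ) =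
        (Real.exp (-ζ.re) : ℂ) * Complex.exp ((α - ζ.im : ℝ) * Complex.I) := by
      rw [Complex.ofReal_exp, ← Complex.exp_add, ← Complex.exp_add]
      congr 1
      apply Complex.ext <;> simp [sub_eq_add_neg]
    rw [mul_assoc, this]; push_cast; ring
  rw [hz, hball ?_, ← hs _ him]
  · have hρ : 0 < r * Real.exp (-ζ.re) := by positivity
    generalize r * Real.exp (-ζ.re) = ρ at hρ
    generalize α - ζ.im = β
    have e1 : ε * ((p + ε * ((ρ : ℂ) * Complex.exp (β * Complex.I))).re - p.re) = ρ * Real.cos β := by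
      rw [Complex.add_re, Complex.re_ofReal_mul, Complex.re_ofReal_mul, Complex.exp_ofReal_mul_I_re]
      linear_combination (ρ * Real.cos β) * hε
    have e2 : ε * ((p + ε * ((ρ : ℂ) * Complex.exp (β * Complex.I))).im - p.im) = ρ * Real.sin β := by
      rw [Complex.add_im, Complex.im_ofReal_mul, Complex.im_ofReal_mul, Complex.exp_ofReal_mul_I_im]
      linear_combination (ρ * Real.sin β) * hε
    rw [e1, e2, mul_neg_iff, mul_pos_iff]
    simp [hρ, hρ.not_gt]
  · rw [dist_eq_norm, add_sub_cancel_left, norm_mul, hε1, norm_mul, Complex.norm_exp_ofReal_mul_I,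
      Complex.norm_real, Real.norm_of_nonneg (by positivity), one_mul, mul_one]
    have : Real.exp (-ζ.re) < 1 := by simpa using hζ
    nlinarith

/-- A chart at the end of a half-strip with axis `q + κ ℝ`. -/
theorem isBoundaryChart_strip {Ω : Set ℂ} {𝓕 : Filter ℂ} {q κ : ℂ} {θ : ℝ} (hκ : κ ≠ 0)
    (hθ : 0 < θ) (hloc : ∀ ζ : ℂ, 0 < ζ.re → (q + κ * ζ ∈ Ω ↔ ζ.im ∈ Ioo (-θ) θ))
    (h𝓕 : 𝓕.HasBasis (fun t : ℝ => 0 < t) fun t => {z | z ∈ Ω ∧ t < ((z - q) / κ).re}) :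
    IsBoundaryChart Ω 𝓕 (fun ζ => q + κ * ζ) θ := by
  have hinv : ∀ ζ, (q + κ * ζ - q) / κ = ζ := fun ζ => by field_simp; ring
  have hinv' : ∀ z, q + κ * ((z - q) / κ) = z := fun z => by field_simp; ring
  refine ⟨hθ, by fun_prop, fun ζ => ?_, fun ζ _ ω _ h => ?_, fun ζ hζ => (hloc ζ hζ.1).2 hζ.2, ?_,
    ?_, ?_⟩
  · have h1 : HasDerivAt (fun ζ : ℂ => q + κ * ζ) (κ * 1) ζ := ((hasDerivAt_id ζ).const_mul κ).const_add q
    rw [h1.deriv]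
    simpa using hκ
  · exact mul_left_cancel₀ hκ (add_left_cancel h)
  · refine h𝓕.congr (fun _ => Iff.rfl) fun t ht => ?_
    ext z
    constructor
    · rintro ⟨hz, hzt⟩
      exact ⟨_, ⟨hzt, (hloc _ (ht.trans hzt)).1 (by rwa [hinv'])⟩, hinv' z⟩
    · rintro ⟨ζ, hζ, rfl⟩
      have h1 : t < ζ.re := hζ.1
      exact ⟨(hloc ζ (ht.trans h1)).2 hζ.2, by rwa [hinv]⟩
  · intro t ht z hz hzc
    have h1 : t ≤ ((z - q) / κ).re := by
      have hcl : IsClosed {z : ℂ | t ≤ ((z - q) / κ).re} :=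
        isClosed_le continuous_const (by fun_prop)
      refine closure_minimal ?_ hcl hzc
      rintro _ ⟨ζ, hζ, rfl⟩
      rw [mem_ofPred_eq, hinv]
      exact hζ.1
    exact ⟨_, ⟨h1, (hloc _ (ht.trans_le h1)).1 (by rwa [hinv'])⟩, hinv' z⟩
  · intro t ht hmem
    have := (hloc (t + θ * Complex.I) (by simpa using ht)).1 hmem
    simp at this

/-- The curve that runs along two sides of a corner at `(d, -d)`. -/
def cornerCurve (d s : ℝ) : ℂ := ⟨s + |s| + d, s - |s| - d⟩

theorem continuous_cornerCurve (d : ℝ) : Continuous (cornerCurve d) := by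
  have : cornerCurve d = fun s : ℝ => ((s + |s| + d : ℝ) : ℂ) + ((s - |s| - d : ℝ) : ℂ) * Complex.I := by
    funext s; apply Complex.ext <;> simp [cornerCurve]
  rw [this]; fun_prop

/-- A set which meets all lines in the direction `(1, -1)` in intervals and contains a corner curve
is simply connected. -/
theorem isSimplyConnected_of_cornerCurve {Ω : Set ℂ} {d : ℝ} (hd : ∀ s, cornerCurve d s ∈ Ω)
    (hconv : ∀ z ∈ Ω, ∀ w ∈ Ω, z.re + z.im = w.re + w.im → segment ℝ z w ⊆ Ω) :
    IsSimplyConnected Ω := by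
  have hsum : ∀ s, (cornerCurve d s).re + (cornerCurve d s).im = 2 * s := fun s => by
    simp only [cornerCurve]; ring
  let u : C(Ω, ℝ) := ⟨fun z => ((z : ℂ).re + (z : ℂ).im) / 2, by fun_prop⟩
  let c : C(ℝ, Ω) := ⟨fun s => ⟨cornerCurve d s, hd s⟩, (continuous_cornerCurve d).subtype_mk _⟩
  have hcc := continuous_cornerCurve d
  let F : C(unitInterval × Ω, Ω) :=
    ⟨fun a => ⟨(1 - (a.1 : ℝ) : ℝ) • cornerCurve d (u a.2) + (a.1 : ℝ) • (a.2 : ℂ), by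
      refine hconv _ (hd (u a.2)) _ a.2.2 ?_ ?_
      · rw [hsum]; simp only [u, ContinuousMap.coe_mk]; ring
      · exact ⟨1 - a.1, a.1, by linarith [a.1.2.2], a.1.2.1, by ring, rfl⟩⟩, by
      refine Continuous.subtype_mk ?_ _
      have h1 : Continuous fun a : unitInterval × Ω => cornerCurve d (u a.2) :=
        hcc.comp (u.continuous.comp continuous_snd)
      fun_prop⟩
  let e : ContinuousMap.HomotopyEquiv Ω ℝ :=
    { toFun := u
      invFun := c
      left_inv := ⟨⟨F, fun z => by
          apply Subtype.ext
          simp [F, c], fun z => by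
          apply Subtype.ext
          simp [F]⟩⟩
      right_inv := by
        have : u.comp c = ContinuousMap.id ℝ := by
          ext s
          simp only [u, c, ContinuousMap.comp_apply, ContinuousMap.coe_mk, ContinuousMap.id_apply,
            hsum]
          ring
        rw [this] }
  have : ContractibleSpace Ω := e.contractibleSpace
  exact (inferInstance : SimplyConnectedSpace Ω)

/-! ### The ends of a domain and the end points of its edges -/

/-- The points of `Ω` tending to infinity to the right. -/
def rightEnd (Ω : Set ℂ) : Filter ℂ := comap Complex.re atTop ⊓ 𝓟 Ω

/-- The points of `Ω` tending to infinity downwards. -/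
def downEnd (Ω : Set ℂ) : Filter ℂ := comap Complex.im atBot ⊓ 𝓟 Ω

theorem mem_rightEnd {Ω S : Set ℂ} (M : ℝ) :
    S ∈ rightEnd Ω ↔ ∃ t > M, ∀ z ∈ Ω, t < z.re → z ∈ S := by
  have h := ((atTop_basis_Ioi' M).comap Complex.re).inf_principal Ω
  rw [rightEnd, h.mem_iff]
  exact exists_congr fun t => and_congr_right fun _ =>
    ⟨fun H z hz hzt => H ⟨hzt, hz⟩, fun H z hz => H z hz.2 hz.1⟩

theorem mem_downEnd {Ω S : Set ℂ} (M : ℝ) :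
    S ∈ downEnd Ω ↔ ∃ t > M, ∀ z ∈ Ω, z.im < -t → z ∈ S := by
  have h := ((atBot_basis_Iio' (-M)).comap Complex.im).inf_principal Ω
  rw [downEnd, h.mem_iff]
  constructor
  · rintro ⟨t, ht, H⟩
    exact ⟨-t, by linarith, fun z hz hzt => H ⟨by simpa using hzt, hz⟩⟩
  · rintro ⟨t, ht, H⟩
    exact ⟨-t, by linarith, fun z hz => H z hz.2 hz.1⟩

theorem rightEnd_le_cobounded (Ω : Set ℂ) : rightEnd Ω ≤ Bornology.cobounded ℂ := by
  rw [← comap_norm_atTop, ← tendsto_iff_comap]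
  refine tendsto_atTop_mono (fun z => Complex.re_le_norm z) ?_
  exact tendsto_comap.mono_left inf_le_left

theorem downEnd_le_cobounded (Ω : Set ℂ) : downEnd Ω ≤ Bornology.cobounded ℂ := by
  rw [← comap_norm_atTop, ← tendsto_iff_comap]
  refine tendsto_atTop_mono (f := fun z : ℂ => -z.im)
    (fun z => (neg_le_abs _).trans (Complex.abs_im_le_norm z)) ?_
  exact tendsto_neg_atBot_atTop.comp (tendsto_comap.mono_left inf_le_left)

theorem disjoint_rightEnd_downEnd {Ω : Set ℂ} {M : ℝ} (h : ∀ z ∈ Ω, M < z.re → -M < z.im) :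
    Disjoint (rightEnd Ω) (downEnd Ω) := by
  rw [Filter.disjoint_iff]
  refine ⟨{z | z ∈ Ω ∧ M < z.re}, ?_, {z | z.im < -M}, ?_, ?_⟩
  · exact (mem_rightEnd M).2 ⟨M + 1, by linarith, fun z hz hzt => ⟨hz, by linarith⟩⟩
  · exact (mem_downEnd M).2 ⟨M + 1, by linarith, fun z hz hzt => by
      rw [mem_ofPred_eq]; linarith⟩
  · rw [Set.disjoint_left]
    rintro z ⟨hz, hzM⟩ hz'
    exact lt_asymm hz' (h z hz hzM)

theorem cobounded_le_ends {Ω : Set ℂ} {R : ℝ} (h : ∀ z ∈ Ω, -R ≤ z.re ∧ z.im ≤ R) :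
    Bornology.cobounded ℂ ⊓ 𝓟 Ω ≤ rightEnd Ω ⊔ downEnd Ω := by
  intro S hS
  obtain ⟨t, ht, h1⟩ := (mem_rightEnd |R|).1 hS.1
  obtain ⟨t', ht', h2⟩ := (mem_downEnd |R|).1 hS.2
  rw [mem_inf_principal, ← comap_norm_atTop]
  refine ((tendsto_comap (f := (norm : ℂ → ℝ))).eventually_gt_atTop (t + t')).mono fun z hz hzΩ => ?_
  by_cases hre : t < z.re
  · exact h1 z hzΩ hre
  · refine h2 z hzΩ ?_
    by_contra! him
    have hR := le_abs_self R
    have e1 : |z.re| ≤ t := abs_le.2 ⟨by linarith [(h z hzΩ).1], not_lt.1 hre⟩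
    have e2 : |z.im| ≤ t' := abs_le.2 ⟨him, by linarith [(h z hzΩ).2]⟩
    linarith [Complex.norm_le_abs_re_add_abs_im z]

theorem tendsto_diagRefl_downEnd {Ω : Set ℂ} (h : MapsTo diagRefl Ω Ω) :
    Tendsto diagRefl (downEnd Ω) (rightEnd Ω) := by
  intro S hS
  obtain ⟨t, ht, hS⟩ := (mem_rightEnd 0).1 hS
  exact (mem_downEnd 0).2 ⟨t, ht, fun z hz hzt => hS _ (h hz) (by rw [diagRefl_re]; linarith)⟩

theorem tendsto_diagRefl_rightEnd {Ω : Set ℂ} (h : MapsTo diagRefl Ω Ω) :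
    Tendsto diagRefl (rightEnd Ω) (downEnd Ω) := by
  intro S hS
  obtain ⟨t, ht, hS⟩ := (mem_downEnd 0).1 hS
  exact (mem_rightEnd 0).2 ⟨t, ht, fun z hz hzt => hS _ (h hz) (by rw [diagRefl_im]; linarith)⟩

/-- If far to the right `Ω` is a half-strip, then it has a chart at its right end. -/
theorem exists_chart_rightEnd {Ω : Set ℂ} {M y₁ y₂ : ℝ} (hy : y₁ < y₂)
    (h : ∀ z : ℂ, M < z.re → (z ∈ Ω ↔ z.im ∈ Ioo y₁ y₂)) :
    ∃ χ θ, IsBoundaryChart Ω (rightEnd Ω) χ θ := by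
  refine ⟨_, (y₂ - y₁) / 2, isBoundaryChart_strip (q := ⟨M, (y₁ + y₂) / 2⟩) (κ := 1) one_ne_zero
    (by linarith) (fun ζ hζ => ?_) ⟨fun S => ?_⟩⟩
  · rw [h _ (by simpa using hζ)]
    simp only [one_mul, Complex.add_im, mem_Ioo]
    constructor <;> rintro ⟨h1, h2⟩ <;> constructor <;> linarith
  · rw [mem_rightEnd M]
    simp only [div_one, Complex.sub_re]
    constructor
    · rintro ⟨t, ht, H⟩
      exact ⟨t - M, by linarith, fun z hz => H z hz.1 (by linarith [hz.2])⟩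
    · rintro ⟨t, ht, H⟩
      exact ⟨M + t, by linarith, fun z hz hzt => H ⟨hz, by linarith⟩⟩

/-- If far down `Ω` is a half-strip, then it has a chart at its lower end. -/
theorem exists_chart_downEnd {Ω : Set ℂ} {M x₁ x₂ : ℝ} (hx : x₁ < x₂)
    (h : ∀ z : ℂ, z.im < -M → (z ∈ Ω ↔ z.re ∈ Ioo x₁ x₂)) :
    ∃ χ θ, IsBoundaryChart Ω (downEnd Ω) χ θ := by
  refine ⟨_, (x₂ - x₁) / 2, isBoundaryChart_strip (q := ⟨(x₁ + x₂) / 2, -M⟩) (κ := -Complex.I)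
    (neg_ne_zero.2 Complex.I_ne_zero) (by linarith) (fun ζ hζ => ?_) ⟨fun S => ?_⟩⟩
  · rw [h _ (by simpa using hζ)]
    simp only [neg_mul, Complex.add_re, Complex.neg_re, Complex.mul_re, Complex.I_re, Complex.I_im,
      zero_mul, one_mul, zero_sub, neg_neg, mem_Ioo]
    constructor <;> rintro ⟨h1, h2⟩ <;> constructor <;> linarith
  · rw [mem_downEnd M]
    have e : ∀ w : ℂ, (w / -Complex.I).re = -w.im := fun w => by
      rw [div_neg, Complex.div_I]; simp
    simp only [e, Complex.sub_im]
    constructor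
    · rintro ⟨t, ht, H⟩
      exact ⟨t - M, by linarith, fun z hz => H z hz.1 (by linarith [hz.2])⟩
    · rintro ⟨t, ht, H⟩
      exact ⟨M + t, by linarith, fun z hz hzt => H ⟨hz, by linarith⟩⟩

/-- A parametrisation of `A` by an interval of the line through `q` in direction `κ`. -/
structure IsStraight (A : Set ℂ) (q κ : ℂ) (J : Set ℝ) : Prop where
  eq_image : A = (fun t : ℝ => q + κ * t) '' J
  ordConnected : J.OrdConnected
  nonempty : J.Nonempty
  ne_zero : κ ≠ 0

variable {D : Labelled} {A : Set ℂ} {q κ : ℂ} {J : Set ℝ}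

theorem IsStraight.reverse (H : IsStraight A q κ J) : IsStraight A q (-κ) {t | -t ∈ J} := by
  refine ⟨?_, ⟨fun s hs t ht u hu => ?_⟩, ?_, neg_ne_zero.2 H.ne_zero⟩
  · rw [H.eq_image]
    ext z
    constructor
    · rintro ⟨t, ht, rfl⟩
      exact ⟨-t, by simpa using ht, by simp⟩
    · rintro ⟨t, ht, rfl⟩
      exact ⟨-t, ht, by simp⟩
  · exact H.ordConnected.out ht hs ⟨neg_le_neg hu.2, neg_le_neg hu.1⟩
  · obtain ⟨t, ht⟩ := H.nonempty
    exact ⟨-t, by simpa using ht⟩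

theorem IsStraight.isOrientedEdge (H : IsStraight A q κ J) {η : ℝ} (hη : 0 < η)
    (hs : ∀ t ∈ J, ∀ y ∈ Ioo (0 : ℝ) η, q + κ * (t + y * Complex.I) ∈ D.dom)
    (hA : ∀ p ∈ A, p ∉ D.dom ∧ p ≠ D.V) : IsOrientedEdge D A q κ J :=
  ⟨H.eq_image, H.ordConnected, H.nonempty, H.ne_zero, ⟨η, hη, hs⟩, fun p hp => (hA p hp).1,
    fun p hp => (hA p hp).2⟩

theorem StartsAt.reverse {𝓕 : Filter ℂ} (h : StartsAt D q κ J 𝓕) :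
    EndsAt D q (-κ) {t | -t ∈ J} 𝓕 := by
  intro t ht S hS
  obtain ⟨t', ht', hlt, h1⟩ := h (-t) ht S hS
  exact ⟨-t', by simpa using ht', by linarith, by simpa using h1⟩

theorem EndsAt.reverse {𝓕 : Filter ℂ} (h : EndsAt D q κ J 𝓕) :
    StartsAt D q (-κ) {t | -t ∈ J} 𝓕 := by
  intro t ht S hS
  obtain ⟨t', ht', hlt, h1⟩ := h (-t) ht S hS
  exact ⟨-t', by simpa using ht', by linarith, by simpa using h1⟩

theorem startsAt_of_eventually {𝓕 : Filter ℂ} (l : Filter ℝ) [l.NeBot]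
    (hl : ∀ t ∈ J, ∀ᶠ t' in l, t' ∈ J ∧ t' < t)
    (hS : ∀ S ∈ 𝓕, ∀ᶠ t' : ℝ in l, S ∈ 𝓝[D.dom] (q + κ * t')) : StartsAt D q κ J 𝓕 := by
  intro t ht S h
  obtain ⟨t', h1, h2⟩ := ((hl t ht).and (hS S h)).exists
  exact ⟨t', h1.1, h1.2, h2⟩

theorem endsAt_of_eventually {𝓕 : Filter ℂ} (l : Filter ℝ) [l.NeBot]
    (hl : ∀ t ∈ J, ∀ᶠ t' in l, t' ∈ J ∧ t < t')
    (hS : ∀ S ∈ 𝓕, ∀ᶠ t' : ℝ in l, S ∈ 𝓝[D.dom] (q + κ * t')) : EndsAt D q κ J 𝓕 := by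
  intro t ht S h
  obtain ⟨t', h1, h2⟩ := ((hl t ht).and (hS S h)).exists
  exact ⟨t', h1.1, h1.2, h2⟩

theorem eventually_mem_nhdsWithin_line {Ω S : Set ℂ} {a : ℝ} (hS : S ∈ 𝓝[Ω] (q + κ * a)) :
    ∀ᶠ t : ℝ in 𝓝 a, S ∈ 𝓝[Ω] (q + κ * t) := by
  have hc : Continuous fun t : ℝ => q + κ * t := by fun_prop
  exact (hc.tendsto a).eventually (eventually_nhds_nhdsWithin.2 hS)

theorem startsAt_nhdsWithin {a : ℝ} (h : ∀ t ∈ J, a < t ∧ Ioo a t ⊆ J) :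
    StartsAt D q κ J (𝓝[D.dom] (q + κ * a)) :=
  startsAt_of_eventually (𝓝[>] a)
    (fun t ht => by
      filter_upwards [Ioo_mem_nhdsGT (h t ht).1] with s hs using ⟨(h t ht).2 hs, hs.2⟩)
    fun _ hS => (eventually_mem_nhdsWithin_line hS).filter_mono nhdsWithin_le_nhds

theorem endsAt_nhdsWithin {a : ℝ} (h : ∀ t ∈ J, t < a ∧ Ioo t a ⊆ J) :
    EndsAt D q κ J (𝓝[D.dom] (q + κ * a)) :=
  endsAt_of_eventually (𝓝[<] a)
    (fun t ht => by
      filter_upwards [Ioo_mem_nhdsLT (h t ht).1] with s hs using ⟨(h t ht).2 hs, hs.1⟩)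
    fun _ hS => (eventually_mem_nhdsWithin_line hS).filter_mono nhdsWithin_le_nhds

/-- An edge running horizontally to the right ends at the right end. -/
theorem endsAt_rightEnd (h : ∀ t ∈ J, Ioi t ⊆ J) : EndsAt D q 1 J (rightEnd D.dom) := by
  refine endsAt_of_eventually atTop (fun t ht => ?_) fun S hS => ?_
  · filter_upwards [eventually_gt_atTop t] with s hs using ⟨h t ht hs, hs⟩
  · obtain ⟨M, -, hM⟩ := (mem_rightEnd 0).1 hS
    filter_upwards [eventually_gt_atTop (M - q.re)] with s hs
    refine mem_nhdsWithin.2 ⟨{z | M < z.re}, isOpen_lt continuous_const Complex.continuous_re, ?_,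
      fun z hz => hM z hz.2 hz.1⟩
    simp only [mem_ofPred_eq, one_mul, Complex.add_re, Complex.ofReal_re]
    linarith

/-- An edge running vertically upwards from infinity starts at the lower end. -/
theorem startsAt_downEnd (h : ∀ t ∈ J, Iio t ⊆ J) :
    StartsAt D q Complex.I J (downEnd D.dom) := by
  refine startsAt_of_eventually atBot (fun t ht => ?_) fun S hS => ?_
  · filter_upwards [eventually_lt_atBot t] with s hs using ⟨h t ht hs, hs⟩
  · obtain ⟨M, -, hM⟩ := (mem_downEnd 0).1 hS
    filter_upwards [eventually_lt_atBot (-M - q.im)] with s hs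
    refine mem_nhdsWithin.2 ⟨{z | z.im < -M}, isOpen_lt Complex.continuous_im continuous_const, ?_,
      fun z hz => hM z hz.2 hz.1⟩
    simp only [mem_ofPred_eq, Complex.add_im, Complex.mul_im, Complex.I_re, Complex.I_im,
      Complex.ofReal_re, Complex.ofReal_im]
    linarith

theorem isStraight_horizontal (y : ℝ) (hJ : J.OrdConnected) (hn : J.Nonempty) :
    IsStraight {z | z.im = y ∧ z.re ∈ J} (y * Complex.I) 1 J := by
  refine ⟨?_, hJ, hn, one_ne_zero⟩
  ext z
  constructor
  · rintro ⟨h1, h2⟩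
    exact ⟨z.re, h2, by apply Complex.ext <;> simp [h1]⟩
  · rintro ⟨t, ht, rfl⟩
    exact ⟨by simp, by simpa using ht⟩

theorem isStraight_vertical (x : ℝ) (hJ : J.OrdConnected) (hn : J.Nonempty) :
    IsStraight {z | z.re = x ∧ z.im ∈ J} x Complex.I J := by
  refine ⟨?_, hJ, hn, Complex.I_ne_zero⟩
  ext z
  constructor
  · rintro ⟨h1, h2⟩
    exact ⟨z.im, h2, by apply Complex.ext <;> simp [h1]⟩
  · rintro ⟨t, ht, rfl⟩
    exact ⟨by simp, by simpa using ht⟩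

theorem mem_closure_of_ray {Ω : Set ℂ} {p : ℂ} (w : ℂ) {η : ℝ} (hη : 0 < η)
    (h : ∀ s ∈ Ioo 0 η, p + s * w ∈ Ω) : p ∈ closure Ω := by
  have h1 : Tendsto (fun s : ℝ => p + s * w) (𝓝[>] 0) (𝓝 p) := by
    have : Continuous fun s : ℝ => p + s * w := by fun_prop
    have h2 := this.tendsto 0
    simp only [Complex.ofReal_zero, zero_mul, add_zero] at h2
    exact h2.mono_left nhdsWithin_le_nhds
  refine mem_closure_of_tendsto h1 ?_
  filter_upwards [Ioo_mem_nhdsGT hη] with s hs using h s hs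

/-- The intersection of a set closed under moves to the upper left with one closed under moves to
the lower right meets the lines in direction `(1, -1)` in intervals. -/
theorem segment_subset_inter {S T : Set ℂ}
    (hS : ∀ z ∈ S, ∀ w : ℂ, w.re ≤ z.re → z.im ≤ w.im → w ∈ S)
    (hT : ∀ z ∈ T, ∀ w : ℂ, z.re ≤ w.re → w.im ≤ z.im → w ∈ T) :
    ∀ z ∈ S ∩ T, ∀ w ∈ S ∩ T, z.re + z.im = w.re + w.im → segment ℝ z w ⊆ S ∩ T := by
  have key : ∀ z ∈ S ∩ T, ∀ w ∈ S ∩ T, z.re ≤ w.re → z.re + z.im = w.re + w.im →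
      segment ℝ z w ⊆ S ∩ T := by
    rintro z hz w hw hle heq _ ⟨a, b, ha, hb, hab, rfl⟩
    have him : w.im ≤ z.im := by linarith
    have e1 : (a • z + b • w).re = a * z.re + b * w.re := by simp
    have e2 : (a • z + b • w).im = a * z.im + b * w.im := by simp
    obtain rfl : a = 1 - b := by linarith
    refine ⟨hS w hw.1 _ ?_ ?_, hT z hz.2 _ ?_ ?_⟩ <;> simp only [e1, e2] <;> nlinarith
  intro z hz w hw heq
  rcases le_total z.re w.re with h | h
  · exact key z hz w hw h heq
  · rw [segment_symm]
    exact key w hw z hz h heq.symm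

namespace Coord

/-! ### The staircase -/

variable {g : ℕ} (X : Coord g)

theorem P_re (j : ℕ) :
    (X.P j).re = ∑ k : Fin (2 * g), if (k : ℕ) < j ∧ Even (k : ℕ) then X.len k else 0 := by
  simp only [P, stairVertex, Complex.add_re, Complex.re_sum]
  simp only [neg_mul, Complex.neg_re, Complex.mul_re, Complex.I_re, Complex.I_im, mul_zero,
    Complex.ofReal_im, zero_mul, sub_zero, neg_zero, zero_add]
  refine Finset.sum_congr rfl fun k _ => ?_
  by_cases h1 : (k : ℕ) < j <;> by_cases h2 : Even (k : ℕ) <;> simp [h1, h2]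

theorem P_im (j : ℕ) :
    (X.P j).im = -∑ k : Fin (2 * g), if j ≤ (k : ℕ) ∧ Odd (k : ℕ) then X.len k else 0 := by
  simp only [P, stairVertex, Complex.add_im, Complex.im_sum]
  simp only [neg_mul, Complex.neg_im, Complex.mul_im, Complex.I_re, Complex.I_im, mul_zero, mul_one,
    Complex.ofReal_re, add_zero]
  rw [neg_add_eq_sub, ← Finset.sum_sub_distrib, ← Finset.sum_neg_distrib]
  refine Finset.sum_congr rfl fun k _ => ?_
  by_cases h1 : (k : ℕ) < j <;> by_cases h2 : Even (k : ℕ) <;>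
    simp [h1, h2, ← Nat.not_even_iff_odd, not_le.2, not_lt.1]

theorem diagRefl_P {j : ℕ} (hj : j ≤ 2 * g) : diagRefl (X.P j) = X.P (2 * g - j) := by
  have key : ∀ j ≤ 2 * g, -(X.P j).im = (X.P (2 * g - j)).re := by
    intro j hj
    rw [P_im, P_re, neg_neg, ← Equiv.sum_comp Fin.revPerm]
    refine Finset.sum_congr rfl fun k _ => ?_
    have hk := k.2
    have h1 : j ≤ ((Fin.revPerm k : Fin (2 * g)) : ℕ) ↔ (k : ℕ) < 2 * g - j := by
      simp only [Fin.revPerm_apply, Fin.val_rev]; omega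
    have h2 : Odd ((Fin.revPerm k : Fin (2 * g)) : ℕ) ↔ Even (k : ℕ) := by
      simp only [Fin.revPerm_apply, Fin.val_rev, Nat.odd_iff, Nat.even_iff]; omega
    simp only [h1, h2]
    simp only [Fin.revPerm_apply, X.len_symm]
  apply Complex.ext
  · rw [diagRefl_re, key j hj]
  · rw [diagRefl_im, ← neg_neg (X.P (2 * g - j)).im, key _ (Nat.sub_le _ _), Nat.sub_sub_self hj]

theorem P_re_mono : Monotone fun j => (X.P j).re := by
  intro i j hij
  simp only [P_re]
  refine Finset.sum_le_sum fun k _ => ?_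
  have := (X.len_pos k).le
  split_ifs with h1 h2 h2
  exacts [le_rfl, absurd ⟨h1.1.trans_le hij, h1.2⟩ h2, this, le_rfl]

theorem P_im_mono : Monotone fun j => (X.P j).im := by
  intro i j hij
  simp only [P_im]
  refine neg_le_neg (Finset.sum_le_sum fun k _ => ?_)
  have := (X.len_pos k).le
  split_ifs with h1 h2 h2
  exacts [le_rfl, absurd ⟨hij.trans h1.1, h1.2⟩ h2, this, le_rfl]

theorem P_zero_re : (X.P 0).re = 0 := by simp [P_re]

theorem P_im_eq_zero {j : ℕ} (hj : 2 * g ≤ j) : (X.P j).im = 0 := by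
  rw [P_im, neg_eq_zero]
  exact Finset.sum_eq_zero fun k _ => if_neg fun h => absurd k.2 (not_lt.2 (hj.trans h.1))

theorem P_re_nonneg (j : ℕ) : 0 ≤ (X.P j).re := by
  rw [← X.P_zero_re]; exact X.P_re_mono (Nat.zero_le j)

theorem P_im_nonpos (j : ℕ) : (X.P j).im ≤ 0 := by
  rw [← X.P_im_eq_zero (le_max_right j (2 * g))]; exact X.P_im_mono (le_max_left _ _)

/-- Even steps of the staircase go to the right. -/
theorem P_succ_of_even {j : ℕ} (hj : j < 2 * g) (h : Even j) :
    (X.P j).re < (X.P (j + 1)).re ∧ (X.P (j + 1)).im = (X.P j).im := by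
  constructor
  · simp only [P_re]
    refine Finset.sum_lt_sum (fun k _ => ?_) ⟨⟨j, hj⟩, Finset.mem_univ _, ?_⟩
    · have := (X.len_pos k).le
      split_ifs with h1 h2 h2
      exacts [le_rfl, absurd ⟨by omega, h1.2⟩ h2, this, le_rfl]
    · simp [h, X.len_pos]
  · simp only [P_im]
    congr 1
    refine Finset.sum_congr rfl fun k _ => if_congr (and_congr_left fun hk => ?_) rfl rfl
    have : (k : ℕ) ≠ j := fun h' => (Nat.not_even_iff_odd.2 hk) (h' ▸ h)
    omega

/-- Odd steps of the staircase go upwards. -/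
theorem P_succ_of_odd {j : ℕ} (hj : j < 2 * g) (h : Odd j) :
    (X.P j).im < (X.P (j + 1)).im ∧ (X.P (j + 1)).re = (X.P j).re := by
  constructor
  · simp only [P_im]
    refine neg_lt_neg (Finset.sum_lt_sum (fun k _ => ?_) ⟨⟨j, hj⟩, Finset.mem_univ _, ?_⟩)
    · have := (X.len_pos k).le
      split_ifs with h1 h2 h2
      exacts [le_rfl, absurd ⟨by omega, h1.2⟩ h2, this, le_rfl]
    · simp [h, X.len_pos]
  · simp only [P_re]
    refine Finset.sum_congr rfl fun k _ => if_congr (and_congr_left fun hk => ?_) rfl rfl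
    have : (k : ℕ) ≠ j := fun h' => (Nat.not_even_iff_odd.2 h) (h' ▸ hk)
    omega

theorem P_middle_im : (X.P g).im = -(X.P g).re := by
  have h := congrArg Complex.im (X.diagRefl_P (j := g) (by omega))
  rw [diagRefl_im, show 2 * g - g = g by omega] at h
  exact h.symm

theorem middle_lt_b : (X.P g).re < X.b := X.lt_b

theorem b_pos : 0 < X.b := (X.P_re_nonneg g).trans_lt X.middle_lt_b

/-- The range of the coordinate along the edge with index `k`. -/
def edgeRange (k : ℕ) : Set ℝ :=
  if Even k then {t | (k ≠ 0 → (X.P (k - 1)).im < t) ∧ t < (X.P k).im}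
  else {t | (X.P (k - 1)).re < t ∧ (k ≤ 2 * g → t < (X.P k).re)}

theorem edgeRange_of_even {k : ℕ} (hk : Even k) :
    X.edgeRange k = {t | (k ≠ 0 → (X.P (k - 1)).im < t) ∧ t < (X.P k).im} := if_pos hk

theorem edgeRange_of_odd {k : ℕ} (hk : Odd k) :
    X.edgeRange k = {t | (X.P (k - 1)).re < t ∧ (k ≤ 2 * g → t < (X.P k).re)} :=
  if_neg (Nat.not_even_iff_odd.2 hk)

theorem ordConnected_edgeRange (k : ℕ) : (X.edgeRange k).OrdConnected := by
  unfold edgeRange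
  split_ifs with h
  · exact ⟨fun s hs t ht u hu => ⟨fun h0 => (hs.1 h0).trans_le hu.1, hu.2.trans_lt ht.2⟩⟩
  · exact ⟨fun s hs t ht u hu => ⟨hs.1.trans_le hu.1, fun h0 => hu.2.trans_lt (ht.2 h0)⟩⟩

theorem nonempty_edgeRange {k : ℕ} (hk : k ≤ 2 * g + 1) : (X.edgeRange k).Nonempty := by
  unfold edgeRange
  split_ifs with h
  · by_cases h0 : k = 0
    · obtain ⟨t, ht⟩ := exists_lt (X.P k).im
      exact ⟨t, fun h' => absurd h0 h', ht⟩
    · obtain ⟨j, rfl⟩ : ∃ j, k = j + 1 := ⟨k - 1, by omega⟩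
      have hj : Odd j := by grind
      obtain ⟨t, h1, h2⟩ := exists_between (X.P_succ_of_odd (by grind) hj).1
      exact ⟨t, fun _ => h1, h2⟩
  · obtain ⟨j, rfl⟩ : ∃ j, k = j + 1 := ⟨k - 1, by grind⟩
    have hj : Even j := by grind
    by_cases h0 : j + 1 ≤ 2 * g
    · obtain ⟨t, h1, h2⟩ := exists_between (X.P_succ_of_even (by omega) hj).1
      exact ⟨t, h1, fun _ => h2⟩
    · obtain ⟨t, ht⟩ := exists_gt (X.P j).re
      exact ⟨t, ht, fun h' => absurd h' h0⟩

theorem mem_openSegment_horizontal {p q z : ℂ} (h : p.re < q.re) (h' : q.im = p.im) :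
    z ∈ openSegment ℝ p q ↔ z.im = q.im ∧ p.re < z.re ∧ z.re < q.re := by
  rw [openSegment_eq_image']
  have hpos : 0 < q.re - p.re := sub_pos.2 h
  constructor
  · rintro ⟨t, ht, rfl⟩
    simp only [Complex.add_im, Complex.add_re, Complex.real_smul, Complex.re_ofReal_mul,
      Complex.im_ofReal_mul, Complex.sub_re, Complex.sub_im]
    refine ⟨by rw [h']; ring, ?_, ?_⟩ <;> nlinarith [ht.1, ht.2]
  · rintro ⟨h1, h2, h3⟩
    refine ⟨(z.re - p.re) / (q.re - p.re), ⟨by positivity [sub_pos.2 h2], ?_⟩, ?_⟩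
    · rw [div_lt_one hpos]; linarith
    · apply Complex.ext
      · simp only [Complex.add_re, Complex.real_smul, Complex.re_ofReal_mul, Complex.sub_re]
        field_simp; ring
      · simp only [Complex.add_im, Complex.real_smul, Complex.im_ofReal_mul, Complex.sub_im]
        rw [h1, h']; ring

theorem mem_openSegment_vertical {p q z : ℂ} (h : p.im < q.im) (h' : q.re = p.re) :
    z ∈ openSegment ℝ p q ↔ z.re = q.re ∧ p.im < z.im ∧ z.im < q.im := by
  rw [openSegment_eq_image']
  have hpos : 0 < q.im - p.im := sub_pos.2 h
  constructor
  · rintro ⟨t, ht, rfl⟩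
    simp only [Complex.add_im, Complex.add_re, Complex.real_smul, Complex.re_ofReal_mul,
      Complex.im_ofReal_mul, Complex.sub_re, Complex.sub_im]
    refine ⟨by rw [h']; ring, ?_, ?_⟩ <;> nlinarith [ht.1, ht.2]
  · rintro ⟨h1, h2, h3⟩
    refine ⟨(z.im - p.im) / (q.im - p.im), ⟨by positivity [sub_pos.2 h2], ?_⟩, ?_⟩
    · rw [div_lt_one hpos]; linarith
    · apply Complex.ext
      · simp only [Complex.add_re, Complex.real_smul, Complex.re_ofReal_mul, Complex.sub_re]
        rw [h1, h']; ring
      · simp only [Complex.add_im, Complex.real_smul, Complex.im_ofReal_mul, Complex.sub_im]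
        field_simp; ring

theorem edge_of_even {k : ℕ} (hk : k ≤ 2 * g) (h : Even k) :
    X.edge k = {z | z.re = (X.P k).re ∧ z.im ∈ X.edgeRange k} := by
  rw [edgeRange_of_even X h]
  ext z
  by_cases h0 : k = 0
  · subst h0
    simp [edge, P_zero_re]
  · obtain ⟨j, rfl⟩ : ∃ j, k = j + 1 := ⟨k - 1, by omega⟩
    obtain ⟨h1, h2⟩ := X.P_succ_of_odd (j := j) (by omega) (by grind)
    rw [edge, if_neg h0, if_pos hk, Nat.add_sub_cancel, mem_openSegment_vertical h1 h2]
    simp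

theorem edge_of_odd {k : ℕ} (hk : k ≤ 2 * g + 1) (h : Odd k) :
    X.edge k = {z | z.im = (X.P k).im ∧ z.re ∈ X.edgeRange k} := by
  rw [edgeRange_of_odd X h]
  have h0 : k ≠ 0 := by grind
  ext z
  obtain ⟨j, rfl⟩ : ∃ j, k = j + 1 := ⟨k - 1, by omega⟩
  by_cases hg : j + 1 ≤ 2 * g
  · obtain ⟨h1, h2⟩ := X.P_succ_of_even (j := j) (by omega) (by grind)
    rw [edge, if_neg h0, if_pos hg, Nat.add_sub_cancel, mem_openSegment_horizontal h1 h2]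
    simp [hg]
  · obtain rfl : j = 2 * g := by omega
    simp [edge, P_im_eq_zero]

theorem P_pred_of_even {k : ℕ} (hk : k ≤ 2 * g) (h : Even k) : (X.P (k - 1)).re = (X.P k).re := by
  by_cases h0 : k = 0
  · simp [h0]
  · obtain ⟨j, rfl⟩ : ∃ j, k = j + 1 := ⟨k - 1, by omega⟩
    exact (X.P_succ_of_odd (j := j) (by omega) (by grind)).2.symm

theorem P_pred_of_odd {k : ℕ} (hk : k ≤ 2 * g + 1) (h : Odd k) :
    (X.P (k - 1)).im = (X.P k).im := by
  obtain ⟨j, rfl⟩ : ∃ j, k = j + 1 := ⟨k - 1, by grind⟩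
  rw [Nat.add_sub_cancel]
  by_cases hg : j < 2 * g
  · exact (X.P_succ_of_even hg (by grind)).2.symm
  · rw [X.P_im_eq_zero (not_lt.1 hg), X.P_im_eq_zero (by omega)]

/-- Direction of the edges of the zigzag. -/
def edgeDir (k : ℕ) : ℂ := if Even k then Complex.I else 1

/-- Base point of the line through an edge of the zigzag. -/
def edgeBase (k : ℕ) : ℂ := if Even k then ((X.P k).re : ℂ) else (X.P k).im * Complex.I

theorem isStraight_edge {k : ℕ} (hk : k ≤ 2 * g + 1) :
    IsStraight (X.edge k) (X.edgeBase k) (edgeDir k) (X.edgeRange k) := by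
  have h2 := X.ordConnected_edgeRange k
  have h3 := X.nonempty_edgeRange hk
  by_cases h : Even k
  · rw [edgeBase, edgeDir, if_pos h, if_pos h, X.edge_of_even (by grind) h]
    exact isStraight_vertical _ h2 h3
  · rw [edgeBase, edgeDir, if_neg h, if_neg h, X.edge_of_odd hk (Nat.not_even_iff_odd.1 h)]
    exact isStraight_horizontal _ h2 h3

theorem startsAt_edge (D : Labelled) {k : ℕ} (hk : k ≤ 2 * g) :
    StartsAt D (X.edgeBase (k + 1)) (edgeDir (k + 1)) (X.edgeRange (k + 1)) (𝓝[D.dom] (X.P k)) := by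
  by_cases h : Even (k + 1)
  · have hp : X.P k = X.edgeBase (k + 1) + edgeDir (k + 1) * ((X.P k).im : ℝ) := by
      have := X.P_pred_of_even (by grind) h
      rw [Nat.add_sub_cancel] at this
      rw [edgeBase, edgeDir, if_pos h, if_pos h, ← this]
      apply Complex.ext <;> simp
    rw [hp]
    refine startsAt_nhdsWithin fun t ht => ?_
    rw [edgeRange_of_even X h] at ht ⊢
    exact ⟨ht.1 (by omega), fun s hs => ⟨fun _ => hs.1, hs.2.trans ht.2⟩⟩
  · have h' := Nat.not_even_iff_odd.1 h
    have hp : X.P k = X.edgeBase (k + 1) + edgeDir (k + 1) * ((X.P k).re : ℝ) := by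
      have := X.P_pred_of_odd (by omega) h'
      rw [Nat.add_sub_cancel] at this
      rw [edgeBase, edgeDir, if_neg h, if_neg h, ← this]
      apply Complex.ext <;> simp
    rw [hp]
    refine startsAt_nhdsWithin fun t ht => ?_
    rw [edgeRange_of_odd X h'] at ht ⊢
    exact ⟨ht.1, fun s hs => ⟨hs.1, fun hg => hs.2.trans (ht.2 hg)⟩⟩

theorem endsAt_edge (D : Labelled) {k : ℕ} (hk : k ≤ 2 * g) :
    EndsAt D (X.edgeBase k) (edgeDir k) (X.edgeRange k) (𝓝[D.dom] (X.P k)) := by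
  by_cases h : Even k
  · have hp : X.P k = X.edgeBase k + edgeDir k * ((X.P k).im : ℝ) := by
      rw [edgeBase, edgeDir, if_pos h, if_pos h]
      apply Complex.ext <;> simp
    rw [hp]
    refine endsAt_nhdsWithin fun t ht => ?_
    rw [edgeRange_of_even X h] at ht ⊢
    exact ⟨ht.2, fun s hs => ⟨fun h0 => (ht.1 h0).trans hs.1, hs.2⟩⟩
  · have h' := Nat.not_even_iff_odd.1 h
    have hp : X.P k = X.edgeBase k + edgeDir k * ((X.P k).re : ℝ) := by
      rw [edgeBase, edgeDir, if_neg h, if_neg h]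
      apply Complex.ext <;> simp
    rw [hp]
    refine endsAt_nhdsWithin fun t ht => ?_
    rw [edgeRange_of_odd X h'] at ht ⊢
    exact ⟨ht.2 hk, fun s hs => ⟨ht.1.trans hs.1, fun _ => hs.2⟩⟩

theorem startsAt_edge_zero (D : Labelled) :
    StartsAt D (X.edgeBase 0) (edgeDir 0) (X.edgeRange 0) (downEnd D.dom) := by
  rw [edgeDir, if_pos Even.zero]
  refine startsAt_downEnd fun t ht s hs => ?_
  rw [edgeRange_of_even X Even.zero] at ht ⊢
  exact ⟨fun h => absurd rfl h, lt_trans hs ht.2⟩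

theorem endsAt_edge_last (D : Labelled) :
    EndsAt D (X.edgeBase (2 * g + 1)) (edgeDir (2 * g + 1)) (X.edgeRange (2 * g + 1))
      (rightEnd D.dom) := by
  have h : Odd (2 * g + 1) := ⟨g, rfl⟩
  rw [edgeDir, if_neg (Nat.not_even_iff_odd.2 h)]
  refine endsAt_rightEnd fun t ht s hs => ?_
  rw [edgeRange_of_odd X h] at ht ⊢
  exact ⟨ht.1.trans hs, fun h => absurd h (by omega)⟩

/-! ### The two sides of the zigzag -/

theorem mem_zigzag {z : ℂ} :
    z ∈ X.zigzag ↔ (∃ k ≤ 2 * g + 1, z ∈ X.edge k) ∨ ∃ j ≤ 2 * g, z = X.P j := by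
  simp only [zigzag, mem_union, mem_iUnion, Finset.mem_range, mem_singleton_iff, exists_prop,
    Nat.lt_succ_iff]

theorem mem_edge_cases {k : ℕ} (hk : k ≤ 2 * g + 1) {z : ℂ} (hz : z ∈ X.edge k) :
    (k ≤ 2 * g ∧ z.re = (X.P k).re ∧ (X.P (k - 1)).re = z.re ∧
      (k ≠ 0 → (X.P (k - 1)).im < z.im) ∧ z.im < (X.P k).im) ∨
    (k ≠ 0 ∧ z.im = (X.P k).im ∧ (X.P (k - 1)).im = z.im ∧
      (X.P (k - 1)).re < z.re ∧ (k ≤ 2 * g → z.re < (X.P k).re)) := by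
  by_cases h : Even k
  · have hk' : k ≤ 2 * g := by grind
    rw [X.edge_of_even hk' h, edgeRange_of_even X h] at hz
    exact Or.inl ⟨hk', hz.1, (X.P_pred_of_even hk' h).trans hz.1.symm, hz.2.1, hz.2.2⟩
  · have h' := Nat.not_even_iff_odd.1 h
    rw [X.edge_of_odd hk h', edgeRange_of_odd X h'] at hz
    exact Or.inr ⟨by grind, hz.1, (X.P_pred_of_odd hk h').trans hz.1.symm, hz.2.1, hz.2.2⟩

theorem mem_upperLeft {z : ℂ} : z ∈ X.upperLeft ↔
    z.re < 0 ∨ 0 < z.im ∨ ∃ j ≤ 2 * g, z.re < (X.P j).re ∧ (X.P j).im < z.im := by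
  constructor
  · rintro ⟨w, hw, h1, h2⟩
    rcases X.mem_zigzag.1 hw with ⟨k, hk, hw⟩ | ⟨j, hj, rfl⟩
    · rcases X.mem_edge_cases hk hw with ⟨hk', e1, e2, e3, e4⟩ | ⟨hk', e1, e2, e3, e4⟩
      · by_cases h0 : k = 0
        · left
          rw [h0, X.P_zero_re] at e1
          linarith
        · exact Or.inr (Or.inr ⟨k - 1, by omega, by linarith, by linarith [e3 h0]⟩)
      · by_cases h0 : k ≤ 2 * g
        · exact Or.inr (Or.inr ⟨k, h0, by linarith [e4 h0], by linarith⟩)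
        · rw [X.P_im_eq_zero (by omega)] at e1
          exact Or.inr (Or.inl (by linarith))
    · exact Or.inr (Or.inr ⟨j, hj, h1, h2⟩)
  · rintro (h | h | ⟨j, hj, h1, h2⟩)
    · refine ⟨⟨0, min (X.P 0).im z.im - 1⟩, X.mem_zigzag.2 (Or.inl ⟨0, by omega, ?_⟩), h, ?_⟩
      · rw [edge, if_pos rfl]
        exact ⟨rfl, by linarith [min_le_left (X.P 0).im z.im]⟩
      · show min (X.P 0).im z.im - 1 < z.im
        linarith [min_le_right (X.P 0).im z.im]
    · refine ⟨⟨max (X.P (2 * g)).re z.re + 1, 0⟩,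
        X.mem_zigzag.2 (Or.inl ⟨2 * g + 1, le_rfl, ?_⟩), ?_, h⟩
      · rw [edge, if_neg (by omega), if_neg (by omega)]
        exact ⟨rfl, by linarith [le_max_left (X.P (2 * g)).re z.re]⟩
      · show z.re < max (X.P (2 * g)).re z.re + 1
        linarith [le_max_right (X.P (2 * g)).re z.re]
    · exact ⟨X.P j, X.mem_zigzag.2 (Or.inr ⟨j, hj, rfl⟩), h1, h2⟩

theorem mem_lowerRight {z : ℂ} : z ∈ X.lowerRight ↔
    ∃ j ≤ 2 * g, (X.P j).re < z.re ∧ z.im < (X.P j).im := by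
  constructor
  · rintro ⟨w, hw, h1, h2⟩
    rcases X.mem_zigzag.1 hw with ⟨k, hk, hw⟩ | ⟨j, hj, rfl⟩
    · rcases X.mem_edge_cases hk hw with ⟨hk', e1, e2, e3, e4⟩ | ⟨hk', e1, e2, e3, e4⟩
      · exact ⟨k, hk', by linarith, by linarith⟩
      · exact ⟨k - 1, by omega, by linarith, by linarith⟩
    · exact ⟨j, hj, h1, h2⟩
  · rintro ⟨j, hj, h1, h2⟩
    exact ⟨X.P j, X.mem_zigzag.2 (Or.inr ⟨j, hj, rfl⟩), h1, h2⟩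

theorem isOpen_upperLeft : IsOpen X.upperLeft := by
  have : X.upperLeft = ⋃ w ∈ X.zigzag, {z : ℂ | z.re < w.re ∧ w.im < z.im} := by
    ext z; simp only [upperLeft, mem_ofPred_eq, mem_iUnion, exists_prop]
  rw [this]
  exact isOpen_biUnion fun w _ => (isOpen_lt Complex.continuous_re continuous_const).inter
    (isOpen_lt continuous_const Complex.continuous_im)

theorem isOpen_lowerRight : IsOpen X.lowerRight := by
  have : X.lowerRight = ⋃ w ∈ X.zigzag, {z : ℂ | w.re < z.re ∧ z.im < w.im} := by
    ext z; simp only [lowerRight, mem_ofPred_eq, mem_iUnion, exists_prop]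
  rw [this]
  exact isOpen_biUnion fun w _ => (isOpen_lt continuous_const Complex.continuous_re).inter
    (isOpen_lt Complex.continuous_im continuous_const)

theorem lt_of_P_re_lt {i j : ℕ} (h : (X.P i).re < (X.P j).re) : i < j :=
  X.P_re_mono.reflect_lt h

theorem lt_of_P_im_lt {i j : ℕ} (h : (X.P i).im < (X.P j).im) : i < j :=
  X.P_im_mono.reflect_lt h

theorem disjoint_upperLeft_lowerRight : Disjoint X.upperLeft X.lowerRight := by
  rw [Set.disjoint_left]
  intro z h1 h2
  obtain ⟨i, hi, h2, h3⟩ := X.mem_lowerRight.1 h2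
  rcases X.mem_upperLeft.1 h1 with h | h | ⟨j, hj, h4, h5⟩
  · linarith [X.P_re_nonneg i]
  · linarith [X.P_im_nonpos i]
  · exact lt_asymm (X.lt_of_P_re_lt (h2.trans h4)) (X.lt_of_P_im_lt (h5.trans h3))

theorem zigzag_bounds {z : ℂ} (hz : z ∈ X.zigzag) :
    0 ≤ z.re ∧ z.im ≤ 0 ∧ (z.re ≤ (X.P g).re ∨ -(X.P g).re ≤ z.im) := by
  rw [← X.P_middle_im]
  rcases X.mem_zigzag.1 hz with ⟨k, hk, hw⟩ | ⟨j, hj, rfl⟩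
  · have hk1 := X.P_re_nonneg k
    have hk2 := X.P_im_nonpos k
    have hk3 := X.P_re_nonneg (k - 1)
    rcases X.mem_edge_cases hk hw with ⟨hk', e1, e2, e3, e4⟩ | ⟨hk', e1, e2, e3, e4⟩
    · refine ⟨by linarith, by linarith, ?_⟩
      rcases Nat.lt_or_ge g k with h | h
      · right
        have : (X.P g).im ≤ (X.P (k - 1)).im := X.P_im_mono (by omega)
        linarith [e3 (by omega)]
      · left
        rw [e1]; exact X.P_re_mono h
    · refine ⟨by linarith, by linarith, ?_⟩
      rcases Nat.lt_or_ge g k with h | h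
      · right
        rw [e1]; exact X.P_im_mono h.le
      · left
        have : (X.P k).re ≤ (X.P g).re := X.P_re_mono h
        linarith [e4 (by omega)]
  · refine ⟨X.P_re_nonneg j, X.P_im_nonpos j, ?_⟩
    rcases le_total j g with h | h
    exacts [Or.inl (X.P_re_mono h), Or.inr (X.P_im_mono h)]

theorem notMem_of_mem_zigzag {z : ℂ} (hz : z ∈ X.zigzag) :
    z ∉ X.upperLeft ∧ z ∉ X.lowerRight := by
  obtain ⟨hre, him, -⟩ := X.zigzag_bounds hz
  rw [mem_upperLeft, mem_lowerRight]
  rcases X.mem_zigzag.1 hz with ⟨k, hk, hw⟩ | ⟨j, hj, rfl⟩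
  · rcases X.mem_edge_cases hk hw with ⟨hk', e1, e2, e3, e4⟩ | ⟨hk', e1, e2, e3, e4⟩
    · constructor
      · rintro (h | h | ⟨i, hi, h1, h2⟩)
        · linarith
        · linarith
        · exact lt_asymm (X.lt_of_P_re_lt (e1 ▸ h1)) (X.lt_of_P_im_lt (h2.trans e4))
      · rintro ⟨i, hi, h1, h2⟩
        have hik := X.lt_of_P_re_lt (e1 ▸ h1)
        have : (X.P i).im ≤ (X.P (k - 1)).im := X.P_im_mono (by omega)
        linarith [e3 (by omega)]
    · constructor
      · rintro (h | h | ⟨i, hi, h1, h2⟩)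
        · linarith
        · linarith
        · have hik := X.lt_of_P_im_lt (e1 ▸ h2)
          have : (X.P i).re ≤ (X.P (k - 1)).re := X.P_re_mono (by omega)
          linarith
      · rintro ⟨i, hi, h1, h2⟩
        have hik := X.lt_of_P_im_lt (e1 ▸ h2)
        have : (X.P k).re ≤ (X.P i).re := X.P_re_mono hik.le
        linarith [e4 (by omega)]
  · constructor
    · rintro (h | h | ⟨i, hi, h1, h2⟩)
      · linarith
      · linarith
      · exact lt_asymm (X.lt_of_P_re_lt h1) (X.lt_of_P_im_lt h2)
    · rintro ⟨i, hi, h1, h2⟩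
      exact lt_asymm (X.lt_of_P_re_lt h1) (X.lt_of_P_im_lt h2)

theorem mem_zigzag_of_notMem {z : ℂ} (h1 : z ∉ X.upperLeft) (h2 : z ∉ X.lowerRight) :
    z ∈ X.zigzag := by
  rw [mem_upperLeft] at h1
  rw [mem_lowerRight] at h2
  push Not at h1 h2
  obtain ⟨hre, him, h1⟩ := h1
  have key : ∀ m n, m + n = 2 * g → (X.P n).re ≤ z.re → (X.P n).im ≤ z.im → z ∈ X.zigzag := by
    intro m
    induction m with
    | zero =>
      intro n hn e1 e2
      obtain rfl : n = 2 * g := by omega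
      rw [X.P_im_eq_zero le_rfl] at e2
      have e3 : z.im = 0 := le_antisymm him e2
      rcases e1.eq_or_lt with e1 | e1
      · exact X.mem_zigzag.2 (Or.inr ⟨2 * g, le_rfl,
          Complex.ext e1.symm (by rw [e3, X.P_im_eq_zero le_rfl])⟩)
      · refine X.mem_zigzag.2 (Or.inl ⟨2 * g + 1, le_rfl, ?_⟩)
        rw [edge, if_neg (by omega), if_neg (by omega)]
        exact ⟨e3, e1⟩
    | succ m ih =>
      intro n hn e1 e2
      by_cases hc : (X.P (n + 1)).re ≤ z.re ∧ (X.P (n + 1)).im ≤ z.im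
      · exact ih (n + 1) (by omega) hc.1 hc.2
      · rcases Nat.even_or_odd n with hpar | hpar
        · obtain ⟨s1, s2⟩ := X.P_succ_of_even (by omega) hpar
          have e3 : z.re < (X.P (n + 1)).re := by
            by_contra! h; exact hc ⟨h, s2.le.trans e2⟩
          have e4 : z.im = (X.P n).im := le_antisymm (s2 ▸ h1 (n + 1) (by omega) e3) e2
          rcases e1.eq_or_lt with e1 | e1
          · exact X.mem_zigzag.2 (Or.inr ⟨n, by omega, Complex.ext e1.symm e4⟩)
          · refine X.mem_zigzag.2 (Or.inl ⟨n + 1, by omega, ?_⟩)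
            rw [X.edge_of_odd (by omega) (by grind), edgeRange_of_odd X (by grind)]
            exact ⟨e4.trans s2.symm, e1, fun _ => e3⟩
        · obtain ⟨s1, s2⟩ := X.P_succ_of_odd (by omega) hpar
          have e3 : z.im < (X.P (n + 1)).im := by
            by_contra! h; exact hc ⟨s2.le.trans e1, h⟩
          have e4 : z.re = (X.P n).re := by
            refine le_antisymm ?_ e1
            by_contra! h
            exact absurd (h2 (n + 1) (by omega) (s2 ▸ h)) (not_le.2 e3)
          rcases e2.eq_or_lt with e2 | e2
          · exact X.mem_zigzag.2 (Or.inr ⟨n, by omega, Complex.ext e4 e2.symm⟩)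
          · refine X.mem_zigzag.2 (Or.inl ⟨n + 1, by omega, ?_⟩)
            rw [X.edge_of_even (by omega) (by grind), edgeRange_of_even X (by grind)]
            exact ⟨e4.trans s2.symm, fun _ => e2, e3⟩
  by_cases h0 : (X.P 0).im ≤ z.im
  · exact key (2 * g) 0 (by omega) (by rwa [X.P_zero_re]) h0
  · push Not at h0
    have e : z.re = 0 := by
      refine le_antisymm ?_ hre
      by_contra! h
      exact absurd (h2 0 (by omega) (by rwa [X.P_zero_re])) (not_le.2 h0)
    refine X.mem_zigzag.2 (Or.inl ⟨0, by omega, ?_⟩)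
    rw [edge, if_pos rfl]
    exact ⟨e, h0⟩

theorem hasCornerGerm_upperLeft (p : ℂ) : HasCornerGerm 1 X.upperLeft p := by
  have : X.upperLeft = ({z | 1 * z.re < 0} ∪ {z | 0 < 1 * z.im}) ∪
      ⋃ j ≤ 2 * g, {z : ℂ | 1 * z.re < (X.P j).re} ∩ {z | (X.P j).im < 1 * z.im} := by
    ext z
    simp only [mem_upperLeft, mem_union, mem_iUnion, mem_inter_iff, mem_ofPred_eq, exists_prop,
      one_mul, or_assoc]
  rw [this]
  exact ((hasCornerGerm_re _ _ _).union (hasCornerGerm_im _ _ _)).union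
    (HasCornerGerm.biUnion (fun j => (hasCornerGerm_re _ _ _).inter (hasCornerGerm_im _ _ _)) _)

theorem hasCornerGerm_lowerRight (p : ℂ) : HasCornerGerm (-1) X.lowerRight p := by
  have : X.lowerRight =
      ⋃ j ≤ 2 * g, {z : ℂ | -1 * z.re < -(X.P j).re} ∩ {z | -(X.P j).im < -1 * z.im} := by
    ext z
    simp only [mem_lowerRight, mem_iUnion, mem_inter_iff, mem_ofPred_eq, exists_prop, neg_mul,
      one_mul, neg_lt_neg_iff]
  rw [this]
  exact HasCornerGerm.biUnion (fun j => (hasCornerGerm_re _ _ _).inter (hasCornerGerm_im _ _ _)) _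

end Coord

namespace Coord

/-! ### The two orthodisks -/

variable {g : ℕ} (X : Coord g)

theorem upperLeft_of_le {z w : ℂ} (hz : z ∈ X.upperLeft) (h1 : w.re ≤ z.re) (h2 : z.im ≤ w.im) :
    w ∈ X.upperLeft := by
  obtain ⟨p, hp, h3, h4⟩ := hz
  exact ⟨p, hp, h1.trans_lt h3, h4.trans_le h2⟩

theorem lowerRight_of_le {z w : ℂ} (hz : z ∈ X.lowerRight) (h1 : z.re ≤ w.re) (h2 : w.im ≤ z.im) :
    w ∈ X.lowerRight := by
  obtain ⟨p, hp, h3, h4⟩ := hz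
  exact ⟨p, hp, h3.trans_le h1, h2.trans_lt h4⟩

theorem lowerRight_bounds {z : ℂ} (hz : z ∈ X.lowerRight) : 0 < z.re ∧ z.im < 0 := by
  obtain ⟨j, -, h1, h2⟩ := X.mem_lowerRight.1 hz
  exact ⟨(X.P_re_nonneg j).trans_lt h1, h2.trans_le (X.P_im_nonpos j)⟩

theorem diagRefl_upperLeft {z : ℂ} (hz : z ∈ X.upperLeft) : diagRefl z ∈ X.upperLeft := by
  rw [mem_upperLeft] at hz ⊢
  rw [diagRefl_re, diagRefl_im]
  rcases hz with h | h | ⟨j, hj, h1, h2⟩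
  · exact Or.inr (Or.inl (by linarith))
  · exact Or.inl (by linarith)
  · refine Or.inr (Or.inr ⟨2 * g - j, Nat.sub_le _ _, ?_, ?_⟩) <;> rw [← X.diagRefl_P hj]
    · rw [diagRefl_re]; linarith
    · rw [diagRefl_im]; linarith

theorem diagRefl_lowerRight {z : ℂ} (hz : z ∈ X.lowerRight) : diagRefl z ∈ X.lowerRight := by
  rw [mem_lowerRight] at hz ⊢
  rw [diagRefl_re, diagRefl_im]
  obtain ⟨j, hj, h1, h2⟩ := hz
  refine ⟨2 * g - j, Nat.sub_le _ _, ?_, ?_⟩ <;> rw [← X.diagRefl_P hj]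
  · rw [diagRefl_re]; linarith
  · rw [diagRefl_im]; linarith

theorem mem_plus {z : ℂ} : z ∈ X.plus.dom ↔ z ∈ X.upperLeft ∧ -X.b < z.re ∧ z.im < X.b := Iff.rfl

theorem mem_minus {z : ℂ} :
    z ∈ X.minus.dom ↔ z ∈ X.lowerRight ∧ (z.re < X.b ∨ -X.b < z.im) := Iff.rfl

theorem isOpen_plus : IsOpen X.plus.dom :=
  X.isOpen_upperLeft.inter ((isOpen_lt continuous_const Complex.continuous_re).inter
    (isOpen_lt Complex.continuous_im continuous_const))

theorem isOpen_minus : IsOpen X.minus.dom :=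
  X.isOpen_lowerRight.inter ((isOpen_lt Complex.continuous_re continuous_const).union
    (isOpen_lt continuous_const Complex.continuous_im))

theorem closure_plus {z : ℂ} (hz : z ∈ closure X.plus.dom) :
    z ∉ X.lowerRight ∧ -X.b ≤ z.re ∧ z.im ≤ X.b := by
  have hc : IsClosed (X.lowerRightᶜ ∩ {z | -X.b ≤ z.re ∧ z.im ≤ X.b}) :=
    X.isOpen_lowerRight.isClosed_compl.inter ((isClosed_le continuous_const Complex.continuous_re).inter
      (isClosed_le Complex.continuous_im continuous_const))
  refine closure_minimal (fun w hw => ?_) hc hz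
  exact ⟨Set.disjoint_left.1 X.disjoint_upperLeft_lowerRight hw.1, hw.2.1.le, hw.2.2.le⟩

theorem closure_minus {z : ℂ} (hz : z ∈ closure X.minus.dom) :
    z ∉ X.upperLeft ∧ (z.re ≤ X.b ∨ -X.b ≤ z.im) := by
  have hc : IsClosed (X.upperLeftᶜ ∩ {z | z.re ≤ X.b ∨ -X.b ≤ z.im}) :=
    X.isOpen_upperLeft.isClosed_compl.inter ((isClosed_le Complex.continuous_re continuous_const).union
      (isClosed_le continuous_const Complex.continuous_im))
  refine closure_minimal (fun w hw => ?_) hc hz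
  exact ⟨Set.disjoint_right.1 X.disjoint_upperLeft_lowerRight hw.1, hw.2.imp le_of_lt le_of_lt⟩

theorem isSimplyConnected_plus : IsSimplyConnected X.plus.dom := by
  have hb := X.b_pos
  refine isSimplyConnected_of_cornerCurve (d := -(X.b / 2)) (fun s => ?_)
    (segment_subset_inter (fun z hz w h1 h2 => X.upperLeft_of_le hz h1 h2)
      fun z hz w h1 h2 => ⟨hz.1.trans_le h1, h2.trans_lt hz.2⟩)
  rw [mem_plus, mem_upperLeft]
  simp only [cornerCurve]
  rcases le_total 0 s with h | h
  · rw [abs_of_nonneg h]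
    exact ⟨Or.inr (Or.inl (by linarith)), by linarith, by linarith⟩
  · rw [abs_of_nonpos h]
    exact ⟨Or.inl (by linarith), by linarith, by linarith⟩

theorem isSimplyConnected_minus : IsSimplyConnected X.minus.dom := by
  have hb := X.middle_lt_b
  have hm := X.P_middle_im
  have hconv := segment_subset_inter (S := {z : ℂ | z.re < X.b ∨ -X.b < z.im}) (T := X.lowerRight)
    (fun z hz w h1 h2 => hz.imp h1.trans_lt fun h => h.trans_le h2)
    fun z hz w h1 h2 => X.lowerRight_of_le hz h1 h2
  rw [inter_comm] at hconv
  refine isSimplyConnected_of_cornerCurve (d := ((X.P g).re + X.b) / 2) (fun s => ?_) hconv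
  rw [mem_minus, mem_lowerRight]
  simp only [cornerCurve]
  rcases le_total 0 s with h | h
  · rw [abs_of_nonneg h]
    exact ⟨⟨g, by omega, by linarith, by linarith⟩, Or.inr (by linarith)⟩
  · rw [abs_of_nonpos h]
    exact ⟨⟨g, by omega, by linarith, by linarith⟩, Or.inl (by linarith)⟩

theorem exists_chart_plus {p : ℂ} (hp : p ∈ closure X.plus.dom \ X.plus.dom) :
    ∃ χ θ, IsBoundaryChart X.plus.dom (𝓝[X.plus.dom] p) χ θ := by
  by_cases h : p ∈ X.upperLeft
  · refine HasCornerGerm.exists_chart (ε := -1) (by norm_num) ?_ hp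
    refine hasCornerGerm_of_eventually ((hasCornerGerm_re (-1) X.b p).inter
      (hasCornerGerm_im (-1) (-X.b) p)) ?_
    filter_upwards [X.isOpen_upperLeft.mem_nhds h] with z hz
    simp only [mem_plus, hz, true_and, mem_inter_iff, mem_ofPred_eq]
    constructor <;> rintro ⟨h1, h2⟩ <;> constructor <;> linarith
  · refine HasCornerGerm.exists_chart (ε := 1) (by norm_num) ?_ hp
    refine hasCornerGerm_of_eventually (X.hasCornerGerm_upperLeft p) ?_
    have hz := X.zigzag_bounds (X.mem_zigzag_of_notMem h (X.closure_plus hp.1).1)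
    have hb := X.b_pos
    filter_upwards [Complex.continuous_re.continuousAt.eventually_const_lt
      (show -X.b < p.re by linarith [hz.1]), Complex.continuous_im.continuousAt.eventually_lt_const
      (show p.im < X.b by linarith [hz.2.1])] with z h1 h2
    simp only [mem_plus, h1, h2, and_true]

theorem exists_chart_minus {p : ℂ} (hp : p ∈ closure X.minus.dom \ X.minus.dom) :
    ∃ χ θ, IsBoundaryChart X.minus.dom (𝓝[X.minus.dom] p) χ θ := by
  by_cases h : p ∈ X.lowerRight
  · refine HasCornerGerm.exists_chart (ε := 1) (by norm_num) ?_ hp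
    refine hasCornerGerm_of_eventually ((hasCornerGerm_re 1 X.b p).union
      (hasCornerGerm_im 1 (-X.b) p)) ?_
    filter_upwards [X.isOpen_lowerRight.mem_nhds h] with z hz
    simp only [mem_minus, hz, true_and, mem_union, mem_ofPred_eq, one_mul]
  · refine HasCornerGerm.exists_chart (ε := -1) (by norm_num) ?_ hp
    refine hasCornerGerm_of_eventually (X.hasCornerGerm_lowerRight p) ?_
    have hz := X.zigzag_bounds (X.mem_zigzag_of_notMem (X.closure_minus hp.1).1 h)
    have hb := X.middle_lt_b
    rcases hz.2.2 with h1 | h1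
    · filter_upwards [Complex.continuous_re.continuousAt.eventually_lt_const
        (show p.re < X.b by linarith)] with z h2
      simp only [mem_minus, h2, true_or, and_true]
    · filter_upwards [Complex.continuous_im.continuousAt.eventually_const_lt
        (show -X.b < p.im by linarith)] with z h2
      simp only [mem_minus, h2, or_true, and_true]

theorem isSymmetricDomain_plus : IsSymmetricDomain g X.plus := by
  have hb := X.b_pos
  have hrefl : MapsTo diagRefl X.plus.dom X.plus.dom := fun z hz => by
    refine ⟨X.diagRefl_upperLeft hz.1, ?_, ?_⟩
    · rw [diagRefl_re]; linarith [hz.2.2]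
    · rw [diagRefl_im]; linarith [hz.2.1]
  have hzig : ∀ j ≤ 2 * g, X.P j ∈ X.zigzag := fun j hj => X.mem_zigzag.2 (Or.inr ⟨j, hj, rfl⟩)
  refine
    { isOpen := X.isOpen_plus
      simplyConnected := X.isSimplyConnected_plus
      far := ⟨((-X.b - 2 : ℝ) : ℂ), 1, one_pos, fun z hz => ?_⟩
      refl := hrefl
      center := ⟨⟨-(X.b / 2), X.b / 2⟩, ⟨X.mem_upperLeft.2 (Or.inl (by simpa using hb)), ?_, ?_⟩, ?_⟩
      chart := fun p hp => X.exists_chart_plus hp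
      chart₁ := exists_chart_rightEnd (M := (X.P (2 * g)).re) hb fun z hz => ?_
      chart₂ := exists_chart_downEnd (M := -(X.P 0).im) (neg_lt_zero.2 hb) fun z hz => ?_
      le_cobounded₁ := rightEnd_le_cobounded _
      le_cobounded₂ := downEnd_le_cobounded _
      disjoint := disjoint_rightEnd_downEnd (M := (X.P (2 * g)).re) fun z hz h => ?_
      cobounded_le := cobounded_le_ends (R := X.b) fun z hz => ⟨hz.2.1.le, hz.2.2.le⟩
      refl_vertex := fun j hj => X.diagRefl_P hj
      refl_outer := ?_
      refl_end := tendsto_diagRefl_downEnd hrefl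
      outer_mem := ⟨?_, fun h => lt_irrefl _ h.2.1⟩
      vertex_mem := fun j hj => ⟨?_, fun h => (X.notMem_of_mem_zigzag (hzig j hj)).1 h.1⟩
      vertex_ne := fun j hj h => ?_ }
  · have h1 := Complex.re_le_norm (z - ((-X.b - 2 : ℝ) : ℂ))
    rw [Complex.sub_re, Complex.ofReal_re] at h1
    rw [dist_eq_norm]
    linarith [hz.2.1]
  · show -X.b < -(X.b / 2)
    linarith
  · show X.b / 2 < X.b
    linarith
  · apply Complex.ext <;> simp
  · have hj : ∀ j ≤ 2 * g, (X.P j).re ≤ (X.P (2 * g)).re := fun j hj => X.P_re_mono hj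
    have h0 := X.P_re_nonneg (2 * g)
    rw [mem_plus, mem_upperLeft]
    constructor
    · rintro ⟨h | h | ⟨j, hj', h, -⟩, h2, h3⟩
      · linarith
      · exact ⟨h, h3⟩
      · linarith [hj j hj']
    · exact fun h => ⟨Or.inr (Or.inl h.1), by linarith, h.2⟩
  · have hj : ∀ j, (X.P 0).im ≤ (X.P j).im := fun j => X.P_im_mono (Nat.zero_le j)
    have h0 := X.P_im_nonpos 0
    rw [neg_neg] at hz
    rw [mem_plus, mem_upperLeft]
    constructor
    · rintro ⟨h | h | ⟨j, hj', -, h⟩, h2, h3⟩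
      · exact ⟨h2, h⟩
      · linarith
      · linarith [hj j]
    · exact fun h => ⟨Or.inl h.2, h.1, by linarith⟩
  · have h0 := X.P_re_nonneg (2 * g)
    rcases X.mem_upperLeft.1 hz.1 with h1 | h1 | ⟨j, hj, h1, -⟩
    · linarith
    · linarith
    · have : (X.P j).re ≤ (X.P (2 * g)).re := X.P_re_mono hj
      linarith
  · apply Complex.ext <;> simp [plus]
  · refine mem_closure_of_ray (1 - Complex.I) hb fun s hs => ?_
    rw [mem_plus, mem_upperLeft]
    simp only [plus, Complex.add_re, Complex.add_im, Complex.re_ofReal_mul, Complex.im_ofReal_mul,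
      Complex.sub_re, Complex.sub_im, Complex.one_re, Complex.one_im, Complex.I_re, Complex.I_im]
    exact ⟨Or.inl (by linarith [hs.2]), by linarith [hs.1], by linarith [hs.1]⟩
  · refine mem_closure_of_ray (Complex.I - 1) hb fun s hs => ?_
    have h1 := X.P_re_nonneg j
    have h2 := X.P_im_nonpos j
    rw [mem_plus, mem_upperLeft]
    simp only [plus, Complex.add_re, Complex.add_im, Complex.re_ofReal_mul, Complex.im_ofReal_mul,
      Complex.sub_re, Complex.sub_im, Complex.one_re, Complex.one_im, Complex.I_re, Complex.I_im]
    exact ⟨Or.inr (Or.inr ⟨j, hj, by linarith [hs.1], by linarith [hs.1]⟩), by linarith [hs.2],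
      by linarith [hs.2]⟩
  · have h1 : (X.P j).re = -X.b := congrArg Complex.re h
    linarith [X.P_re_nonneg j]

theorem isSymmetricDomain_minus : IsSymmetricDomain g X.minus := by
  have hb := X.b_pos
  have hcb := X.middle_lt_b
  have hm := X.P_middle_im
  have hrefl : MapsTo diagRefl X.minus.dom X.minus.dom := fun z hz => by
    refine ⟨X.diagRefl_lowerRight hz.1, ?_⟩
    rcases hz.2 with h | h
    · right; rw [diagRefl_im]; linarith
    · left; rw [diagRefl_re]; linarith
  have hzig : ∀ j ≤ 2 * g, X.P j ∈ X.zigzag := fun j hj => X.mem_zigzag.2 (Or.inr ⟨j, hj, rfl⟩)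
  refine
    { isOpen := X.isOpen_minus
      simplyConnected := X.isSimplyConnected_minus
      far := ⟨((-2 : ℝ) : ℂ), 1, one_pos, fun z hz => ?_⟩
      refl := hrefl
      center := ⟨⟨((X.P g).re + X.b) / 2, -(((X.P g).re + X.b) / 2)⟩,
        ⟨X.mem_lowerRight.2 ⟨g, by omega, ?_, ?_⟩, Or.inl ?_⟩, ?_⟩
      chart := fun p hp => X.exists_chart_minus hp
      chart₁ := exists_chart_downEnd (M := X.b - (X.P 0).im) hb fun z hz => ?_
      chart₂ := exists_chart_rightEnd (M := X.b + (X.P (2 * g)).re) (neg_lt_zero.2 hb) fun z hz => ?_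
      le_cobounded₁ := downEnd_le_cobounded _
      le_cobounded₂ := rightEnd_le_cobounded _
      disjoint := (disjoint_rightEnd_downEnd (M := X.b) fun z hz h => ?_).symm
      cobounded_le := (cobounded_le_ends (R := 0) fun z hz => ?_).trans (sup_comm _ _).le
      refl_vertex := fun j hj => X.diagRefl_P (Nat.sub_le _ _)
      refl_outer := ?_
      refl_end := tendsto_diagRefl_rightEnd hrefl
      outer_mem := ⟨?_, fun h => h.2.elim (lt_irrefl _) (lt_irrefl _)⟩
      vertex_mem := fun j hj =>
        ⟨?_, fun h => (X.notMem_of_mem_zigzag (hzig _ (Nat.sub_le (2 * g) j))).2 h.1⟩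
      vertex_ne := fun j hj h => ?_ }
  · have h1 := Complex.re_le_norm (z - ((-2 : ℝ) : ℂ))
    rw [Complex.sub_re, Complex.ofReal_re] at h1
    rw [dist_eq_norm]
    linarith [(X.lowerRight_bounds hz.1).1]
  · show (X.P g).re < ((X.P g).re + X.b) / 2
    linarith
  · show -(((X.P g).re + X.b) / 2) < (X.P g).im
    linarith
  · show ((X.P g).re + X.b) / 2 < X.b
    linarith
  · apply Complex.ext <;> simp
  · have h0 := X.P_im_nonpos 0
    rw [mem_minus]
    constructor
    · rintro ⟨h1, h2⟩
      exact ⟨(X.lowerRight_bounds h1).1, h2.resolve_right (by linarith)⟩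
    · exact fun h => ⟨X.mem_lowerRight.2 ⟨0, by omega, by rw [X.P_zero_re]; exact h.1, by linarith⟩,
        Or.inl h.2⟩
  · have h0 := X.P_re_nonneg (2 * g)
    rw [mem_minus]
    constructor
    · rintro ⟨h1, h2⟩
      exact ⟨h2.resolve_left (by linarith), (X.lowerRight_bounds h1).2⟩
    · exact fun h => ⟨X.mem_lowerRight.2 ⟨2 * g, le_rfl, by linarith,
        by rw [X.P_im_eq_zero le_rfl]; exact h.2⟩, Or.inr h.1⟩
  · exact hz.2.resolve_left (not_lt.2 h.le)
  · have := X.lowerRight_bounds hz.1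
    exact ⟨by linarith, this.2.le⟩
  · apply Complex.ext <;> simp [minus]
  · refine mem_closure_of_ray (-1) (sub_pos.2 hcb) fun s hs => ?_
    rw [mem_minus, mem_lowerRight]
    simp only [minus, Complex.add_re, Complex.add_im, Complex.re_ofReal_mul, Complex.im_ofReal_mul,
      Complex.neg_re, Complex.neg_im, Complex.one_re, Complex.one_im]
    exact ⟨⟨g, by omega, by linarith [hs.2], by linarith⟩, Or.inl (by linarith [hs.1])⟩
  · refine mem_closure_of_ray (1 - Complex.I) (sub_pos.2 hcb) fun s hs => ?_
    have h1 := (X.zigzag_bounds (hzig _ (Nat.sub_le (2 * g) j))).2.2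
    rw [mem_minus, mem_lowerRight]
    simp only [minus, Complex.add_re, Complex.add_im, Complex.re_ofReal_mul, Complex.im_ofReal_mul,
      Complex.sub_re, Complex.sub_im, Complex.one_re, Complex.one_im, Complex.I_re, Complex.I_im]
    refine ⟨⟨2 * g - j, Nat.sub_le _ _, by linarith [hs.1], by linarith [hs.1]⟩, ?_⟩
    rcases h1 with h1 | h1
    · left; linarith [hs.2]
    · right; linarith [hs.2]
  · have h1 : (X.P (2 * g - j)).re = X.b := congrArg Complex.re h
    have h2 : (X.P (2 * g - j)).im = -X.b := congrArg Complex.im h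
    rcases (X.zigzag_bounds (hzig _ (Nat.sub_le (2 * g) j))).2.2 with h3 | h3 <;> linarith

end Coord

namespace Coord

variable {g : ℕ} (X : Coord g)

theorem edgeBase_add_re_im (k : ℕ) (t y : ℝ) (hk : Even k) :
    X.edgeBase k + edgeDir k * (t + y * Complex.I) = ⟨(X.P k).re - y, t⟩ := by
  rw [edgeBase, edgeDir, if_pos hk, if_pos hk]
  apply Complex.ext <;> simp [sub_eq_add_neg]

theorem edgeBase_add_re_im' (k : ℕ) (t y : ℝ) (hk : Odd k) :
    X.edgeBase k + edgeDir k * (t + y * Complex.I) = ⟨t, (X.P k).im + y⟩ := by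
  rw [edgeBase, edgeDir, if_neg (Nat.not_even_iff_odd.2 hk), if_neg (Nat.not_even_iff_odd.2 hk)]
  apply Complex.ext <;> simp

theorem strip_plus {k : ℕ} (hk : k ≤ 2 * g + 1) {t y : ℝ} (ht : t ∈ X.edgeRange k)
    (hy : y ∈ Ioo 0 X.b) :
    X.edgeBase k + edgeDir k * (t + y * Complex.I) ∈ X.plus.dom := by
  have h1 := X.P_re_nonneg k
  have h2 := X.P_im_nonpos k
  have h3 := X.P_re_nonneg (k - 1)
  have hb := X.b_pos
  rcases Nat.even_or_odd k with h | h
  · have hk' : k ≤ 2 * g := by grind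
    rw [edgeRange_of_even X h] at ht
    rw [X.edgeBase_add_re_im k t y h, mem_plus, mem_upperLeft]
    refine ⟨?_, show -X.b < (X.P k).re - y by linarith [hy.2], show t < X.b by linarith [ht.2]⟩
    by_cases h0 : k = 0
    · subst h0
      left
      show (X.P 0).re - y < 0
      rw [X.P_zero_re]; linarith [hy.1]
    · refine Or.inr (Or.inr ⟨k - 1, by omega, ?_, ht.1 h0⟩)
      show (X.P k).re - y < (X.P (k - 1)).re
      rw [X.P_pred_of_even hk' h]; linarith [hy.1]
  · rw [edgeRange_of_odd X h] at ht
    rw [X.edgeBase_add_re_im' k t y h, mem_plus, mem_upperLeft]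
    refine ⟨?_, show -X.b < t by linarith [ht.1], show (X.P k).im + y < X.b by linarith [hy.2]⟩
    by_cases h0 : k ≤ 2 * g
    · exact Or.inr (Or.inr ⟨k, h0, ht.2 h0, show (X.P k).im < (X.P k).im + y by linarith [hy.1]⟩)
    · right; left
      show 0 < (X.P k).im + y
      rw [X.P_im_eq_zero (by omega)]; linarith [hy.1]

theorem strip_minus {k : ℕ} (hk : k ≤ 2 * g + 1) {t y : ℝ} (ht : -t ∈ X.edgeRange k)
    (hy : y ∈ Ioo 0 (X.b - (X.P g).re)) :
    X.edgeBase k + -edgeDir k * (t + y * Complex.I) ∈ X.minus.dom := by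
  have hm := X.P_middle_im
  have hcb := X.middle_lt_b
  have he : X.edgeBase k + -edgeDir k * (t + y * Complex.I) =
      X.edgeBase k + edgeDir k * ((-t : ℝ) + (-y : ℝ) * Complex.I) := by push_cast; ring
  rw [he]
  rcases Nat.even_or_odd k with h | h
  · have hk' : k ≤ 2 * g := by grind
    rw [edgeRange_of_even X h] at ht
    rw [X.edgeBase_add_re_im k _ _ h, mem_minus, mem_lowerRight]
    refine ⟨⟨k, hk', show (X.P k).re < (X.P k).re - -y by linarith [hy.1], ht.2⟩, ?_⟩
    rcases Nat.lt_or_ge g k with h1 | h1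
    · right
      show -X.b < -t
      have : (X.P g).im ≤ (X.P (k - 1)).im := X.P_im_mono (by omega)
      linarith [ht.1 (by omega)]
    · left
      show (X.P k).re - -y < X.b
      have : (X.P k).re ≤ (X.P g).re := X.P_re_mono h1
      linarith [hy.2]
  · rw [edgeRange_of_odd X h] at ht
    have hp := X.P_pred_of_odd hk h
    rw [X.edgeBase_add_re_im' k _ _ h, mem_minus, mem_lowerRight]
    refine ⟨⟨k - 1, by grind, ht.1, show (X.P k).im + -y < (X.P (k - 1)).im by linarith [hy.1]⟩, ?_⟩
    rcases Nat.lt_or_ge g k with h1 | h1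
    · right
      show -X.b < (X.P k).im + -y
      have : (X.P g).im ≤ (X.P k).im := X.P_im_mono h1.le
      linarith [hy.2]
    · left
      show -t < X.b
      have : (X.P k).re ≤ (X.P g).re := X.P_re_mono h1
      linarith [ht.2 (by omega)]

theorem edge_subset_zigzag {k : ℕ} (hk : k ≤ 2 * g + 1) : X.edge k ⊆ X.zigzag := fun _ hz =>
  X.mem_zigzag.2 (Or.inl ⟨k, hk, hz⟩)

theorem isOrthodisk_plus : IsOrthodisk g X.plus {z | z.im = X.b ∧ z.re ∈ Ioi (-X.b)}
    {z | z.re = -X.b ∧ z.im ∈ Iio X.b} := by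
  have hb := X.b_pos
  refine { X.isSymmetricDomain_plus with
    edge := fun k hk => ⟨_, _, _, (X.isStraight_edge hk).isOrientedEdge hb
      (fun t ht y hy => X.strip_plus hk ht hy) fun p hp => ⟨fun h =>
        (X.notMem_of_mem_zigzag (X.edge_subset_zigzag hk hp)).1 h.1, fun h => ?_⟩, ?_, ?_⟩
    outerEdge₁ := ⟨_, _, _, ((isStraight_horizontal X.b ordConnected_Ioi
      ⟨_, lt_add_one (-X.b)⟩).reverse).isOrientedEdge hb ?_ ?_,
      (endsAt_rightEnd (D := X.plus) fun t ht => Ioi_subset_Ioi (mem_Ioi.1 ht).le).reverse⟩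
    outerEdge₂ := ⟨_, _, _, ((isStraight_vertical (-X.b) ordConnected_Iio
      ⟨_, sub_one_lt X.b⟩).reverse).isOrientedEdge hb ?_ ?_,
      (startsAt_downEnd (D := X.plus) fun t ht => Iio_subset_Iio (mem_Iio.1 ht).le).reverse⟩
    cases := fun p hp => ?_ }
  · have h1 := (X.zigzag_bounds (X.edge_subset_zigzag hk hp)).1
    have h2 : p.re = -X.b := congrArg Complex.re h
    linarith
  · rcases Nat.eq_zero_or_pos k with rfl | h0
    · rw [vertexFilter, if_pos rfl]
      exact X.startsAt_edge_zero X.plus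
    · obtain ⟨j, rfl⟩ : ∃ j, k = j + 1 := ⟨k - 1, by omega⟩
      rw [vertexFilter, if_neg (by omega), if_neg (by omega), Nat.add_sub_cancel]
      exact X.startsAt_edge X.plus (by omega)
  · by_cases h0 : k = 2 * g + 1
    · subst h0
      rw [vertexFilter, if_neg (by omega), if_pos rfl]
      exact X.endsAt_edge_last X.plus
    · rw [vertexFilter, if_neg (by omega), if_neg (by omega), Nat.add_sub_cancel]
      exact X.endsAt_edge X.plus (by omega)
  · intro t ht y hy
    have ht' : -X.b < -t := ht
    rw [mem_plus, mem_upperLeft]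
    simp only [Complex.add_re, Complex.add_im, Complex.mul_re, Complex.mul_im, Complex.neg_re,
      Complex.neg_im, Complex.one_re, Complex.one_im, Complex.I_re, Complex.I_im, Complex.ofReal_re,
      Complex.ofReal_im]
    exact ⟨Or.inr (Or.inl (by linarith [hy.2])), by linarith, by linarith [hy.1]⟩
  · intro p hp
    refine ⟨fun h => ?_, fun h => ?_⟩
    · have h1 := h.2.2
      rw [hp.1] at h1
      exact lt_irrefl _ h1
    · have h1 : p.re = -X.b := congrArg Complex.re h
      exact absurd hp.2 (by simp [h1])
  · intro t ht y hy
    have ht' : -t < X.b := ht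
    rw [mem_plus, mem_upperLeft]
    simp only [Complex.add_re, Complex.add_im, Complex.mul_re, Complex.mul_im, Complex.neg_re,
      Complex.neg_im, Complex.I_re, Complex.I_im, Complex.ofReal_re, Complex.ofReal_im]
    exact ⟨Or.inl (by linarith [hy.2]), by linarith [hy.1], by linarith⟩
  · intro p hp
    refine ⟨fun h => ?_, fun h => ?_⟩
    · have h1 := h.2.1
      rw [hp.1] at h1
      exact lt_irrefl _ h1
    · have h1 : p.im = X.b := congrArg Complex.im h
      exact absurd hp.2 (by simp [h1])
  · obtain ⟨h1, h2, h3⟩ := X.closure_plus hp.1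
    by_cases hU : p ∈ X.upperLeft
    · rcases h2.eq_or_lt with h2 | h2
      · rcases h3.eq_or_lt with h3 | h3
        · exact Or.inl (Complex.ext h2.symm h3)
        · exact Or.inr (Or.inr (Or.inr (Or.inr ⟨h2.symm, h3⟩)))
      · rcases h3.eq_or_lt with h3 | h3
        · exact Or.inr (Or.inr (Or.inr (Or.inl ⟨h3, h2⟩)))
        · exact absurd ⟨hU, h2, h3⟩ hp.2
    · rcases X.mem_zigzag.1 (X.mem_zigzag_of_notMem hU h1) with h | h
      · exact Or.inr (Or.inr (Or.inl h))
      · exact Or.inr (Or.inl h)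

theorem isOrthodisk_minus : IsOrthodisk g X.minus {z | z.re = X.b ∧ z.im ∈ Iio (-X.b)}
    {z | z.im = -X.b ∧ z.re ∈ Ioi X.b} := by
  have hb := X.b_pos
  have hcb := X.middle_lt_b
  have hm := X.P_middle_im
  refine { X.isSymmetricDomain_minus with
    edge := fun k hk => ?_
    outerEdge₁ := ⟨_, _, _, (isStraight_vertical X.b ordConnected_Iio
      ⟨_, sub_one_lt (-X.b)⟩).isOrientedEdge (sub_pos.2 hcb) ?_ ?_,
      startsAt_downEnd (D := X.minus) fun t ht => Iio_subset_Iio (mem_Iio.1 ht).le⟩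
    outerEdge₂ := ⟨_, _, _, (isStraight_horizontal (-X.b) ordConnected_Ioi
      ⟨_, lt_add_one X.b⟩).isOrientedEdge (sub_pos.2 hcb) ?_ ?_,
      endsAt_rightEnd (D := X.minus) fun t ht => Ioi_subset_Ioi (mem_Ioi.1 ht).le⟩
    cases := fun p hp => ?_ }
  · obtain ⟨l, hl, hkl⟩ : ∃ l, l ≤ 2 * g + 1 ∧ k + l = 2 * g + 1 := ⟨2 * g + 1 - k, by omega, by omega⟩
    have hedge : X.minus.edge k = X.edge l := by
      show X.edge (2 * g + 1 - k) = _
      congr 1; omega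
    rw [hedge]
    refine ⟨_, _, _, (X.isStraight_edge hl).reverse.isOrientedEdge (sub_pos.2 hcb)
      (fun t ht y hy => X.strip_minus hl ht hy) fun p hp => ⟨fun h =>
        (X.notMem_of_mem_zigzag (X.edge_subset_zigzag hl hp)).2 h.1, fun h => ?_⟩,
        EndsAt.reverse ?_, StartsAt.reverse ?_⟩
    · have h1 : p.re = X.b := congrArg Complex.re h
      have h2 : p.im = -X.b := congrArg Complex.im h
      rcases (X.zigzag_bounds (X.edge_subset_zigzag hl hp)).2.2 with h3 | h3 <;> linarith
    · by_cases h0 : k = 0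
      · obtain rfl : l = 2 * g + 1 := by omega
        rw [vertexFilter, if_pos h0]
        exact X.endsAt_edge_last X.minus
      · have hP : X.minus.P (k - 1) = X.P l := by
          show X.P (2 * g - (k - 1)) = _
          congr 1; omega
        rw [vertexFilter, if_neg h0, if_neg (by omega), hP]
        exact X.endsAt_edge X.minus (by omega)
    · rcases Nat.eq_zero_or_pos l with rfl | h0
      · rw [vertexFilter, if_neg (by omega), if_pos (by omega)]
        exact X.startsAt_edge_zero X.minus
      · obtain ⟨j, rfl⟩ : ∃ j, l = j + 1 := ⟨l - 1, by omega⟩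
        have hP : X.minus.P (k + 1 - 1) = X.P j := by
          show X.P (2 * g - (k + 1 - 1)) = _
          congr 1; omega
        rw [vertexFilter, if_neg (by omega), if_neg (by omega), hP]
        exact X.startsAt_edge X.minus (by omega)
  · intro t ht y hy
    have ht' : t < -X.b := ht
    rw [mem_minus, mem_lowerRight]
    simp only [Complex.add_re, Complex.add_im, Complex.mul_re, Complex.mul_im,
      Complex.I_re, Complex.I_im, Complex.ofReal_re, Complex.ofReal_im]
    exact ⟨⟨g, by omega, by linarith [hy.2], by linarith⟩, Or.inl (by linarith [hy.1])⟩
  · intro p hp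
    have h2 : p.im < -X.b := hp.2
    refine ⟨fun h => ?_, fun h => ?_⟩
    · rcases h.2 with h1 | h1
      · rw [hp.1] at h1
        exact lt_irrefl _ h1
      · exact lt_asymm h1 h2
    · have h1 : p.im = -X.b := congrArg Complex.im h
      exact h2.ne h1
  · intro t ht y hy
    have ht' : X.b < t := ht
    rw [mem_minus, mem_lowerRight]
    simp only [Complex.add_re, Complex.add_im, Complex.mul_re, Complex.mul_im, Complex.one_re,
      Complex.one_im, Complex.I_re, Complex.I_im, Complex.ofReal_re, Complex.ofReal_im]
    exact ⟨⟨g, by omega, by linarith, by linarith [hy.2]⟩, Or.inr (by linarith [hy.1])⟩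
  · intro p hp
    have h2 : X.b < p.re := hp.2
    refine ⟨fun h => ?_, fun h => ?_⟩
    · rcases h.2 with h1 | h1
      · exact lt_asymm h1 h2
      · rw [hp.1] at h1
        exact lt_irrefl _ h1
    · have h1 : p.re = X.b := congrArg Complex.re h
      exact h2.ne' h1
  · obtain ⟨h1, h2⟩ := X.closure_minus hp.1
    by_cases hL : p ∈ X.lowerRight
    · have h3 : X.b ≤ p.re ∧ p.im ≤ -X.b :=
        ⟨not_lt.1 fun h => hp.2 ⟨hL, Or.inl h⟩, not_lt.1 fun h => hp.2 ⟨hL, Or.inr h⟩⟩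
      rcases h3.1.eq_or_lt with h4 | h4
      · rcases h3.2.eq_or_lt with h5 | h5
        · exact Or.inl (Complex.ext h4.symm h5)
        · exact Or.inr (Or.inr (Or.inr (Or.inl ⟨h4.symm, h5⟩)))
      · exact Or.inr (Or.inr (Or.inr (Or.inr
          ⟨le_antisymm h3.2 (h2.resolve_left (not_le.2 h4)), h4⟩)))
    · rcases X.mem_zigzag.1 (X.mem_zigzag_of_notMem h1 hL) with ⟨k, hk, h⟩ | ⟨j, hj, h⟩
      · refine Or.inr (Or.inr (Or.inl ⟨2 * g + 1 - k, Nat.sub_le _ _, ?_⟩))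
        show p ∈ X.edge (2 * g + 1 - (2 * g + 1 - k))
        rwa [Nat.sub_sub_self hk]
      · refine Or.inr (Or.inl ⟨2 * g - j, Nat.sub_le _ _, ?_⟩)
        show p = X.P (2 * g - (2 * g - j))
        rwa [Nat.sub_sub_self hj]

end Coord

end Scherk

end

theorem lemma4p13 (g : ℕ) (hg : 1 ≤ g) (X : Scherk.Coord g)
    (h : Scherk.height g X.plus X.minus = 0) :
    Scherk.Reflexive g X.plus X.minus := by
  obtain ⟨φ, k, x, U⟩ := X.isOrthodisk_plus.exists_uniformized
  obtain ⟨φ', k', x', U'⟩ := X.isOrthodisk_minus.exists_uniformized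
  exact Scherk.reflexive_of_uniformized hg U U' h
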